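/- \textbf{Notation.} Let $h,h'$ be integers, $k$ a positive integer with $\gcd(h,k)=1$, and $z\in\mathbb C$ with $\mathrm{Re}(z)>0$. Put $q=e^{\frac{2\pi i}{k}(h+iz)}$, $q_1=e^{\frac{2\pi i}{k}(h'+\frac iz)}$, $q_1^{1/2}=e^{\frac{\pi i}{k}(h'+\frac iz)}$; powers $z^{r}$, $r\in\frac12\mathbb Z$, are principal. Let $(q;q)_\infty=\prod_{n\ge1}(1-q^n)$, $\omega_{h,k}=\exp\bigl(\pi i\sum_{\mu=0}^{k-1}((\tfrac{\mu}{k}))((\tfrac{h\mu}{k}))\bigr)$, where $((x))=x-\lfloor x\rfloor-\frac12$ for $x\in\mathbb R\setminus\mathbb Z$ and $((x))=0$ for $x\in\mathbb Z$. An odd Durfee symbol consists of a subscript $n\ge0$ and two rows (finite non-increasing sequences $a_1,\dots,a_i$ and $b_1,\dots,b_j$) of odd positive integers $\le 2n+1$; it partitions $2n^2+2n+1+\sum a_m+\sum b_m$, and its odd rank is $i-j$. Let $N^o(m,n)$ be the number of odd Durfee symbols of $n$ with odd rank $m$, $\eta_2^o(n)=\sum_{m\in\mathbb Z}\binom{m+1}{2}N^o(m,n)$,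 and $R_2^o(q)=\sum_{n\ge1}\eta_2^o(n)q^n$. Define $$\mathcal R^o(q;w)=\frac1{(q^2;q^2)_\infty}\sum_{n\in\mathbb Z}\frac{(-1)^nq^{3n^2+n}}{1-e^{2\pi iw}q^{2n+1}},\qquad L^o(g)=-\frac1{8\pi^2}\Bigl[\frac{\partial}{\partial w}e^{-2\pi iw}\frac{\partial}{\partial w}g\Bigr]_{w=0},$$ $$h^o(q;w)=\frac1{(q;q)_\infty}\sum_{m\in\mathbb Z}\frac{(-1)^mq^{\frac12(3m^2+m)}}{1+e^{\pi iw}q^m},\qquad l^o(q;w)=\frac1{(q^2;q^2)_\infty}\sum_{m\in\mathbb Z}\frac{(-1)^mq^{3m^2+5m}}{1-e^{2\pi iw}q^{2m+1}},$$ $$g^o(q)=\frac1{(q;q)_\infty}\sum_{m\in\mathbb Z}\frac{(-1)^mq^{\frac12(3m^2+m)}}{1+q^m},\qquad h^o(q)=\frac1{(q;q)_\infty}\sum_{m\in\mathbb Z}(-1)^m\frac{q^{\frac12(3m^2+m)}(1-3q^m)}{(1+q^m)^3},$$ $$m^o(q)=\frac1{(q^2;q^2)_\infty}\sum_{m\in\mathbb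 Z}\frac{(-1)^mq^{3m^2+5m}}{1-q^{2m+1}},\qquad H^o_w(x)=\frac1{2\sinh(-\pi iw-\frac x2)},$$ $$I^{o,\pm}_{k,\nu}(z;w)=\int_{\mathbb R}e^{-\frac{3\pi zx^2}{2k}+\frac{3\pi zx}{k}}H^o_w\Bigl(\pm\frac{2\pi i\nu}{k}-\frac{2\pi zx}{k}\mp\frac{\pi i}{3k}\Bigr)dx,$$ $$J^{o,\pm}_{k,\nu}(z;w)=\int_{\mathbb R}e^{-\frac{3\pi z}{2k}(x^2-2x)}H^o_w\Bigl(\frac{2\pi i}{k}(2\nu+1)-\frac{2\pi zx}{k}\mp\frac{2\pi i}{3k}\Bigr)dx,$$ $$I^{o,\pm}_{k,\nu}(z)=\int_{\mathbb R}\frac{e^{-\frac{3\pi zx^2}{2k}+\frac{\pi zx}{k}}}{\sinh^3\bigl(\mp\frac{\pi i\nu}{k}+\frac{\pi zx}{k}\pm\frac{\pi i}{6k}\bigr)}dx,\qquad J^{o,\pm}_{k,\nu}(z)=\int_{\mathbb R}\frac{e^{-\frac{3\pi zx^2}{2k}+\frac{\pi zx}{k}}}{\sinh^3\bigl(-\frac{\pi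 i}{k}(2\nu+1)+\frac{\pi zx}{k}\pm\frac{\pi i}{3k}\bigr)}dx.$$ For $w\in\mathbb C$ let $a_z(w)=\mathrm{Re}(w)+\mathrm{Im}(w)\frac{\mathrm{Im}(z)}{\mathrm{Re}(z)}$, i.e. the real $a$ with $w\in a+iz\mathbb R$ (this is $\mathrm{Re}(w)$ if $z$ is real). Sums over $\nu$ run over $0\le\nu<k$, respectively $0\le\nu<\frac k2$; sums over $\pm$ run over both signs. \textbf{Statement.} (0) $w\mapsto\mathcal R^o(q;w)$ is analytic at $w=0$, the series $R_2^o(q)$ converges absolutely, and $L^o(\mathcal R^o(q;w))=R_2^o(q)$. (1) Let $k$ be odd, $hh'\equiv-1\pmod k$ and $4\mid h'$. For every $w$ with $|a_z(w)|<\frac1{6k}$ and $e^{2\pi iw}q^{2n+1}\ne1$ for all $n\in\mathbb Z$, the integrals $I^{o,\pm}_{k,\nu}(z;w)$ converge absolutely and $$\mathcal R^o(q;w)=-\frac{1}{\sqrt2}z^{-\frac12}\omega_{2h,k}\,e^{\frac{\pi}{24kz}-\frac{2\pi z}{3k}+\frac{\pi ih}{2k}}e^{\frac{\pi i}{2}(k+1+3hk)}e^{2\pi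 iw+\frac{3\pi kw^2}{2z}-\frac{\pi w}{2z}}\,h^o\Bigl(q_1^{\frac12};\frac{iw}{z}\Bigr)$$ $$-\frac{1}{\sqrt2\,k}e^{\frac{\pi i}{2}k(3h+1)}\omega_{2h,k}\,z^{\frac12}e^{-\pi iw}e^{\frac{\pi ih}{2k}-\frac{2\pi z}{3k}}\sum_{\nu\ (\mathrm{mod}\ k),\,\pm}\pm\,e^{\frac{\pi i}{2k}(h'(-3\nu^2+\nu)\mp6\nu\pm1)}I^{o,\pm}_{k,\nu}(z;w).$$ (2) Let $k$ be even and $hh'\equiv-1\pmod{4k}$. For every $w$ with $|a_z(w)|<\frac2{3k}$, the integrals $J^{o,\pm}_{k,\nu}(z;w)$ converge absolutely and $$\mathcal R^o(q;w)=i^{-h'}z^{-\frac12}e^{-\frac{2\pi z}{3k}-\frac{10\pi}{3kz}+\frac{\pi i}{2k}(h+7h')}e^{2\pi iw+\frac{3\pi w^2k}{2z}-\frac{2\pi w}{z}}\omega_{h,\frac k2}\,l^o\Bigl(q_1;\frac{iw}{z}\Bigr)$$ $$+\frac1k(-1)^{\frac12(h'+1)}e^{-\pi iw}\omega_{h,\frac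 k2}\,z^{\frac12}e^{\frac{\pi i}{2k}(h-3h'-6)-\frac{2\pi z}{3k}}\sum_{\nu\ (\mathrm{mod}\ k/2),\,\pm}(-1)^\nu e^{\frac{\pi i}{2k}(h'(-12\nu-12\nu^2\pm4\nu\pm2)-12\nu\pm2)}J^{o,\pm}_{k,\nu}(z;w).$$ (3) Let $k$ be odd, $hh'\equiv-1\pmod k$ and $h'$ even. The integrals $I^{o,\pm}_{k,\nu}(z)$ converge absolutely and $$R_2^o(q)=-\frac1{\sqrt2}\omega_{2h,k}\,e^{\frac{\pi}{24kz}-\frac{2\pi z}{3k}+\frac{\pi ih}{2k}+\frac{\pi i}{2}(k+1+3hk)}\Bigl(-\frac{3k}{8\pi z^{\frac32}}g^o(q_1^{\frac12})-\frac1{16z^{\frac52}}h^o(q_1^{\frac12})\Bigr)$$ $$-\frac{1}{8\sqrt2\,k}e^{\frac{\pi i}{2}k(3h+1)+\frac{\pi ih}{2k}-\frac{2\pi z}{3k}}\omega_{2h,k}\,z^{\frac12}\sum_{\nu\ (\mathrm{mod}\ k),\,\pm}\pm\,e^{\frac{\pi i}{2k}(h'(-3\nu^2+\nu)\pm\frac13\mp2\nu)}I^{o,\pm}_{k,\nu}(z).$$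 (4) Let $k$ be even and $hh'\equiv-1\pmod{4k}$. The integrals $J^{o,\pm}_{k,\nu}(z)$ converge absolutely and $$R_2^o(q)=i^{-h'}e^{-\frac{2\pi z}{3k}-\frac{10\pi}{3kz}+\frac{\pi i}{2k}(h+7h')}\omega_{h,\frac k2}\Bigl(-\frac{3k}{8\pi z^{\frac32}}m^o(q_1)-\frac1{z^{\frac52}}q_1^{-2}R_2^o(q_1)\Bigr)$$ $$+\frac1{8k}(-1)^{\frac12(1+h')}\omega_{h,\frac k2}\,z^{\frac12}e^{\frac{\pi i}{2k}(h-3h')-\frac{2\pi z}{3k}-\frac{\pi i}{k}}\sum_{\nu\ (\mathrm{mod}\ k/2),\,\pm}(-1)^\nu e^{\frac{\pi ih'}{k}(-6\nu-6\nu^2\pm2\nu\pm1)-\frac{2\pi i\nu}{k}\pm\frac{\pi i}{3k}}J^{o,\pm}_{k,\nu}(z).$$ -/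

import Mathlib

open Complex MeasureTheory
open scoped BigOperators

namespace OddRank

noncomputable section

/-! ## Odd Durfee symbols and the moment generating function -/

/-- An odd Durfee symbol: a subscript `side = n` and two rows of odd numbers, each at most `2n+1`.
A row is a non-increasing finite sequence, recorded as a multiset. -/
structure OddDurfeeSymbol where
  side : ℕ
  top : Multiset ℕ
  bottom : Multiset ℕ
  top_spec : ∀ a ∈ top, Odd a ∧ a ≤ 2 * side + 1
  bottom_spec : ∀ b ∈ bottom, Odd b ∧ b ≤ 2 * side + 1

/-- The number partitioned by an odd Durfee symbol: `2n² + 2n + 1` plus the sum of all entries. -/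
def OddDurfeeSymbol.size (σ : OddDurfeeSymbol) : ℕ :=
  2 * σ.side ^ 2 + 2 * σ.side + 1 + σ.top.sum + σ.bottom.sum

/-- The odd rank: number of entries in the top row minus number of entries in the bottom row. -/
def OddDurfeeSymbol.rank (σ : OddDurfeeSymbol) : ℤ :=
  (σ.top.card : ℤ) - (σ.bottom.card : ℤ)

/-- `N^o(m, n)`: the number of odd Durfee symbols of `n` with odd rank `m`. -/
def oddRankCount (m : ℤ) (n : ℕ) : ℕ :=
  Nat.card {σ : OddDurfeeSymbol // σ.size = n ∧ σ.rank = m}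

/-- `η₂^o(n) = ∑_{m ∈ ℤ} binom(m+1, 2) N^o(m, n)`; only `|m| < n` contribute. -/
def etaTwoOdd (n : ℕ) : ℤ :=
  ∑ᶠ m : ℤ, Ring.choose (m + 1) 2 * (oddRankCount m n : ℤ)

/-- `R₂^o(q) = ∑_{n ≥ 1} η₂^o(n) qⁿ`. -/
def R2o (q : ℂ) : ℂ := ∑' n : ℕ, (etaTwoOdd (n + 1) : ℂ) * q ^ (n + 1)

/-! ## The multiplier `ω_{h,k}` -/

/-- `((x))`. -/
def sawtooth (x : ℝ) : ℝ := if Int.fract x = 0 then 0 else x - ⌊x⌋ - 1 / 2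

/-- The Dedekind sum `s(h, k)`. -/
def dedekindSum (h : ℤ) (k : ℕ) : ℝ :=
  ∑ μ ∈ Finset.range k, sawtooth ((μ : ℝ) / (k : ℝ)) * sawtooth ((h : ℝ) * (μ : ℝ) / (k : ℝ))

/-- `ω_{h,k} = exp(π i s(h, k))`. -/
def omega (h : ℤ) (k : ℕ) : ℂ := exp (Real.pi * I * (dedekindSum h k : ℂ))

/-! ## The `q`-series -/

/-- `(q; q)_∞`. -/
def qPoch (q : ℂ) : ℂ := ∏' n : ℕ, (1 - q ^ (n + 1))

/-- `𝓡^o(q; w)`. -/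
def calRo (q w : ℂ) : ℂ :=
  1 / qPoch (q ^ 2) *
    ∑' n : ℤ, (-1 : ℂ) ^ n * q ^ (3 * n ^ 2 + n) / (1 - exp (2 * Real.pi * I * w) * q ^ (2 * n + 1))

/-- The operator `L^o(g) = -1/(8π²) [∂_w (e^{-2πiw} ∂_w g)]_{w=0}`. -/
def Lo (g : ℂ → ℂ) : ℂ :=
  -1 / (8 * Real.pi ^ 2) * deriv (fun w : ℂ => exp (-2 * Real.pi * I * w) * deriv g w) 0

/-- `h^o(q; w)`. -/
def hoW (q w : ℂ) : ℂ :=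
  1 / qPoch q *
    ∑' m : ℤ, (-1 : ℂ) ^ m * q ^ ((3 * m ^ 2 + m) / 2) / (1 + exp (Real.pi * I * w) * q ^ m)

/-- `l^o(q; w)`. -/
def loW (q w : ℂ) : ℂ :=
  1 / qPoch (q ^ 2) *
    ∑' m : ℤ, (-1 : ℂ) ^ m * q ^ (3 * m ^ 2 + 5 * m) /
      (1 - exp (2 * Real.pi * I * w) * q ^ (2 * m + 1))

/-- `g^o(q)`. -/
def go (q : ℂ) : ℂ :=
  1 / qPoch q * ∑' m : ℤ, (-1 : ℂ) ^ m * q ^ ((3 * m ^ 2 + m) / 2) / (1 + q ^ m)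

/-- `h^o(q)`. -/
def ho (q : ℂ) : ℂ :=
  1 / qPoch q *
    ∑' m : ℤ, (-1 : ℂ) ^ m * (q ^ ((3 * m ^ 2 + m) / 2) * (1 - 3 * q ^ m)) / (1 + q ^ m) ^ 3

/-- `m^o(q)`. -/
def mo (q : ℂ) : ℂ :=
  1 / qPoch (q ^ 2) * ∑' m : ℤ, (-1 : ℂ) ^ m * q ^ (3 * m ^ 2 + 5 * m) / (1 - q ^ (2 * m + 1))

/-! ## The Mordell type integrals (a sign `±` is an integer `s = ±1`) -/

/-- `H_w^o(x)`. -/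
def Ho (w x : ℂ) : ℂ := 1 / (2 * sinh (-Real.pi * I * w - x / 2))

/-- The integrand of `I_{k,ν}^{o,±}(z; w)`. -/
def IoWIntegrand (k : ℕ) (ν s : ℤ) (z w : ℂ) (x : ℝ) : ℂ :=
  exp (-3 * Real.pi * z * x ^ 2 / (2 * k) + 3 * Real.pi * z * x / k) *
    Ho w (s * (2 * Real.pi * I * ν / k) - 2 * Real.pi * z * x / k - s * (Real.pi * I / (3 * k)))

/-- `I_{k,ν}^{o,±}(z; w)`. -/
def IoW (k : ℕ) (ν s : ℤ) (z w : ℂ) : ℂ := ∫ x : ℝ, IoWIntegrand k ν s z w x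

/-- The integrand of `J_{k,ν}^{o,±}(z; w)`. -/
def JoWIntegrand (k : ℕ) (ν s : ℤ) (z w : ℂ) (x : ℝ) : ℂ :=
  exp (-3 * Real.pi * z / (2 * k) * (x ^ 2 - 2 * x)) *
    Ho w (2 * Real.pi * I / k * (2 * ν + 1) - 2 * Real.pi * z * x / k
      - s * (2 * Real.pi * I / (3 * k)))

/-- `J_{k,ν}^{o,±}(z; w)`. -/
def JoW (k : ℕ) (ν s : ℤ) (z w : ℂ) : ℂ := ∫ x : ℝ, JoWIntegrand k ν s z w x

/-- The integrand of `I_{k,ν}^{o,±}(z)`. -/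
def IoIntegrand (k : ℕ) (ν s : ℤ) (z : ℂ) (x : ℝ) : ℂ :=
  exp (-3 * Real.pi * z * x ^ 2 / (2 * k) + Real.pi * z * x / k) /
    sinh (-s * (Real.pi * I * ν / k) + Real.pi * z * x / k + s * (Real.pi * I / (6 * k))) ^ 3

/-- `I_{k,ν}^{o,±}(z)`. -/
def Io (k : ℕ) (ν s : ℤ) (z : ℂ) : ℂ := ∫ x : ℝ, IoIntegrand k ν s z x

/-- The integrand of `J_{k,ν}^{o,±}(z)`. -/
def JoIntegrand (k : ℕ) (ν s : ℤ) (z : ℂ) (x : ℝ) : ℂ :=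
  exp (-3 * Real.pi * z * x ^ 2 / (2 * k) + Real.pi * z * x / k) /
    sinh (-(Real.pi * I / k) * (2 * ν + 1) + Real.pi * z * x / k
      + s * (Real.pi * I / (3 * k))) ^ 3

/-- `J_{k,ν}^{o,±}(z)`. -/
def Jo (k : ℕ) (ν s : ℤ) (z : ℂ) : ℂ := ∫ x : ℝ, JoIntegrand k ν s z x

/-! ## The variables `q`, `q₁` and the range of `w` -/

/-- `exp((2πi/k)(h + iz))`: this is `q` for `(h, z)`, and `q₁` for `(h', 1/z)`. -/
def nome (k : ℕ) (h : ℤ) (z : ℂ) : ℂ := exp (2 * Real.pi * I / k * (h + I * z))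

/-- The square root `q₁^{1/2} = exp((πi/k)(h' + i/z))` of `q₁`. -/
def sqrtNome (k : ℕ) (h : ℤ) (z : ℂ) : ℂ := exp (Real.pi * I / k * (h + I * z))

/-- Writing `w = a + i z t` with real `a, t`, which is possible in exactly one way when `Re z > 0`,
this is `a`. For real `z` it is `Re w`. -/
def obliqueRe (z w : ℂ) : ℝ := w.re + w.im * z.im / z.re

end

end OddRank

/-!
All series involved are values of one function, `rankFn`: up to a factor `1 - y` it is the generating
function `G(p; y) = (p; p)_∞⁻¹ ∑ (-1)ⁿ p^{n(3n+1)/2} / (1 - y pⁿ)` of Dyson's rank.  Its functional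
equation `G(p; yp) = -p y³ G(p; y) - p y² + 1` (`rankFn_mul_nome`) is an immediate consequence of the
pentagonal number theorem, and it drives the whole proof.

*The deformed function.*  Put `p = q²`, so that `𝓡^o(q; w) = G(p; q e^{2πiw})`.  The function
`e^{πiw} 𝓡^o(q; w)` changes sign under `w ↦ w + 1`, and the functional equation gives it a multiplier
for a second period `iZ`.  A Gaussian times a rank function in the transformed nome has the same poles
with the same residues and the same multiplier for the period `iZ`, but it is antiperiodic under
`w ↦ w + 1` only up to a finite sum of Gaussians, the *jump*, obtained by iterating its own functional
equation (`oddJump_add_one`, `evenJump_add_one`).  The difference `D` of the two functions is therefore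
entire, and the quasi-period `iZ` makes it bounded on strips in the direction `iZ`.  The residue theorem
for `D(s) / sin π(s - w)` between a line and its translate by `1` expresses `D(w)` as an integral of
the jump (`eq_integral_of_add_one`), and shifting the line of each Gaussian to its critical point
turns this integral into the sum of Mordell integrals (`RankPair.eq_main_add_integral`,
`integral_oddJump`, `integral_evenJump`).  The direction of the lines is the reason why the admissible
`w` are described by `obliqueRe`: the critical points have to lie between `w` and `w + 1`, as measured
by `obliqueRe`, for no pole of the kernel to be crossed.

The equality of the residues is the transformation law of `(q; q)_∞`.  It is derived from
`η(-1/τ) = √(τ/i) η(τ)` and the reciprocity law of Dedekind sums by the Euclidean algorithm.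

*The second moment.*  The generating function of odd Durfee symbols by rank is a sum over Durfee
squares, and this sum equals the rank function (`rankFn_eq_tsum_durfeeTerm`): both sides satisfy the
same functional equation, so that their difference, multiplied by a theta function which removes the
poles, is an entire doubly quasi-periodic function of negative degree, hence zero.  Differentiating
under the sum gives `L^o(𝓡^o(q; w)) = R₂^o(q)` (`Lo_calRo`).  The transformation law of `R₂^o` then
results from applying `L^o` to that of `𝓡^o(q; w)`.  The transformed rank function is `e^{2πiw + cw²}`
times an even function, so that only its values and second derivatives at `0` enter (`Lo_gauss_mul`),
and in the Mordell integrals `L^o` replaces `1 / sinh` by `1 / sinh³` (`Lo_mordell`).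
-/

open Filter Topology

namespace OddRank

/-! ### Pentagonal exponents and the pentagonal number theorem -/

/-- The pentagonal exponent `n(3n+1)/2`. -/
def pent (n : ℤ) : ℤ := (3 * n ^ 2 + n) / 2

theorem two_mul_pent (n : ℤ) : 2 * pent n = 3 * n ^ 2 + n := by
  unfold pent
  rcases Int.even_or_odd' n with ⟨m, rfl | rfl⟩
  · rw [show 3 * (2 * m) ^ 2 + 2 * m = 2 * (6 * m ^ 2 + m) by ring,
      Int.mul_ediv_cancel_left _ (by norm_num)]
  · rw [show 3 * (2 * m + 1) ^ 2 + (2 * m + 1) = 2 * (6 * m ^ 2 + 7 * m + 2) by ring,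
      Int.mul_ediv_cancel_left _ (by norm_num)]

theorem pent_neg (n : ℤ) : pent (-n) = pent n - n := by
  have h1 := two_mul_pent n
  have h2 := two_mul_pent (-n)
  linarith [show 3 * (-n) ^ 2 + -n = 3 * n ^ 2 + n - 2 * n by ring]

theorem pent_succ (n : ℤ) : pent (n + 1) = pent n + 3 * n + 2 := by
  have h1 := two_mul_pent n
  have h2 := two_mul_pent (n + 1)
  linarith [show 3 * (n + 1) ^ 2 + (n + 1) = 3 * n ^ 2 + n + 6 * n + 4 by ring]

theorem abs_sub_le_pent_add (n j : ℤ) : |n| - (|j| + 2) ^ 2 ≤ pent n + j * n := by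
  have h1 := two_mul_pent n
  have h2 : -(|j| * |n|) ≤ j * n := by rw [← abs_mul]; exact neg_abs_le _
  have h3 : -|n| ≤ n := neg_abs_le n
  have h4 : n ^ 2 = |n| ^ 2 := (sq_abs n).symm
  rw [h4] at h1
  nlinarith [abs_nonneg n, abs_nonneg j, sq_nonneg (|n| - (|j| + 2)), sq_nonneg (|j|)]

theorem summable_pow_natAbs {r : ℝ} (h0 : 0 ≤ r) (h1 : r < 1) :
    Summable fun n : ℤ => r ^ n.natAbs := by
  have := summable_geometric_of_lt_one h0 h1
  apply Summable.of_nat_of_neg <;> simpa using this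

/-- The coefficients `(-1)ⁿ p^{n(3n+1)/2}` decay faster than any geometric progression. -/
theorem summable_norm_pent {p : ℂ} (hp0 : p ≠ 0) (hp : ‖p‖ < 1) (j : ℤ) :
    Summable fun n : ℤ => ‖(-1 : ℂ) ^ n * p ^ (pent n + j * n)‖ := by
  have hpos : 0 < ‖p‖ := norm_pos_iff.mpr hp0
  refine Summable.of_nonneg_of_le (fun n => norm_nonneg _) (fun n => ?_)
    ((summable_pow_natAbs hpos.le hp).mul_left (‖p‖ ^ (-(|j| + 2) ^ 2)))
  rw [norm_mul, norm_zpow, norm_zpow, norm_neg, norm_one, one_zpow, one_mul, ← zpow_natCast,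
    ← zpow_add₀ hpos.ne']
  apply zpow_le_zpow_right_of_le_one₀ hpos hp.le
  have := abs_sub_le_pent_add n j
  rw [Int.natCast_natAbs]
  linarith

theorem summable_pent {p : ℂ} (hp0 : p ≠ 0) (hp : ‖p‖ < 1) (j : ℤ) :
    Summable fun n : ℤ => (-1 : ℂ) ^ n * p ^ (pent n + j * n) :=
  (summable_norm_pent hp0 hp j).of_norm

theorem norm_prod_one_sub_pow_le {p : ℂ} (hp : ‖p‖ < 1) (k n : ℕ) :
    ‖∏ i ∈ Finset.range n, (1 - p ^ (k + i + 1))‖ ≤ Real.exp (1 / (1 - ‖p‖)) := by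
  calc ‖∏ i ∈ Finset.range n, (1 - p ^ (k + i + 1))‖
      ≤ ∏ i ∈ Finset.range n, Real.exp (‖p‖ ^ i) := by
        rw [norm_prod]
        apply Finset.prod_le_prod (fun _ _ => norm_nonneg _)
        intro i _
        calc ‖1 - p ^ (k + i + 1)‖ ≤ 1 + ‖p‖ ^ (k + i + 1) := by
              refine (norm_sub_le _ _).trans ?_
              rw [norm_one, norm_pow]
          _ ≤ ‖p‖ ^ i + 1 := by
              have := pow_le_pow_of_le_one (norm_nonneg p) hp.le (show i ≤ k + i + 1 by omega)
              linarith
          _ ≤ _ := Real.add_one_le_exp _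
    _ = Real.exp (∑ i ∈ Finset.range n, ‖p‖ ^ i) := (Real.exp_sum _ _).symm
    _ ≤ _ := by
        apply Real.exp_le_exp.mpr
        rw [one_div, ← tsum_geometric_of_lt_one (norm_nonneg p) hp]
        exact (summable_geometric_of_lt_one (norm_nonneg p) hp).sum_le_tsum _
          (fun i _ => by positivity)

theorem qPoch_ne_zero {p : ℂ} (hp : ‖p‖ < 1) : qPoch p ≠ 0 := by
  unfold qPoch
  have := tprod_one_add_ne_zero_of_summable (f := fun n : ℕ => -p ^ (n + 1)) (fun n => ?_) ?_
  · simpa [sub_eq_add_neg] using this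
  · rw [← sub_eq_add_neg, sub_ne_zero]
    intro h
    have h2 := congrArg norm h
    rw [norm_one, norm_pow] at h2
    exact (pow_lt_one₀ (norm_nonneg p) hp (Nat.succ_ne_zero n)).ne' h2
  · simpa using (summable_nat_add_iff 1).mpr (summable_geometric_of_lt_one (norm_nonneg _) hp)

/-- The pentagonal number theorem for a complex nome. -/
theorem tsum_pent_eq_qPoch {p : ℂ} (hp0 : p ≠ 0) (hp : ‖p‖ < 1) :
    ∑' n : ℤ, (-1 : ℂ) ^ n * p ^ pent n = qPoch p := by
  have hpos : 0 < ‖p‖ := norm_pos_iff.mpr hp0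
  have hS : Summable fun n : ℤ => (-1 : ℂ) ^ n * p ^ pent n := by
    simpa using summable_pent hp0 hp 0
  have e1 (k : ℕ) : p ^ pentagonal (-(k : ℤ)) = p ^ pent k := by
    rw [← zpow_natCast]
    congr 1
    have h1 := two_mul_natCast_pentagonal_neg k
    have h2 := two_mul_pent k
    linarith [show (k : ℤ) * (3 * k + 1) = 3 * (k : ℤ) ^ 2 + k by ring]
  have e2 (k : ℕ) : p ^ pentagonal ((k : ℤ) + 1) = p ^ pent (-((k : ℤ) + 1)) := by
    rw [← zpow_natCast]
    congr 1
    have h1 := two_mul_natCast_pentagonal (k + 1)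
    have h2 := two_mul_pent (-((k : ℤ) + 1))
    linarith [show ((k : ℤ) + 1) * (3 * (k + 1) - 1) = 3 * (-((k : ℤ) + 1)) ^ 2 + -((k : ℤ) + 1) by
      ring]
  have hR (k : ℕ) : (-1 : ℂ) ^ k * (p ^ pentagonal (-(k : ℤ)) - p ^ pentagonal ((k : ℤ) + 1))
      = (-1 : ℂ) ^ (k : ℤ) * p ^ pent k + (-1 : ℂ) ^ (-((k : ℤ) + 1)) * p ^ pent (-((k : ℤ) + 1)) := by
    rw [e1, e2, zpow_neg, zpow_add₀ (by norm_num), zpow_natCast, zpow_one, mul_inv, ← inv_pow]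
    norm_num
    ring
  have hmul (k : ℕ) : Multipliable fun n : ℕ => 1 - p ^ (n + k + 1) := by
    apply multipliable_one_add_of_summable (f := fun n ↦ -p ^ (n + k + 1))
    simpa [add_assoc] using (summable_nat_add_iff (k + 1)).mpr
      (summable_geometric_of_lt_one (norm_nonneg _) hp)
  have hbd (k n : ℕ) : ‖p ^ ((k + 1) * n) * ∏ i ∈ Finset.range (n + 1), (1 - p ^ (k + i + 1))‖
      ≤ ‖p‖ ^ n * Real.exp (1 / (1 - ‖p‖)) := by
    rw [norm_mul, norm_pow]
    exact mul_le_mul (pow_le_pow_of_le_one hpos.le hp.le (by nlinarith))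
      (norm_prod_one_sub_pow_le hp k (n + 1)) (norm_nonneg _) (by positivity)
  have hgs := (summable_geometric_of_lt_one hpos.le hp).mul_right (Real.exp (1 / (1 - ‖p‖)))
  rw [qPoch, Pentagonal.tprod_one_sub_pow]
  · simp_rw [hR]
    exact (tsum_nat_add_neg_add_one hS).symm
  · exact tendsto_pow_atTop_nhds_zero_of_norm_lt_one hp
  · exact fun k => Summable.of_norm_bounded hgs (hbd k)
  · exact hmul
  · simp_rw [hR]
    exact hS.nat_add_neg_add_one
  · refine squeeze_zero_norm (a := fun k => ‖p‖ ^ k *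
      ∑' n, ‖p‖ ^ n * Real.exp (1 / (1 - ‖p‖))) (fun k => ?_) ?_
    · rw [norm_mul, norm_mul, norm_pow, norm_pow, norm_neg, norm_one, one_pow, one_mul]
      refine mul_le_mul (pow_le_pow_of_le_one hpos.le hp.le ?_)
        (tsum_of_norm_bounded hgs.hasSum (hbd k)) (norm_nonneg _) (by positivity)
      rw [Nat.le_div_iff_mul_le (by norm_num)]
      nlinarith
    · simpa using (tendsto_pow_atTop_nhds_zero_of_lt_one hpos.le hp).mul_const _

/-! ### The rank function -/

/-- `∑_{n ∈ ℤ} (-1)ⁿ p^{n(3n+1)/2} / (1 - y pⁿ)`. -/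
noncomputable def rankSum (p y : ℂ) : ℂ :=
  ∑' n : ℤ, (-1 : ℂ) ^ n * p ^ pent n / (1 - y * p ^ n)

/-- The normalised sum `G(p; y) = (p; p)_∞⁻¹ ∑_{n ∈ ℤ} (-1)ⁿ p^{n(3n+1)/2} / (1 - y pⁿ)`, which up
to the factor `1 - y` is the generating function of Dyson's rank.  All the `q`-series of this file
are values of it. -/
noncomputable def rankFn (p y : ℂ) : ℂ := 1 / qPoch p * rankSum p y

/-- Close to a point `y₀ ≠ 0` the factors `1 - y pⁿ` which do not vanish at `y₀` are bounded away
from zero, uniformly in `n`. -/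
theorem exists_le_norm_one_sub {p y₀ : ℂ} (hp0 : p ≠ 0) (hp : ‖p‖ < 1) (hy : y₀ ≠ 0) :
    ∃ c > 0, ∀ᶠ y in 𝓝 y₀, ∀ n : ℤ, y₀ * p ^ n ≠ 1 → c ≤ ‖1 - y * p ^ n‖ := by
  have hpos : 0 < ‖p‖ := norm_pos_iff.mpr hp0
  have hypos : 0 < ‖y₀‖ := norm_pos_iff.mpr hy
  obtain ⟨N, hN⟩ := ((tendsto_pow_atTop_nhds_zero_of_lt_one hpos.le hp).eventually
    (gt_mem_nhds (show 0 < min (1 / (4 * ‖y₀‖)) (‖y₀‖ / 4) by positivity))).exists_forall_of_atTop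
  have hfin : ∀ n ∈ Set.Icc (-(N : ℤ)) N, ∃ c > 0, ∀ᶠ y in 𝓝 y₀,
      y₀ * p ^ n ≠ 1 → c ≤ ‖1 - y * p ^ n‖ := by
    intro n _
    by_cases h : y₀ * p ^ n = 1
    · exact ⟨1, one_pos, by simp [h]⟩
    · have hpos' : 0 < ‖1 - y₀ * p ^ n‖ := norm_pos_iff.mpr (sub_ne_zero.mpr (Ne.symm h))
      refine ⟨‖1 - y₀ * p ^ n‖ / 2, by positivity, ?_⟩
      have hc : ContinuousAt (fun y : ℂ => ‖1 - y * p ^ n‖) y₀ := by fun_prop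
      filter_upwards [hc.eventually (lt_mem_nhds (half_lt_self hpos'))] with y hy _ using hy.le
  choose! c hc0 hc using hfin
  obtain ⟨c₀, hc₀, hc₀'⟩ : ∃ c₀ > 0, ∀ n ∈ Set.Icc (-(N : ℤ)) N, c₀ ≤ c n := by
    have hne : (Finset.Icc (-(N : ℤ)) N).Nonempty := ⟨0, by simp⟩
    obtain ⟨m, hm, hm'⟩ := Finset.exists_min_image _ c hne
    exact ⟨c m, hc0 m (by simpa using hm), fun n hn => hm' n (by simpa using hn)⟩
  refine ⟨min c₀ (1 / 2), by positivity, ?_⟩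
  have hev := ((Set.finite_Icc (-(N : ℤ)) N).eventually_all).mpr hc
  have hball : ∀ᶠ y in 𝓝 y₀, ‖y‖ < 2 * ‖y₀‖ ∧ ‖y₀‖ / 2 < ‖y‖ := by
    have hcn : ContinuousAt (fun y : ℂ => ‖y‖) y₀ := by fun_prop
    exact (hcn.eventually (gt_mem_nhds (by linarith))).and
      (hcn.eventually (lt_mem_nhds (by linarith)))
  filter_upwards [hev, hball] with y hy1 hy2 n hn
  by_cases hmem : n ∈ Set.Icc (-(N : ℤ)) N
  · exact (min_le_left _ _).trans ((hc₀' n hmem).trans (hy1 n hmem hn))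
  refine (min_le_right _ _).trans ?_
  have hcase : (N : ℤ) < n ∨ n < -N := by
    by_contra hcon
    push Not at hcon
    exact hmem ⟨hcon.2, hcon.1⟩
  rcases hcase with hlt | hlt
  · have h1 := hN n.toNat (by omega)
    have h2 : ‖p ^ n‖ = ‖p‖ ^ n.toNat := by
      rw [norm_zpow, ← zpow_natCast, Int.toNat_of_nonneg (by omega)]
    rw [← h2] at h1
    have h3 : ‖p ^ n‖ * (4 * ‖y₀‖) < 1 := by
      rw [← lt_div_iff₀ (by positivity)]
      exact h1.trans_le (min_le_left _ _)
    have h4 : ‖y * p ^ n‖ ≤ 1 / 2 := by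
      rw [norm_mul]
      nlinarith [norm_nonneg (p ^ n)]
    have := norm_sub_norm_le 1 (y * p ^ n)
    rw [norm_one] at this
    linarith
  · have h1 := hN (-n).toNat (by omega)
    have h2 : ‖p ^ n‖⁻¹ = ‖p‖ ^ (-n).toNat := by
      rw [norm_zpow, ← zpow_neg, ← zpow_natCast, Int.toNat_of_nonneg (by omega)]
    rw [← h2] at h1
    have h5 : 0 < ‖p ^ n‖ := norm_pos_iff.mpr (zpow_ne_zero _ hp0)
    have h3 : 1 < ‖y₀‖ / 4 * ‖p ^ n‖ := by
      have := h1.trans_le (min_le_right _ _)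
      rwa [inv_lt_iff_one_lt_mul₀ h5] at this
    have h4 : 2 ≤ ‖y * p ^ n‖ := by
      rw [norm_mul]
      nlinarith
    have := norm_sub_norm_le (y * p ^ n) 1
    rw [norm_one, norm_sub_rev] at this
    linarith

theorem zpow_injective_of_norm_lt_one {p : ℂ} (hp0 : p ≠ 0) (hp : ‖p‖ < 1) {m n : ℤ}
    (h : p ^ m = p ^ n) : m = n := by
  have := congrArg norm h
  rw [norm_zpow, norm_zpow] at this
  exact (zpow_right_strictAnti₀ (norm_pos_iff.mpr hp0) hp).injective this

/-- Omitting the polar term, a sum of the shape `∑ aₙ / (1 - y pⁿ)` is holomorphic near `y₀`. -/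
theorem analyticAt_tsum_regular {p y₀ : ℂ} (hp0 : p ≠ 0) (hp : ‖p‖ < 1) (hy : y₀ ≠ 0)
    {a : ℤ → ℂ} (ha : Summable fun n => ‖a n‖) :
    AnalyticAt ℂ (fun y => ∑' n : ℤ, if y₀ * p ^ n = 1 then 0 else a n / (1 - y * p ^ n)) y₀ := by
  obtain ⟨c, hc, hev⟩ := exists_le_norm_one_sub hp0 hp hy
  obtain ⟨U, hU, hUo, hyU⟩ := eventually_nhds_iff.mp hev
  refine DifferentiableOn.analyticAt (s := U) ?_ (hUo.mem_nhds hyU)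
  refine differentiableOn_tsum_of_summable_norm (ha.mul_left (1 / c)) (fun n => ?_) hUo
    (fun n y hyU => ?_)
  · split_ifs with h
    · exact differentiableOn_const _
    · refine DifferentiableOn.div (by fun_prop) (by fun_prop) (fun y hy h0 => ?_)
      have := hU y hy n h
      rw [h0, norm_zero] at this
      linarith
  · split_ifs with h
    · simpa using by positivity
    · rw [norm_div, div_eq_mul_inv, mul_comm, one_div]
      gcongr
      exact hU y hyU n h

/-- The summability of the series defining `rankFn` away from its poles. -/
theorem summable_div_one_sub {p y : ℂ} (hp0 : p ≠ 0) (hp : ‖p‖ < 1) (hy : y ≠ 0)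
    {a : ℤ → ℂ} (ha : Summable fun n => ‖a n‖) :
    Summable fun n : ℤ => a n / (1 - y * p ^ n) := by
  obtain ⟨c, hc, hev⟩ := exists_le_norm_one_sub hp0 hp hy
  have h := hev.self_of_nhds
  refine Summable.of_norm_bounded (ha.mul_left (1 / c)) (fun n => ?_)
  by_cases h1 : y * p ^ n = 1
  · simp [h1]; positivity
  · rw [norm_div, div_eq_mul_inv, mul_comm, one_div]
    gcongr
    exact h n h1

theorem rankSum_summable {p y : ℂ} (hp0 : p ≠ 0) (hp : ‖p‖ < 1) (hy : y ≠ 0) :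
    Summable fun n : ℤ => (-1 : ℂ) ^ n * p ^ pent n / (1 - y * p ^ n) :=
  summable_div_one_sub hp0 hp hy (by simpa using summable_norm_pent hp0 hp 0)

theorem analyticAt_rankFn {p y₀ : ℂ} (hp0 : p ≠ 0) (hp : ‖p‖ < 1) (hy : y₀ ≠ 0)
    (h : ∀ n : ℤ, y₀ * p ^ n ≠ 1) : AnalyticAt ℂ (rankFn p) y₀ := by
  have h1 := analyticAt_tsum_regular (a := fun n => (-1 : ℂ) ^ n * p ^ pent n) hp0 hp hy
    (by simpa using summable_norm_pent hp0 hp 0)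
  simp only [h, if_false] at h1
  exact analyticAt_const.mul h1

/-- The principal part of `rankFn` at its pole `p^{-n}`. -/
theorem exists_rankFn_eq_add_polar {p y₀ : ℂ} (hp0 : p ≠ 0) (hp : ‖p‖ < 1) (n : ℤ)
    (h : y₀ * p ^ n = 1) : ∃ H : ℂ → ℂ, AnalyticAt ℂ H y₀ ∧
      ∀ y, y ≠ 0 → rankFn p y = H y + 1 / qPoch p * ((-1 : ℂ) ^ n * p ^ pent n / (1 - y * p ^ n)) := by
  have hy : y₀ ≠ 0 := by rintro rfl; simp at h
  have hs : Summable fun n => ‖(-1 : ℂ) ^ n * p ^ pent n‖ := by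
    simpa using summable_norm_pent hp0 hp 0
  have h1 := analyticAt_tsum_regular (a := fun n => (-1 : ℂ) ^ n * p ^ pent n) hp0 hp hy hs
  refine ⟨_, analyticAt_const (v := 1 / qPoch p) |>.mul h1, fun y hy => ?_⟩
  have hiff (m : ℤ) : y₀ * p ^ m = 1 ↔ m = n := by
    refine ⟨fun hm => zpow_injective_of_norm_lt_one hp0 hp ?_, fun hm => hm ▸ h⟩
    exact mul_left_cancel₀ (by rintro rfl; simp at h) (hm.trans h.symm)
  simp only [Pi.mul_apply, rankFn, rankSum, hiff]
  rw [← mul_add, (rankSum_summable hp0 hp hy).tsum_eq_add_tsum_ite n, add_comm]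

theorem tsum_pent_sub_one {p : ℂ} (hp0 : p ≠ 0) (hp : ‖p‖ < 1) :
    ∑' n : ℤ, (-1 : ℂ) ^ n * p ^ (pent n + -1 * n) = qPoch p := by
  rw [← tsum_pent_eq_qPoch hp0 hp, ← (Equiv.neg ℤ).tsum_eq]
  refine tsum_congr fun n => ?_
  rw [Equiv.neg_apply, pent_neg, zpow_neg, ← inv_zpow]
  norm_num

theorem tsum_pent_sub_two {p : ℂ} :
    ∑' n : ℤ, (-1 : ℂ) ^ n * p ^ (pent n + -2 * n) = 0 := by
  have h : ∑' n : ℤ, (-1 : ℂ) ^ n * p ^ (pent n + -2 * n)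
      = -∑' n : ℤ, (-1 : ℂ) ^ n * p ^ (pent n + -2 * n) := by
    conv_lhs => rw [← (Equiv.subLeft (1 : ℤ)).tsum_eq]
    rw [← tsum_neg]
    refine tsum_congr fun n => ?_
    rw [Equiv.subLeft_apply, show pent (1 - n) + -2 * (1 - n) = pent n + -2 * n by
      have h1 := two_mul_pent n
      have h2 := two_mul_pent (1 - n)
      linarith [show 3 * (1 - n) ^ 2 + (1 - n) = 3 * n ^ 2 - 7 * n + 4 by ring],
      zpow_sub₀ (by norm_num), zpow_one, div_eq_mul_inv, ← inv_zpow]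
    norm_num
  exact self_eq_neg.mp h

theorem tsum_pent_sub_three {p : ℂ} (hp0 : p ≠ 0) (hp : ‖p‖ < 1) :
    ∑' n : ℤ, (-1 : ℂ) ^ n * p ^ (pent n + -3 * n) = -p⁻¹ * qPoch p := by
  rw [← tsum_pent_eq_qPoch hp0 hp, ← tsum_mul_left, ← (Equiv.addRight (1 : ℤ)).tsum_eq]
  refine tsum_congr fun n => ?_
  rw [Equiv.coe_addRight, pent_succ, show pent n + 3 * n + 2 + -3 * (n + 1) = pent n + -1 by ring,
    zpow_add₀ hp0, zpow_add₀ (by norm_num), zpow_one, zpow_neg_one]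
  ring

/-- The functional equation of the rank function: its inhomogeneity has only two terms.  Of the
three theta series `∑ (-1)ⁿ p^{n(3n+1)/2 - jn}`, `j = 1, 2, 3`, that arise in it, the middle one
vanishes and the outer ones are multiples of `(p; p)_∞`. -/
theorem rankFn_mul_nome {p y : ℂ} (hp0 : p ≠ 0) (hp : ‖p‖ < 1) (hy : y ≠ 0)
    (h : ∀ n : ℤ, y * p ^ n ≠ 1) :
    rankFn p (y * p) = -p * y ^ 3 * rankFn p y - p * y ^ 2 + 1 := by
  have hq := qPoch_ne_zero hp
  have hkey : rankSum p (y * p) = -p * y ^ 3 * (rankSum p y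
      + (y⁻¹ * ∑' n : ℤ, (-1 : ℂ) ^ n * p ^ (pent n + -1 * n)
      + y⁻¹ ^ 2 * ∑' n : ℤ, (-1 : ℂ) ^ n * p ^ (pent n + -2 * n)
      + y⁻¹ ^ 3 * ∑' n : ℤ, (-1 : ℂ) ^ n * p ^ (pent n + -3 * n))) := by
    rw [rankSum, rankSum, ← (Equiv.subRight (1 : ℤ)).tsum_eq, ← tsum_mul_left, ← tsum_mul_left,
      ← tsum_mul_left]
    have s1 := (summable_pent hp0 hp (-1)).mul_left y⁻¹
    have s2 := (summable_pent hp0 hp (-2)).mul_left (y⁻¹ ^ 2)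
    have s3 := (summable_pent hp0 hp (-3)).mul_left (y⁻¹ ^ 3)
    rw [← s1.tsum_add s2, ← (s1.add s2).tsum_add s3,
      ← (rankSum_summable hp0 hp hy).tsum_add ((s1.add s2).add s3), ← tsum_mul_left]
    refine tsum_congr fun n => ?_
    have h1 : 1 - y * p ^ n ≠ 0 := sub_ne_zero.mpr (h n).symm
    have e1 : pent (n - 1) = pent n - 3 * n + 1 := by
      have := pent_succ (n - 1)
      rw [sub_add_cancel] at this
      linarith
    have e2 : y * p * p ^ (n - 1) = y * p ^ n := by
      rw [zpow_sub_one₀ hp0]; field_simp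
    have hX : p ^ n ≠ 0 := zpow_ne_zero _ hp0
    rw [Equiv.subRight_apply, e1, e2, zpow_sub_one₀ (by norm_num), zpow_add₀ hp0, zpow_sub₀ hp0,
      zpow_one, zpow_add₀ hp0, zpow_add₀ hp0, zpow_add₀ hp0,
      show (-1 : ℤ) * n = n * (-1) by ring, show (-2 : ℤ) * n = n * (-2) by ring,
      show (-3 : ℤ) * n = n * (-3) by ring, show (3 : ℤ) * n = n * 3 by ring,
      zpow_mul, zpow_mul, zpow_mul, zpow_mul]
    generalize p ^ n = X at *
    have e3 : X ^ (3 : ℤ) = X ^ 3 := by norm_cast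
    have e4 : X ^ (-1 : ℤ) = X⁻¹ := zpow_neg_one X
    have e5 : X ^ (-2 : ℤ) = (X ^ 2)⁻¹ := by rw [zpow_neg]; norm_cast
    have e6 : X ^ (-3 : ℤ) = (X ^ 3)⁻¹ := by rw [zpow_neg]; norm_cast
    have h1' : 1 - X * y ≠ 0 := by rwa [mul_comm]
    rw [e3, e4, e5, e6]
    field_simp
    ring
  rw [tsum_pent_sub_one hp0 hp, tsum_pent_sub_two, tsum_pent_sub_three hp0 hp] at hkey
  rw [rankFn, rankFn, hkey]
  field_simp
  ring

/-- The reflection of the summation index, in terms of the argument `y`. -/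
theorem rankFn_inv {p y : ℂ} (hp0 : p ≠ 0) (hy : y ≠ 0) :
    rankFn p y⁻¹ = -y * rankFn p y := by
  rw [rankFn, rankFn, rankSum, rankSum, mul_left_comm, ← tsum_mul_left (a := -y),
    ← (Equiv.neg ℤ).tsum_eq]
  congr 1
  refine tsum_congr fun n => ?_
  have hX : p ^ n ≠ 0 := zpow_ne_zero _ hp0
  rw [Equiv.neg_apply, pent_neg, zpow_neg, ← inv_zpow, show ((-1 : ℂ))⁻¹ = -1 by norm_num,
    zpow_sub₀ hp0, zpow_neg]
  generalize p ^ n = X at *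
  by_cases h : y * X = 1
  · have h' : y⁻¹ * X⁻¹ = 1 := by rw [← mul_inv, h, inv_one]
    simp [h, h']
  · have h1 : 1 - y * X ≠ 0 := sub_ne_zero.mpr (Ne.symm h)
    have h2 : 1 - y⁻¹ * X⁻¹ ≠ 0 := by
      rw [← mul_inv, sub_ne_zero]
      intro h3
      exact h (by rw [← inv_inv (y * X), ← h3, inv_one])
    have h3 : y * X - 1 ≠ 0 := sub_ne_zero.mpr h
    have h4 : 1 - y⁻¹ * X⁻¹ = -(1 - y * X) / (y * X) := by field_simp; ring
    rw [h4, div_div_eq_mul_div, div_neg, div_eq_mul_inv, div_eq_mul_inv ((-1 : ℂ) ^ n * p ^ pent n)]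
    field_simp

/-! ### The `q`-series as values of the rank function -/

theorem calRo_eq_rankFn (q w : ℂ) (hq : q ≠ 0) :
    calRo q w = rankFn (q ^ 2) (exp (2 * Real.pi * I * w) * q) := by
  rw [calRo, rankFn, rankSum]
  congr 1
  refine tsum_congr fun n => ?_
  have e : ((q ^ 2) ^ pent n : ℂ) = q ^ (3 * n ^ 2 + n) := by
    rw [← two_mul_pent, ← zpow_natCast, ← zpow_mul]; norm_num
  have e2 : q * (q ^ 2) ^ n = q ^ (2 * n + 1) := by
    rw [← zpow_natCast, ← zpow_mul, zpow_add_one₀ hq, mul_comm]; norm_num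
  rw [e, mul_assoc (exp _), e2]

theorem hoW_eq_rankFn (q w : ℂ) : hoW q w = rankFn q (-exp (Real.pi * I * w)) := by
  rw [hoW, rankFn, rankSum]
  congr 1
  refine tsum_congr fun n => ?_
  rw [neg_mul, sub_neg_eq_add, pent]

/-- With `X = e^{2πiw} q^{2m+1}` this is the identity `X² / (1 - X) = 1 / (1 - X) - 1 - X`, summed over
`m`: the theta series of `1` is `(q²; q²)_∞`, and that of `X` vanishes. -/
theorem loW_eq_calRo {q w : ℂ} (hq0 : q ≠ 0) (hq : ‖q‖ < 1)
    (h : ∀ n : ℤ, exp (2 * Real.pi * I * w) * q ^ (2 * n + 1) ≠ 1) :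
    loW q w = (exp (2 * Real.pi * I * w))⁻¹ ^ 2 * q⁻¹ ^ 2 * (calRo q w - 1) := by
  set x := exp (2 * Real.pi * I * w) with hx
  have hx0 : x ≠ 0 := exp_ne_zero _
  have hp0 : q ^ 2 ≠ 0 := pow_ne_zero _ hq0
  have hp : ‖q ^ 2‖ < 1 := by rw [norm_pow]; exact pow_lt_one₀ (norm_nonneg _) hq (by norm_num)
  have hPh := qPoch_ne_zero hp
  have e2 (n : ℤ) : x * q * (q ^ 2) ^ n = x * q ^ (2 * n + 1) := by
    rw [← zpow_natCast, ← zpow_mul, zpow_add_one₀ hq0, mul_assoc, mul_comm q]; norm_num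
  have hpole (n : ℤ) : x * q * (q ^ 2) ^ n ≠ 1 := by rw [e2]; exact h n
  have key : ∑' m : ℤ, (-1 : ℂ) ^ m * q ^ (3 * m ^ 2 + 5 * m) / (1 - x * q ^ (2 * m + 1))
      = x⁻¹ ^ 2 * q⁻¹ ^ 2 * (rankSum (q ^ 2) (x * q)
        - ∑' n : ℤ, (-1 : ℂ) ^ n * (q ^ 2) ^ (pent n)
        - x * q * ∑' n : ℤ, (-1 : ℂ) ^ n * (q ^ 2) ^ (pent n + 1 * n)) := by
    have s1 := summable_pent hp0 hp 0
    simp only [zero_mul, add_zero] at s1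
    have s2 := (summable_pent hp0 hp 1).mul_left (x * q)
    have s3 := rankSum_summable hp0 hp (mul_ne_zero hx0 hq0)
    rw [rankSum, ← tsum_mul_left (a := x * q), ← s3.tsum_sub s1, ← (s3.sub s1).tsum_sub s2,
      ← tsum_mul_left]
    refine tsum_congr fun n => ?_
    have h1 : 1 - x * q * (q ^ 2) ^ n ≠ 0 := sub_ne_zero.mpr (hpole n).symm
    have e3 : q ^ (3 * n ^ 2 + 5 * n) = (q ^ 2) ^ pent n * ((q ^ 2) ^ n) ^ 2 := by
      rw [← zpow_natCast, ← zpow_natCast, ← zpow_mul, ← zpow_mul, ← zpow_mul, ← zpow_add₀ hq0]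
      congr 1
      have := two_mul_pent n
      push_cast
      linarith
    rw [← e2, e3, zpow_add₀ hp0, one_mul]
    generalize (q ^ 2) ^ n = X at *
    have h1' : 1 - q * X * x ≠ 0 := by convert h1 using 2; ring
    have h1'' : 1 - q * x * X ≠ 0 := by convert h1 using 2; ring
    field_simp
    ring
  have hz : ∑' n : ℤ, (-1 : ℂ) ^ n * (q ^ 2) ^ (pent n + 1 * n) = 0 := by
    have := tsum_pent_sub_two (p := q ^ 2)
    rw [← (Equiv.addRight (1 : ℤ)).tsum_eq] at this
    rw [← neg_eq_zero, ← this, ← tsum_neg]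
    refine tsum_congr fun n => ?_
    rw [Equiv.coe_addRight, pent_succ, zpow_add_one₀ (by norm_num : (-1 : ℂ) ≠ 0),
      show pent n + 3 * n + 2 + -2 * (n + 1) = pent n + 1 * n by ring]
    ring
  rw [loW, ← hx, key, tsum_pent_eq_qPoch hp0 hp, hz, calRo_eq_rankFn q w hq0, rankFn, ← hx]
  field_simp
  ring

/-! ### Contour shifts along oblique lines -/

/-- The point with parameter `t` on the line of direction `iz` through the real number `a`. -/
noncomputable def obliqueLine (z : ℂ) (a t : ℝ) : ℂ := a + I * z * t

theorem obliqueRe_add (z u v : ℂ) : obliqueRe z (u + v) = obliqueRe z u + obliqueRe z v := by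
  simp only [obliqueRe, add_re, add_im]; ring

theorem obliqueRe_neg (z u : ℂ) : obliqueRe z (-u) = -obliqueRe z u := by
  simp only [obliqueRe, neg_re, neg_im]; ring

theorem obliqueRe_sub (z u v : ℂ) : obliqueRe z (u - v) = obliqueRe z u - obliqueRe z v := by
  rw [sub_eq_add_neg, obliqueRe_add, obliqueRe_neg, sub_eq_add_neg]

theorem obliqueRe_ofReal (z : ℂ) (a : ℝ) : obliqueRe z a = a := by simp [obliqueRe]

theorem obliqueRe_obliqueLine {z : ℂ} (hz : 0 < z.re) (a t : ℝ) :
    obliqueRe z (obliqueLine z a t) = a := by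
  simp only [obliqueRe, obliqueLine, add_re, mul_re, mul_im, I_re, I_im, ofReal_re, ofReal_im,
    add_im]
  field_simp
  ring

theorem obliqueLine_im (z : ℂ) (a t : ℝ) : (obliqueLine z a t).im = z.re * t := by
  simp [obliqueLine]

theorem obliqueLine_eq {z : ℂ} (hz : 0 < z.re) (w : ℂ) :
    obliqueLine z (obliqueRe z w) (w.im / z.re) = w := by
  apply Complex.ext
  · simp only [obliqueRe, obliqueLine, add_re, mul_re, mul_im, I_re, I_im, ofReal_re, ofReal_im]
    field_simp
    ring
  · rw [obliqueLine_im]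
    field_simp

theorem obliqueLine_add (z : ℂ) (a b s t : ℝ) :
    obliqueLine z (a + b) (s + t) = obliqueLine z a s + obliqueLine z b t := by
  simp only [obliqueLine]; push_cast; ring

theorem continuous_obliqueLine (z : ℂ) : Continuous fun x : ℝ × ℝ => obliqueLine z x.1 x.2 := by
  unfold obliqueLine; fun_prop

theorem hasDerivAt_obliqueLine (z : ℂ) (a t : ℝ) : HasDerivAt (obliqueLine z a) (I * z) t := by
  unfold obliqueLine
  simpa using ((hasDerivAt_id t).ofReal_comp.const_mul (I * z)).const_add (a : ℂ)

theorem hasDerivAt_obliqueLine_left (z : ℂ) (a t : ℝ) :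
    HasDerivAt (fun a => obliqueLine z a t) 1 a := by
  unfold obliqueLine
  simpa using (hasDerivAt_id a).ofReal_comp.add_const (I * z * t)

theorem isOpen_obliqueStrip (z : ℂ) (a₁ a₂ : ℝ) :
    IsOpen {s : ℂ | a₁ < obliqueRe z s ∧ obliqueRe z s < a₂} := by
  have : Continuous (obliqueRe z) := by unfold obliqueRe; fun_prop
  exact (isOpen_lt continuous_const this).inter (isOpen_lt this continuous_const)

theorem integrable_exp_neg_mul_abs {c : ℝ} (hc : 0 < c) :
    Integrable fun t : ℝ => Real.exp (-(c * |t|)) := by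
  rw [← integrableOn_univ, ← Set.Iic_union_Ioi (a := (0 : ℝ))]
  refine IntegrableOn.union ?_ ?_
  · refine (integrableOn_exp_mul_Iic hc 0).congr_fun (fun t ht => ?_) measurableSet_Iic
    simp [abs_of_nonpos (Set.mem_Iic.mp ht)]
  · refine (integrableOn_exp_mul_Ioi (neg_lt_zero.mpr hc) 0).congr_fun (fun t ht => ?_)
      measurableSet_Ioi
    simp [abs_of_pos (Set.mem_Ioi.mp ht)]

/-- Exponential decay of `F` along the lines of direction `iz`, locally uniformly for the lines
in an open strip. -/
def ExpDecay (z : ℂ) (F : ℂ → ℂ) (a₁ a₂ : ℝ) : Prop :=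
  ∃ B c : ℝ, 0 < c ∧ ∀ a, a₁ < a → a < a₂ → ∀ t : ℝ,
    ‖F (obliqueLine z a t)‖ ≤ B * Real.exp (-(c * |t|))

theorem ExpDecay.integrable {z : ℂ} (hz : 0 < z.re) {F : ℂ → ℂ} {a₁ a₂ a : ℝ}
    (h : ExpDecay z F a₁ a₂)
    (hF : ContinuousOn F {s : ℂ | a₁ < obliqueRe z s ∧ obliqueRe z s < a₂}) (h1 : a₁ < a)
    (h2 : a < a₂) : Integrable fun t : ℝ => F (obliqueLine z a t) := by
  obtain ⟨B, c, hc, hb⟩ := h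
  refine ((integrable_exp_neg_mul_abs hc).const_mul B).mono' ?_ (ae_of_all _ (hb a h1 h2))
  refine (hF.comp_continuous (f := fun t => obliqueLine z a t) ?_ fun t => ?_).aestronglyMeasurable
  · unfold obliqueLine; fun_prop
  · simp [obliqueRe_obliqueLine hz, h1, h2]

/-- The integral of a decaying holomorphic function along a line of direction `iz` does not depend
on the line: its derivative in the transversal parameter is the integral of a derivative along the
line. -/
theorem ExpDecay.integral_eq {z : ℂ} (hz : 0 < z.re) {F : ℂ → ℂ} {a₁ a₂ : ℝ}
    (h : ExpDecay z F a₁ a₂)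
    (hF : DifferentiableOn ℂ F {s : ℂ | a₁ < obliqueRe z s ∧ obliqueRe z s < a₂})
    {a b : ℝ} (ha1 : a₁ < a) (ha2 : a < a₂) (hb1 : a₁ < b) (hb2 : b < a₂) :
    ∫ t : ℝ, F (obliqueLine z a t) = ∫ t : ℝ, F (obliqueLine z b t) := by
  have hS := isOpen_obliqueStrip z a₁ a₂
  have hint := fun {a : ℝ} => h.integrable hz hF.continuousOn (a := a)
  obtain ⟨B, c, hc, hb⟩ := h
  have hmem {a : ℝ} (h1 : a₁ < a) (h2 : a < a₂) (t : ℝ) :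
      obliqueLine z a t ∈ {s : ℂ | a₁ < obliqueRe z s ∧ obliqueRe z s < a₂} := by
    simp [obliqueRe_obliqueLine hz, h1, h2]
  have hd {a : ℝ} (h1 : a₁ < a) (h2 : a < a₂) (t : ℝ) :
      HasDerivAt F (deriv F (obliqueLine z a t)) (obliqueLine z a t) :=
    (hF.differentiableAt (hS.mem_nhds (hmem h1 h2 t))).hasDerivAt
  have key : ∀ a, a₁ < a → a < a₂ →
      HasDerivAt (fun a : ℝ => ∫ t : ℝ, F (obliqueLine z a t)) 0 a := by
    intro a h1 h2
    -- `δ` bounds the distance to the boundary of the strip, `r` is the radius for Cauchy's estimate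
    obtain ⟨δ, hδ, hδ1, hδ2⟩ : ∃ δ > 0, a₁ < a - 2 * δ ∧ a + 2 * δ < a₂ := by
      refine ⟨min (a - a₁) (a₂ - a) / 4, by
        have := lt_min (sub_pos.mpr h1) (sub_pos.mpr h2); positivity, ?_, ?_⟩
      · have := min_le_left (a - a₁) (a₂ - a); linarith
      · have := min_le_right (a - a₁) (a₂ - a); linarith
    set M := 1 + |z.im / z.re| with hM
    have hMpos : 0 < M := by positivity
    set r := δ / M with hr
    have hrpos : 0 < r := by positivity
    have hob (u : ℂ) (hu : ‖u‖ ≤ r) : |obliqueRe z u| ≤ δ := by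
      have e : obliqueRe z u = u.re + u.im * (z.im / z.re) := by unfold obliqueRe; ring
      rw [e]
      calc |u.re + u.im * (z.im / z.re)| ≤ |u.re| + |u.im| * |z.im / z.re| := by
            rw [← abs_mul]; exact abs_add_le _ _
        _ ≤ r + r * |z.im / z.re| := by
            gcongr
            · exact (abs_re_le_norm u).trans hu
            · exact (abs_im_le_norm u).trans hu
        _ = δ := by rw [hr, hM]; field_simp
    have hbound : ∀ a' ∈ Metric.ball a δ, ∀ t : ℝ, ‖deriv F (obliqueLine z a' t)‖ ≤
        (|B| * Real.exp (c * (r / z.re)) / r) * Real.exp (-(c * |t|)) := by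
      intro a' ha' t
      rw [Metric.mem_ball, Real.dist_eq, abs_lt] at ha'
      have hin (u : ℂ) (hu : ‖u‖ ≤ r) : obliqueLine z a' t + u = obliqueLine z (a' + obliqueRe z u)
          (t + u.im / z.re) ∧ a₁ < a' + obliqueRe z u ∧ a' + obliqueRe z u < a₂ := by
        have := abs_le.mp (hob u hu)
        refine ⟨by rw [obliqueLine_add, obliqueLine_eq hz], ?_, ?_⟩ <;> linarith
      have hcl : ∀ s ∈ Metric.closedBall (obliqueLine z a' t) r,
          s ∈ {s : ℂ | a₁ < obliqueRe z s ∧ obliqueRe z s < a₂} := by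
        intro s hs
        obtain ⟨e, e1, e2⟩ := hin (s - obliqueLine z a' t) (by simpa [dist_eq] using hs)
        rw [add_sub_cancel] at e
        rw [e]
        exact hmem e1 e2 _
      have := norm_deriv_le_of_forall_mem_sphere_norm_le (f := F) (c := obliqueLine z a' t)
        (C := |B| * Real.exp (c * (r / z.re)) * Real.exp (-(c * |t|))) hrpos
        ((hF.mono hcl).diffContOnCl_ball subset_rfl) ?_
      · convert this using 1; ring
      · intro s hs
        have hs' : ‖s - obliqueLine z a' t‖ = r := by simpa [dist_eq] using hs
        obtain ⟨e, e1, e2⟩ := hin (s - obliqueLine z a' t) hs'.le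
        set u := s - obliqueLine z a' t
        rw [add_sub_cancel] at e
        rw [e]
        refine (hb _ e1 e2 _).trans ?_
        rw [mul_assoc, ← Real.exp_add]
        refine mul_le_mul (le_abs_self B) (Real.exp_le_exp.mpr ?_) (Real.exp_nonneg _)
          (abs_nonneg _)
        have h3 : |t| ≤ |t + u.im / z.re| + r / z.re := by
          calc |t| = |t + u.im / z.re + -(u.im / z.re)| := by ring_nf
            _ ≤ |t + u.im / z.re| + |-(u.im / z.re)| := abs_add_le _ _
            _ ≤ _ := by
              gcongr
              rw [abs_neg, abs_div, abs_of_pos hz]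
              gcongr
              exact (abs_im_le_norm u).trans hs'.le
        nlinarith
    have hball : ∀ a' ∈ Metric.ball a δ, a₁ < a' ∧ a' < a₂ := by
      intro a' ha'
      rw [Metric.mem_ball, Real.dist_eq, abs_lt] at ha'
      constructor <;> linarith
    have hcontd : Continuous fun t : ℝ => deriv F (obliqueLine z a t) := by
      refine (hF.deriv hS).continuousOn.comp_continuous (f := fun t => obliqueLine z a t) ?_
        (hmem h1 h2)
      unfold obliqueLine; fun_prop
    obtain ⟨hi, hD⟩ := hasDerivAt_integral_of_dominated_loc_of_deriv_le
      (F := fun (a : ℝ) (t : ℝ) => F (obliqueLine z a t))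
      (F' := fun (a : ℝ) (t : ℝ) => deriv F (obliqueLine z a t)) (μ := volume)
      (Metric.ball_mem_nhds a hδ)
      (by filter_upwards [Metric.ball_mem_nhds a hδ] with a' ha'
          exact (hint (hball a' ha').1 (hball a' ha').2).aestronglyMeasurable)
      (hint h1 h2) hcontd.aestronglyMeasurable
      (ae_of_all _ fun t a' ha' => hbound a' ha' t)
      ((integrable_exp_neg_mul_abs hc).const_mul _)
      (ae_of_all _ fun t a' ha' => by
        have := (hd (hball a' ha').1 (hball a' ha').2 t).comp a' (hasDerivAt_obliqueLine_left z a' t)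
        rw [mul_one] at this
        exact this)
    have hz0 : I * z ≠ 0 := mul_ne_zero I_ne_zero (by rintro rfl; simp at hz)
    have hlim : Tendsto (fun t : ℝ => (I * z)⁻¹ * F (obliqueLine z a t)) (cocompact ℝ) (𝓝 0) := by
      rw [← mul_zero (I * z)⁻¹]
      refine Tendsto.const_mul _ (squeeze_zero_norm (hb a h1 h2) ?_)
      rw [← mul_zero B]
      refine Tendsto.const_mul _ (Real.tendsto_exp_neg_atTop_nhds_zero.comp ?_)
      exact (tendsto_norm_cocompact_atTop (E := ℝ)).const_mul_atTop hc
    have h0 := integral_of_hasDerivAt_of_tendsto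
      (f := fun t : ℝ => (I * z)⁻¹ * F (obliqueLine z a t)) (fun t => by
        have := ((hd h1 h2 t).comp t (hasDerivAt_obliqueLine z a t)).const_mul (I * z)⁻¹
        rw [mul_comm (deriv F _), inv_mul_cancel_left₀ hz0] at this
        exact this)
      hi (hlim.mono_left atBot_le_cocompact) (hlim.mono_left atTop_le_cocompact)
    rw [h0, sub_zero] at hD
    exact hD
  refine isOpen_Ioo.is_const_of_deriv_eq_zero (s := Set.Ioo a₁ a₂)
    (f := fun a : ℝ => ∫ t : ℝ, F (obliqueLine z a t)) isPreconnected_Ioo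
    (fun a ha => (key a ha.1 ha.2).differentiableAt.differentiableWithinAt)
    (fun a ha => (key a ha.1 ha.2).deriv) ⟨ha1, ha2⟩ ⟨hb1, hb2⟩

/-- Decay far out on the lines suffices: the remaining part of a closed strip is compact. -/
theorem ExpDecay.of_tail {z : ℂ} {F : ℂ → ℂ} {a₁ a₂ : ℝ} {B c T : ℝ} (hc : 0 < c)
    (hF : ∀ a ∈ Set.Icc a₁ a₂, ∀ t, ContinuousAt F (obliqueLine z a t))
    (h : ∀ a ∈ Set.Icc a₁ a₂, ∀ t : ℝ, T ≤ |t| →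
      ‖F (obliqueLine z a t)‖ ≤ B * Real.exp (-(c * |t|))) :
    ExpDecay z F a₁ a₂ := by
  have hcomp : IsCompact (Set.Icc a₁ a₂ ×ˢ Set.Icc (-T) T) := isCompact_Icc.prod isCompact_Icc
  have hcont : ContinuousOn (fun x : ℝ × ℝ => F (obliqueLine z x.1 x.2))
      (Set.Icc a₁ a₂ ×ˢ Set.Icc (-T) T) := fun x hx =>
    (ContinuousAt.comp (f := fun x : ℝ × ℝ => obliqueLine z x.1 x.2) (hF x.1 hx.1 x.2)
      (continuous_obliqueLine z).continuousAt).continuousWithinAt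
  obtain ⟨C, hC⟩ := hcomp.exists_bound_of_continuousOn hcont
  refine ⟨max |B| (|C| * Real.exp (c * |T|)), c, hc, fun a h1 h2 t => ?_⟩
  by_cases ht : T ≤ |t|
  · refine (h a ⟨h1.le, h2.le⟩ t ht).trans ?_
    gcongr
    exact (le_abs_self B).trans (le_max_left _ _)
  · push Not at ht
    refine (hC (a, t) ⟨⟨h1.le, h2.le⟩, ?_⟩).trans ?_
    · exact ⟨by linarith [neg_abs_le t], by linarith [le_abs_self t]⟩
    calc C ≤ |C| * 1 := by rw [mul_one]; exact le_abs_self C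
      _ ≤ |C| * (Real.exp (c * |T|) * Real.exp (-(c * |t|))) := by
          gcongr
          rw [← Real.exp_add]
          apply Real.one_le_exp
          nlinarith [le_abs_self T]
      _ ≤ _ := by
          rw [← mul_assoc]
          gcongr
          exact le_max_right _ _

/-! ### The kernel `1 / sin` and the reconstruction of an entire function -/

theorem exp_abs_im_le_norm_sin {u : ℂ} (hu : 1 ≤ |u.im|) :
    Real.exp |u.im| / 4 ≤ ‖sin u‖ := by
  have h1 : ‖exp (-u * I)‖ = Real.exp u.im := by rw [norm_exp]; simp
  have h2 : ‖exp (u * I)‖ = Real.exp (-u.im) := by rw [norm_exp]; simp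
  have h3 : ‖sin u‖ = ‖exp (-u * I) - exp (u * I)‖ / 2 := by
    rw [sin, norm_div, norm_mul, norm_I, mul_one, RCLike.norm_ofNat]
  have h5 : Real.exp (-|u.im|) ≤ Real.exp |u.im| / 2 := by
    have e : Real.exp (-|u.im|) * Real.exp |u.im| = 1 := by rw [← Real.exp_add]; simp
    have := Real.add_one_le_exp |u.im|
    have := Real.exp_pos (-|u.im|)
    nlinarith
  have h6 : Real.exp |u.im| - Real.exp (-|u.im|) ≤ ‖exp (-u * I) - exp (u * I)‖ := by
    rcases abs_cases u.im with ⟨h, _⟩ | ⟨h, _⟩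
    · rw [h, ← h1, ← h2]; exact norm_sub_norm_le _ _
    · rw [h, neg_neg, ← h1, ← h2, norm_sub_rev]; exact norm_sub_norm_le _ _
  rw [h3]
  linarith

theorem sin_pi_mul_ne_zero {z u : ℂ} (h : ∀ n : ℤ, obliqueRe z u ≠ n) : sin (Real.pi * u) ≠ 0 := by
  rw [Ne, sin_eq_zero_iff]
  rintro ⟨k, hk⟩
  have hpi : (Real.pi : ℂ) ≠ 0 := ofReal_ne_zero.mpr Real.pi_ne_zero
  rw [mul_comm] at hk
  have : u = ((k : ℝ) : ℂ) := by exact_mod_cast mul_right_cancel₀ hpi hk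
  exact h k (by rw [this, obliqueRe_ofReal])

/-- Far out on the lines, `1 / sin (π (s - w))` decays exponentially. -/
theorem inv_sin_tail {z w : ℂ} (hz : 0 < z.re) : ∃ B c T : ℝ, 0 < c ∧ 0 ≤ B ∧ ∀ a t : ℝ, T ≤ |t| →
    ‖(sin (Real.pi * (obliqueLine z a t - w)))⁻¹‖ ≤ B * Real.exp (-(c * |t|)) := by
  have hpi := Real.pi_pos
  refine ⟨4 * Real.exp (Real.pi * |w.im|), Real.pi * z.re, (1 / Real.pi + |w.im|) / z.re,
    by positivity, by positivity, fun a t ht => ?_⟩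
  have him : (Real.pi * (obliqueLine z a t - w)).im = Real.pi * (z.re * t - w.im) := by
    rw [im_ofReal_mul, sub_im, obliqueLine_im]
  have h1 : z.re * |t| - |w.im| ≤ |z.re * t - w.im| := by
    have := abs_sub_abs_le_abs_sub (z.re * t) w.im
    rwa [abs_mul, abs_of_pos hz] at this
  have h2 : 1 / Real.pi ≤ z.re * |t| - |w.im| := by
    rw [div_le_iff₀ hz] at ht; linarith
  have h3 : Real.pi * (z.re * |t| - |w.im|) ≤ |(Real.pi * (obliqueLine z a t - w)).im| := by
    rw [him, abs_mul, abs_of_pos hpi]; gcongr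
  have h4 : 1 ≤ |(Real.pi * (obliqueLine z a t - w)).im| := by
    refine le_trans ?_ h3
    rw [div_le_iff₀ hpi] at h2; linarith
  have h5 := exp_abs_im_le_norm_sin h4
  have h6 := Real.exp_le_exp.mpr h3
  rw [norm_inv]
  calc ‖sin (Real.pi * (obliqueLine z a t - w))‖⁻¹
      ≤ (Real.exp (Real.pi * (z.re * |t| - |w.im|)) / 4)⁻¹ := by
        gcongr; linarith
    _ = _ := by
        rw [inv_div, div_eq_mul_inv, ← Real.exp_neg, mul_assoc, ← Real.exp_add]
        ring_nf

/-- On the lines with `0 < a < 1` the value `tan (πu/2)`, written in terms of `e^{πiu}`, is defined and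
avoids the branch cut of the logarithm. -/
theorem tan_half_mem_slitPlane {z : ℂ} (hz : 0 < z.re) {a : ℝ} (h0 : 0 < a) (h1 : a < 1) (t : ℝ) :
    1 + exp (I * Real.pi * obliqueLine z a t) ≠ 0 ∧
    I * (1 - exp (I * Real.pi * obliqueLine z a t)) / (1 + exp (I * Real.pi * obliqueLine z a t))
      ∈ slitPlane := by
  set u := obliqueLine z a t with hu
  set E := exp (I * Real.pi * u) with hE
  have hnorm : ‖E‖ = Real.exp (-(Real.pi * (z.re * t))) := by
    rw [hE, norm_exp]
    congr 1
    rw [← obliqueLine_im z a t, ← hu]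
    simp
  -- `E` lies on the unit circle only for `t = 0`, where `E = exp (π i a)` is in the upper half plane
  have hpos : ‖E‖ = 1 → 0 < E.im := by
    intro h
    rw [hnorm, Real.exp_eq_one_iff, neg_eq_zero, mul_eq_zero, mul_eq_zero] at h
    have ht : t = 0 := by
      rcases h with h | h | h
      · exact absurd h Real.pi_ne_zero
      · exact absurd h hz.ne'
      · exact h
    have : E = exp ((Real.pi * a : ℝ) * I) := by
      rw [hE, hu, ht, obliqueLine]; push_cast; ring_nf
    rw [this, exp_ofReal_mul_I_im]
    exact Real.sin_pos_of_pos_of_lt_pi (by positivity) (by nlinarith [Real.pi_pos])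
  have hne : 1 + E ≠ 0 := by
    intro h
    have h2 : E = -1 := by linear_combination h
    have := hpos (by rw [h2]; simp)
    rw [h2] at this
    simp at this
  refine ⟨hne, ?_⟩
  rw [mem_slitPlane_iff_not_le_zero, Complex.le_def]
  rintro ⟨hre, him⟩
  set r := (I * (1 - E) / (1 + E)).re with hr
  have hval : I * (1 - E) / (1 + E) = r := by
    apply Complex.ext
    · rw [hr, ofReal_re]
    · rw [ofReal_im, him, zero_im]
  rw [div_eq_iff hne] at hval
  have hre' := congrArg re hval
  have him' := congrArg im hval
  simp at hre' him'
  simp only [zero_re] at hre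
  -- the two real equations say `E = (i - r) / (i + r)`
  have e1 : E.im * (1 + r ^ 2) = 2 * r := by nlinarith
  have e2 : E.re * (1 + r ^ 2) = 1 - r ^ 2 := by nlinarith
  have hp : 0 < 1 + r ^ 2 := by positivity
  have h3 : ‖E‖ = 1 := by
    have h4 : (E.re ^ 2 + E.im ^ 2) * (1 + r ^ 2) ^ 2 = 1 * (1 + r ^ 2) ^ 2 := by
      linear_combination (E.re * (1 + r ^ 2) + 1 - r ^ 2) * e2 + (E.im * (1 + r ^ 2) + 2 * r) * e1
    have h5 := mul_right_cancel₀ (pow_ne_zero 2 hp.ne') h4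
    have h6 : ‖E‖ ^ 2 = 1 := by
      rw [← normSq_eq_norm_sq, normSq_apply, ← h5]; ring
    exact (pow_eq_one_iff_of_nonneg (norm_nonneg _) (by norm_num)).mp h6
  have := hpos h3
  nlinarith

/-- `log tan (πu/2)` is a primitive of `π / sin (πu)` along a line `0 < a < 1`. -/
theorem integral_inv_sin {z : ℂ} (hz : 0 < z.re) {a : ℝ} (h0 : 0 < a) (h1 : a < 1) :
    Integrable (fun t : ℝ => (sin (Real.pi * obliqueLine z a t))⁻¹) ∧
      ∫ t : ℝ, (sin (Real.pi * obliqueLine z a t))⁻¹ = 1 / z := by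
  have hpi : (Real.pi : ℂ) ≠ 0 := ofReal_ne_zero.mpr Real.pi_ne_zero
  have hz0 : z ≠ 0 := by rintro rfl; simp at hz
  have hsin (t : ℝ) : sin (Real.pi * obliqueLine z a t) ≠ 0 := by
    refine sin_pi_mul_ne_zero (z := z) fun n hn => ?_
    rw [obliqueRe_obliqueLine hz] at hn
    rw [hn] at h0 h1
    have h0' : 0 < n := by exact_mod_cast h0
    have h1' : n < 1 := by exact_mod_cast h1
    omega
  have hint : Integrable (fun t : ℝ => (sin (Real.pi * obliqueLine z a t))⁻¹) := by
    obtain ⟨B, c, T, hc, -, hB⟩ := inv_sin_tail (w := 0) hz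
    have := ExpDecay.of_tail (z := z) (F := fun s => (sin (Real.pi * (s - 0)))⁻¹) (a₁ := a / 2)
      (a₂ := (1 + a) / 2) hc (fun b hb t => ?_) (fun b _ t ht => hB b t ht)
    · have := this.integrable (a := a) hz ?_ (by linarith) (by linarith)
      · simpa using this
      · refine ContinuousOn.inv₀ (by fun_prop) fun s hs => ?_
        rw [sub_zero]
        refine sin_pi_mul_ne_zero (z := z) fun n hn => ?_
        simp only [Set.mem_ofPred_eq, hn] at hs
        have h0' : 0 < n := by exact_mod_cast (by linarith : (0 : ℝ) < n)
        have h1' : n < 1 := by exact_mod_cast (by linarith : (n : ℝ) < 1)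
        omega
    · refine ContinuousAt.inv₀ (by fun_prop) ?_
      rw [sub_zero]
      refine sin_pi_mul_ne_zero (z := z) fun n hn => ?_
      rw [obliqueRe_obliqueLine hz] at hn
      rw [hn, Set.mem_Icc] at hb
      have h0' : 0 < n := by exact_mod_cast (by linarith : (0 : ℝ) < n)
      have h1' : n < 1 := by exact_mod_cast (by linarith : (n : ℝ) < 1)
      omega
  refine ⟨hint, ?_⟩
  set E : ℝ → ℂ := fun t => exp (I * Real.pi * obliqueLine z a t) with hE
  have hE0 (t : ℝ) : E t ≠ 0 := exp_ne_zero _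
  have hnorm (t : ℝ) : ‖E t‖ = Real.exp (-(Real.pi * (z.re * t))) := by
    rw [hE, norm_exp]
    congr 1
    rw [← obliqueLine_im z a t]
    simp
  have hEd (t : ℝ) : HasDerivAt E (E t * (I * Real.pi * (I * z))) t := by
    have := ((hasDerivAt_obliqueLine z a t).const_mul (I * Real.pi)).cexp
    exact this
  have htop : Tendsto E atTop (𝓝 0) := by
    refine squeeze_zero_norm (fun t => (hnorm t).le) ?_
    refine Real.tendsto_exp_neg_atTop_nhds_zero.comp ?_
    exact (tendsto_id.const_mul_atTop hz).const_mul_atTop Real.pi_pos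
  have hbot : Tendsto (fun t => (E t)⁻¹) atBot (𝓝 0) := by
    refine squeeze_zero_norm (a := fun t => Real.exp (Real.pi * (z.re * t))) (fun t => ?_) ?_
    · rw [norm_inv, hnorm, ← Real.exp_neg, neg_neg]
    · refine Real.tendsto_exp_atBot.comp ?_
      exact (tendsto_id.const_mul_atBot hz).const_mul_atBot Real.pi_pos
  set L : ℝ → ℂ := fun t => (I * z * Real.pi)⁻¹ * log (I * (1 - E t) / (1 + E t)) with hL
  have hLd (t : ℝ) : HasDerivAt L ((sin (Real.pi * obliqueLine z a t))⁻¹) t := by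
    obtain ⟨hne, hslit⟩ := tan_half_mem_slitPlane hz h0 h1 t
    have hn2 : 1 - E t ≠ 0 := by
      intro h
      have h' : exp (I * Real.pi * obliqueLine z a t) = 1 := by
        linear_combination -h
      rw [h'] at hslit
      simp at hslit
    have hne' : 1 + E t ≠ 0 := hne
    have hq : HasDerivAt (fun t => I * (1 - E t) / (1 + E t)) _ t :=
      (((hEd t).const_sub 1).const_mul I).div ((hEd t).const_add 1) hne
    have h2 := ((hq.clog_real hslit).const_mul (I * z * Real.pi)⁻¹)
    refine h2.congr_deriv (Eq.symm ?_)
    have hs : sin (Real.pi * obliqueLine z a t) = ((E t)⁻¹ - E t) * I / 2 := by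
      rw [sin, hE, ← exp_neg]; ring_nf
    have hs' : (E t)⁻¹ - E t ≠ 0 := by
      intro h; rw [h] at hs; exact hsin t (by rw [hs]; simp)
    rw [hs]
    have hE0t := hE0 t
    have hs'' : 1 - E t ^ 2 ≠ 0 := by
      intro h; apply hs'; field_simp; rw [h, mul_zero]
    generalize E t = X at *
    have hs3 : (X⁻¹ - X) = (1 - X ^ 2) / X := by field_simp
    rw [hs3]
    field_simp
    rw [show (1 - X ^ 2) = (1 - X) * (1 + X) by ring, I_sq]
    ring
  have hltop : Tendsto L atTop (𝓝 ((I * z * Real.pi)⁻¹ * log I)) := by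
    refine Tendsto.const_mul _ (Tendsto.clog ?_ (by simp [slitPlane]))
    have : Tendsto (fun t => I * (1 - E t) / (1 + E t)) atTop (𝓝 (I * (1 - 0) / (1 + 0))) :=
      ((htop.const_sub 1).const_mul I).div (htop.const_add 1) (by norm_num)
    simpa using this
  have hlbot : Tendsto L atBot (𝓝 ((I * z * Real.pi)⁻¹ * log (-I))) := by
    refine Tendsto.const_mul _ (Tendsto.clog ?_ (by simp [slitPlane]))
    have : Tendsto (fun t => I * ((E t)⁻¹ - 1) / ((E t)⁻¹ + 1)) atBot
        (𝓝 (I * (0 - 1) / (0 + 1))) :=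
      ((hbot.sub_const 1).const_mul I).div (hbot.add_const 1) (by norm_num)
    have h3 : I * ((0 : ℂ) - 1) / (0 + 1) = -I := by norm_num
    rw [h3] at this
    refine this.congr fun t => ?_
    have hE0t := hE0 t
    rw [show (E t)⁻¹ - 1 = (1 - E t) / E t by field_simp,
      show (E t)⁻¹ + 1 = (1 + E t) / E t by field_simp]
    field_simp
  rw [integral_of_hasDerivAt_of_tendsto hLd hint hlbot hltop, log_I, log_neg_I]
  field_simp
  ring

/-- Boundedness on every closed strip of lines of direction `iz`. -/
def BoundedOnStrips (z : ℂ) (D : ℂ → ℂ) : Prop :=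
  ∀ a₁ a₂ : ℝ, ∃ B : ℝ, ∀ a ∈ Set.Icc a₁ a₂, ∀ t : ℝ, ‖D (obliqueLine z a t)‖ ≤ B

theorem sin_pi_sub_ne_zero {z w s : ℂ} (h1 : obliqueRe z w - 1 < obliqueRe z s)
    (h2 : obliqueRe z s < obliqueRe z w + 1) (hne : s ≠ w) : sin (Real.pi * (s - w)) ≠ 0 := by
  rw [Ne, sin_eq_zero_iff]
  rintro ⟨k, hk⟩
  have hpi : (Real.pi : ℂ) ≠ 0 := ofReal_ne_zero.mpr Real.pi_ne_zero
  rw [mul_comm] at hk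
  have hk' : s - w = ((k : ℝ) : ℂ) := by exact_mod_cast mul_right_cancel₀ hpi hk
  have h3 : obliqueRe z s - obliqueRe z w = k := by
    rw [← obliqueRe_sub, hk', obliqueRe_ofReal]
  have h4 : -1 < k := by exact_mod_cast (by linarith : (-1 : ℝ) < k)
  have h5 : k < 1 := by exact_mod_cast (by linarith : (k : ℝ) < 1)
  have h6 : k = 0 := by omega
  rw [h6] at hk'
  exact hne (sub_eq_zero.mp (by simpa using hk'))

/-- Integrability on a line which avoids the poles `w + ℤ` of the kernel. -/
theorem integrable_mul_inv_sin {z w : ℂ} (hz : 0 < z.re) {D : ℂ → ℂ} (hD : Continuous D)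
    (hbd : BoundedOnStrips z D) {a : ℝ} (ha : ∀ n : ℤ, a - obliqueRe z w ≠ n) :
    Integrable fun t : ℝ => D (obliqueLine z a t) * (sin (Real.pi * (obliqueLine z a t - w)))⁻¹ := by
  obtain ⟨C, hC⟩ := hbd a a
  obtain ⟨B, c, T, hc, hB0, hB⟩ := inv_sin_tail (w := w) hz
  have hne (t : ℝ) : sin (Real.pi * (obliqueLine z a t - w)) ≠ 0 :=
    sin_pi_mul_ne_zero (z := z) fun n hn => ha n (by
      rw [obliqueRe_sub, obliqueRe_obliqueLine hz] at hn; exact hn)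
  have hcont : Continuous fun t : ℝ => (sin (Real.pi * (obliqueLine z a t - w)))⁻¹ := by
    refine Continuous.inv₀ ?_ hne
    unfold obliqueLine; fun_prop
  have hI : Integrable fun t : ℝ => (sin (Real.pi * (obliqueLine z a t - w)))⁻¹ := by
    obtain ⟨M, hM⟩ := (isCompact_Icc (a := -T) (b := T)).exists_bound_of_continuousOn
      hcont.continuousOn
    refine ((integrable_exp_neg_mul_abs hc).const_mul (max B (|M| * Real.exp (c * |T|)))).mono'
      hcont.aestronglyMeasurable (ae_of_all _ fun t => ?_)
    by_cases ht : T ≤ |t|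
    · refine (hB a t ht).trans ?_
      gcongr
      exact le_max_left _ _
    · push Not at ht
      refine (hM t ⟨by linarith [neg_abs_le t], by linarith [le_abs_self t]⟩).trans ?_
      calc M ≤ |M| * 1 := by rw [mul_one]; exact le_abs_self M
        _ ≤ |M| * (Real.exp (c * |T|) * Real.exp (-(c * |t|))) := by
            gcongr
            rw [← Real.exp_add]
            apply Real.one_le_exp
            nlinarith [le_abs_self T]
        _ ≤ _ := by
            rw [← mul_assoc]
            gcongr
            exact le_max_right _ _
  refine hI.bdd_mul (c := C) ?_ (ae_of_all _ fun t => hC a ⟨le_rfl, le_rfl⟩ t)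
  exact (hD.comp (by unfold obliqueLine; fun_prop)).aestronglyMeasurable

/-- An entire function which is bounded on oblique strips is recovered from `D(s+1) + D(s)`: the
residue theorem for `D(s) / sin π(s - w)` between a line and its translate by `1`. -/
theorem eq_integral_of_add_one {z : ℂ} (hz : 0 < z.re) {D g : ℂ → ℂ} (hD : Differentiable ℂ D)
    (hbd : BoundedOnStrips z D) (hg : ∀ s, D (s + 1) + D s = g s) {w : ℂ} {a : ℝ}
    (h1 : obliqueRe z w - 1 < a) (h2 : a < obliqueRe z w) :
    D w = -(z / 2) *
      ∫ t : ℝ, g (obliqueLine z a t) * (sin (Real.pi * (obliqueLine z a t - w)))⁻¹ := by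
  have hz0 : z ≠ 0 := by rintro rfl; simp at hz
  set α := obliqueRe z w with hα
  set S : ℂ → ℂ := fun s => sin (Real.pi * (s - w)) with hS
  have hSd : Differentiable ℂ S := by rw [hS]; fun_prop
  have hSw : S w = 0 := by simp [hS]
  have hS' : deriv S w = Real.pi := by
    have : HasDerivAt S _ w := (((hasDerivAt_id w).sub_const w).const_mul (Real.pi : ℂ)).csin
    rw [this.deriv]; simp
  have hdS {s : ℂ} (e1 : α - 1 < obliqueRe z s) (e2 : obliqueRe z s < α + 1) :
      dslope S w s ≠ 0 := by
    by_cases hs : s = w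
    · rw [hs, dslope_same, hS']; exact ofReal_ne_zero.mpr Real.pi_ne_zero
    · rw [dslope_of_ne _ hs, slope_def_field, hSw, sub_zero]
      exact div_ne_zero (sin_pi_sub_ne_zero e1 e2 hs) (sub_ne_zero.mpr hs)
  have hdd (f : ℂ → ℂ) (hf : Differentiable ℂ f) : Differentiable ℂ (dslope f w) := by
    have := (differentiableOn_dslope (f := f) (s := Set.univ) (c := w) Filter.univ_mem).mpr
      hf.differentiableOn
    exact differentiableOn_univ.mp this
  -- the quotient `(D(s) - D(w)) / sin π(s - w)` with its singularity removed
  set F : ℂ → ℂ := fun s => dslope D w s / dslope S w s with hF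
  have hFeq {s : ℂ} (hs : s ≠ w) : F s = (D s - D w) * (S s)⁻¹ := by
    simp only [hF]
    rw [dslope_of_ne _ hs, dslope_of_ne _ hs, slope_def_field, slope_def_field, hSw, sub_zero,
      div_div_div_cancel_right₀ (sub_ne_zero.mpr hs), div_eq_mul_inv]
  have hFd {s : ℂ} (e1 : α - 1 < obliqueRe z s) (e2 : obliqueRe z s < α + 1) :
      DifferentiableAt ℂ F s := (hdd D hD s).div (hdd S hSd s) (hdS e1 e2)
  obtain ⟨b, hb1, hb2⟩ := exists_between h1
  have hline (a t : ℝ) (ha : a ≠ α) : obliqueLine z a t ≠ w := by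
    intro h
    apply ha
    rw [hα, ← h, obliqueRe_obliqueLine hz]
  have hdecay : ExpDecay z F b (a + 1 + (b - (α - 1)) / 2 ⊓ ((α - a) / 2)) := by
    obtain ⟨B, c, T, hc, hB0, hB⟩ := inv_sin_tail (w := w) hz
    obtain ⟨C, hC⟩ := hbd b (a + 1 + (b - (α - 1)) / 2 ⊓ ((α - a) / 2))
    have hm : (b - (α - 1)) / 2 ⊓ ((α - a) / 2) ≤ (α - a) / 2 := inf_le_right
    refine ExpDecay.of_tail (B := (C + ‖D w‖) * B) (T := max T (|w.im / z.re| + 1)) hc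
      (fun a' ha' t => ?_) fun a' ha' t ht => ?_
    · apply (hFd _ _).continuousAt <;> rw [obliqueRe_obliqueLine hz] <;> linarith [ha'.1, ha'.2]
    · have hne : obliqueLine z a' t ≠ w := by
        intro h
        have h3 := congrArg im h
        rw [obliqueLine_im] at h3
        have h4 : t = w.im / z.re := by rw [← h3]; field_simp
        have := (le_max_right T (|w.im / z.re| + 1)).trans ht
        rw [h4] at this
        linarith
      rw [hFeq hne, norm_mul, mul_assoc]
      exact mul_le_mul ((norm_sub_le _ _).trans (by gcongr; exact hC a' ha' t))
        (hB a' t ((le_max_left _ _).trans ht)) (norm_nonneg _)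
        (add_nonneg ((norm_nonneg _).trans (hC a' ha' t)) (norm_nonneg _))
  have hmin : 0 < (b - (α - 1)) / 2 ⊓ ((α - a) / 2) := lt_min (by linarith) (by linarith)
  have hmin' : (b - (α - 1)) / 2 ⊓ ((α - a) / 2) ≤ (α - a) / 2 := inf_le_right
  have hJ := hdecay.integral_eq hz (fun s hs => (hFd (by linarith [hs.1])
    (by linarith [hs.2])).differentiableWithinAt) (a := a) (b := a + 1) hb2 (by linarith)
    (by linarith) (by linarith)
  -- integrals of the kernel alone, on both sides of `w`
  have hshift (b t : ℝ) : obliqueLine z b t - w = obliqueLine z (b - α) (t - w.im / z.re) := by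
    rw [sub_eq_add_neg b, sub_eq_add_neg t, obliqueLine_add, sub_eq_add_neg]
    congr 1
    conv_lhs => rw [← obliqueLine_eq hz w]
    simp only [obliqueLine]; push_cast; ring
  have hKr : Integrable (fun t => (S (obliqueLine z (a + 1) t))⁻¹) ∧
      ∫ t : ℝ, (S (obliqueLine z (a + 1) t))⁻¹ = 1 / z := by
    obtain ⟨i1, i2⟩ := integral_inv_sin (z := z) (a := a + 1 - α) hz (by linarith) (by linarith)
    simp only [hS, hshift]
    refine ⟨i1.comp_sub_right _, ?_⟩
    rw [integral_sub_right_eq_self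
      (fun t => (sin (Real.pi * obliqueLine z (a + 1 - α) t))⁻¹), i2]
  have hKl : Integrable (fun t => (S (obliqueLine z a t))⁻¹) ∧
      ∫ t : ℝ, (S (obliqueLine z a t))⁻¹ = -(1 / z) := by
    have e (t : ℝ) : S (obliqueLine z a t) = -S (obliqueLine z (a + 1) t) := by
      simp only [hS]
      rw [← sin_add_pi]
      simp only [obliqueLine]
      push_cast
      rw [← sin_add_two_pi]
      ring_nf
    simp only [e, inv_neg]
    exact ⟨hKr.1.neg, by rw [integral_neg, hKr.2]⟩
  have hnz (b : ℝ) (hb1 : -1 < b - α) (hb2 : b - α < 1) (hb : b ≠ α) (n : ℤ) : b - α ≠ n := by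
    intro h
    have h4 : -1 < n := by exact_mod_cast (by linarith : (-1 : ℝ) < n)
    have h5 : n < 1 := by exact_mod_cast (by linarith : (n : ℝ) < 1)
    have h6 : n = 0 := by omega
    rw [h6] at h
    exact hb (by push_cast at h; linarith)
  have hIl := integrable_mul_inv_sin (w := w) hz hD.continuous hbd
    (hnz a (by linarith) (by linarith) h2.ne)
  have hIr := integrable_mul_inv_sin (w := w) hz hD.continuous hbd
    (hnz (a + 1) (by linarith) (by linarith) (by linarith))
  have hl : ∫ t : ℝ, F (obliqueLine z a t) =
      (∫ t : ℝ, D (obliqueLine z a t) * (S (obliqueLine z a t))⁻¹) + D w * (1 / z) := by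
    simp only [fun t => hFeq (hline a t h2.ne), sub_mul]
    rw [integral_sub hIl (hKl.1.const_mul _), integral_const_mul, hKl.2]
    ring
  have hr : ∫ t : ℝ, F (obliqueLine z (a + 1) t) =
      (∫ t : ℝ, D (obliqueLine z (a + 1) t) * (S (obliqueLine z (a + 1) t))⁻¹)
        - D w * (1 / z) := by
    simp only [fun t => hFeq (hline (a + 1) t (by linarith)), sub_mul]
    rw [integral_sub hIr (hKr.1.const_mul _), integral_const_mul, hKr.2]
  have hline1 (t : ℝ) : obliqueLine z (a + 1) t = obliqueLine z a t + 1 := by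
    simp only [obliqueLine]; push_cast; ring
  have hSS (t : ℝ) : S (obliqueLine z (a + 1) t) = -S (obliqueLine z a t) := by
    rw [hline1]
    simp only [hS]
    rw [← sin_add_pi]
    ring_nf
  have hg' (t : ℝ) : g (obliqueLine z a t) * (sin (Real.pi * (obliqueLine z a t - w)))⁻¹ =
      D (obliqueLine z a t) * (S (obliqueLine z a t))⁻¹
        - D (obliqueLine z (a + 1) t) * (S (obliqueLine z (a + 1) t))⁻¹ := by
    rw [hSS, ← hg, hline1, inv_neg]
    ring
  simp only [hg']
  rw [integral_sub hIl hIr]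
  rw [hl, hr] at hJ
  field_simp at hJ ⊢
  linear_combination hJ

/-- Boundedness on strips from a quasi-period in the direction of the strips: the multiplier and
the inhomogeneity have to be under control in both directions. -/
theorem boundedOnStrips_of_quasiPeriod {z : ℂ} {D α β : ℂ → ℂ} (hD : Continuous D)
    (hq : ∀ s, D (s + I * z) = α s * D s + β s)
    (hup : ∀ a₁ a₂ : ℝ, ∃ T B : ℝ, ∀ a ∈ Set.Icc a₁ a₂, ∀ t ≥ T,
      ‖α (obliqueLine z a t)‖ ≤ 1 / 2 ∧ ‖β (obliqueLine z a t)‖ ≤ B)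
    (hdown : ∀ a₁ a₂ : ℝ, ∃ T B : ℝ, ∀ a ∈ Set.Icc a₁ a₂, ∀ t ≤ T,
      2 ≤ ‖α (obliqueLine z a t)‖ ∧
        ‖β (obliqueLine z a t)‖ ≤ B * ‖α (obliqueLine z a t)‖) :
    BoundedOnStrips z D := by
  intro a₁ a₂
  obtain ⟨T₁, B₁, h1⟩ := hup a₁ a₂
  obtain ⟨T₂, B₂, h2⟩ := hdown a₁ a₂
  set T := max |T₁| |T₂| + 1 with hT
  have hcomp : IsCompact (Set.Icc a₁ a₂ ×ˢ Set.Icc (-T) T) := isCompact_Icc.prod isCompact_Icc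
  obtain ⟨C, hC⟩ := hcomp.exists_bound_of_continuousOn
    (hD.comp (continuous_obliqueLine z)).continuousOn
  simp only [Function.comp_apply] at hC
  set M := max |C| (max (2 * |B₁|) (2 * |B₂|)) with hM
  have hstep (a t : ℝ) : obliqueLine z a (t + 1) = obliqueLine z a t + I * z := by
    simp only [obliqueLine]; push_cast; ring
  have hMC : |C| ≤ M := le_max_left _ _
  have hM1 : 2 * |B₁| ≤ M := (le_max_left _ _).trans (le_max_right _ _)
  have hM2 : 2 * |B₂| ≤ M := (le_max_right _ _).trans (le_max_right _ _)
  have hT1 : T₁ ≤ T - 1 := by rw [hT]; linarith [le_abs_self T₁, le_max_left |T₁| |T₂|]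
  have hT2 : -(T - 1) ≤ T₂ := by rw [hT]; linarith [neg_abs_le T₂, le_max_right |T₁| |T₂|]
  have hT0 : 1 ≤ T := by rw [hT]; linarith [abs_nonneg T₁, le_max_left |T₁| |T₂|]
  refine ⟨M, fun a ha => ?_⟩
  have hpos : ∀ n : ℕ, ∀ t : ℝ, -T ≤ t → t ≤ T + n → ‖D (obliqueLine z a t)‖ ≤ M := by
    intro n
    induction n with
    | zero =>
      intro t ht0 ht
      exact ((hC (a, t) ⟨ha, ht0, by simpa using ht⟩).trans (le_abs_self C)).trans hMC
    | succ n ih =>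
      intro t ht0 ht
      by_cases htT : t ≤ T + n
      · exact ih t ht0 htT
      · push Not at htT
        push_cast at ht
        have hn : (0 : ℝ) ≤ n := Nat.cast_nonneg n
        obtain ⟨e1, e2⟩ := h1 a ha (t - 1) (by linarith)
        have e3 := ih (t - 1) (by linarith) (by linarith)
        have e4 := hstep a (t - 1)
        rw [sub_add_cancel] at e4
        rw [e4, hq]
        refine (norm_add_le _ _).trans ?_
        rw [norm_mul]
        have := mul_le_mul e1 e3 (norm_nonneg _) (by norm_num)
        linarith [le_abs_self B₁]
  have hneg : ∀ n : ℕ, ∀ t : ℝ, t ≤ T → -T - n ≤ t → ‖D (obliqueLine z a t)‖ ≤ M := by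
    intro n
    induction n with
    | zero =>
      intro t ht0 ht
      exact ((hC (a, t) ⟨ha, by simpa using ht, ht0⟩).trans (le_abs_self C)).trans hMC
    | succ n ih =>
      intro t ht0 ht
      by_cases htT : -T - n ≤ t
      · exact ih t ht0 htT
      · push Not at htT
        push_cast at ht
        have hn : (0 : ℝ) ≤ n := Nat.cast_nonneg n
        obtain ⟨e1, e2⟩ := h2 a ha t (by linarith)
        have e3 := ih (t + 1) (by linarith) (by linarith)
        rw [hstep, hq] at e3
        have e5 : ‖α (obliqueLine z a t)‖ * ‖D (obliqueLine z a t)‖ ≤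
            M + B₂ * ‖α (obliqueLine z a t)‖ := by
          rw [← norm_mul]
          have := norm_sub_le (α (obliqueLine z a t) * D (obliqueLine z a t)
            + β (obliqueLine z a t)) (β (obliqueLine z a t))
          rw [add_sub_cancel_right] at this
          linarith
        have hM0 : 0 ≤ M := (abs_nonneg C).trans hMC
        have e6 : ‖α (obliqueLine z a t)‖ * ‖D (obliqueLine z a t)‖ ≤
            ‖α (obliqueLine z a t)‖ * M := by
          nlinarith [le_abs_self B₂]
        exact le_of_mul_le_mul_left e6 (by linarith)
  intro t
  rcases le_total 0 t with ht | ht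
  · obtain ⟨n, hn⟩ := exists_nat_ge t
    exact hpos n t (by linarith) (by linarith)
  · obtain ⟨n, hn⟩ := exists_nat_ge (-t)
    exact hneg n t (by linarith) (by linarith)

/-! ### Dedekind sums and their reciprocity law -/

theorem sawtooth_add_int (x : ℝ) (n : ℤ) : sawtooth (x + n) = sawtooth x := by
  unfold sawtooth
  rw [Int.fract_add_intCast, Int.floor_add_intCast]
  push_cast
  split_ifs <;> ring

theorem sawtooth_neg (x : ℝ) : sawtooth (-x) = -sawtooth x := by
  unfold sawtooth
  by_cases h : Int.fract x = 0
  · have h' : Int.fract (-x) = 0 := Int.fract_neg_eq_zero.mpr h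
    simp [h, h']
  · have h' : Int.fract (-x) ≠ 0 := fun h0 => h (Int.fract_neg_eq_zero.mp h0)
    have e := Int.fract_neg h
    have e1 := Int.self_sub_floor x
    have e2 := Int.self_sub_floor (-x)
    rw [if_neg h, if_neg h']
    linarith

theorem dedekindSum_congr {h h₀ : ℤ} {k : ℕ} (hk : 0 < k) (n : ℤ) (hh : h = h₀ + k * n) :
    dedekindSum h k = dedekindSum h₀ k := by
  unfold dedekindSum
  refine Finset.sum_congr rfl fun μ _ => ?_
  have hk' : (k : ℝ) ≠ 0 := by positivity
  rw [show (h : ℝ) * μ / k = (h₀ : ℝ) * μ / k + ((n * μ : ℤ) : ℝ) by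
    rw [hh]; push_cast; field_simp, sawtooth_add_int]

theorem dedekindSum_neg (h : ℤ) (k : ℕ) : dedekindSum (-h) k = -dedekindSum h k := by
  unfold dedekindSum
  rw [← Finset.sum_neg_distrib]
  refine Finset.sum_congr rfl fun μ _ => ?_
  rw [show ((-h : ℤ) : ℝ) * μ / k = -((h : ℝ) * μ / k) by push_cast; ring, sawtooth_neg]
  ring

/-- Multiplication by a unit permutes the residues modulo `k`. -/
theorem sum_mul_mod {h k : ℕ} (hk : 0 < k) (hc : h.Coprime k) (f : ℕ → ℝ) :
    ∑ μ ∈ Finset.range k, f (h * μ % k) = ∑ μ ∈ Finset.range k, f μ := by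
  have hm : Set.MapsTo (fun μ => h * μ % k) (Finset.range k : Set ℕ) (Finset.range k) :=
    fun μ _ => by simpa using Nat.mod_lt _ hk
  have hi : Set.InjOn (fun μ => h * μ % k) (Finset.range k : Set ℕ) := by
    intro a ha b hb hab
    have h1 : h * a ≡ h * b [MOD k] := hab
    have h2 : a ≡ b [MOD k] := Nat.ModEq.cancel_left_of_coprime hc.symm h1
    exact Nat.ModEq.eq_of_lt_of_lt h2 (by simpa using ha) (by simpa using hb)
  refine Finset.sum_nbij (fun μ => h * μ % k) (fun a ha => by simpa using hm ha) hi ?_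
    (fun _ _ => rfl)
  exact Finset.surjOn_of_injOn_of_card_le _ hm hi le_rfl

theorem sum_range_cast (k : ℕ) : ∑ μ ∈ Finset.range k, (μ : ℝ) = k * (k - 1) / 2 := by
  induction k with
  | zero => simp
  | succ n ih => rw [Finset.sum_range_succ, ih]; push_cast; ring

theorem sum_range_cast_sq (k : ℕ) :
    ∑ μ ∈ Finset.range k, (μ : ℝ) ^ 2 = k * (k - 1) * (2 * k - 1) / 6 := by
  induction k with
  | zero => simp
  | succ n ih => rw [Finset.sum_range_succ, ih]; push_cast; ring

theorem cast_mul_mod (h k μ : ℕ) :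
    ((h * μ % k : ℕ) : ℝ) = h * μ - k * ((h * μ / k : ℕ) : ℝ) := by
  have := Nat.div_add_mod (h * μ) k
  have h2 : ((k * (h * μ / k) + h * μ % k : ℕ) : ℝ) = ((h * μ : ℕ) : ℝ) := by rw [this]
  push_cast at h2
  linarith

theorem sum_mul_div {h k : ℕ} (hk : 0 < k) (hc : h.Coprime k) :
    ∑ μ ∈ Finset.range k, ((h * μ / k : ℕ) : ℝ) = (h - 1) * (k - 1) / 2 := by
  have h1 := sum_mul_mod hk hc (fun n => (n : ℝ))
  simp only [cast_mul_mod, Finset.sum_sub_distrib, ← Finset.mul_sum, sum_range_cast] at h1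
  have hk' : (k : ℝ) ≠ 0 := by positivity
  field_simp at h1 ⊢
  linarith

/-- The Dedekind sum in terms of `∑ μ ⌊hμ/k⌋`, which is accessible to lattice point counting. -/
theorem dedekindSum_eq {h k : ℕ} (hk : 0 < k) (hc : h.Coprime k) :
    dedekindSum h k = h * (k - 1) * (2 * k - 1) / (6 * k)
      - (∑ μ ∈ Finset.range k, (μ : ℝ) * ((h * μ / k : ℕ) : ℝ)) / k - (k - 1) / 4 := by
  have hk' : (k : ℝ) ≠ 0 := by positivity
  have hterm : ∀ μ ∈ Finset.range k, sawtooth ((μ : ℝ) / k) * sawtooth ((h : ℤ) * μ / k)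
      = ((μ : ℝ) / k - 1 / 2) * (((h * μ % k : ℕ) : ℝ) / k - 1 / 2)
        - if μ = 0 then 1 / 4 else 0 := by
    intro μ hμ
    rw [Finset.mem_range] at hμ
    by_cases h0 : μ = 0
    · subst h0; simp [sawtooth]; norm_num
    have hmod : h * μ % k ≠ 0 := by
      intro h1
      have := (hc.symm.dvd_of_dvd_mul_left (Nat.dvd_of_mod_eq_zero h1))
      exact absurd (Nat.le_of_dvd (Nat.pos_of_ne_zero h0) this) (by omega)
    have hs (n : ℕ) (hn0 : n ≠ 0) (hn : n < k) : sawtooth ((n : ℝ) / k) = (n : ℝ) / k - 1 / 2 := by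
      have h1 : 0 < (n : ℝ) / k := by positivity
      have h2 : (n : ℝ) / k < 1 := by
        rw [div_lt_one (by positivity)]; exact_mod_cast hn
      have h3 : ⌊(n : ℝ) / k⌋ = 0 := Int.floor_eq_zero_iff.mpr ⟨h1.le, h2⟩
      have h4 : Int.fract ((n : ℝ) / k) = n / k := by
        rw [← Int.self_sub_floor, h3]; simp
      rw [sawtooth, if_neg (by rw [h4]; exact h1.ne'), h3]
      simp
    have e : ((h : ℤ) : ℝ) * μ / k = ((h * μ % k : ℕ) : ℝ) / k
        + (((h * μ / k : ℕ) : ℤ) : ℝ) := by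
      rw [cast_mul_mod, Int.cast_natCast, Int.cast_natCast]; field_simp; ring
    rw [e, sawtooth_add_int, hs μ h0 hμ, hs _ hmod (Nat.mod_lt _ hk), if_neg h0, sub_zero]
  unfold dedekindSum
  rw [Finset.sum_congr rfl hterm, Finset.sum_sub_distrib]
  rw [Finset.sum_ite_eq' (Finset.range k) 0 (fun _ => (1 / 4 : ℝ)), if_pos (by simpa using hk)]
  have e2 : ∀ μ ∈ Finset.range k, ((μ : ℝ) / k - 1 / 2) * (((h * μ % k : ℕ) : ℝ) / k - 1 / 2)
      = h / k ^ 2 * (μ : ℝ) ^ 2 - 1 / k * (μ * ((h * μ / k : ℕ) : ℝ)) - 1 / (2 * k) * (μ : ℝ)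
        - 1 / (2 * k) * ((h * μ % k : ℕ) : ℝ) + 1 / 4 := by
    intro μ _
    rw [cast_mul_mod]; field_simp; ring
  rw [Finset.sum_congr rfl e2]
  simp only [Finset.sum_add_distrib, Finset.sum_sub_distrib, ← Finset.mul_sum]
  rw [sum_mul_mod hk hc (fun n => (n : ℝ)), sum_range_cast, sum_range_cast_sq, Finset.sum_const,
    Finset.card_range, nsmul_eq_mul]
  field_simp
  ring

/-- Lattice points under the diagonal, counted with the weight `2ν - 1` in both orders. -/
theorem sum_mul_div_sq {h k : ℕ} (hh : 0 < h) (hk : 0 < k) (hc : h.Coprime k) :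
    ∑ μ ∈ Finset.range k, ((h * μ / k : ℕ) : ℝ) ^ 2 = (k - 1) * (h - 1) ^ 2
      - 2 * ∑ ν ∈ Finset.range h, (ν : ℝ) * ((k * ν / h : ℕ) : ℝ) + (h - 1) * (k - 1) / 2 := by
  have hsq (n : ℕ) : ∑ ν ∈ Finset.Ico 1 (n + 1), (2 * (ν : ℝ) - 1) = (n : ℝ) ^ 2 := by
    induction n with
    | zero => simp
    | succ n ih => rw [Finset.sum_Ico_succ_top (by omega), ih]; push_cast; ring
  have h1 : ∀ μ ∈ Finset.range k, ((h * μ / k : ℕ) : ℝ) ^ 2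
      = ∑ ν ∈ Finset.Ico 1 h, if k * ν ≤ h * μ then (2 * (ν : ℝ) - 1) else 0 := by
    intro μ hμ
    rw [Finset.mem_range] at hμ
    rw [← hsq, ← Finset.sum_filter]
    refine Finset.sum_congr ?_ fun _ _ => rfl
    ext ν
    simp only [Finset.mem_Ico, Finset.mem_filter, Nat.lt_succ_iff, Nat.le_div_iff_mul_le hk,
      mul_comm ν k]
    constructor
    · rintro ⟨e1, e2⟩
      refine ⟨⟨e1, ?_⟩, e2⟩
      by_contra hcon
      push Not at hcon
      nlinarith
    · rintro ⟨⟨e1, -⟩, e2⟩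
      exact ⟨e1, e2⟩
  rw [Finset.sum_congr rfl h1, Finset.sum_comm]
  have h2 : ∀ ν ∈ Finset.Ico 1 h,
      (∑ μ ∈ Finset.range k, if k * ν ≤ h * μ then (2 * (ν : ℝ) - 1) else 0)
      = (2 * (ν : ℝ) - 1) * (k - 1 - ((k * ν / h : ℕ) : ℝ)) := by
    intro ν hν
    rw [Finset.mem_Ico] at hν
    have hcard : (Finset.range k).filter (fun μ => ¬ k * ν ≤ h * μ)
        = Finset.range (k * ν / h + 1) := by
      ext μ
      simp only [Finset.mem_filter, Finset.mem_range, not_le, Nat.lt_succ_iff,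
        Nat.le_div_iff_mul_le hh, mul_comm μ h]
      constructor
      · rintro ⟨_, e⟩; exact e.le
      · intro e
        refine ⟨by nlinarith, lt_of_le_of_ne e fun heq => ?_⟩
        have : h ∣ ν := hc.dvd_of_dvd_mul_left (Dvd.intro μ heq)
        exact absurd (Nat.le_of_dvd (by omega) this) (by omega)
    have hsplit := Finset.sum_filter_add_sum_filter_not (Finset.range k)
      (fun μ => k * ν ≤ h * μ) (fun _ => (2 * (ν : ℝ) - 1))
    rw [hcard, Finset.sum_filter] at hsplit
    simp only [Finset.sum_const, Finset.card_range, nsmul_eq_mul] at hsplit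
    push_cast at hsplit ⊢
    linarith
  rw [Finset.sum_congr rfl h2]
  have h3 : ∑ ν ∈ Finset.Ico 1 h, (2 * (ν : ℝ) - 1) * (k - 1 - ((k * ν / h : ℕ) : ℝ))
      = (∑ ν ∈ Finset.range h, (2 * (ν : ℝ) - 1) * (k - 1 - ((k * ν / h : ℕ) : ℝ)))
        + (k - 1) := by
    rw [Finset.range_eq_Ico, Finset.sum_eq_sum_Ico_succ_bot hh]
    simp
    ring
  have h4 : ∀ ν ∈ Finset.range h, (2 * (ν : ℝ) - 1) * (k - 1 - ((k * ν / h : ℕ) : ℝ))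
      = 2 * ((k : ℝ) - 1) * ν - (k - 1) - 2 * ((ν : ℝ) * ((k * ν / h : ℕ) : ℝ))
        + ((k * ν / h : ℕ) : ℝ) := fun ν _ => by ring
  rw [h3, Finset.sum_congr rfl h4]
  simp only [Finset.sum_add_distrib, Finset.sum_sub_distrib, ← Finset.mul_sum]
  simp only [sum_mul_div hh hc.symm, sum_range_cast, Finset.sum_const, Finset.card_range,
    nsmul_eq_mul]
  ring

/-- Dedekind reciprocity. -/
theorem dedekindSum_reciprocity {h k : ℕ} (hh : 0 < h) (hk : 0 < k) (hc : h.Coprime k) :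
    dedekindSum h k + dedekindSum k h
      = -1 / 4 + ((h : ℝ) / k + (k : ℝ) / h + 1 / (h * k)) / 12 := by
  have hk' : (k : ℝ) ≠ 0 := by positivity
  have hh' : (h : ℝ) ≠ 0 := by positivity
  have h1 := sum_mul_mod hk hc (fun n => (n : ℝ) ^ 2)
  have e : ∀ μ ∈ Finset.range k, ((h * μ % k : ℕ) : ℝ) ^ 2 = (h : ℝ) ^ 2 * (μ : ℝ) ^ 2
      - 2 * h * k * ((μ : ℝ) * ((h * μ / k : ℕ) : ℝ)) + k ^ 2 * ((h * μ / k : ℕ) : ℝ) ^ 2 :=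
    fun μ _ => by rw [cast_mul_mod]; ring
  rw [Finset.sum_congr rfl e] at h1
  simp only [Finset.sum_add_distrib, Finset.sum_sub_distrib, ← Finset.mul_sum] at h1
  rw [sum_range_cast_sq, sum_mul_div_sq hh hk hc] at h1
  rw [dedekindSum_eq hk hc, dedekindSum_eq hh hc.symm]
  set X := ∑ μ ∈ Finset.range k, (μ : ℝ) * ((h * μ / k : ℕ) : ℝ)
  set Y := ∑ ν ∈ Finset.range h, (ν : ℝ) * ((k * ν / h : ℕ) : ℝ)
  field_simp
  have h2 : (k : ℝ) * (2 * h * X + 2 * k * Y) = k * ((h : ℝ) ^ 2 * ((k - 1) * (2 * k - 1) / 6)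
      + k * ((k - 1) * (h - 1) ^ 2 + (h - 1) * (k - 1) / 2) - (k - 1) * (2 * k - 1) / 6) := by
    linear_combination -h1
  have h3 := mul_left_cancel₀ hk' h2
  linear_combination (-144) * h3

/-! ### The transformation of `(q; q)_∞` -/

theorem eta_eq (τ : ℂ) : ModularForm.eta τ =
    exp (2 * Real.pi * I * τ / 24) * qPoch (exp (2 * Real.pi * I * τ)) := by
  rw [ModularForm.eta, qPoch]
  simp only [ModularForm.eta_q_eq_pow]
  rw [Function.Periodic.qParam]
  push_cast
  rfl

theorem eta_add_int (τ : ℂ) (n : ℤ) :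
    ModularForm.eta (τ + n) = exp (Real.pi * I * n / 12) * ModularForm.eta τ := by
  have h : exp (2 * Real.pi * I * (τ + n)) = exp (2 * Real.pi * I * τ) := by
    rw [mul_add, exp_add, show 2 * Real.pi * I * (n : ℂ) = n * (2 * Real.pi * I) by ring,
      exp_int_mul_two_pi_mul_I, mul_one]
  rw [eta_eq, eta_eq, h, ← mul_assoc, ← exp_add]
  congr 2
  ring

theorem eta_neg_inv {τ : ℂ} (hτ : 0 < τ.im) :
    ModularForm.eta (-1 / τ) = exp (-(Real.pi * I / 4)) * τ ^ (1 / 2 : ℂ) * ModularForm.eta τ := by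
  have h := ModularForm.eta_comp_eq_csqrt_I_inv hτ
  simp only [Function.comp_apply, Pi.smul_apply, Pi.mul_apply, smul_eq_mul] at h
  rw [h, ← mul_assoc]
  congr 2
  · rw [sqrt_eq_exp I_ne_zero, log_I, ← exp_neg]
    congr 1
    ring
  · rw [sqrt_eq_exp (by rintro rfl; simp at hτ), cpow_def_of_ne_zero (by rintro rfl; simp at hτ)]
    congr 1
    ring

/-- Multiplicativity of the principal square root, where no argument wraps around. -/
theorem cpow_half_mul_cpow_half {u τ v : ℂ} (hu : 0 < u.re) (hτ : 0 < τ.im)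
    (hv : -(Real.pi / 2) < v.arg) (h : u * τ = v) :
    u ^ (1 / 2 : ℂ) * τ ^ (1 / 2 : ℂ) = v ^ (1 / 2 : ℂ) := by
  have hu0 : u ≠ 0 := by rintro rfl; simp at hu
  have hτ0 : τ ≠ 0 := by rintro rfl; simp at hτ
  have hv0 : v ≠ 0 := by rw [← h]; exact mul_ne_zero hu0 hτ0
  have e1 : log u + log τ = log v := by
    have a1 := abs_lt.mp (abs_arg_lt_pi_div_two_iff.mpr (Or.inl hu))
    have a3 : 0 ≤ τ.arg := arg_nonneg_iff.mpr hτ.le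
    have a4 : τ.arg ≤ Real.pi := arg_le_pi τ
    have a5 : v.arg ≤ Real.pi := arg_le_pi v
    have hexp : exp (log u + log τ) = exp (log v) := by
      rw [exp_add, exp_log hu0, exp_log hτ0, exp_log hv0, h]
    obtain ⟨n, hn⟩ := exp_eq_exp_iff_exists_int.mp hexp
    have him := congrArg im hn
    simp [log_im] at him
    have hpi := Real.pi_pos
    have h1 : n < 1 := by
      by_contra hcon
      push Not at hcon
      have : (1 : ℝ) ≤ n := by exact_mod_cast hcon
      nlinarith
    have h2 : -1 < n := by
      by_contra hcon
      push Not at hcon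
      have : (n : ℝ) ≤ -1 := by exact_mod_cast (by omega : n ≤ -1)
      nlinarith
    have h3 : n = 0 := by omega
    rw [hn, h3]; simp
  rw [cpow_def_of_ne_zero hu0, cpow_def_of_ne_zero hτ0, cpow_def_of_ne_zero hv0, ← exp_add,
    ← add_mul, e1]

theorem cpow_half_I_mul {z : ℂ} (hz : 0 < z.re) :
    (I * z) ^ (1 / 2 : ℂ) = exp (Real.pi * I / 4) * z ^ (1 / 2 : ℂ) := by
  have hz0 : z ≠ 0 := by rintro rfl; simp at hz
  have h := cpow_half_mul_cpow_half (u := z) (τ := I) (v := I * z) hz (by simp) (by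
    have : 0 ≤ (I * z).arg := arg_nonneg_iff.mpr (by simpa using hz.le)
    linarith [Real.pi_pos]) (mul_comm _ _)
  rw [← h, mul_comm, cpow_def_of_ne_zero I_ne_zero, log_I]
  congr 2
  ring

theorem omega_congr {h h₀ : ℤ} {k : ℕ} (hk : 0 < k) (n : ℤ) (hh : h = h₀ + k * n) :
    omega h k = omega h₀ k := by
  rw [omega, omega, dedekindSum_congr hk n hh]

/-- The transformation of the eta function under the modular substitution attached to a Farey
fraction `h/k`, by the Euclidean algorithm. -/
theorem eta_transform (k : ℕ) (hk : 0 < k) : ∀ (h h' : ℤ), h * h' ≡ -1 [ZMOD (k : ℤ)] →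
    ∀ z : ℂ, 0 < z.re → ModularForm.eta ((h' + I / z) / k) =
      omega h k * exp (Real.pi * I * (h' - h) / (12 * k)) * z ^ (1 / 2 : ℂ)
        * ModularForm.eta ((h + I * z) / k) := by
  induction k using Nat.strong_induction_on with
  | _ k ih =>
  intro h h' hh z hz
  have hz0 : z ≠ 0 := by rintro rfl; simp at hz
  have hkC : (k : ℂ) ≠ 0 := by exact_mod_cast hk.ne'
  have hinv : I / z = -1 / (I * z) := by
    rw [div_eq_div_iff hz0 (mul_ne_zero I_ne_zero hz0)]; linear_combination z * I_mul_I
  by_cases hk1 : k = 1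
  · subst hk1
    have e1 : ((h' : ℂ) + I / z) / (1 : ℕ) = -1 / (I * z) + h' := by rw [hinv]; simp [add_comm]
    have e2 : ((h : ℂ) + I * z) / (1 : ℕ) = I * z + h := by simp [add_comm]
    have e3 : omega h 1 = 1 := by simp [omega, dedekindSum, sawtooth]
    have hIz : 0 < (I * z).im := by simpa using hz
    rw [e1, e2, e3, eta_add_int, eta_add_int, eta_neg_inv hIz]
    rw [cpow_half_I_mul hz]
    have e4 : exp (Real.pi * I * h' / 12) * (exp (-(Real.pi * I / 4)) * exp (Real.pi * I / 4)) =
        exp (Real.pi * I * (h' - h) / (12 * (1 : ℕ))) * exp (Real.pi * I * h / 12) := by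
      rw [← exp_add, ← exp_add, ← exp_add]
      congr 1
      push_cast
      ring
    linear_combination (z ^ (1 / 2 : ℂ) * ModularForm.eta (I * z)) * e4
  -- reduce to `0 < h₀ < k`
  set h₀ := h % k with hh₀
  have hk' : (0 : ℤ) < k := by exact_mod_cast hk
  have hdiv : h = h₀ + k * (h / k) := (Int.emod_add_mul_ediv h k).symm
  have h0nn : 0 ≤ h₀ := Int.emod_nonneg _ hk'.ne'
  have h0lt : h₀ < k := Int.emod_lt_of_pos _ hk'
  have hmod : h₀ * h' ≡ -1 [ZMOD (k : ℤ)] := by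
    refine Int.ModEq.trans (Int.ModEq.mul_right h' ?_) hh
    exact Int.mod_modEq h k
  obtain ⟨k', hk'eq⟩ : ∃ k' : ℤ, h₀ * h' + 1 = k * k' := by
    obtain ⟨c, hc⟩ := hmod.dvd
    exact ⟨-c, by linarith⟩
  have h0pos : 0 < h₀ := by
    rcases h0nn.lt_or_eq with h1 | h1
    · exact h1
    · rw [← h1] at hk'eq
      have hd : (k : ℤ) ∣ 1 := ⟨k', by linarith⟩
      have := Int.le_of_dvd one_pos hd
      omega
  obtain ⟨m, hm⟩ : ∃ m : ℕ, h₀ = m := ⟨h₀.toNat, (Int.toNat_of_nonneg h0nn).symm⟩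
  have hmpos : 0 < m := by omega
  have hmk : m < k := by omega
  have hcop : m.Coprime k := by
    rw [← Nat.isCoprime_iff_coprime, ← hm]
    exact ⟨-h', k', by linarith⟩
  have hmC : (m : ℂ) ≠ 0 := by exact_mod_cast hmpos.ne'
  have hm0 : ((h₀ : ℤ) : ℂ) = m := by rw [hm]; simp
  have hkk : ((m : ℂ) * h' + 1) = k * k' := by
    have : (((h₀ * h' + 1 : ℤ)) : ℂ) = ((k * k' : ℤ) : ℂ) := by rw [hk'eq]
    push_cast at this
    rwa [hm0] at this
  set τ : ℂ := (m + I * z) / k with hτ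
  have hτim : 0 < τ.im := by
    rw [hτ, div_natCast_im]
    simp
    positivity
  have hτ0 : τ ≠ 0 := by rintro h1; rw [h1] at hτim; simp at hτim
  have hden : (m : ℂ) + I * z ≠ 0 := by
    intro h1; rw [hτ, h1] at hτ0; simp at hτ0
  set Z : ℂ := k * z / (m + I * z) with hZ
  have hZre : 0 < Z.re := by
    rw [hZ, div_eq_mul_inv, mul_assoc, ← Complex.ofReal_natCast, re_ofReal_mul]
    have hn : 0 < normSq ((m : ℂ) + I * z) := normSq_pos.mpr hden
    have : (z * ((m : ℂ) + I * z)⁻¹).re = m * z.re / normSq ((m : ℂ) + I * z) := by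
      rw [mul_re, inv_re, inv_im]
      simp
      field_simp
      ring
    rw [this]
    positivity
  have hZ0 : Z ≠ 0 := by intro h1; rw [h1] at hZre; simp at hZre
  have hIH := ih m hmk hmpos (-k) k' (by
    rw [Int.modEq_iff_dvd]
    exact ⟨h', by rw [← hm]; linarith⟩) Z hZre
  have eL : ((k' : ℂ) + I / Z) / m = (h' + I / z) / k := by
    rw [hZ]
    field_simp
    linear_combination (-z) * hkk + z * I_mul_I
  have eR : (((-(k : ℤ) : ℤ) : ℂ) + I * Z) / m = -1 / τ := by
    rw [hZ, hτ]
    push_cast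
    field_simp
    ring
  rw [eL, eR, eta_neg_inv hτim] at hIH
  have hsq := cpow_half_mul_cpow_half hZre hτim
    (abs_lt.mp (abs_arg_lt_pi_div_two_iff.mpr (Or.inl hz))).1
    (show Z * τ = z by
      have hden' : (m : ℂ) + z * I ≠ 0 := by rwa [mul_comm z]
      rw [hZ, hτ]; field_simp)
  have hhC : (h : ℂ) = m + k * ((h / k : ℤ) : ℂ) := by
    have : ((h : ℤ) : ℂ) = ((h₀ + k * (h / k) : ℤ) : ℂ) := congrArg _ hdiv
    rw [this]; push_cast; rw [hm0]
  have e1 : ((h : ℂ) + I * z) / k = τ + ((h / k : ℤ) : ℂ) := by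
    rw [hτ, hhC]; field_simp; ring
  have e2 : omega h k = omega m k := omega_congr hk (h / k) (by rw [← hm]; exact hdiv)
  have hs : dedekindSum (-k) m = dedekindSum m k + 1 / 4
      - ((m : ℝ) / k + (k : ℝ) / m + 1 / (m * k)) / 12 := by
    have := dedekindSum_reciprocity hmpos hk hcop
    rw [dedekindSum_neg]
    linarith
  have e3 : omega (-k) m * exp (Real.pi * I * (k' - ((-(k : ℤ) : ℤ) : ℂ)) / (12 * m))
      * exp (-(Real.pi * I / 4)) = omega m k * exp (Real.pi * I * (h' - h) / (12 * k))
      * exp (Real.pi * I * ((h / k : ℤ) : ℂ) / 12) := by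
    rw [omega, omega, hs, ← exp_add, ← exp_add, ← exp_add, ← exp_add]
    congr 1
    rw [hhC]
    push_cast
    field_simp
    linear_combination (-4) * hkk
  rw [hIH, e1, eta_add_int, e2]
  linear_combination (Z ^ (1 / 2 : ℂ) * τ ^ (1 / 2 : ℂ) * ModularForm.eta τ) * e3
    + (omega m k * exp (Real.pi * I * (h' - h) / (12 * k))
      * exp (Real.pi * I * ((h / k : ℤ) : ℂ) / 12) * ModularForm.eta τ) * hsq

theorem norm_nome_lt_one {k : ℕ} (hk : 0 < k) (h : ℤ) {z : ℂ} (hz : 0 < z.re) :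
    ‖nome k h z‖ < 1 := by
  rw [nome, norm_exp, Real.exp_lt_one_iff]
  have hk' : (k : ℂ) ≠ 0 := by exact_mod_cast hk.ne'
  have : 2 * Real.pi * I / k * (h + I * z) = ((2 * Real.pi / k : ℝ) : ℂ) * (I * h - z) := by
    push_cast
    field_simp
    linear_combination z * I_mul_I
  rw [this, re_ofReal_mul]
  have : 0 < 2 * Real.pi / k := by positivity
  simp
  nlinarith

theorem nome_ne_zero (k : ℕ) (h : ℤ) (z : ℂ) : nome k h z ≠ 0 := exp_ne_zero _

/-- The transformation of `(q; q)_∞` with the multiplier `ω_{h,k}`. -/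
theorem qPoch_transform {k : ℕ} (hk : 0 < k) {h h' : ℤ} (hh : h * h' ≡ -1 [ZMOD (k : ℤ)])
    {z : ℂ} (hz : 0 < z.re) : qPoch (nome k h' (1 / z)) =
      omega h k * z ^ (1 / 2 : ℂ) * exp (Real.pi / (12 * k) * (1 / z - z))
        * qPoch (nome k h z) := by
  have hz0 : z ≠ 0 := by rintro rfl; simp at hz
  have hk' : (k : ℂ) ≠ 0 := by exact_mod_cast hk.ne'
  have h1 := eta_transform k hk h h' hh z hz
  rw [eta_eq, eta_eq] at h1
  have e1 : exp (2 * Real.pi * I * (((h' : ℂ) + I / z) / k)) = nome k h' (1 / z) := by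
    rw [nome]; congr 1; field_simp
  have e2 : exp (2 * Real.pi * I * (((h : ℂ) + I * z) / k)) = nome k h z := by
    rw [nome]; congr 1; field_simp
  rw [e1, e2] at h1
  have h2 : exp (2 * Real.pi * I * (((h' : ℂ) + I / z) / k) / 24) ≠ 0 := exp_ne_zero _
  apply mul_left_cancel₀ h2
  rw [h1]
  have e3 : exp (Real.pi * I * (h' - h) / (12 * k)) * exp (2 * Real.pi * I * ((h + I * z) / k) / 24)
      = exp (2 * Real.pi * I * (((h' : ℂ) + I / z) / k) / 24)
        * exp (Real.pi / (12 * k) * (1 / z - z)) := by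
    rw [← exp_add, ← exp_add]
    congr 1
    field_simp
    linear_combination 24 * (z ^ 2 - 1) * I_mul_I
  linear_combination (omega h k * z ^ (1 / 2 : ℂ) * qPoch (nome k h z)) * e3

/-! ### Cancellation of poles -/

/-- A function with only removable singularities agrees with an entire function wherever it is
continuous. -/
theorem exists_entire_extension {F : ℂ → ℂ}
    (h : ∀ w₀, ∃ g : ℂ → ℂ, AnalyticAt ℂ g w₀ ∧ ∀ᶠ w in 𝓝[≠] w₀, F w = g w) :
    ∃ D : ℂ → ℂ, Differentiable ℂ D ∧ ∀ w, ContinuousAt F w → D w = F w := by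
  choose g hg hF using h
  have hlim {w : ℂ} {φ ψ : ℂ → ℂ} (h1 : ContinuousAt φ w) (h2 : ContinuousAt ψ w)
      (h3 : ∀ᶠ v in 𝓝[≠] w, φ v = ψ v) : φ w = ψ w :=
    tendsto_nhds_unique_of_eventuallyEq (l := 𝓝[≠] w) (h1.tendsto.mono_left nhdsWithin_le_nhds)
      (h2.tendsto.mono_left nhdsWithin_le_nhds) h3
  refine ⟨fun w => g w w, fun w₀ => ?_, fun w hw => ?_⟩
  · have hev : (fun w => g w w) =ᶠ[𝓝 w₀] g w₀ := by
      have h1 := (hg w₀).eventually_analyticAt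
      have h2 := eventually_nhdsWithin_iff.mp (hF w₀)
      rw [← eventually_eventually_nhds] at h2
      filter_upwards [h1, h2] with w hw1 hw2
      by_cases hw : w = w₀
      · rw [hw]
      · refine hlim (hg w).continuousAt hw1.continuousAt ?_
        have hne : ∀ᶠ v in 𝓝[≠] w, v ≠ w₀ :=
          nhdsWithin_le_nhds (isOpen_ne.mem_nhds hw)
        filter_upwards [hF w, nhdsWithin_le_nhds hw2, hne] with v hv1 hv2 hv3
        rw [← hv1, hv2 hv3]
    exact ((hg w₀).congr hev.symm).differentiableAt
  · exact hlim (hg w).continuousAt hw ((hF w).mono fun v hv => hv.symm)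

/-- If the residues of `C₁(w) / (1 - e^{α(w - w₀)})` and `C₂(w) / (1 - e^{β(w - w₀)})` at `w₀`
agree, the difference has a removable singularity. -/
theorem exists_analyticAt_sub_polar {C₁ C₂ : ℂ → ℂ} {w₀ α β : ℂ} (hα : α ≠ 0) (hβ : β ≠ 0)
    (h1 : AnalyticAt ℂ C₁ w₀) (h2 : AnalyticAt ℂ C₂ w₀) (hres : C₁ w₀ / α = C₂ w₀ / β) :
    ∃ g : ℂ → ℂ, AnalyticAt ℂ g w₀ ∧ ∀ᶠ w in 𝓝[≠] w₀,
      C₁ w / (1 - exp (α * (w - w₀))) - C₂ w / (1 - exp (β * (w - w₀))) = g w := by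
  have hds (f : ℂ → ℂ) (hf : AnalyticAt ℂ f w₀) : AnalyticAt ℂ (dslope f w₀) w₀ := by
    obtain ⟨U, hU, hfU⟩ := hf.exists_mem_nhds_analyticOnNhd
    exact ((differentiableOn_dslope hU).mpr hfU.differentiableOn).analyticAt hU
  have hE (α : ℂ) : AnalyticAt ℂ (fun w => exp (α * (w - w₀))) w₀ := by fun_prop
  have hd0 (α : ℂ) : dslope (fun w => exp (α * (w - w₀))) w₀ w₀ = α := by
    rw [dslope_same]
    have : HasDerivAt (fun w => exp (α * (w - w₀))) _ w₀ :=
      (((hasDerivAt_id w₀).sub_const w₀).const_mul α).cexp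
    rw [this.deriv]; simp
  have hd (α w : ℂ) (hw : w ≠ w₀) : 1 - exp (α * (w - w₀)) =
      -((w - w₀) * dslope (fun w => exp (α * (w - w₀))) w₀ w) := by
    have := sub_smul_dslope (fun w => exp (α * (w - w₀))) w₀ w
    rw [smul_eq_mul] at this
    rw [this]; simp
  set N : ℂ → ℂ := fun w => C₁ w / dslope (fun w => exp (α * (w - w₀))) w₀ w
    - C₂ w / dslope (fun w => exp (β * (w - w₀))) w₀ w with hN
  have hNa : AnalyticAt ℂ N w₀ :=
    (h1.div (hds _ (hE α)) (by rw [hd0]; exact hα)).sub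
      (h2.div (hds _ (hE β)) (by rw [hd0]; exact hβ))
  have hN0 : N w₀ = 0 := by simp only [hN, hd0]; rw [hres, sub_self]
  refine ⟨fun w => -dslope N w₀ w, (hds N hNa).neg, ?_⟩
  filter_upwards [self_mem_nhdsWithin] with w hw
  have hw' : w - w₀ ≠ 0 := sub_ne_zero.mpr hw
  have hNw : dslope N w₀ w = N w / (w - w₀) := by
    rw [dslope_of_ne N hw, slope_def_field, hN0, sub_zero]
  rw [hd α w hw, hd β w hw, hNw]
  simp only [hN]
  rw [div_neg, div_neg, sub_div, div_div, div_div, mul_comm (w - w₀), mul_comm (w - w₀)]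
  ring

/-! ### The reconstruction of the rank function -/

/-- The functional equation iterated `n` times, with the inhomogeneity under control for small and
for large arguments. -/
theorem rankFn_mul_nome_pow {p : ℂ} (hp0 : p ≠ 0) (hp : ‖p‖ < 1) (n : ℕ) :
    ∃ (P : ℂ → ℂ) (C : ℝ), (∀ y, y ≠ 0 → (∀ m : ℤ, y * p ^ m ≠ 1) →
      rankFn p (y * p ^ n) = (-1) ^ n * p ^ pent (-n) * y ^ (3 * n) * rankFn p y + P y) ∧
      0 ≤ C ∧ Continuous P ∧ (∀ y, ‖y‖ ≤ 1 → ‖P y‖ ≤ C) ∧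
      (∀ y, 1 ≤ ‖y‖ → ‖y‖ * ‖P y‖ ≤ C * ‖y‖ ^ (3 * n)) := by
  induction n with
  | zero =>
    refine ⟨fun _ => 0, 0, fun y _ _ => ?_, le_rfl, continuous_const, by simp, by simp⟩
    simp [pent]
  | succ n ih =>
    obtain ⟨P, C, h1, hC, hcont, h2, h3⟩ := ih
    have hpn : ‖p ^ n‖ ≤ 1 := by rw [norm_pow]; exact pow_le_one₀ (norm_nonneg _) hp.le
    refine ⟨fun y => -p * (y * p ^ n) ^ 3 * P y - p * (y * p ^ n) ^ 2 + 1, C + 2,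
      fun y hy hpole => ?_, by linarith, by fun_prop, fun y hy => ?_, fun y hy => ?_⟩
    · have hpole' (m : ℤ) : y * p ^ n * p ^ m ≠ 1 := by
        rw [mul_assoc, ← zpow_natCast, ← zpow_add₀ hp0]; exact hpole _
      rw [pow_succ, ← mul_assoc, rankFn_mul_nome hp0 hp (mul_ne_zero hy (pow_ne_zero _ hp0)) hpole',
        h1 y hy hpole]
      have e : p ^ pent (-((n + 1 : ℕ) : ℤ)) = p * (p ^ n) ^ 3 * p ^ pent (-(n : ℤ)) := by
        have e1 := two_mul_pent (-((n + 1 : ℕ) : ℤ))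
        have e2 := two_mul_pent (-(n : ℤ))
        have e3 : pent (-((n + 1 : ℕ) : ℤ)) = 1 + (n : ℤ) * 3 + pent (-(n : ℤ)) := by
          push_cast at e1 ⊢
          linarith [show 3 * (-((n : ℤ) + 1)) ^ 2 + -((n : ℤ) + 1)
            = 3 * (-(n : ℤ)) ^ 2 + -(n : ℤ) + 2 + 6 * n by ring]
        rw [e3, zpow_add₀ hp0, zpow_add₀ hp0, zpow_one, zpow_mul, zpow_natCast]
        norm_cast
      rw [e]
      ring
    · have e1 : ‖y * p ^ n‖ ≤ 1 := by
        rw [norm_mul]; exact mul_le_one₀ hy (norm_nonneg _) hpn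
      calc ‖-p * (y * p ^ n) ^ 3 * P y - p * (y * p ^ n) ^ 2 + 1‖
          ≤ ‖p‖ * ‖y * p ^ n‖ ^ 3 * ‖P y‖ + ‖p‖ * ‖y * p ^ n‖ ^ 2 + 1 := by
            refine (norm_add_le _ _).trans ?_
            rw [norm_one]
            gcongr
            refine (norm_sub_le _ _).trans (le_of_eq ?_)
            simp only [norm_mul, norm_neg, norm_pow]
        _ ≤ 1 * 1 ^ 3 * C + 1 * 1 ^ 2 + 1 := by
            gcongr
            exact h2 y hy
        _ = C + 2 := by ring
    · have e1 : ‖y * p ^ n‖ ≤ ‖y‖ := by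
        rw [norm_mul]; exact mul_le_of_le_one_right (norm_nonneg _) hpn
      have hy0 : 0 ≤ ‖y‖ := norm_nonneg _
      calc ‖y‖ * ‖-p * (y * p ^ n) ^ 3 * P y - p * (y * p ^ n) ^ 2 + 1‖
          ≤ ‖y‖ * (‖p‖ * ‖y * p ^ n‖ ^ 3 * ‖P y‖ + ‖p‖ * ‖y * p ^ n‖ ^ 2 + 1) := by
            gcongr
            refine (norm_add_le _ _).trans ?_
            rw [norm_one]
            gcongr
            refine (norm_sub_le _ _).trans (le_of_eq ?_)
            simp only [norm_mul, norm_neg, norm_pow]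
        _ ≤ ‖y‖ * (1 * ‖y‖ ^ 3 * ‖P y‖ + 1 * ‖y‖ ^ 2 + 1) := by gcongr
        _ = ‖y‖ ^ 3 * (‖y‖ * ‖P y‖) + ‖y‖ ^ 3 + ‖y‖ := by ring
        _ ≤ ‖y‖ ^ 3 * (C * ‖y‖ ^ (3 * n)) + ‖y‖ ^ (3 * (n + 1)) + ‖y‖ ^ (3 * (n + 1)) := by
            gcongr ?_ + ?_ + ?_
            · exact mul_le_mul_of_nonneg_left (h3 y hy) (by positivity)
            · exact pow_le_pow_right₀ hy (by omega)
            · exact le_self_pow₀ hy (by omega)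
        _ = (C + 2) * ‖y‖ ^ (3 * (n + 1)) := by ring

/-- The data of the two rank functions which are to be compared: `e^{πiw} G(p; y₀ e^{2πiw})` and
`γ(w) G(p₁; Y₀ e^{-2πw/Z})`. -/
structure RankPair where
  /-- the number of functional equations making up a period -/
  K : ℕ
  /-- the modular variable; the second nome is that of `1/Z` -/
  Z : ℂ
  p : ℂ
  p₁ : ℂ
  y₀ : ℂ
  Y₀ : ℂ
  γ : ℂ → ℂ
  K_pos : 0 < K
  Z_re : 0 < Z.re
  p_ne : p ≠ 0
  p_lt : ‖p‖ < 1
  p₁_ne : p₁ ≠ 0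
  p₁_lt : ‖p₁‖ < 1
  y₀_ne : y₀ ≠ 0
  Y₀_ne : Y₀ ≠ 0
  γ_diff : Differentiable ℂ γ
  p_pow : p ^ K = exp (-2 * Real.pi * Z)
  /-- both functions have the same poles, with the same residues -/
  pole : ∀ (w : ℂ) (n : ℤ), y₀ * exp (2 * Real.pi * I * w) * p ^ n = 1 →
    ∃ m : ℤ, Y₀ * exp (-2 * Real.pi * w / Z) * p₁ ^ m = 1 ∧
      exp (Real.pi * I * w) * (1 / qPoch p * ((-1) ^ n * p ^ pent n)) * I =
        Z * (γ w * (1 / qPoch p₁ * ((-1) ^ m * p₁ ^ pent m)))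
  pole' : ∀ (w : ℂ) (m : ℤ), Y₀ * exp (-2 * Real.pi * w / Z) * p₁ ^ m = 1 →
    ∃ n : ℤ, y₀ * exp (2 * Real.pi * I * w) * p ^ n = 1
  /-- both functions have the same multiplier for the period `iZ` -/
  γ_period : ∀ w, γ (w + I * Z) = exp (-Real.pi * Z) * ((-1) ^ K * p ^ pent (-K) *
    (y₀ * exp (2 * Real.pi * I * w)) ^ (3 * K)) * γ w

namespace RankPair

variable (R : RankPair)

/-- The argument `y₀ e^{2πiw}` of the first rank function. -/
noncomputable def y (w : ℂ) : ℂ := R.y₀ * exp (2 * Real.pi * I * w)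

/-- The argument `Y₀ e^{-2πw/Z}` of the second rank function. -/
noncomputable def Y (w : ℂ) : ℂ := R.Y₀ * exp (-2 * Real.pi * w / R.Z)

/-- The points where neither function has a pole. -/
def Regular (w : ℂ) : Prop := ∀ n : ℤ, R.y w * R.p ^ n ≠ 1

/-- `e^{πiw} G(p; y₀ e^{2πiw}) - γ(w) G(p₁; Y₀ e^{-2πw/Z})`. -/
noncomputable def diff (w : ℂ) : ℂ :=
  exp (Real.pi * I * w) * rankFn R.p (R.y w) - R.γ w * rankFn R.p₁ (R.Y w)

theorem y_ne (w : ℂ) : R.y w ≠ 0 := mul_ne_zero R.y₀_ne (exp_ne_zero _)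

theorem Y_ne (w : ℂ) : R.Y w ≠ 0 := mul_ne_zero R.Y₀_ne (exp_ne_zero _)

theorem Z_ne : R.Z ≠ 0 := by
  have := R.Z_re
  intro h; rw [h] at this; simp at this

theorem y_analytic (w : ℂ) : AnalyticAt ℂ R.y w := by unfold y; fun_prop

theorem Y_analytic (w : ℂ) : AnalyticAt ℂ R.Y w := by
  unfold Y
  exact Differentiable.analyticAt (by fun_prop) w

theorem Regular.second {R : RankPair} {w : ℂ} (h : R.Regular w) (m : ℤ) :
    R.Y w * R.p₁ ^ m ≠ 1 := by
  intro hm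
  obtain ⟨n, hn⟩ := R.pole' w m hm
  exact h n hn

theorem analyticAt_diff {w : ℂ} (h : R.Regular w) : AnalyticAt ℂ R.diff w := by
  have h1 := (analyticAt_rankFn R.p_ne R.p_lt (R.y_ne w) h).comp (R.y_analytic w)
  have h2 := (analyticAt_rankFn R.p₁_ne R.p₁_lt (R.Y_ne w) h.second).comp (R.Y_analytic w)
  have h3 : AnalyticAt ℂ (fun w : ℂ => exp (Real.pi * I * w)) w := by fun_prop
  exact (h3.mul h1).sub ((R.γ_diff.analyticAt w).mul h2)

/-- The poles cancel in the difference of the two functions. -/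
theorem exists_extension : ∃ D : ℂ → ℂ, Differentiable ℂ D ∧ ∀ w, R.Regular w → D w = R.diff w := by
  obtain ⟨D, hD, hD'⟩ := exists_entire_extension (F := R.diff) fun w₀ => by
    by_cases hreg : R.Regular w₀
    · exact ⟨R.diff, R.analyticAt_diff hreg, Eventually.of_forall fun _ => rfl⟩
    unfold Regular at hreg
    push Not at hreg
    obtain ⟨n, hn⟩ := hreg
    obtain ⟨m, hm, hres⟩ := R.pole w₀ n hn
    have hm' : R.Y w₀ * R.p₁ ^ m = 1 := hm
    obtain ⟨H₁, hH₁, e₁⟩ := exists_rankFn_eq_add_polar R.p_ne R.p_lt n hn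
    obtain ⟨H₂, hH₂, e₂⟩ := exists_rankFn_eq_add_polar R.p₁_ne R.p₁_lt m hm'
    have hexp : AnalyticAt ℂ (fun w : ℂ => exp (Real.pi * I * w)) w₀ := by fun_prop
    have hγ := R.γ_diff.analyticAt w₀
    have hpi : (Real.pi : ℂ) ≠ 0 := ofReal_ne_zero.mpr Real.pi_ne_zero
    have hZ := R.Z_ne
    obtain ⟨g, hg, hgeq⟩ := exists_analyticAt_sub_polar (w₀ := w₀) (α := 2 * Real.pi * I)
      (β := -2 * Real.pi / R.Z)
      (C₁ := fun w => exp (Real.pi * I * w) * (1 / qPoch R.p * ((-1) ^ n * R.p ^ pent n)))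
      (C₂ := fun w => R.γ w * (1 / qPoch R.p₁ * ((-1) ^ m * R.p₁ ^ pent m)))
      (by simp [hpi]) (by simp [hpi, hZ])
      (hexp.mul analyticAt_const) (hγ.mul analyticAt_const) (by
        have hres' : exp (Real.pi * I * w₀) * (1 / qPoch R.p * ((-1) ^ n * R.p ^ pent n)) =
            -I * (R.Z * (R.γ w₀ * (1 / qPoch R.p₁ * ((-1) ^ m * R.p₁ ^ pent m)))) := by
          rw [← hres]
          linear_combination (exp (Real.pi * I * w₀) *
            (1 / qPoch R.p * ((-1) ^ n * R.p ^ pent n))) * I_mul_I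
        rw [hres', div_eq_div_iff (by simp [hpi]) (by simp [hpi, hZ])]
        generalize R.γ w₀ * (1 / qPoch R.p₁ * ((-1) ^ m * R.p₁ ^ pent m)) = B
        field_simp)
    refine ⟨fun w => exp (Real.pi * I * w) * H₁ (R.y w) - R.γ w * H₂ (R.Y w) + g w,
      ((hexp.mul (hH₁.comp (R.y_analytic w₀))).sub (hγ.mul (hH₂.comp (R.Y_analytic w₀)))).add hg,
      ?_⟩
    filter_upwards [hgeq] with w hw
    have f1 : R.y w * R.p ^ n = exp (2 * Real.pi * I * (w - w₀)) := by
      have e : R.y w = exp (2 * Real.pi * I * (w - w₀)) * R.y w₀ := by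
        rw [y, y, mul_left_comm, ← exp_add]
        congr 2; ring
      rw [e, mul_assoc, hn, mul_one]
    have f2 : R.Y w * R.p₁ ^ m = exp (-2 * Real.pi / R.Z * (w - w₀)) := by
      have e : R.Y w = exp (-2 * Real.pi / R.Z * (w - w₀)) * R.Y w₀ := by
        rw [Y, Y, mul_left_comm, ← exp_add]
        congr 2; ring
      rw [e, mul_assoc, hm', mul_one]
    rw [diff, e₁ _ (R.y_ne w), e₂ _ (R.Y_ne w), f1, f2, ← hw]
    ring
  exact ⟨D, hD, fun w hw => hD' w (R.analyticAt_diff hw).continuousAt⟩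

/-- The set of poles is countable. -/
theorem dense_regular : Dense {w | R.Regular w} := by
  have hc : (⋃ n : ℤ, {w | R.y w * R.p ^ n = 1}).Countable := by
    refine Set.countable_iUnion fun n => ?_
    by_cases hne : ∃ w₀, R.y w₀ * R.p ^ n = 1
    · obtain ⟨w₀, h₀⟩ := hne
      refine (Set.countable_range fun m : ℤ => w₀ + m).mono fun w hw => ?_
      have hw' : R.y w * R.p ^ n = 1 := hw
      rw [← h₀] at hw'
      have h1 := mul_right_cancel₀ (zpow_ne_zero n R.p_ne) hw'
      rw [y, y] at h1
      obtain ⟨m, hm⟩ := exp_eq_exp_iff_exists_int.mp (mul_left_cancel₀ R.y₀_ne h1)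
      refine ⟨m, ?_⟩
      refine mul_left_cancel₀ Complex.two_pi_I_ne_zero ?_
      rw [hm]; ring
    · rw [Set.eq_empty_of_forall_notMem (fun w hw => hne ⟨w, hw⟩)]
      exact Set.countable_empty
  have : {w | R.Regular w} = (⋃ n : ℤ, {w | R.y w * R.p ^ n = 1})ᶜ := by
    ext w; simp [Regular]
  rw [this]
  exact hc.dense_compl ℝ

theorem y_add_one (w : ℂ) : R.y (w + 1) = R.y w := by
  rw [y, y, mul_add, mul_one, exp_add, exp_two_pi_mul_I, mul_one]

theorem y_add_period (w : ℂ) : R.y (w + I * R.Z) = R.y w * R.p ^ R.K := by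
  rw [y, y, R.p_pow, mul_assoc R.y₀, ← exp_add]
  congr 2
  linear_combination 2 * Real.pi * R.Z * I_mul_I

theorem Y_add_period (w : ℂ) : R.Y (w + I * R.Z) = R.Y w := by
  have hZ := R.Z_ne
  rw [Y, Y, show -2 * Real.pi * (w + I * R.Z) / R.Z
    = -2 * Real.pi * w / R.Z + ((-1 : ℤ) : ℂ) * (2 * Real.pi * I) by push_cast; field_simp; ring,
    exp_add, exp_int_mul_two_pi_mul_I, mul_one]

theorem regular_add_one {w : ℂ} : R.Regular (w + 1) ↔ R.Regular w := by
  simp [Regular, y_add_one]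

theorem regular_add_period {w : ℂ} (h : R.Regular w) : R.Regular (w + I * R.Z) := by
  intro n
  rw [y_add_period, mul_assoc, ← zpow_natCast, ← zpow_add₀ R.p_ne]
  exact h _

theorem norm_y_obliqueLine (a t : ℝ) : ‖R.y (obliqueLine R.Z a t)‖ =
    ‖R.y₀‖ * Real.exp (-(2 * Real.pi * R.Z.re * t)) := by
  rw [y, norm_mul, norm_exp]
  congr 2
  simp [obliqueLine]
  ring

/-- The multiplier of the period `iZ`. -/
noncomputable def mult (w : ℂ) : ℂ :=
  exp (-Real.pi * R.Z) * ((-1) ^ R.K * R.p ^ pent (-R.K) * R.y w ^ (3 * R.K))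

theorem norm_mult (w : ℂ) : ‖R.mult w‖ =
    ‖exp (-Real.pi * R.Z) * R.p ^ pent (-R.K)‖ * ‖R.y w‖ ^ (3 * R.K) := by
  simp [mult]
  ring

/-- The second rank function, with an elementary correction. -/
noncomputable def main (c w : ℂ) : ℂ := R.γ w * (rankFn R.p₁ (R.Y w) + c / R.Y w)

/-- The difference of the two rank functions is the Mordell integral of the failure of the second
one to be antiperiodic. -/
theorem eq_main_add_integral (c : ℂ) {g : ℂ → ℂ} (hgc : Continuous g)
    (hg : ∀ s, R.Regular s → g s = R.main c (s + 1) + R.main c s) {w : ℂ} (hw : R.Regular w)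
    {a : ℝ} (h1 : obliqueRe R.Z w - 1 < a) (h2 : a < obliqueRe R.Z w) :
    exp (Real.pi * I * w) * rankFn R.p (R.y w) = R.main c w + R.Z / 2 *
      ∫ t : ℝ, g (obliqueLine R.Z a t) * (sin (Real.pi * (obliqueLine R.Z a t - w)))⁻¹ := by
  obtain ⟨D, hD, hDe⟩ := R.exists_extension
  obtain ⟨P, C, hP, hC, hPc, hP1, hP2⟩ := rankFn_mul_nome_pow R.p_ne R.p_lt R.K
  have hyd : Differentiable ℂ R.y := fun w => (R.y_analytic w).differentiableAt
  have hYd : Differentiable ℂ R.Y := fun w => (R.Y_analytic w).differentiableAt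
  set E : ℂ → ℂ := fun w => D w - R.γ w * (c / R.Y w) with hE
  have hEd : Differentiable ℂ E :=
    hD.sub (R.γ_diff.mul ((differentiable_const c).div hYd R.Y_ne))
  have hEe (s : ℂ) (hs : R.Regular s) :
      E s = exp (Real.pi * I * s) * rankFn R.p (R.y s) - R.main c s := by
    simp only [hE, hDe s hs, diff, main]; ring
  set β : ℂ → ℂ := fun w => exp (-Real.pi * R.Z) * exp (Real.pi * I * w) * P (R.y w) with hβ
  have hyc := hyd.continuous
  have hmc : Continuous R.mult := by unfold mult; fun_prop
  -- the two functional equations extend from the regular points by continuity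
  have hone : ∀ s, E (s + 1) + E s = -g s := by
    have : (fun s => E (s + 1) + E s) = fun s => -g s := by
      refine Continuous.ext_on R.dense_regular ?_ hgc.neg fun s hs => ?_
      · exact (hEd.continuous.comp (by fun_prop)).add hEd.continuous
      · have hs' : R.Regular s := hs
        rw [hEe s hs', hEe _ (R.regular_add_one.mpr hs'), hg s hs', y_add_one, mul_add, mul_one,
          exp_add, exp_pi_mul_I]
        ring
    exact congrFun this
  have hper : ∀ s, E (s + I * R.Z) = R.mult s * E s + β s := by
    have : (fun s => E (s + I * R.Z)) = fun s => R.mult s * E s + β s := by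
      refine Continuous.ext_on R.dense_regular (hEd.continuous.comp (by fun_prop))
        ((hmc.mul hEd.continuous).add (by fun_prop)) fun s hs => ?_
      have hs' : R.Regular s := hs
      rw [hEe s hs', hEe _ (R.regular_add_period hs'), main, main, y_add_period, Y_add_period,
        R.γ_period, hP _ (R.y_ne s) hs', hβ, mult, y,
        show Real.pi * I * (s + I * R.Z) = -Real.pi * R.Z + Real.pi * I * s by
          linear_combination Real.pi * R.Z * I_mul_I, exp_add]
      simp only [y]
      ring
    exact congrFun this
  set A : ℝ := ‖exp (-Real.pi * R.Z) * R.p ^ pent (-R.K)‖ with hA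
  have hA0 : 0 < A := norm_pos_iff.mpr (mul_ne_zero (exp_ne_zero _) (zpow_ne_zero _ R.p_ne))
  have hy0 : 0 < ‖R.y₀‖ := norm_pos_iff.mpr R.y₀_ne
  have hcoef : 0 < 2 * Real.pi * R.Z.re := by have := R.Z_re; positivity
  have hK : 3 * R.K ≠ 0 := by have := R.K_pos; omega
  have hβn (a t : ℝ) : ‖β (obliqueLine R.Z a t)‖ = ‖exp (-Real.pi * R.Z)‖ *
      Real.exp (-(Real.pi * R.Z.re * t)) * ‖P (R.y (obliqueLine R.Z a t))‖ := by
    simp only [hβ, norm_mul]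
    congr 2
    rw [norm_exp]
    congr 1
    simp [obliqueLine]
    ring
  have hbd : BoundedOnStrips R.Z E := by
    refine boundedOnStrips_of_quasiPeriod hEd.continuous hper (fun a₁ a₂ => ?_) fun a₁ a₂ => ?_
    · have ht : Tendsto (fun t : ℝ => ‖R.y₀‖ * Real.exp (-(2 * Real.pi * R.Z.re * t))) atTop
          (𝓝 0) := by
        rw [← mul_zero ‖R.y₀‖]
        exact (Real.tendsto_exp_neg_atTop_nhds_zero.comp
          (tendsto_id.const_mul_atTop hcoef)).const_mul _
      have hpos : 0 < min 1 (1 / (2 * A)) := by positivity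
      obtain ⟨T, hT⟩ := eventually_atTop.mp ((ht.eventually_lt_const hpos).and
        (eventually_ge_atTop 0))
      refine ⟨T, ‖exp (-Real.pi * R.Z)‖ * 1 * C, fun a _ t ht => ?_⟩
      obtain ⟨hT1, hT0⟩ := hT t ht
      rw [← R.norm_y_obliqueLine a t, lt_min_iff] at hT1
      refine ⟨?_, ?_⟩
      · rw [norm_mult]
        calc A * ‖R.y (obliqueLine R.Z a t)‖ ^ (3 * R.K)
            ≤ A * ‖R.y (obliqueLine R.Z a t)‖ := by
              gcongr
              exact pow_le_of_le_one (norm_nonneg _) hT1.1.le hK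
          _ ≤ A * (1 / (2 * A)) := by gcongr; exact hT1.2.le
          _ = 1 / 2 := by field_simp
      · rw [hβn]
        gcongr
        · rw [Real.exp_le_one_iff, neg_nonpos]
          have := R.Z_re; positivity
        · exact hP1 _ hT1.1.le
    · have ht : Tendsto (fun t : ℝ => ‖R.y₀‖ * Real.exp (-(2 * Real.pi * R.Z.re * t))) atBot
          atTop := by
        refine (Real.tendsto_exp_atTop.comp ?_).const_mul_atTop hy0
        exact tendsto_neg_atBot_atTop.comp (tendsto_id.const_mul_atBot hcoef)
      obtain ⟨T, hT⟩ := eventually_atBot.mp ((ht.eventually_ge_atTop (max 1 (2 / A))).and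
        (eventually_le_atBot 0))
      refine ⟨T, ‖exp (-Real.pi * R.Z)‖ / ‖R.y₀‖ * C / A, fun a _ t ht => ?_⟩
      obtain ⟨hT1, hT0⟩ := hT t ht
      have hyn := R.norm_y_obliqueLine a t
      rw [← hyn, max_le_iff] at hT1
      set y := R.y (obliqueLine R.Z a t) with hy
      refine ⟨?_, ?_⟩
      · rw [norm_mult]
        calc (2 : ℝ) = A * (2 / A) := by field_simp
          _ ≤ A * ‖y‖ := by gcongr; exact hT1.2
          _ ≤ A * ‖y‖ ^ (3 * R.K) := by
              gcongr
              exact le_self_pow₀ hT1.1 hK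
      · rw [hβn, norm_mult]
        have hu : 1 ≤ Real.exp (-(Real.pi * R.Z.re * t)) := by
          rw [Real.one_le_exp_iff, neg_nonneg]
          exact mul_nonpos_of_nonneg_of_nonpos (by have := R.Z_re; positivity) hT0
        have hu2 : Real.exp (-(Real.pi * R.Z.re * t)) ≤ ‖y‖ / ‖R.y₀‖ := by
          rw [hyn, mul_div_cancel_left₀ _ hy0.ne',
            show -(2 * Real.pi * R.Z.re * t) = -(Real.pi * R.Z.re * t) + -(Real.pi * R.Z.re * t) by
              ring, Real.exp_add]
          exact le_mul_of_one_le_left (by positivity) hu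
        calc ‖exp (-Real.pi * R.Z)‖ * Real.exp (-(Real.pi * R.Z.re * t)) * ‖P y‖
            ≤ ‖exp (-Real.pi * R.Z)‖ * (‖y‖ / ‖R.y₀‖) * ‖P y‖ := by gcongr
          _ = ‖exp (-Real.pi * R.Z)‖ / ‖R.y₀‖ * (‖y‖ * ‖P y‖) := by ring
          _ ≤ ‖exp (-Real.pi * R.Z)‖ / ‖R.y₀‖ * (C * ‖y‖ ^ (3 * R.K)) :=
              mul_le_mul_of_nonneg_left (hP2 y hT1.1) (by positivity)
          _ = ‖exp (-Real.pi * R.Z)‖ / ‖R.y₀‖ * C / A * (A * ‖y‖ ^ (3 * R.K)) := by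
              field_simp
  have hmain := eq_integral_of_add_one R.Z_re hEd hbd hone h1 h2
  rw [hEe w hw] at hmain
  simp only [neg_mul, integral_neg] at hmain
  linear_combination hmain

end RankPair

/-! ### The two rank functions for odd denominators -/

theorem exp_eq_of_sub_eq {a b : ℂ} (n : ℤ) (h : a - b = n * (2 * Real.pi * I)) :
    exp a = exp b := by
  rw [← sub_add_cancel a b, h, exp_add, exp_int_mul_two_pi_mul_I, one_mul]

theorem nome_zpow (k : ℕ) (h : ℤ) (z : ℂ) (n : ℤ) :
    nome k h z ^ n = exp (2 * Real.pi * I / k * (h + I * z) * n) := by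
  rw [nome, ← exp_int_mul, mul_comm]

theorem nome_sq (k : ℕ) (h : ℤ) (z : ℂ) : nome k h z ^ 2 = nome k (2 * h) (2 * z) := by
  rw [nome, nome, ← exp_nat_mul]
  congr 1
  push_cast
  ring

theorem sqrtNome_zpow (k : ℕ) (h : ℤ) (z : ℂ) (n : ℤ) :
    sqrtNome k h z ^ n = exp (Real.pi * I / k * (h + I * z) * n) := by
  rw [sqrtNome, ← exp_int_mul, mul_comm]

theorem sqrtNome_ne_zero (k : ℕ) (h : ℤ) (z : ℂ) : sqrtNome k h z ≠ 0 := exp_ne_zero _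

theorem sqrtNome_eq_nome {k : ℕ} {h : ℤ} {z : ℂ} (b : ℤ) (hb : h = 2 * b) :
    sqrtNome k h (1 / z) = nome k b (1 / (2 * z)) := by
  rw [sqrtNome, nome, hb]
  congr 1
  push_cast
  rw [one_div, one_div, mul_inv]
  ring

theorem re_one_div_pos {z : ℂ} (hz : 0 < z.re) : 0 < (1 / z).re := by
  rw [one_div, inv_re]
  have : z ≠ 0 := by rintro rfl; simp at hz
  exact div_pos hz (normSq_pos.mpr this)

theorem norm_sqrtNome_lt_one {k : ℕ} (hk : 0 < k) (h : ℤ) {z : ℂ} (hz : 0 < z.re) :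
    ‖sqrtNome k h z‖ < 1 := by
  have h1 := norm_nome_lt_one hk h hz
  have h2 : nome k h z = sqrtNome k h z ^ 2 := by
    rw [nome, sqrtNome, ← exp_nat_mul]
    congr 1
    push_cast
    ring
  rw [h2, norm_pow] at h1
  exact (pow_lt_one_iff_of_nonneg (norm_nonneg _) two_ne_zero).mp h1

theorem neg_one_zpow_eq_exp (n : ℤ) : (-1 : ℂ) ^ n = exp (Real.pi * I * n) := by
  rw [← exp_pi_mul_I, ← exp_int_mul, mul_comm]

theorem neg_one_pow_eq_exp (n : ℕ) : (-1 : ℂ) ^ n = exp (Real.pi * I * n) := by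
  rw [← exp_pi_mul_I, ← exp_nat_mul, mul_comm]

theorem two_mul_cpow_half {z : ℂ} (hz : z ≠ 0) :
    (2 * z) ^ (1 / 2 : ℂ) = Real.sqrt 2 * z ^ (1 / 2 : ℂ) := by
  have h2 : ((2 : ℝ) : ℂ) ^ (1 / 2 : ℂ) = Real.sqrt 2 := by
    rw [Real.sqrt_eq_rpow, ofReal_cpow zero_le_two]
    norm_num
  rw [← h2, cpow_def_of_ne_zero (by simpa using hz), cpow_def_of_ne_zero hz,
    cpow_def_of_ne_zero (by norm_num), show (2 : ℂ) * z = ((2 : ℝ) : ℂ) * z by norm_num,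
    log_ofReal_mul zero_lt_two hz, ← exp_add, ofReal_log zero_le_two, add_mul]

theorem cpow_neg_half_mul {z : ℂ} (hz : z ≠ 0) : z ^ (-1 / 2 : ℂ) * z = z ^ (1 / 2 : ℂ) := by
  nth_rewrite 2 [← cpow_one z]
  rw [← cpow_add _ _ hz]
  norm_num

/-- The constant in front of the second rank function, for odd denominators. -/
noncomputable def oddConst (k : ℕ) (h : ℤ) (z : ℂ) : ℂ :=
  -(1 / (Real.sqrt 2 : ℂ)) * z ^ (-1 / 2 : ℂ) * omega (2 * h) k
    * exp (Real.pi / (24 * k * z) - 2 * Real.pi * z / (3 * k) + Real.pi * I * h / (2 * k))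
    * exp (Real.pi * I / 2 * (k + 1 + 3 * h * k))

/-- The Gaussian factor of the second rank function, for odd denominators. -/
noncomputable def oddGauss (k : ℕ) (h : ℤ) (z w : ℂ) : ℂ :=
  oddConst k h z *
    exp (3 * Real.pi * I * w + 3 * Real.pi * k * w ^ 2 / (2 * z) - Real.pi * w / (2 * z))

/-- The congruence between the exponents of `i` in the two residues at a pole, for odd denominators. -/
theorem odd_residue_mod_four : ∀ n c b h l : ZMod 4,
    3 * (2 * n + 1) * l + (2 * n + 1) - 3 - (2 * c + 1) - 3 * h * (2 * c + 1)
      - 2 * ((2 * n + 1) * h - (2 * c + 1) * l)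
      - ((2 * n + 1) * ((2 * c + 1) * (1 + h * (2 * b))) - l * (2 * b))
        * (3 * ((2 * n + 1) * h - (2 * c + 1) * l) + 1) = 0 := by
  decide

section Odd

variable {k : ℕ} {h h' : ℤ} {z : ℂ}

theorem norm_nome_sq_lt_one (hk : 0 < k) (hz : 0 < z.re) : ‖nome k h z ^ 2‖ < 1 := by
  rw [norm_pow]
  exact pow_lt_one₀ (norm_nonneg _) (norm_nome_lt_one hk h hz) two_ne_zero

/-- The poles of the first function are poles of the second one, with the same residue.  The residues
are compared through the transformation law of `(q; q)_∞`; the roots of unity agree because the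
exponents, integers multiplied by `πi/2`, are congruent modulo `4`. -/
theorem odd_pole (hk : 0 < k) (hodd : Odd k) (hh : h * h' ≡ -1 [ZMOD (k : ℤ)]) (he : 2 ∣ h')
    (hz : 0 < z.re) (w : ℂ) (n : ℤ)
    (hp : nome k h z * exp (2 * Real.pi * I * w) * (nome k h z ^ 2) ^ n = 1) :
    ∃ m : ℤ, -1 * exp (-2 * Real.pi * w / (2 * z)) * sqrtNome k h' (1 / z) ^ m = 1 ∧
      exp (Real.pi * I * w) *
        (1 / qPoch (nome k h z ^ 2) * ((-1) ^ n * (nome k h z ^ 2) ^ pent n)) * I =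
      2 * z * (oddGauss k h z w * (1 / qPoch (sqrtNome k h' (1 / z)) *
        ((-1) ^ m * sqrtNome k h' (1 / z) ^ pent m))) := by
  have hz0 : z ≠ 0 := by rintro rfl; simp at hz
  have hk0 : (k : ℂ) ≠ 0 := by exact_mod_cast hk.ne'
  have hpi : (Real.pi : ℂ) ≠ 0 := ofReal_ne_zero.mpr Real.pi_ne_zero
  have h2piI := Complex.two_pi_I_ne_zero
  obtain ⟨b, hb⟩ := he
  obtain ⟨kp, hkp⟩ := hh.symm.dvd
  obtain ⟨c, hc⟩ := hodd
  have hcZ : (k : ℤ) = 2 * c + 1 := by exact_mod_cast hc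
  have hkpC : (h : ℂ) * h' = k * kp - 1 := by
    have : h * h' = k * kp - 1 := by linarith
    exact_mod_cast this
  -- the position of the pole
  rw [← zpow_natCast (nome k h z), ← zpow_mul, nome_zpow, nome, ← exp_add, ← exp_add] at hp
  obtain ⟨l, hl⟩ := exp_eq_one_iff.mp hp
  set m : ℤ := (2 * n + 1) * h - k * l with hm
  have hmC : (m : ℂ) = (2 * n + 1) * h - k * l := by rw [hm]; push_cast; ring
  have hw : w = -(m + I * (2 * n + 1) * z) / k := by
    refine mul_left_cancel₀ h2piI ?_
    rw [hmC]
    field_simp at hl ⊢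
    push_cast at hl
    linear_combination hl
  have hmh : (2 * n + 1 : ℂ) + m * h' = k * ((2 * n + 1) * kp - l * h') := by
    rw [hmC]; linear_combination (2 * n + 1) * hkpC
  refine ⟨m, ?_, ?_⟩
  · rw [sqrtNome_zpow, mul_assoc, ← exp_add, neg_one_mul, neg_eq_iff_eq_neg, ← exp_pi_mul_I]
    -- the parity of `(2n+1)k' - lh'` makes the second factor have a pole as well
    have hpar : ∃ j : ℤ, (2 * n + 1) * kp - l * h' = 2 * j + 1 := by
      have h1 : Odd kp := by
        have : Odd (k * kp) := by
          rw [show (k : ℤ) * kp = h * h' + 1 by linarith, hb]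
          exact ⟨h * b, by ring⟩
        exact (Int.odd_mul.mp this).2
      obtain ⟨r, hr⟩ := h1
      exact ⟨(2 * n + 1) * r + n - l * b, by rw [hr, hb]; ring⟩
    obtain ⟨j, hj⟩ := hpar
    have hjC : (2 * n + 1 : ℂ) * kp - l * h' = 2 * j + 1 := by exact_mod_cast hj
    refine exp_eq_of_sub_eq j ?_
    rw [hw]
    field_simp
    rw [hjC] at hmh
    linear_combination I * z * hmh + (m : ℂ) * I_sq
  -- the phases of the two residues, as exponents of `i`
  · have hres : ∃ j : ℤ, 3 * (2 * n + 1) * l + (2 * n + 1) - 3 - k - 3 * h * k - 2 * m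
        - ((2 * n + 1) * kp - l * h') * (3 * m + 1) = 4 * j := by
      refine (ZMod.intCast_zmod_eq_zero_iff_dvd _ 4).mp ?_
      have hkp4 : (kp : ZMod 4) = (2 * c + 1) * (1 + h * (2 * b)) := by
        have h1 : ((k : ℤ) : ZMod 4) * kp = 1 + h * h' := by
          have : (k : ℤ) * kp = 1 + h * h' := by linarith
          exact_mod_cast congrArg (Int.cast : ℤ → ZMod 4) this
        rw [hcZ, hb] at h1
        push_cast at h1
        rw [← h1]
        generalize (c : ZMod 4) = c
        generalize (kp : ZMod 4) = kp
        revert c kp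
        decide
      have := odd_residue_mod_four n c b h l
      rw [hm, hb, hcZ]
      push_cast
      rw [hkp4]
      exact this
    obtain ⟨j, hj⟩ := hres
    have hjC : (3 * (2 * n + 1) * l + (2 * n + 1) - 3 - k - 3 * h * k - 2 * m
        - ((2 * n + 1) * kp - l * h') * (3 * m + 1) : ℂ) = 4 * j := by exact_mod_cast hj
    -- the nome `q²` belongs to `2h` and `2z`, and the inverse of `2h` modulo `k` is `-h'/2`
    have htr := qPoch_transform hk (h := 2 * h) (h' := b) (z := 2 * z)
      (by rw [show 2 * h * b = h * h' by rw [hb]; ring]; exact hh) (by simpa using hz)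
    rw [← sqrtNome_eq_nome b hb, ← nome_sq] at htr
    have hP := qPoch_ne_zero (norm_nome_sq_lt_one (h := h) hk hz)
    have hom : omega (2 * h) k ≠ 0 := exp_ne_zero _
    have hs2 := two_mul_cpow_half hz0
    have hzz := cpow_neg_half_mul hz0
    have hz2 : z ^ (1 / 2 : ℂ) ≠ 0 := by simp [cpow_eq_zero_iff, hz0]
    have hsq : (Real.sqrt 2 : ℂ) * Real.sqrt 2 = 2 := by
      rw [← ofReal_mul, Real.mul_self_sqrt zero_le_two]; norm_num
    have hsq0 : (Real.sqrt 2 : ℂ) ≠ 0 := by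
      intro h0; rw [h0] at hsq; simp at hsq
    have hexp : exp (Real.pi * I * w) * (-1) ^ n * (nome k h z ^ 2) ^ pent n *
        exp (Real.pi / 2 * I) *
        exp (Real.pi / (12 * k) * (1 / (2 * z) - 2 * z)) =
        -(exp (Real.pi / (24 * k * z) - 2 * Real.pi * z / (3 * k) + Real.pi * I * h / (2 * k))
          * exp (Real.pi * I / 2 * (k + 1 + 3 * h * k)) *
        exp (3 * Real.pi * I * w + 3 * Real.pi * k * w ^ 2 / (2 * z) - Real.pi * w / (2 * z)) *
        (-1) ^ m * sqrtNome k h' (1 / z) ^ pent m) := by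
      rw [← zpow_natCast (nome k h z), ← zpow_mul, nome_zpow, sqrtNome_zpow, neg_one_zpow_eq_exp,
        neg_one_zpow_eq_exp, ← neg_one_mul, ← exp_pi_mul_I]
      simp only [← exp_add]
      refine exp_eq_of_sub_eq (j - l) ?_
      have e1 : ((2 : ℤ) * pent n : ℂ) = 3 * n ^ 2 + n := by exact_mod_cast two_mul_pent n
      have e2 : (pent m : ℂ) = (3 * m ^ 2 + m) / 2 := by
        have : (2 * pent m : ℂ) = 3 * m ^ 2 + m := by exact_mod_cast two_mul_pent m
        linear_combination this / 2
      have hR : -2 * m + 2 * k * n + k + h * (3 * (2 * n + 1) ^ 2 - 4 * (2 * n + 1) + 1) - 2 * k - h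
          - k ^ 2 - k - 3 * h * k ^ 2 + 6 * m - 6 * m * (2 * n + 1) - (2 * n + 1) - 2 * k * m
          - h' * (3 * m ^ 2 + m) = (4 * k * (j - l) : ℂ) := by
        linear_combination -(3 * m + 1) * hmh + (4 - 3 * (2 * n + 1)) * hmC + k * hjC
      push_cast at e1 ⊢
      rw [e1, e2, hw]
      field_simp
      linear_combination 864 * I * z * hR + 864 * (z ^ 2 - m - 3 * m ^ 2) * I_sq
    rw [exp_pi_div_two_mul_I] at hexp
    rw [htr]
    have : oddGauss k h z w = z ^ (-1 / 2 : ℂ) * (-(1 / (Real.sqrt 2 : ℂ)) * omega (2 * h) k *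
        (exp (Real.pi / (24 * k * z) - 2 * Real.pi * z / (3 * k) + Real.pi * I * h / (2 * k))
          * exp (Real.pi * I / 2 * (k + 1 + 3 * h * k)) *
        exp (3 * Real.pi * I * w + 3 * Real.pi * k * w ^ 2 / (2 * z) - Real.pi * w / (2 * z)))) := by
      rw [oddGauss, oddConst]; ring
    rw [this, hs2]
    have hE : exp (Real.pi / (12 * k) * (1 / (2 * z) - 2 * z)) ≠ 0 := exp_ne_zero _
    generalize exp (Real.pi / (12 * k) * (1 / (2 * z) - 2 * z)) = E at hE hexp ⊢
    rw [← hzz] at hz2 ⊢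
    have hzm := left_ne_zero_of_mul hz2
    generalize z ^ (-1 / 2 : ℂ) = zm at hzm ⊢
    generalize qPoch (nome k h z ^ 2) = P at hP ⊢
    generalize omega (2 * h) k = o at hom ⊢
    generalize (Real.sqrt 2 : ℂ) = S at hsq hsq0 ⊢
    generalize sqrtNome k h' (1 / z) ^ pent m = p1 at hexp ⊢
    generalize (nome k h z ^ 2) ^ pent n = p at hexp ⊢
    generalize exp (Real.pi / (24 * k * z) - 2 * Real.pi * z / (3 * k) + Real.pi * I * h / (2 * k))
      = B₁ at hexp ⊢
    generalize exp (Real.pi * I / 2 * (k + 1 + 3 * h * k)) = B₂ at hexp ⊢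
    generalize exp (3 * Real.pi * I * w + 3 * Real.pi * k * w ^ 2 / (2 * z)
      - Real.pi * w / (2 * z)) = B₃ at hexp ⊢
    field_simp
    linear_combination 2 * hexp + exp (Real.pi * I * w) * (-1) ^ n * p * I * E * hsq

/-- Conversely the poles of the second function are poles of the first one. -/
theorem odd_pole' (hk : 0 < k) (hodd : Odd k) (hh : h * h' ≡ -1 [ZMOD (k : ℤ)]) (he : 2 ∣ h')
    (hz : 0 < z.re) (w : ℂ) (m : ℤ)
    (hp : -1 * exp (-2 * Real.pi * w / (2 * z)) * sqrtNome k h' (1 / z) ^ m = 1) :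
    ∃ n : ℤ, nome k h z * exp (2 * Real.pi * I * w) * (nome k h z ^ 2) ^ n = 1 := by
  have hz0 : z ≠ 0 := by rintro rfl; simp at hz
  have hk0 : (k : ℂ) ≠ 0 := by exact_mod_cast hk.ne'
  have hpi : (Real.pi : ℂ) ≠ 0 := ofReal_ne_zero.mpr Real.pi_ne_zero
  obtain ⟨b, hb⟩ := he
  obtain ⟨kp, hkp⟩ := hh.symm.dvd
  have hkpC : (h : ℂ) * h' = k * kp - 1 := by
    have : h * h' = k * kp - 1 := by linarith
    exact_mod_cast this
  rw [sqrtNome_zpow, mul_assoc, ← exp_add, ← exp_pi_mul_I, ← exp_add] at hp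
  obtain ⟨j, hj⟩ := exp_eq_one_iff.mp hp
  obtain ⟨c, hc⟩ := hodd
  have hcC : (k : ℂ) = 2 * c + 1 := by exact_mod_cast hc
  have hbC : (h' : ℂ) = 2 * b := by exact_mod_cast hb
  have hw : w = (I * z * (m * h' - k * (2 * j - 1)) - m) / k := by
    refine mul_left_cancel₀ hpi ?_
    field_simp at hj ⊢
    linear_combination -hj + m * I_sq
  refine ⟨k * j - c - m * b - 1, ?_⟩
  rw [← zpow_natCast (nome k h z), ← zpow_mul, nome_zpow, nome, ← exp_add, ← exp_add,
    exp_eq_one_iff]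
  refine ⟨h * (2 * j - 1) - m * kp, ?_⟩
  rw [hw]
  push_cast
  field_simp
  linear_combination (-m) * hkpC + (h + I * z) * (hcC + m * hbC)

theorem oddGauss_add_period (hk : 0 < k) (hodd : Odd k) (hz : 0 < z.re) (w : ℂ) :
    oddGauss k h z (w + I * (2 * z)) = exp (-Real.pi * (2 * z)) *
      ((-1) ^ k * (nome k h z ^ 2) ^ pent (-k) *
        (nome k h z * exp (2 * Real.pi * I * w)) ^ (3 * k)) * oddGauss k h z w := by
  have hz0 : z ≠ 0 := by rintro rfl; simp at hz
  have hk0 : (k : ℂ) ≠ 0 := by exact_mod_cast hk.ne'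
  have e2 : (pent (-k) : ℂ) = (3 * k ^ 2 - k) / 2 := by
    have : (2 * pent (-k) : ℂ) = 3 * (-k) ^ 2 + -k := by exact_mod_cast two_mul_pent (-k)
    linear_combination this / 2
  rw [oddGauss, oddGauss, mul_left_comm _ (oddConst k h z)]
  refine congrArg (oddConst k h z * ·) ?_
  rw [← zpow_natCast (nome k h z), ← zpow_mul, nome_zpow, nome, ← exp_add, ← exp_nat_mul,
    hodd.neg_one_pow, ← exp_pi_mul_I]
  simp only [← exp_add]
  refine exp_eq_of_sub_eq (-((3 * k + 2) * h + 1)) ?_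
  push_cast
  rw [e2]
  field_simp
  linear_combination 4 * z ^ 2 * I_sq

theorem differentiable_oddGauss (k : ℕ) (h : ℤ) (z : ℂ) : Differentiable ℂ (oddGauss k h z) := by
  unfold oddGauss
  fun_prop

theorem nome_sq_pow (hk : 0 < k) : (nome k h z ^ 2) ^ k = exp (-2 * Real.pi * (2 * z)) := by
  have hk0 : (k : ℂ) ≠ 0 := by exact_mod_cast hk.ne'
  rw [← pow_mul, ← zpow_natCast, nome_zpow]
  refine exp_eq_of_sub_eq (2 * h) ?_
  push_cast
  field_simp
  linear_combination z * I_sq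

/-- The pair of rank functions attached to a fraction with odd denominator. -/
noncomputable def oddPair (hk : 0 < k) (hodd : Odd k) (hh : h * h' ≡ -1 [ZMOD (k : ℤ)])
    (he : 2 ∣ h') (hz : 0 < z.re) : RankPair where
  K := k
  Z := 2 * z
  p := nome k h z ^ 2
  p₁ := sqrtNome k h' (1 / z)
  y₀ := nome k h z
  Y₀ := -1
  γ := oddGauss k h z
  K_pos := hk
  Z_re := by simpa using hz
  p_ne := pow_ne_zero _ (nome_ne_zero _ _ _)
  p_lt := norm_nome_sq_lt_one hk hz
  p₁_ne := sqrtNome_ne_zero _ _ _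
  p₁_lt := norm_sqrtNome_lt_one hk _ (re_one_div_pos hz)
  y₀_ne := nome_ne_zero _ _ _
  Y₀_ne := by norm_num
  γ_diff := differentiable_oddGauss k h z
  p_pow := nome_sq_pow hk
  pole := odd_pole hk hodd hh he hz
  pole' := odd_pole' hk hodd hh he hz
  γ_period := oddGauss_add_period hk hodd hz

end Odd

/-! ### Mordell integrals -/

/-- The integral of `D(s) / sin π(s - w)` along oblique lines does not change as long as the line
does not cross a zero of the sine. -/
theorem integral_mul_inv_sin_eq {z w : ℂ} (hz : 0 < z.re) {D : ℂ → ℂ} (hD : Differentiable ℂ D)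
    (hbd : BoundedOnStrips z D) {a b : ℝ} (ha1 : obliqueRe z w < a) (ha2 : a < obliqueRe z w + 1)
    (hb1 : obliqueRe z w < b) (hb2 : b < obliqueRe z w + 1) :
    ∫ t : ℝ, D (obliqueLine z a t) * (sin (Real.pi * (obliqueLine z a t - w)))⁻¹ =
      ∫ t : ℝ, D (obliqueLine z b t) * (sin (Real.pi * (obliqueLine z b t - w)))⁻¹ := by
  obtain ⟨c, hc1, hc2⟩ := exists_between (lt_min ha1 hb1)
  obtain ⟨d, hd1, hd2⟩ := exists_between (max_lt ha2 hb2)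
  rw [lt_min_iff] at hc2
  rw [max_lt_iff] at hd1
  have hne {s : ℂ} (h1 : c ≤ obliqueRe z s) (h2 : obliqueRe z s ≤ d) :
      sin (Real.pi * (s - w)) ≠ 0 := by
    refine sin_pi_sub_ne_zero (z := z) (by linarith) (by linarith) ?_
    rintro rfl
    linarith
  have hdiff {s : ℂ} (h1 : c ≤ obliqueRe z s) (h2 : obliqueRe z s ≤ d) :
      DifferentiableAt ℂ (fun s => D s * (sin (Real.pi * (s - w)))⁻¹) s :=
    (hD s).mul (DifferentiableAt.inv (by fun_prop) (hne h1 h2))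
  obtain ⟨B, c', T, hc', hB0, hB⟩ := inv_sin_tail (w := w) hz
  obtain ⟨C, hC⟩ := hbd c d
  have hdecay : ExpDecay z (fun s => D s * (sin (Real.pi * (s - w)))⁻¹) c d := by
    refine ExpDecay.of_tail (B := C * B) (T := T) hc' (fun a ha t => ?_) fun a ha t ht => ?_
    · apply (hdiff _ _).continuousAt <;> rw [obliqueRe_obliqueLine hz]
      exacts [ha.1, ha.2]
    · rw [norm_mul, mul_assoc]
      exact mul_le_mul (hC a ha t) (hB a t ht) (norm_nonneg _)
        ((norm_nonneg _).trans (hC a ha t))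
  exact hdecay.integral_eq hz (fun s hs => (hdiff hs.1.le hs.2.le).differentiableWithinAt)
    hc2.1 hd1.1 hc2.2 hd1.2

/-- Gaussians with a decaying quadratic exponent are bounded on strips. -/
theorem boundedOnStrips_gauss {z : ℂ} (hz : 0 < z.re) {κ : ℝ} (hκ : 0 < κ) (B : ℂ) :
    BoundedOnStrips z fun s => exp (κ * s ^ 2 / z + B * s) := by
  have hz0 : z ≠ 0 := by rintro rfl; simp at hz
  intro a₁ a₂
  set M : ℝ := max |a₁| |a₂| with hM
  refine ⟨Real.exp (κ * M ^ 2 * |(1 / z).re| + M * ‖B‖ + ‖B * z‖ ^ 2 / (4 * (κ * z.re))),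
    fun a ha t => ?_⟩
  have haM : |a| ≤ M := abs_le_max_abs_abs ha.1 ha.2
  have hM0 : 0 ≤ M := (abs_nonneg a).trans haM
  have haM2 : a ^ 2 ≤ M ^ 2 := by rw [← sq_abs a]; gcongr
  rw [norm_exp, Real.exp_le_exp]
  have e : κ * obliqueLine z a t ^ 2 / z + B * obliqueLine z a t =
      ((κ * a ^ 2 : ℝ) : ℂ) * (1 / z) + ((2 * κ * a * t : ℝ) : ℂ) * I - ((κ * t ^ 2 : ℝ) : ℂ) * z
        + (a : ℝ) * B + (t : ℝ) * (I * (B * z)) := by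
    rw [obliqueLine]
    push_cast
    field_simp
    linear_combination κ * z ^ 2 * t ^ 2 * I_sq
  rw [e]
  simp only [add_re, sub_re, re_ofReal_mul, I_re, mul_zero, add_zero]
  have h1 : (κ * a ^ 2) * (1 / z).re ≤ κ * M ^ 2 * |(1 / z).re| := by
    refine mul_le_mul (by gcongr) (le_abs_self _) ?_ (by positivity)
    exact (re_one_div_pos hz).le
  have h2 : a * B.re ≤ M * ‖B‖ := by
    refine (le_abs_self _).trans ?_
    rw [abs_mul]
    exact mul_le_mul haM (abs_re_le_norm B) (abs_nonneg _) hM0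
  have h3 : t * (I * (B * z)).re ≤ |t| * ‖B * z‖ := by
    refine (le_abs_self _).trans ?_
    rw [abs_mul]
    gcongr
    refine (abs_re_le_norm _).trans ?_
    rw [norm_mul, norm_I, one_mul]
  have h4 : |t| * ‖B * z‖ ≤ κ * t ^ 2 * z.re + ‖B * z‖ ^ 2 / (4 * (κ * z.re)) := by
    have hpos : 0 < κ * z.re := by positivity
    rw [← sub_nonneg]
    have : κ * t ^ 2 * z.re + ‖B * z‖ ^ 2 / (4 * (κ * z.re)) - |t| * ‖B * z‖ =
        (2 * (κ * z.re) * |t| - ‖B * z‖) ^ 2 / (4 * (κ * z.re)) := by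
      field_simp
      rw [← sq_abs t]
      ring
    rw [this]
    positivity
  linarith

/-- The integrand of `mordell`. -/
noncomputable def mordellIntegrand (k : ℕ) (σ : ℝ) (z w : ℂ) (x : ℝ) : ℂ :=
  exp (-3 * Real.pi * z * x ^ 2 / (2 * k) + 3 * Real.pi * z * x / k) *
    (1 / (2 * sinh (Real.pi * I * (σ - w) + Real.pi * z * x / k)))

/-- The Mordell integral attached to the line through the real point `σ`: all the integrals
`I_{k,ν}^{o,±}(z; w)` and `J_{k,ν}^{o,±}(z; w)` are of this form. -/
noncomputable def mordell (k : ℕ) (σ : ℝ) (z w : ℂ) : ℂ := ∫ x : ℝ, mordellIntegrand k σ z w x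

theorem IoWIntegrand_eq (k : ℕ) (ν s : ℤ) (z w : ℂ) :
    IoWIntegrand k ν s z w = mordellIntegrand k (-s * (ν - 1 / 6) / k) z w := by
  ext x
  rw [IoWIntegrand, mordellIntegrand, Ho]
  congr 4
  push_cast
  ring

theorem JoWIntegrand_eq (k : ℕ) (ν s : ℤ) (z w : ℂ) :
    JoWIntegrand k ν s z w = mordellIntegrand k ((s / 3 - (2 * ν + 1)) / k) z w := by
  ext x
  rw [JoWIntegrand, mordellIntegrand, Ho]
  congr 4
  · ring
  · push_cast
    ring

/-- The Gaussian whose critical point lies on the line through `σ`. -/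
noncomputable def centredGauss (k : ℕ) (σ : ℝ) (z s : ℂ) : ℂ :=
  exp (3 * Real.pi * k / (2 * z) * (s ^ 2 - 2 * σ * s + 2 * I * z * s / k))

section

variable {k : ℕ} {z w : ℂ}

theorem differentiable_centredGauss (k : ℕ) (σ : ℝ) (z : ℂ) :
    Differentiable ℂ (centredGauss k σ z) := by
  unfold centredGauss
  fun_prop

theorem boundedOnStrips_centredGauss (hk : 0 < k) (hz : 0 < z.re) (σ : ℝ) :
    BoundedOnStrips z (centredGauss k σ z) := by
  have hz0 : z ≠ 0 := by rintro rfl; simp at hz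
  have hk0 : (k : ℂ) ≠ 0 := by exact_mod_cast hk.ne'
  have hkr : (0 : ℝ) < k := by exact_mod_cast hk
  convert boundedOnStrips_gauss hz (κ := 3 * Real.pi * k / 2) (by positivity)
    (3 * Real.pi * k / (2 * z) * (-2 * σ + 2 * I * z / k)) using 2 with s
  rw [centredGauss]
  congr 1
  push_cast
  field_simp
  ring

/-- The substitution `s = σ - izx/k` turns the hyperbolic sine into the kernel `1 / sin π(s - w)`. -/
theorem mordellIntegrand_eq (hk : 0 < k) (hz : 0 < z.re) (σ : ℝ) (x : ℝ) :
    mordellIntegrand k σ z w x =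
    -(I / 2) * exp (3 * Real.pi * k * σ ^ 2 / (2 * z) - 3 * Real.pi * I * σ) *
      (centredGauss k σ z (obliqueLine z σ ((-1 / k : ℝ) * x)) *
        (sin (Real.pi * (obliqueLine z σ ((-1 / k : ℝ) * x) - w)))⁻¹) := by
  have hz0 : z ≠ 0 := by rintro rfl; simp at hz
  have hk0 : (k : ℂ) ≠ 0 := by exact_mod_cast hk.ne'
  have e1 : Real.pi * I * (σ - w) + Real.pi * z * x / k =
      Real.pi * (obliqueLine z σ ((-1 / k : ℝ) * x) - w) * I := by
    rw [obliqueLine]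
    push_cast
    field_simp
    linear_combination z * x * I_sq
  rw [mordellIntegrand, e1, sinh_mul_I, centredGauss, mul_assoc (-(I / 2)),
    ← mul_assoc (exp _), ← exp_add]
  have e2 : -3 * Real.pi * z * x ^ 2 / (2 * k) + 3 * Real.pi * z * x / k =
      3 * Real.pi * k * σ ^ 2 / (2 * z) - 3 * Real.pi * I * σ + 3 * Real.pi * k / (2 * z) *
      (obliqueLine z σ ((-1 / k : ℝ) * x) ^ 2 - 2 * σ * obliqueLine z σ ((-1 / k : ℝ) * x)
        + 2 * I * z * obliqueLine z σ ((-1 / k : ℝ) * x) / k) := by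
    rw [obliqueLine]
    push_cast
    field_simp
    linear_combination (2 * z ^ 2 * x - z ^ 2 * x ^ 2) * I_sq
  rw [← e2, one_div, mul_inv, mul_inv, inv_I]
  ring

theorem integrable_mordellIntegrand (hk : 0 < k) (hz : 0 < z.re) {σ : ℝ}
    (hσ : ∀ n : ℤ, σ - obliqueRe z w ≠ n) :
    Integrable (mordellIntegrand k σ z w) := by
  have hkr : (0 : ℝ) < k := by exact_mod_cast hk
  have h := integrable_mul_inv_sin hz (differentiable_centredGauss k σ z).continuous
    (boundedOnStrips_centredGauss hk hz σ) hσ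
  have := (h.comp_mul_left' (R := (-1 / k : ℝ)) (by
    rw [neg_div]; exact neg_ne_zero.mpr (by positivity))).const_mul
    (-(I / 2) * exp (3 * Real.pi * k * σ ^ 2 / (2 * z) - 3 * Real.pi * I * σ))
  exact this.congr (ae_of_all _ fun x => (mordellIntegrand_eq hk hz σ x).symm)

/-- A Gaussian integrated against `1 / sin π(s - w)` is, after a shift to the line through its
critical point, a Mordell integral. -/
theorem integral_centredGauss (hk : 0 < k) (hz : 0 < z.re) {σ a : ℝ}
    (ha1 : obliqueRe z w < a) (ha2 : a < obliqueRe z w + 1)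
    (hσ1 : obliqueRe z w < σ) (hσ2 : σ < obliqueRe z w + 1) :
    ∫ t : ℝ, centredGauss k σ z (obliqueLine z a t) *
        (sin (Real.pi * (obliqueLine z a t - w)))⁻¹ =
      2 * I / k * exp (-(3 * Real.pi * k * σ ^ 2 / (2 * z)) + 3 * Real.pi * I * σ)
        * mordell k σ z w := by
  have hkr : (0 : ℝ) < k := by exact_mod_cast hk
  have hk0 : (k : ℂ) ≠ 0 := by exact_mod_cast hk.ne'
  rw [integral_mul_inv_sin_eq hz (differentiable_centredGauss k σ z)
    (boundedOnStrips_centredGauss hk hz σ) ha1 ha2 hσ1 hσ2, mordell]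
  simp only [mordellIntegrand_eq hk hz σ]
  rw [integral_const_mul, Measure.integral_comp_mul_left (fun t => centredGauss k σ z
    (obliqueLine z σ t) * (sin (Real.pi * (obliqueLine z σ t - w)))⁻¹) (-1 / k : ℝ)]
  have habs : |(-1 / k : ℝ)⁻¹| = k := by
    rw [inv_div, div_neg, div_one, abs_neg, abs_of_pos hkr]
  rw [habs, real_smul, show -(3 * Real.pi * k * σ ^ 2 / (2 * z)) + 3 * Real.pi * I * σ
    = -(3 * Real.pi * k * σ ^ 2 / (2 * z) - 3 * Real.pi * I * σ) by ring, exp_neg]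
  push_cast
  have := exp_ne_zero (3 * Real.pi * k * σ ^ 2 / (2 * z) - 3 * Real.pi * I * σ)
  field_simp
  rw [I_sq]
  ring

theorem obliqueLine_two_mul (z : ℂ) (a t : ℝ) :
    obliqueLine (2 * z) a t = obliqueLine z a (2 * t) := by
  rw [obliqueLine, obliqueLine]
  push_cast
  ring

theorem obliqueRe_two_mul (z w : ℂ) : obliqueRe (2 * z) w = obliqueRe z w := by
  rw [obliqueRe, obliqueRe]
  simp
  field_simp

end

/-! ### The transformation law for odd denominators -/

/-- The functional equation iterated towards larger arguments. -/
theorem rankFn_eq_sum_add {p Y : ℂ} (hp0 : p ≠ 0) (hp : ‖p‖ < 1) (hY : Y ≠ 0)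
    (h : ∀ m : ℤ, Y * p ^ m ≠ 1) (n : ℕ) :
    rankFn p Y = ∑ i ∈ Finset.range n, (-1) ^ i * (p ^ (-pent i) * Y ^ (3 * i)
        - p ^ (-pent (-(i + 1))) * Y ^ (3 * i + 2))
      + (-1) ^ n * p ^ (-pent n) * Y ^ (3 * n) * rankFn p (Y * p⁻¹ ^ n) := by
  induction n with
  | zero => simp [pent]
  | succ n ih =>
    rw [Finset.sum_range_succ, add_assoc]
    nth_rewrite 1 [ih]
    congr 1
    have hpn : p⁻¹ ^ (n + 1) ≠ 0 := pow_ne_zero _ (inv_ne_zero hp0)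
    have hpole (m : ℤ) : Y * p⁻¹ ^ (n + 1) * p ^ m ≠ 1 := by
      rw [mul_assoc, ← zpow_natCast, inv_zpow', ← zpow_add₀ hp0]
      exact h _
    have e : Y * p⁻¹ ^ n = Y * p⁻¹ ^ (n + 1) * p := by
      rw [pow_succ]; field_simp
    rw [e, rankFn_mul_nome hp0 hp (mul_ne_zero hY hpn) hpole]
    have t1 := two_mul_pent n
    have t2 := two_mul_pent (-((n : ℤ) + 1))
    have t3 := two_mul_pent ((n + 1 : ℕ) : ℤ)
    push_cast at t3
    have q : p ^ (-((n + 1 : ℕ) : ℤ)) = p⁻¹ ^ (n + 1) := by rw [zpow_neg, zpow_natCast, inv_pow]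
    have e2 : p ^ (-pent (-((n : ℤ) + 1))) = p ^ (-pent n) * (p⁻¹ ^ (n + 1)) ^ 2 * p := by
      rw [show -pent (-((n : ℤ) + 1)) = -pent n + -((n + 1 : ℕ) : ℤ) * 2 + 1 by
        push_cast; linarith [t1, t2, show 3 * (-((n : ℤ) + 1)) ^ 2 + -((n : ℤ) + 1)
          = 3 * (n : ℤ) ^ 2 + n + 4 * n + 2 by ring],
        zpow_add₀ hp0, zpow_add₀ hp0, zpow_one, zpow_mul, q]
      norm_cast
    have e3 : p ^ (-pent ((n + 1 : ℕ) : ℤ)) = p ^ (-pent n) * (p⁻¹ ^ (n + 1)) ^ 3 * p := by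
      rw [show -pent ((n + 1 : ℕ) : ℤ) = -pent n + -((n + 1 : ℕ) : ℤ) * 3 + 1 by
        push_cast; linarith [t1, t3, show 3 * ((n : ℤ) + 1) ^ 2 + ((n : ℤ) + 1)
          = 3 * (n : ℤ) ^ 2 + n + 6 * n + 4 by ring],
        zpow_add₀ hp0, zpow_add₀ hp0, zpow_one, zpow_mul, q]
      norm_cast
    rw [e2, e3]
    ring

theorem sum_range_add_one_of_periodic {f : ℤ → ℂ} {k : ℕ} (hf : ∀ n, f (n + k) = f n) :
    ∑ i ∈ Finset.range k, f (i + 1) = ∑ i ∈ Finset.range k, f i := by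
  have h1 := Finset.sum_range_succ (fun i : ℕ => f i) k
  have h2 := Finset.sum_range_succ' (fun i : ℕ => f i) k
  have h3 : f k = f 0 := by rw [← hf 0, zero_add]
  simp only [Nat.cast_add, Nat.cast_one, Nat.cast_zero] at h2
  rw [h1, h3] at h2
  exact (add_right_cancel h2).symm

theorem sum_range_neg_of_periodic {f : ℤ → ℂ} {k : ℕ} (hf : ∀ n, f (n + k) = f n) :
    ∑ i ∈ Finset.range k, f (-i) = ∑ i ∈ Finset.range k, f i := by
  rw [← sum_range_add_one_of_periodic hf, ← Finset.sum_range_reflect]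
  refine Finset.sum_congr rfl fun i hi => ?_
  have hi' := Finset.mem_range.mp hi
  rw [← hf]
  congr 1
  omega

/-- The sum of Gaussians by which the second rank function fails to be antiperiodic, for odd
denominators. -/
noncomputable def oddJump (k : ℕ) (h h' : ℤ) (z s : ℂ) : ℂ :=
  oddConst k h z * ∑ ν ∈ Finset.range k,
    (sqrtNome k h' (1 / z) ^ (-pent ν) * centredGauss k ((6 * ν + 1) / (6 * k)) z s
      - sqrtNome k h' (1 / z) ^ (-pent (-(ν + 1))) * centredGauss k ((6 * ν + 5) / (6 * k)) z s)

section Odd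

variable {k : ℕ} {h h' : ℤ} {z w : ℂ}

/-- A power of the argument of the rank function moves the centre of the Gaussian. -/
theorem oddGauss_mul_pow (hk : 0 < k) (hz : 0 < z.re) (s : ℂ) (j : ℕ) :
    oddGauss k h z s * exp (-2 * Real.pi * s / (2 * z)) ^ j =
      oddConst k h z * centredGauss k ((2 * j + 1) / (6 * k)) z s := by
  have hz0 : z ≠ 0 := by rintro rfl; simp at hz
  have hk0 : (k : ℂ) ≠ 0 := by exact_mod_cast hk.ne'
  rw [oddGauss, centredGauss, mul_assoc, ← exp_nat_mul, ← exp_add]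
  congr 2
  push_cast
  field_simp
  ring

/-- The translation `s ↦ s + 1` multiplies the argument of the second rank function by `p₁^k`, so the
failure of antiperiodicity is the inhomogeneity of the functional equation iterated `k` times. -/
theorem oddJump_add_one (hk : 0 < k) (hodd : Odd k) (hh : h * h' ≡ -1 [ZMOD (k : ℤ)])
    (he : 2 ∣ h') (hz : 0 < z.re) (s : ℂ) (hs : (oddPair hk hodd hh he hz).Regular s) :
    oddJump k h h' z (s + 1) = (oddPair hk hodd hh he hz).main 0 (s + 1)
      + (oddPair hk hodd hh he hz).main 0 s := by
  have hz0 : z ≠ 0 := by rintro rfl; simp at hz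
  have hk0 : (k : ℂ) ≠ 0 := by exact_mod_cast hk.ne'
  set R := oddPair hk hodd hh he hz with hR
  have hreg := (R.regular_add_one.mpr hs).second
  have hp0 : sqrtNome k h' (1 / z) ≠ 0 := sqrtNome_ne_zero _ _ _
  have hY (s : ℂ) : R.Y s = -exp (-2 * Real.pi * s / (2 * z)) := by
    simp only [RankPair.Y, hR, oddPair]
    ring
  have hshift : R.Y (s + 1) * (sqrtNome k h' (1 / z))⁻¹ ^ k = R.Y s := by
    rw [hY, hY, ← zpow_natCast, inv_zpow', sqrtNome_zpow, neg_mul, ← exp_add]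
    obtain ⟨b, hb⟩ := he
    congr 1
    refine exp_eq_of_sub_eq (-b) ?_
    rw [hb]
    push_cast
    field_simp
    linear_combination -I_sq
  have hexp := rankFn_eq_sum_add hp0 (norm_sqrtNome_lt_one hk h' (re_one_div_pos hz))
    (R.Y_ne (s + 1)) hreg k
  rw [hshift] at hexp
  have hm (s : ℂ) : R.main 0 s = oddGauss k h z s * rankFn (sqrtNome k h' (1 / z)) (R.Y s) := by
    rw [RankPair.main, zero_div, add_zero]
    rfl
  -- the multiplier of the Gaussian cancels the last term of the iterated functional equation
  have hγ : oddGauss k h z (s + 1) * ((-1) ^ k * sqrtNome k h' (1 / z) ^ (-pent k)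
      * R.Y (s + 1) ^ (3 * k)) = -oddGauss k h z s := by
    obtain ⟨b, hb⟩ := he
    obtain ⟨c, hc⟩ := hodd
    have hcC : (k : ℂ) = 2 * c + 1 := by exact_mod_cast hc
    have e2 : (pent k : ℂ) = (3 * k ^ 2 + k) / 2 := by
      have : (2 * pent k : ℂ) = 3 * k ^ 2 + k := by exact_mod_cast two_mul_pent k
      linear_combination this / 2
    have hodd' : Odd k := ⟨c, hc⟩
    rw [hY, neg_pow (exp _), hodd'.neg_one_pow, pow_mul (-1 : ℂ), show (-1 : ℂ) ^ 3 = -1 by norm_num,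
      hodd'.neg_one_pow, sqrtNome_zpow, ← exp_nat_mul, oddGauss, oddGauss]
    have : exp (3 * Real.pi * I * (s + 1) + 3 * Real.pi * k * (s + 1) ^ 2 / (2 * z)
        - Real.pi * (s + 1) / (2 * z)) * (exp (Real.pi * I / k * (h' + I * (1 / z)) *
        ((-pent k : ℤ) : ℂ)) * exp (((3 * k : ℕ) : ℂ) * (-2 * Real.pi * (s + 1) / (2 * z)))) =
        -exp (3 * Real.pi * I * s + 3 * Real.pi * k * s ^ 2 / (2 * z)
        - Real.pi * s / (2 * z)) := by
      rw [← neg_one_mul (exp _), ← exp_pi_mul_I, ← exp_add, ← exp_add, ← exp_add]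
      refine exp_eq_of_sub_eq (1 - b * (3 * c + 2)) ?_
      push_cast
      rw [e2, hb]
      push_cast
      field_simp
      linear_combination (-6 * I * z * b) * hcC - (3 * k + 1) * I_sq
    linear_combination oddConst k h z * this
  rw [hm, hm, hexp, mul_add, ← mul_assoc (oddGauss k h z (s + 1)) (_ * _), hγ, neg_mul,
    add_assoc, neg_add_cancel, add_zero, oddJump, Finset.mul_sum, Finset.mul_sum]
  refine Finset.sum_congr rfl fun i _ => ?_
  have g1 := oddGauss_mul_pow (h := h) hk hz (s + 1) (3 * i)
  have g2 := oddGauss_mul_pow (h := h) hk hz (s + 1) (3 * i + 2)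
  have s1 : ((2 * ((3 * i : ℕ) : ℝ) + 1) / (6 * k)) = (6 * i + 1) / (6 * k) := by
    push_cast; ring
  have s2 : ((2 * ((3 * i + 2 : ℕ) : ℝ) + 1) / (6 * k)) = (6 * i + 5) / (6 * k) := by
    push_cast; ring
  rw [s1] at g1
  rw [s2] at g2
  rw [hY, neg_pow, neg_pow (exp _) (3 * i + 2)]
  have e1 : (-1 : ℂ) ^ i * (-1) ^ (3 * i) = 1 := by
    rw [← pow_add, show i + 3 * i = 2 * (2 * i) by ring, pow_mul]; simp
  have e2 : (-1 : ℂ) ^ i * (-1) ^ (3 * i + 2) = 1 := by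
    rw [← pow_add, show i + (3 * i + 2) = 2 * (2 * i + 1) by ring, pow_mul]; simp
  linear_combination (-sqrtNome k h' (1 / z) ^ (-pent i)) * g1
    + sqrtNome k h' (1 / z) ^ (-pent (-(i + 1))) * g2
    + (-oddGauss k h z (s + 1) * sqrtNome k h' (1 / z) ^ (-pent i) *
    exp (-2 * Real.pi * (s + 1) / (2 * z)) ^ (3 * i)) * e1 + (oddGauss k h z (s + 1) *
    sqrtNome k h' (1 / z) ^ (-pent (-(i + 1))) *
    exp (-2 * Real.pi * (s + 1) / (2 * z)) ^ (3 * i + 2)) * e2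

/-- The terms of the sum of Mordell integrals. -/
noncomputable def oddTerm (k : ℕ) (h' : ℤ) (z w : ℂ) (s ν : ℤ) : ℂ :=
  s * exp (Real.pi * I / (2 * k) * (h' * (-3 * (ν : ℂ) ^ 2 + ν) - s * (6 * ν) + s))
    * IoW k ν s z w

/-- The summands depend only on `ν` modulo `k`, which permits shifts and reflections of the index. -/
theorem oddTerm_add (hk : 0 < k) (hodd : Odd k) (he : 2 ∣ h') {s : ℤ} (hs : s = 1 ∨ s = -1)
    (ν : ℤ) : oddTerm k h' z w s (ν + k) = oddTerm k h' z w s ν := by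
  have hk0 : (k : ℂ) ≠ 0 := by exact_mod_cast hk.ne'
  have h1 : IoW k (ν + k) s z w = -IoW k ν s z w := by
    rw [IoW, IoW, ← integral_neg]
    congr 1
    ext x
    rw [IoWIntegrand, IoWIntegrand, Ho, Ho, ← mul_neg, ← div_neg, ← mul_neg]
    congr 3
    push_cast
    rcases hs with rfl | rfl
    · rw [← sinh_sub_pi_mul_I]
      congr 1
      push_cast
      field_simp
      ring
    · rw [← sinh_add_pi_mul_I]
      congr 1
      push_cast
      field_simp
      ring
  rw [oddTerm, oddTerm, h1, mul_neg, ← neg_mul, ← mul_neg, ← neg_one_mul (exp _), ← exp_pi_mul_I,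
    ← exp_add]
  congr 2
  obtain ⟨b, hb⟩ := he
  obtain ⟨c, hc⟩ := hodd
  have hcC : (k : ℂ) = 2 * c + 1 := by exact_mod_cast hc
  rcases hs with rfl | rfl
  · refine exp_eq_of_sub_eq (b * (-3 * ν - 3 * c - 1) - 1) ?_
    rw [hb]
    push_cast
    field_simp
    linear_combination (-6 * k * b : ℂ) * hcC
  · refine exp_eq_of_sub_eq (b * (-3 * ν - 3 * c - 1) + 2) ?_
    rw [hb]
    push_cast
    field_simp
    linear_combination (-6 * k * b : ℂ) * hcC

/-- A Gaussian of the jump, integrated along the line through its centre `σ`, is a summand of the sum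
of Mordell integrals. -/
theorem centre_term (hk : 0 < k) (hz : 0 < z.re) {s : ℤ} (hs : s = 1 ∨ s = -1) (μ : ℤ) {σ : ℝ}
    (hσ : σ = -s * (μ - 1 / 6) / k) :
    s * sqrtNome k h' (1 / z) ^ (-pent (-μ)) *
      (exp (-(3 * Real.pi * k * σ ^ 2 / (2 * z)) + 3 * Real.pi * I * σ) * mordell k σ z w) =
    exp (-(Real.pi / (24 * k * z))) * oddTerm k h' z w s μ := by
  have hz0 : z ≠ 0 := by rintro rfl; simp at hz
  have hk0 : (k : ℂ) ≠ 0 := by exact_mod_cast hk.ne'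
  have h1 : IoW k μ s z w = mordell k σ z w := by
    rw [IoW, IoWIntegrand_eq, mordell, hσ]
  have e2 : (pent (-μ) : ℂ) = (3 * μ ^ 2 - μ) / 2 := by
    have : (2 * pent (-μ) : ℂ) = 3 * (-μ) ^ 2 + -μ := by exact_mod_cast two_mul_pent (-μ)
    linear_combination this / 2
  have hs2 : (s : ℂ) ^ 2 = 1 := by rcases hs with rfl | rfl <;> simp
  have hexp : sqrtNome k h' (1 / z) ^ (-pent (-μ)) *
      exp (-(3 * Real.pi * k * σ ^ 2 / (2 * z)) + 3 * Real.pi * I * σ) =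
      exp (-(Real.pi / (24 * k * z))) *
      exp (Real.pi * I / (2 * k) * (h' * (-3 * (μ : ℂ) ^ 2 + μ) - s * (6 * μ) + s)) := by
    rw [sqrtNome_zpow, ← exp_add, ← exp_add]
    congr 1
    push_cast
    rw [e2, hσ]
    push_cast
    field_simp
    linear_combination (864 * μ - 2592 * μ ^ 2 - 72 : ℂ) * hs2
      + (864 * μ - 2592 * μ ^ 2 : ℂ) * I_sq
  rw [oddTerm, h1]
  linear_combination s * mordell k σ z w * hexp

/-- A real number `a` with `|a| < 1/(6k)` differs from `±(ν - 1/6)/k` by a non-integer, so the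
line of integration avoids the poles of the integrand. -/
theorem mordell_line_avoids {a : ℝ} (hk : 0 < k) (ha : |a| < 1 / (6 * (k : ℝ))) {s : ℤ}
    (hs : s = 1 ∨ s = -1) (ν n : ℤ) : (-s * (ν - 1 / 6) / k : ℝ) - a ≠ n := by
  intro hn
  have hkr : (0 : ℝ) < k := by exact_mod_cast hk
  have h1 : (k : ℝ) * a = -s * (ν - 1 / 6) - k * n := by
    rw [← hn]; field_simp; ring
  have h2 : |(k : ℝ) * a| < 1 / 6 := by
    rw [abs_mul, abs_of_pos hkr]
    calc (k : ℝ) * |a| < k * (1 / (6 * k)) := by gcongr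
      _ = 1 / 6 := by field_simp
  rw [h1, abs_lt] at h2
  obtain ⟨h3, h4⟩ := h2
  rcases hs with rfl | rfl
  · have h5 : ((-ν - k * n : ℤ) : ℝ) < 0 := by push_cast at h4 ⊢; linarith
    have h6 : (-1 : ℝ) < ((-ν - k * n : ℤ) : ℝ) := by push_cast at h3 ⊢; linarith
    have h5' : (-ν - k * n : ℤ) < 0 := by exact_mod_cast h5
    have h6' : (-1 : ℤ) < -ν - k * n := by exact_mod_cast h6
    omega
  · have h5 : ((ν - k * n : ℤ) : ℝ) < 1 := by push_cast at h4 ⊢; linarith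
    have h6 : (0 : ℝ) < ((ν - k * n : ℤ) : ℝ) := by push_cast at h3 ⊢; linarith
    have h5' : (ν - k * n : ℤ) < 1 := by exact_mod_cast h5
    have h6' : (0 : ℤ) < ν - k * n := by exact_mod_cast h6
    omega

theorem integrable_IoWIntegrand (hk : 0 < k) (hz : 0 < z.re)
    (hw : |obliqueRe z w| < 1 / (6 * (k : ℝ))) (ν : ℤ) {s : ℤ} (hs : s = 1 ∨ s = -1) :
    Integrable (IoWIntegrand k ν s z w) := by
  rw [IoWIntegrand_eq]
  exact integrable_mordellIntegrand hk hz (mordell_line_avoids hk hw hs ν)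

/-- The integral of the jump, as a sum of Mordell integrals. -/
theorem integral_oddJump (hk : 0 < k) (hodd : Odd k) (he : 2 ∣ h') (hz : 0 < z.re)
    (hw : |obliqueRe z w| < 1 / (6 * (k : ℝ))) {a : ℝ} (ha1 : obliqueRe z w < a)
    (ha2 : a < obliqueRe z w + 1) :
    ∫ t : ℝ, oddJump k h h' z (obliqueLine z a t) *
        (sin (Real.pi * (obliqueLine z a t - w)))⁻¹ =
      oddConst k h z * (2 * I / k) * exp (-(Real.pi / (24 * k * z))) *
        ∑ ν ∈ Finset.range k, (oddTerm k h' z w 1 ν + oddTerm k h' z w (-1) ν) := by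
  have hkr : (0 : ℝ) < k := by exact_mod_cast hk
  have hwl := (abs_lt.mp hw).1
  have hwr := (abs_lt.mp hw).2
  have hint (σ : ℝ) : Integrable fun t : ℝ => centredGauss k σ z (obliqueLine z a t) *
      (sin (Real.pi * (obliqueLine z a t - w)))⁻¹ := by
    refine integrable_mul_inv_sin hz (differentiable_centredGauss k σ z).continuous
      (boundedOnStrips_centredGauss hk hz σ) fun n hn => ?_
    have h1 : (0 : ℤ) < n := by exact_mod_cast (by linarith : (0 : ℝ) < n)
    have h2 : n < 1 := by exact_mod_cast (by linarith : (n : ℝ) < 1)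
    omega
  have hsub (c₁ c₂ : ℂ) (σ₁ σ₂ : ℝ) : Integrable fun t : ℝ =>
      c₁ * (centredGauss k σ₁ z (obliqueLine z a t) *
        (sin (Real.pi * (obliqueLine z a t - w)))⁻¹) -
      c₂ * (centredGauss k σ₂ z (obliqueLine z a t) *
        (sin (Real.pi * (obliqueLine z a t - w)))⁻¹) :=
    ((hint σ₁).const_mul c₁).sub ((hint σ₂).const_mul c₂)
  have hsplit (t : ℝ) : oddJump k h h' z (obliqueLine z a t) *
      (sin (Real.pi * (obliqueLine z a t - w)))⁻¹ = oddConst k h z * ∑ ν ∈ Finset.range k,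
      (sqrtNome k h' (1 / z) ^ (-pent ν) *
        (centredGauss k ((6 * ν + 1) / (6 * k)) z (obliqueLine z a t) *
          (sin (Real.pi * (obliqueLine z a t - w)))⁻¹) -
      sqrtNome k h' (1 / z) ^ (-pent (-(ν + 1))) *
        (centredGauss k ((6 * ν + 5) / (6 * k)) z (obliqueLine z a t) *
          (sin (Real.pi * (obliqueLine z a t - w)))⁻¹)) := by
    rw [oddJump, mul_assoc, Finset.sum_mul]
    congr 1
    refine Finset.sum_congr rfl fun i _ => ?_
    ring
  simp only [hsplit]
  rw [integral_const_mul, integral_finsetSum _ fun i _ => hsub _ _ _ _, mul_assoc, mul_assoc]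
  congr 1
  have hper := fun (s : ℤ) (hs : s = 1 ∨ s = -1) => oddTerm_add (z := z) (w := w) hk hodd he hs
  rw [Finset.sum_add_distrib, ← sum_range_neg_of_periodic (hper 1 (Or.inl rfl)),
    ← sum_range_add_one_of_periodic (hper (-1) (Or.inr rfl)), ← Finset.sum_add_distrib,
    Finset.mul_sum, Finset.mul_sum]
  refine Finset.sum_congr rfl fun i hi => ?_
  have hi' : (i : ℝ) + 1 ≤ k := by exact_mod_cast Finset.mem_range.mp hi
  have hi0 : (0 : ℝ) ≤ i := Nat.cast_nonneg i
  have e1 : 1 / (6 * (k : ℝ)) ≤ (6 * i + 1) / (6 * k) := by gcongr; linarith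
  have e2 : (6 * i + 1) / (6 * k) ≤ (6 * i + 5) / (6 * k : ℝ) := by gcongr; norm_num
  have e3 : (6 * i + 5) / (6 * k : ℝ) ≤ 1 - 1 / (6 * k) := by
    rw [le_sub_iff_add_le, ← add_div, div_le_one (by positivity)]; linarith
  rw [integral_sub ((hint _).const_mul _) ((hint _).const_mul _), integral_const_mul,
    integral_const_mul, integral_centredGauss hk hz ha1 ha2 (by linarith) (by linarith),
    integral_centredGauss hk hz ha1 ha2 (by linarith) (by linarith)]
  have t1 := centre_term (h' := h') (w := w) hk hz (Or.inl rfl : (1 : ℤ) = 1 ∨ _) (-i)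
    (σ := (6 * i + 1) / (6 * k)) (by push_cast; field_simp; ring)
  have t2 := centre_term (h' := h') (w := w) hk hz (Or.inr rfl : (-1 : ℤ) = 1 ∨ _) (i + 1)
    (σ := (6 * i + 5) / (6 * k)) (by push_cast; field_simp; ring)
  rw [neg_neg] at t1
  push_cast at t1 t2
  push_cast
  linear_combination 2 * I / k * t1 + 2 * I / k * t2

/-- The transformation law for odd denominators. -/
theorem calRo_transform_odd (hk : 0 < k) (hodd : Odd k) (hh : h * h' ≡ -1 [ZMOD (k : ℤ)])
    (he : 2 ∣ h') (hz : 0 < z.re) (hw : |obliqueRe z w| < 1 / (6 * (k : ℝ)))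
    (hreg : ∀ n : ℤ, exp (2 * Real.pi * I * w) * nome k h z ^ (2 * n + 1) ≠ 1) :
    exp (Real.pi * I * w) * calRo (nome k h z) w =
      oddGauss k h z w * hoW (sqrtNome k h' (1 / z)) (I * w / z)
      - z / 2 * (oddConst k h z * (2 * I / k) * exp (-(Real.pi / (24 * k * z))) *
        ∑ ν ∈ Finset.range k, (oddTerm k h' z w 1 ν + oddTerm k h' z w (-1) ν)) := by
  have hq0 := nome_ne_zero k h z
  set R := oddPair hk hodd hh he hz with hR
  have hreg' : R.Regular w := by
    intro n
    have := hreg n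
    rw [zpow_add_one₀ hq0, zpow_mul] at this
    simp only [RankPair.y, hR, oddPair]
    rw [← zpow_natCast]
    convert this using 1
    push_cast
    ring
  have hZ : R.Z = 2 * z := rfl
  have hgc : Continuous fun s => oddJump k h h' z (s + 1) := by
    unfold oddJump
    have := fun σ => (differentiable_centredGauss k σ z).continuous
    fun_prop
  have hmain := R.eq_main_add_integral 0 hgc (oddJump_add_one hk hodd hh he hz) hreg'
    (a := obliqueRe z w - 1 / 2) (by rw [hZ, obliqueRe_two_mul]; linarith)
    (by rw [hZ, obliqueRe_two_mul]; linarith)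
  have e1 : rankFn R.p (R.y w) = calRo (nome k h z) w := by
    rw [calRo_eq_rankFn _ _ hq0, mul_comm (exp _)]
    rfl
  have e2 : R.main 0 w = oddGauss k h z w * hoW (sqrtNome k h' (1 / z)) (I * w / z) := by
    rw [RankPair.main, zero_div, add_zero, hoW_eq_rankFn]
    have : R.Y w = -exp (Real.pi * I * (I * w / z)) := by
      simp only [RankPair.Y, hR, oddPair]
      rw [neg_one_mul]
      congr 2
      have hz0 : z ≠ 0 := by rintro rfl; simp at hz
      field_simp
      linear_combination -w * I_sq
    rw [this]
    rfl
  have e3 : ∫ t : ℝ, oddJump k h h' z (obliqueLine R.Z (obliqueRe z w - 1 / 2) t + 1) *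
      (sin (Real.pi * (obliqueLine R.Z (obliqueRe z w - 1 / 2) t - w)))⁻¹ =
      -(1 / 2) * ∫ t : ℝ, oddJump k h h' z (obliqueLine z (obliqueRe z w + 1 / 2) t) *
      (sin (Real.pi * (obliqueLine z (obliqueRe z w + 1 / 2) t - w)))⁻¹ := by
    set F : ℝ → ℂ := fun t => -(oddJump k h h' z (obliqueLine z (obliqueRe z w + 1 / 2) t) *
        (sin (Real.pi * (obliqueLine z (obliqueRe z w + 1 / 2) t - w)))⁻¹) with hF
    have hpt (t : ℝ) : oddJump k h h' z (obliqueLine R.Z (obliqueRe z w - 1 / 2) t + 1) *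
        (sin (Real.pi * (obliqueLine R.Z (obliqueRe z w - 1 / 2) t - w)))⁻¹ = F (2 * t) := by
      have e : obliqueLine z (obliqueRe z w + 1 / 2) (2 * t)
          = obliqueLine R.Z (obliqueRe z w - 1 / 2) t + 1 := by
        rw [hZ, obliqueLine_two_mul, obliqueLine, obliqueLine]
        push_cast
        ring
      simp only [hF, e]
      rw [show Real.pi * (obliqueLine R.Z (obliqueRe z w - 1 / 2) t + 1 - w)
        = Real.pi * (obliqueLine R.Z (obliqueRe z w - 1 / 2) t - w) + Real.pi by ring,
        sin_add_pi, inv_neg]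
      ring
    rw [integral_congr_ae (ae_of_all _ hpt), Measure.integral_comp_mul_left F 2, hF, integral_neg,
      abs_of_pos (by norm_num), real_smul]
    push_cast
    ring
  rw [e1, e2, e3, integral_oddJump hk hodd he hz hw (by linarith) (by linarith), hZ] at hmain
  rw [hmain]
  ring

end Odd

/-! ### The two rank functions for even denominators -/

/-- The constant in front of the second rank function, for the even denominator `2K`. -/
noncomputable def evenConst (K : ℕ) (h h' : ℤ) (z : ℂ) : ℂ :=
  -(I ^ (-h') * z ^ (-1 / 2 : ℂ)
    * exp (-(2 * Real.pi * z / (3 * (2 * K : ℕ))) + 8 * Real.pi / (3 * (2 * K : ℕ) * z)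
        + Real.pi * I / (2 * (2 * K : ℕ)) * (h - 5 * h'))
    * omega h K)

/-- The Gaussian factor of the second rank function, for the even denominator `2K`. -/
noncomputable def evenGauss (K : ℕ) (h h' : ℤ) (z w : ℂ) : ℂ :=
  evenConst K h h' z *
    exp (3 * Real.pi * I * w + 3 * Real.pi * (2 * K : ℕ) * w ^ 2 / (2 * z) - 4 * Real.pi * w / z)

/-- The congruence between the exponents of `i` in the two residues at a pole, for even denominators. -/
theorem even_residue_mod_four : ∀ n K a l : ZMod 4,
    3 * (2 * n + 1) * l - 3 * (-(-(2 * a + 1)) * l) * ((2 * n + 1) * (2 * a + 1) - 2 * K * l)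
      + 2 * n - 1 + -(2 * a + 1) - ((2 * n + 1) * (2 * a + 1) - 2 * K * l + 1) = 0 := by
  decide

theorem eq_neg_of_mul_eq_neg_one : ∀ h h' : ZMod 4, h * h' = -1 → h' = -h := by
  decide

section Even

variable {K : ℕ} {h h' : ℤ} {z : ℂ}

theorem nome_two_mul_sq (hK : 0 < K) (h : ℤ) (z : ℂ) : nome (2 * K) h z ^ 2 = nome K h z := by
  have hK0 : (K : ℂ) ≠ 0 := by exact_mod_cast hK.ne'
  rw [nome, nome, ← exp_nat_mul]
  congr 1
  push_cast
  field_simp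

theorem odd_of_modEq (hh : h * h' ≡ -1 [ZMOD (4 * (2 * K : ℕ) : ℤ)]) : Odd h ∧ Odd h' := by
  obtain ⟨c, hc⟩ := hh.symm.dvd
  have : Odd (h * h') := ⟨4 * K * c - 1, by push_cast at hc; linarith⟩
  exact Int.odd_mul.mp this

/-- The poles of the first function are poles of the second one, with the same residue. -/
theorem even_pole (hK : 0 < K) (hh : h * h' ≡ -1 [ZMOD (4 * (2 * K : ℕ) : ℤ)])
    (hz : 0 < z.re) (w : ℂ) (n : ℤ)
    (hp : nome (2 * K) h z * exp (2 * Real.pi * I * w) * (nome (2 * K) h z ^ 2) ^ n = 1) :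
    ∃ m : ℤ, (nome (2 * K) h' (1 / z))⁻¹ * exp (-2 * Real.pi * w / z) *
        (nome (2 * K) h' (1 / z) ^ 2) ^ m = 1 ∧
      exp (Real.pi * I * w) *
        (1 / qPoch (nome (2 * K) h z ^ 2) * ((-1) ^ n * (nome (2 * K) h z ^ 2) ^ pent n)) * I =
      z * (evenGauss K h h' z w * (1 / qPoch (nome (2 * K) h' (1 / z) ^ 2) *
        ((-1) ^ m * (nome (2 * K) h' (1 / z) ^ 2) ^ pent m))) := by
  have hz0 : z ≠ 0 := by rintro rfl; simp at hz
  have hK0 : (K : ℂ) ≠ 0 := by exact_mod_cast hK.ne'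
  have h2piI := Complex.two_pi_I_ne_zero
  obtain ⟨⟨a, ha⟩, -⟩ := odd_of_modEq hh
  obtain ⟨kp, hkp⟩ := hh.symm.dvd
  have hkpC : (h : ℂ) * h' = 2 * K * (4 * kp) - 1 := by
    have : h * h' = 2 * K * (4 * kp) - 1 := by push_cast at hkp; linarith
    exact_mod_cast this
  -- the position of the pole
  have hp' := hp
  rw [← zpow_natCast (nome (2 * K) h z), ← zpow_mul, nome_zpow, nome, ← exp_add, ← exp_add] at hp'
  obtain ⟨l, hl⟩ := exp_eq_one_iff.mp hp'
  set m : ℤ := n * h + a + 1 - K * l with hm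
  have hM : 2 * m - 1 = (2 * n + 1) * h - 2 * K * l := by rw [hm, ha]; ring
  have hMC : (2 * m - 1 : ℂ) = (2 * n + 1) * h - 2 * K * l := by exact_mod_cast hM
  have hw : w = -((2 * m - 1) + I * (2 * n + 1) * z) / (2 * K) := by
    refine mul_left_cancel₀ h2piI ?_
    rw [hMC]
    push_cast at hl
    field_simp at hl ⊢
    linear_combination hl
  have hmh : (2 * n + 1 : ℂ) + (2 * m - 1) * h' = 2 * K * ((2 * n + 1) * (4 * kp) - l * h') := by
    rw [hMC]; linear_combination (2 * n + 1) * hkpC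
  refine ⟨m, ?_, ?_⟩
  · rw [← zpow_neg_one, ← zpow_natCast (nome (2 * K) h' (1 / z)), ← zpow_mul, nome_zpow,
      nome_zpow, ← exp_add, ← exp_add, exp_eq_one_iff]
    refine ⟨(2 * n + 1) * (4 * kp) - l * h', ?_⟩
    rw [hw]
    push_cast
    field_simp
    linear_combination I * z * hmh + (2 * m - 1 : ℂ) * I_sq
  -- the phases of the two residues, as exponents of `i`
  · have hres : ∃ j : ℤ, 3 * (2 * n + 1) * l - 3 * ((2 * n + 1) * (4 * kp) - l * h') * (2 * m - 1)
        + 2 * n - 1 + h' - (2 * m - 1 + 1) = 4 * j := by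
      refine (ZMod.intCast_zmod_eq_zero_iff_dvd _ 4).mp ?_
      have h4 : (4 : ZMod 4) = 0 := by decide
      have hh4 : (h' : ZMod 4) = -(2 * a + 1) := by
        have h1 : ((h * h' : ℤ) : ZMod 4) = -1 := by
          rw [show h * h' = 4 * (2 * K * kp) - 1 by push_cast at hkp; linarith]
          push_cast
          rw [h4]; ring
        rw [ha] at h1
        push_cast at h1
        exact eq_neg_of_mul_eq_neg_one _ _ h1
      rw [hM, ha]
      push_cast
      rw [hh4]
      linear_combination even_residue_mod_four n K a l
        - 3 * (2 * n + 1) * kp * ((2 * n + 1) * (2 * a + 1) - 2 * K * l) * h4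
    obtain ⟨j, hj⟩ := hres
    have hjC : (3 * (2 * n + 1) * l - 3 * ((2 * n + 1) * (4 * kp) - l * h') * (2 * m - 1)
        + 2 * n - 1 + h' - (2 * m - 1 + 1) : ℂ) = 4 * j := by exact_mod_cast hj
    have htr := qPoch_transform hK (h := h) (h' := h') (z := z)
      (Int.ModEq.of_dvd ⟨8, by push_cast; ring⟩ hh) hz
    rw [← nome_two_mul_sq hK, ← nome_two_mul_sq hK] at htr
    have hP := qPoch_ne_zero (norm_nome_sq_lt_one (h := h) (k := 2 * K) (by omega) hz)
    have hom : omega h K ≠ 0 := exp_ne_zero _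
    have hzz := cpow_neg_half_mul hz0
    have hz2 : z ^ (1 / 2 : ℂ) ≠ 0 := by simp [cpow_eq_zero_iff, hz0]
    have hexp : exp (Real.pi * I * w) * (-1) ^ n * (nome (2 * K) h z ^ 2) ^ pent n *
        exp (Real.pi / 2 * I) * exp (Real.pi / (12 * K) * (1 / z - z)) =
        -(exp (Real.pi / 2 * I) ^ (-h') * exp (-(2 * Real.pi * z / (3 * (2 * K : ℕ)))
          + 8 * Real.pi / (3 * (2 * K : ℕ) * z)
          + Real.pi * I / (2 * (2 * K : ℕ)) * (h - 5 * h')) *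
        exp (3 * Real.pi * I * w + 3 * Real.pi * (2 * K : ℕ) * w ^ 2 / (2 * z)
          - 4 * Real.pi * w / z) *
        (-1) ^ m * (nome (2 * K) h' (1 / z) ^ 2) ^ pent m) := by
      rw [← zpow_natCast (nome (2 * K) h z), ← zpow_mul, nome_zpow,
        ← zpow_natCast (nome (2 * K) h' (1 / z)), ← zpow_mul, nome_zpow, neg_one_zpow_eq_exp,
        neg_one_zpow_eq_exp, ← neg_one_mul, ← exp_pi_mul_I, ← exp_int_mul]
      simp only [← exp_add]
      refine exp_eq_of_sub_eq (j - l - 2 * ((2 * n + 1) * (4 * kp) - l * h')) ?_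
      have e1 : (2 * pent n : ℂ) = 3 * n ^ 2 + n := by exact_mod_cast two_mul_pent n
      have e2 : (2 * pent m : ℂ) = 3 * m ^ 2 + m := by exact_mod_cast two_mul_pent m
      have hR : -2 * (2 * m - 1) + 4 * K * n + 2 * K + h * (3 * (2 * n + 1) ^ 2 - 4 * (2 * n + 1) + 1)
          - 4 * K + 2 * K * h' - h + 5 * h' + 6 * (2 * m - 1) - 6 * (2 * m - 1) * (2 * n + 1)
          - 8 * (2 * n + 1) - 4 * K * m - 4 * h' * (3 * m ^ 2 + m)
          = (8 * K * (j - l - 2 * ((2 * n + 1) * (4 * kp) - l * h')) : ℂ) := by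
        linear_combination -(3 * (2 * m - 1) + 8) * hmh + (4 - 3 * (2 * n + 1)) * hMC
          + 2 * K * hjC
      push_cast
      rw [e1, e2, hw]
      field_simp
      linear_combination 36 * I * z * hR + (36 * z ^ 2 - 144 * m - 432 * m ^ 2) * I_sq
    rw [exp_pi_div_two_mul_I] at hexp
    rw [htr]
    have : evenGauss K h h' z w = -(z ^ (-1 / 2 : ℂ) * omega h K * (I ^ (-h') *
        exp (-(2 * Real.pi * z / (3 * (2 * K : ℕ)))
          + 8 * Real.pi / (3 * (2 * K : ℕ) * z)
          + Real.pi * I / (2 * (2 * K : ℕ)) * (h - 5 * h')) *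
        exp (3 * Real.pi * I * w + 3 * Real.pi * (2 * K : ℕ) * w ^ 2 / (2 * z)
          - 4 * Real.pi * w / z))) := by
      rw [evenGauss, evenConst]; ring
    rw [this]
    generalize exp (-(2 * Real.pi * z / (3 * (2 * K : ℕ)))
          + 8 * Real.pi / (3 * (2 * K : ℕ) * z)
          + Real.pi * I / (2 * (2 * K : ℕ)) * (h - 5 * h')) = B₁ at hexp ⊢
    generalize exp (3 * Real.pi * I * w + 3 * Real.pi * (2 * K : ℕ) * w ^ 2 / (2 * z)
          - 4 * Real.pi * w / z) = B₂ at hexp ⊢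
    have hE : exp (Real.pi / (12 * K) * (1 / z - z)) ≠ 0 := exp_ne_zero _
    generalize exp (Real.pi / (12 * K) * (1 / z - z)) = E at hE hexp ⊢
    rw [← hzz] at hz2 ⊢
    have hzm := left_ne_zero_of_mul hz2
    generalize z ^ (-1 / 2 : ℂ) = zm at hzm ⊢
    generalize qPoch (nome (2 * K) h z ^ 2) = P at hP ⊢
    generalize omega h K = o at hom ⊢
    generalize (nome (2 * K) h' (1 / z) ^ 2) ^ pent m = p1 at hexp ⊢
    generalize (nome (2 * K) h z ^ 2) ^ pent n = p at hexp ⊢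
    generalize I ^ (-h') = ih at hexp ⊢
    field_simp
    linear_combination hexp

/-- Conversely the poles of the second function are poles of the first one. -/
theorem even_pole' (hK : 0 < K) (hh : h * h' ≡ -1 [ZMOD (4 * (2 * K : ℕ) : ℤ)])
    (hz : 0 < z.re) (w : ℂ) (m : ℤ)
    (hp : (nome (2 * K) h' (1 / z))⁻¹ * exp (-2 * Real.pi * w / z) *
        (nome (2 * K) h' (1 / z) ^ 2) ^ m = 1) :
    ∃ n : ℤ, nome (2 * K) h z * exp (2 * Real.pi * I * w) * (nome (2 * K) h z ^ 2) ^ n = 1 := by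
  have hz0 : z ≠ 0 := by rintro rfl; simp at hz
  have hK0 : (K : ℂ) ≠ 0 := by exact_mod_cast hK.ne'
  have hpi : (Real.pi : ℂ) ≠ 0 := ofReal_ne_zero.mpr Real.pi_ne_zero
  obtain ⟨-, b, hb⟩ := odd_of_modEq hh
  obtain ⟨kp, hkp⟩ := hh.symm.dvd
  have hkpC : (h : ℂ) * h' = 2 * K * (4 * kp) - 1 := by
    have : h * h' = 2 * K * (4 * kp) - 1 := by push_cast at hkp; linarith
    exact_mod_cast this
  have hbC : (h' : ℂ) = 2 * b + 1 := by exact_mod_cast hb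
  rw [← zpow_neg_one, ← zpow_natCast (nome (2 * K) h' (1 / z)), ← zpow_mul, nome_zpow,
      nome_zpow, ← exp_add, ← exp_add] at hp
  obtain ⟨j, hj⟩ := exp_eq_one_iff.mp hp
  have hw : w = (I * z * ((2 * m - 1) * h' - 2 * K * j) - (2 * m - 1)) / (2 * K) := by
    refine mul_left_cancel₀ hpi ?_
    push_cast at hj
    field_simp at hj ⊢
    linear_combination -hj + (2 * m - 1) * I_sq
  -- `2n + 1 = 2Kj - h'(2m - 1)`
  refine ⟨K * j - h' * m + b, ?_⟩
  rw [← zpow_natCast (nome (2 * K) h z), ← zpow_mul, nome_zpow, nome, ← exp_add, ← exp_add,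
    exp_eq_one_iff]
  refine ⟨h * j - 4 * kp * (2 * m - 1), ?_⟩
  rw [hw]
  push_cast
  field_simp
  linear_combination (-(2 * m - 1)) * hkpC - (h + I * z) * hbC

theorem evenGauss_add_period (hK : 0 < K) (hodd : Odd h) (hz : 0 < z.re) (w : ℂ) :
    evenGauss K h h' z (w + I * z) = exp (-Real.pi * z) *
      ((-1) ^ K * (nome (2 * K) h z ^ 2) ^ pent (-K) *
        (nome (2 * K) h z * exp (2 * Real.pi * I * w)) ^ (3 * K)) * evenGauss K h h' z w := by
  have hz0 : z ≠ 0 := by rintro rfl; simp at hz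
  have hK0 : (K : ℂ) ≠ 0 := by exact_mod_cast hK.ne'
  have e2 : (2 * pent (-K) : ℂ) = 3 * (-K) ^ 2 + -K := by exact_mod_cast two_mul_pent (-K)
  obtain ⟨a, ha⟩ := hodd
  have haC : (h : ℂ) = 2 * a + 1 := by exact_mod_cast ha
  rw [evenGauss, evenGauss, mul_left_comm _ (evenConst K h h' z)]
  refine congrArg (evenConst K h h' z * ·) ?_
  rw [← zpow_natCast (nome (2 * K) h z), ← zpow_mul, nome_zpow, nome, ← exp_add, ← exp_nat_mul,
    neg_one_pow_eq_exp]
  simp only [← exp_add]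
  refine exp_eq_of_sub_eq (-(a * (3 * K + 2) + 2 * K + 3)) ?_
  push_cast
  rw [e2]
  field_simp
  linear_combination (-(3 * K + 2) * I * z) * haC + z ^ 2 * I_sq

theorem differentiable_evenGauss (K : ℕ) (h h' : ℤ) (z : ℂ) :
    Differentiable ℂ (evenGauss K h h' z) := by
  unfold evenGauss
  fun_prop

theorem nome_two_mul_sq_pow (hK : 0 < K) : (nome (2 * K) h z ^ 2) ^ K = exp (-2 * Real.pi * z) := by
  have hK0 : (K : ℂ) ≠ 0 := by exact_mod_cast hK.ne'
  rw [nome_two_mul_sq hK, ← zpow_natCast, nome_zpow]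
  refine exp_eq_of_sub_eq h ?_
  push_cast
  field_simp
  linear_combination z * I_sq

/-- The pair of rank functions attached to a fraction with even denominator `2K`. -/
noncomputable def evenPair (hK : 0 < K) (hh : h * h' ≡ -1 [ZMOD (4 * (2 * K : ℕ) : ℤ)])
    (hz : 0 < z.re) : RankPair where
  K := K
  Z := z
  p := nome (2 * K) h z ^ 2
  p₁ := nome (2 * K) h' (1 / z) ^ 2
  y₀ := nome (2 * K) h z
  Y₀ := (nome (2 * K) h' (1 / z))⁻¹
  γ := evenGauss K h h' z
  K_pos := hK
  Z_re := hz
  p_ne := pow_ne_zero _ (nome_ne_zero _ _ _)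
  p_lt := norm_nome_sq_lt_one (by omega) hz
  p₁_ne := pow_ne_zero _ (nome_ne_zero _ _ _)
  p₁_lt := norm_nome_sq_lt_one (by omega) (re_one_div_pos hz)
  y₀_ne := nome_ne_zero _ _ _
  Y₀_ne := inv_ne_zero (nome_ne_zero _ _ _)
  γ_diff := differentiable_evenGauss K h h' z
  p_pow := nome_two_mul_sq_pow hK
  pole := even_pole hK hh hz
  pole' := even_pole' hK hh hz
  γ_period := evenGauss_add_period hK (odd_of_modEq hh).1 hz

end Even

/-! ### The transformation law for even denominators -/

/-- The constant `evenConst` after the Gaussian has been completed by `Y⁻¹`. -/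
noncomputable def evenJumpConst (K : ℕ) (h h' : ℤ) (z : ℂ) : ℂ :=
  evenConst K h h' z * nome (2 * K) h' (1 / z)

/-- The sum of Gaussians by which the second rank function fails to be antiperiodic, for even
denominators. -/
noncomputable def evenJump (K : ℕ) (h h' : ℤ) (z s : ℂ) : ℂ :=
  evenJumpConst K h h' z * ∑ i ∈ Finset.range K, (-1) ^ i *
    (nome (2 * K) h' (1 / z) ^ (-(3 * (i : ℤ) ^ 2 + 2 * i)) *
        centredGauss (2 * K) ((6 * i + 2) / (3 * (2 * K : ℕ))) z s
      + nome (2 * K) h' (1 / z) ^ (-(3 * (i : ℤ) ^ 2 + 4 * i + 1)) *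
        centredGauss (2 * K) ((6 * i + 4) / (3 * (2 * K : ℕ))) z s)

/-- The iterated functional equation for `1 + Y G(Y)`. -/
theorem one_add_mul_rankFn_eq_sum_add {p Y : ℂ} (hp0 : p ≠ 0) (hp : ‖p‖ < 1) (hY : Y ≠ 0)
    (h : ∀ m : ℤ, Y * p ^ m ≠ 1) (n : ℕ) :
    1 + Y * rankFn p Y = ∑ i ∈ Finset.range n, (-1) ^ i * (p ^ (-pent (-i)) * Y ^ (3 * i)
        + p ^ (-pent i) * Y ^ (3 * i + 1))
      + (-1) ^ n * p ^ (-pent (-n)) * Y ^ (3 * n)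
        * (1 + Y * p⁻¹ ^ n * rankFn p (Y * p⁻¹ ^ n)) := by
  have e : p ^ (-pent n) = p ^ (-pent (-n)) * p⁻¹ ^ n := by
    rw [← zpow_natCast, inv_zpow', ← zpow_add₀ hp0]
    congr 1
    have h1 := two_mul_pent n
    have h2 := two_mul_pent (-n)
    linarith [show 3 * (-(n : ℤ)) ^ 2 + -(n : ℤ) = 3 * (n : ℤ) ^ 2 + n - 2 * n by ring]
  have hsum : ∑ i ∈ Finset.range n, (-1) ^ i * (p ^ (-pent (-i)) * Y ^ (3 * i)
        + p ^ (-pent i) * Y ^ (3 * i + 1)) = 1 + Y * ∑ i ∈ Finset.range n, (-1) ^ i *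
        (p ^ (-pent i) * Y ^ (3 * i) - p ^ (-pent (-(i + 1))) * Y ^ (3 * i + 2))
        - (-1) ^ n * p ^ (-pent (-n)) * Y ^ (3 * n) := by
    clear e
    induction n with
    | zero => simp [pent]
    | succ n ih =>
      rw [Finset.sum_range_succ, Finset.sum_range_succ, ih]
      push_cast
      ring
  rw [hsum, rankFn_eq_sum_add hp0 hp hY h n, e]
  ring

section Even

variable {K : ℕ} {h h' : ℤ} {z w : ℂ}

theorem nome_eq_exp_mul (hK : 0 < K) (hz : 0 < z.re) :
    nome (2 * K) h' (1 / z) = exp (Real.pi * I / K * h' - Real.pi / (K * z)) := by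
  have hz0 : z ≠ 0 := by rintro rfl; simp at hz
  have hK0 : (K : ℂ) ≠ 0 := by exact_mod_cast hK.ne'
  rw [nome]
  congr 1
  push_cast
  field_simp
  linear_combination I_sq

/-- A power of the argument of the rank function moves the centre of the Gaussian. -/
theorem evenGauss_mul_pow (hK : 0 < K) (hz : 0 < z.re) (s : ℂ) (j : ℕ) :
    evenGauss K h h' z s * (exp (-2 * Real.pi * s / z))⁻¹ *
      exp (-2 * Real.pi * s / z) ^ j =
      evenConst K h h' z * centredGauss (2 * K) (2 * (j + 1) / (3 * (2 * K : ℕ))) z s := by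
  have hz0 : z ≠ 0 := by rintro rfl; simp at hz
  have hK0 : (K : ℂ) ≠ 0 := by exact_mod_cast hK.ne'
  rw [evenGauss, centredGauss, mul_assoc, mul_assoc, ← exp_nat_mul, ← exp_neg, ← exp_add, ← exp_add]
  congr 2
  push_cast
  field_simp
  ring

/-- As for odd denominators, with `G(Y) + 1/Y` in place of `G(Y)`: the correction lowers the powers of `Y`
in the inhomogeneity of the functional equation, and with them the centres of the Gaussians. -/
theorem evenJump_add_one (hK : 0 < K) (hh : h * h' ≡ -1 [ZMOD (4 * (2 * K : ℕ) : ℤ)])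
    (hz : 0 < z.re) (s : ℂ) (hs : (evenPair hK hh hz).Regular s) :
    evenJump K h h' z (s + 1) = (evenPair hK hh hz).main 1 (s + 1)
      + (evenPair hK hh hz).main 1 s := by
  have hz0 : z ≠ 0 := by rintro rfl; simp at hz
  have hK0 : (K : ℂ) ≠ 0 := by exact_mod_cast hK.ne'
  set R := evenPair hK hh hz with hR
  obtain ⟨-, b, hb⟩ := odd_of_modEq hh
  have hreg := (R.regular_add_one.mpr hs).second
  have hq0 : nome (2 * K) h' (1 / z) ≠ 0 := nome_ne_zero _ _ _
  have hp0 : nome (2 * K) h' (1 / z) ^ 2 ≠ 0 := pow_ne_zero _ hq0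
  have hY (s : ℂ) : R.Y s = (nome (2 * K) h' (1 / z))⁻¹ * exp (-2 * Real.pi * s / z) := rfl
  have hshift : R.Y (s + 1) * (nome (2 * K) h' (1 / z) ^ 2)⁻¹ ^ K = R.Y s := by
    rw [hY, hY, nome_two_mul_sq hK, ← zpow_natCast, inv_zpow', nome_zpow, mul_assoc, ← exp_add]
    congr 1
    refine exp_eq_of_sub_eq (-h') ?_
    push_cast
    field_simp
    linear_combination -I_sq
  have hexp := one_add_mul_rankFn_eq_sum_add hp0
    (norm_nome_sq_lt_one (k := 2 * K) (h := h') (by omega) (re_one_div_pos hz))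
    (R.Y_ne (s + 1)) hreg K
  rw [hshift] at hexp
  have hm (s : ℂ) : R.main 1 s = evenGauss K h h' z s * (R.Y s)⁻¹ *
      (1 + R.Y s * rankFn (nome (2 * K) h' (1 / z) ^ 2) (R.Y s)) := by
    have := R.Y_ne s
    rw [RankPair.main]
    change evenGauss K h h' z s * (rankFn (nome (2 * K) h' (1 / z) ^ 2) (R.Y s) + _) = _
    field_simp
    ring
  -- the multiplier of the Gaussian cancels the last term of the iterated functional equation
  have hγ : evenGauss K h h' z (s + 1) * (R.Y (s + 1))⁻¹ * ((-1) ^ K *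
      (nome (2 * K) h' (1 / z) ^ 2) ^ (-pent (-K)) * R.Y (s + 1) ^ (3 * K)) =
      -(evenGauss K h h' z s * (R.Y s)⁻¹) := by
    have hbC : (h' : ℂ) = 2 * b + 1 := by exact_mod_cast hb
    have e2 : (2 * pent (-K) : ℂ) = 3 * (-K) ^ 2 + -K := by exact_mod_cast two_mul_pent (-K)
    have : exp (3 * Real.pi * I * (s + 1) + 3 * Real.pi * (2 * K : ℕ) * (s + 1) ^ 2 / (2 * z)
        - 4 * Real.pi * (s + 1) / z) * exp (-(-2 * Real.pi * (s + 1) / z)) * ((-1) ^ K *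
        exp (Real.pi * I / K * h' - Real.pi / (K * z)) ^ (2 * (-pent (-K))) *
        exp (-(Real.pi * I / K * h' - Real.pi / (K * z)) + -2 * Real.pi * (s + 1) / z) ^ (3 * K)) =
        -(exp (3 * Real.pi * I * s + 3 * Real.pi * (2 * K : ℕ) * s ^ 2 / (2 * z)
        - 4 * Real.pi * s / z) * exp (-(-2 * Real.pi * s / z))) := by
      rw [neg_one_pow_eq_exp, ← neg_one_mul (exp _ * exp _), ← exp_pi_mul_I, ← exp_int_mul,
        ← exp_nat_mul]
      simp only [← exp_add]
      refine exp_eq_of_sub_eq (-K - b * (3 * K + 2)) ?_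
      push_cast
      field_simp
      linear_combination (1 - I * z * h') * e2 - (2 * K + 3 * K ^ 2) * I * z * hbC
    have hYs (s : ℂ) : R.Y s = exp (-(Real.pi * I / K * h' - Real.pi / (K * z))
        + -2 * Real.pi * s / z) := by
      rw [hY, nome_eq_exp_mul hK hz, exp_add, exp_neg]
    have hYi (s : ℂ) : (R.Y s)⁻¹ = nome (2 * K) h' (1 / z) * exp (-(-2 * Real.pi * s / z)) := by
      rw [hY, mul_inv, inv_inv, exp_neg]
    have hp (n : ℤ) : (nome (2 * K) h' (1 / z) ^ 2) ^ n =
        exp (Real.pi * I / K * h' - Real.pi / (K * z)) ^ (2 * n) := by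
      rw [nome_eq_exp_mul hK hz, zpow_mul]
      norm_cast
    rw [hYi, hYi, hYs, hp, evenGauss, evenGauss]
    linear_combination evenConst K h h' z * nome (2 * K) h' (1 / z) * this
  rw [hm, hm, hexp, mul_add, ← mul_assoc (evenGauss K h h' z (s + 1) * _) (_ * _), hγ, neg_mul,
    add_assoc, neg_add_cancel, add_zero, evenJump, Finset.mul_sum, Finset.mul_sum]
  refine Finset.sum_congr rfl fun i _ => ?_
  have g1 := evenGauss_mul_pow (h := h) (h' := h') hK hz (s + 1) (3 * i)
  have g2 := evenGauss_mul_pow (h := h) (h' := h') hK hz (s + 1) (3 * i + 1)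
  have s1 : (2 * (((3 * i : ℕ) : ℝ) + 1) / (3 * (2 * K : ℕ))) = (6 * i + 2) / (3 * (2 * K : ℕ)) := by
    push_cast; ring
  have s2 : (2 * (((3 * i + 1 : ℕ) : ℝ) + 1) / (3 * (2 * K : ℕ)))
      = (6 * i + 4) / (3 * (2 * K : ℕ)) := by
    push_cast; ring
  rw [s1] at g1
  rw [s2] at g2
  have t1 := two_mul_pent i
  have t2 := two_mul_pent (-i)
  have k1 : (nome (2 * K) h' (1 / z) ^ 2) ^ (-pent (-i)) * (nome (2 * K) h' (1 / z))⁻¹ ^ (3 * i) =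
      nome (2 * K) h' (1 / z) ^ (-(3 * (i : ℤ) ^ 2 + 2 * i)) := by
    rw [← zpow_natCast, ← zpow_natCast, ← zpow_mul, inv_zpow', ← zpow_add₀ hq0]
    congr 1
    push_cast
    linarith [show 3 * (-(i : ℤ)) ^ 2 + -(i : ℤ) = 3 * (i : ℤ) ^ 2 - i by ring]
  have k2 : (nome (2 * K) h' (1 / z) ^ 2) ^ (-pent i) *
      (nome (2 * K) h' (1 / z))⁻¹ ^ (3 * i + 1) =
      nome (2 * K) h' (1 / z) ^ (-(3 * (i : ℤ) ^ 2 + 4 * i + 1)) := by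
    rw [← zpow_natCast, ← zpow_natCast, ← zpow_mul, inv_zpow', ← zpow_add₀ hq0]
    congr 1
    push_cast
    linarith
  rw [← k1, ← k2, evenJumpConst, hY, mul_pow, mul_pow, mul_inv, inv_inv]
  linear_combination (-nome (2 * K) h' (1 / z) * (-1) ^ i *
      ((nome (2 * K) h' (1 / z) ^ 2) ^ (-pent (-i)) * (nome (2 * K) h' (1 / z))⁻¹ ^ (3 * i))) * g1
    - (nome (2 * K) h' (1 / z) * (-1) ^ i *
      ((nome (2 * K) h' (1 / z) ^ 2) ^ (-pent i) *
        (nome (2 * K) h' (1 / z))⁻¹ ^ (3 * i + 1))) * g2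

/-- The terms of the sum of Mordell integrals. -/
noncomputable def evenTerm (K : ℕ) (h' : ℤ) (z w : ℂ) (s ν : ℤ) : ℂ :=
  (-1 : ℂ) ^ ν * exp (Real.pi * I / (2 * (2 * K : ℕ))
      * (h' * (-12 * (ν : ℂ) - 12 * (ν : ℂ) ^ 2 + s * (4 * ν) + s * 2) - 12 * ν + s * 2))
    * JoW (2 * K) ν s z w

/-- The summands depend only on `ν` modulo `K`. -/
theorem evenTerm_add (hK : 0 < K) (hodd : Odd h') {s : ℤ} (hs : s = 1 ∨ s = -1)
    (ν : ℤ) : evenTerm K h' z w s (ν + K) = evenTerm K h' z w s ν := by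
  have hK0 : (K : ℂ) ≠ 0 := by exact_mod_cast hK.ne'
  have h1 : JoW (2 * K) (ν + K) s z w = -JoW (2 * K) ν s z w := by
    rw [JoW, JoW, ← integral_neg]
    congr 1
    ext x
    rw [JoWIntegrand, JoWIntegrand, Ho, Ho, ← mul_neg, ← div_neg, ← mul_neg]
    congr 3
    push_cast
    rw [← sinh_sub_pi_mul_I]
    congr 1
    field_simp
    ring
  rw [evenTerm, evenTerm, h1, neg_one_zpow_eq_exp, neg_one_zpow_eq_exp, mul_neg, ← neg_mul,
    ← mul_neg, ← neg_one_mul (exp (_ / _ * _)), ← exp_pi_mul_I]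
  simp only [← exp_add]
  congr 1
  obtain ⟨b, hb⟩ := hodd
  have hbC : (h' : ℂ) = 2 * b + 1 := by exact_mod_cast hb
  rcases hs with rfl | rfl
  · refine exp_eq_of_sub_eq (b * (-2 - 6 * ν - 3 * K) - 3 * ν - K - 2) ?_
    push_cast
    field_simp
    linear_combination (-(8 * K + 24 * K * ν + 12 * K ^ 2) : ℂ) * hbC
  · refine exp_eq_of_sub_eq (b * (-4 - 6 * ν - 3 * K) - 3 * ν - K - 3) ?_
    push_cast
    field_simp
    linear_combination (-(16 * K + 24 * K * ν + 12 * K ^ 2) : ℂ) * hbC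

/-- A Gaussian of the jump, integrated along the line through its centre `σ`, is a summand of the sum
of Mordell integrals. -/
theorem centre_term_even (hK : 0 < K) (hz : 0 < z.re) {s : ℤ} (hs : s = 1 ∨ s = -1) (ν e : ℤ)
    (he : 2 * e = 6 * ν ^ 2 + 6 * ν + 1 - s * (2 * ν + 1)) {σ : ℝ}
    (hσ : σ = (s / 3 - (2 * ν + 1)) / (2 * K : ℕ)) :
    (-1 : ℂ) ^ ν * nome (2 * K) h' (1 / z) ^ (-e) *
      (exp (-(3 * Real.pi * (2 * K : ℕ) * σ ^ 2 / (2 * z)) + 3 * Real.pi * I * σ)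
        * mordell (2 * K) σ z w) =
    exp (-(2 * Real.pi / (3 * (2 * K : ℕ) * z))) *
      exp (Real.pi * I / (2 * (2 * K : ℕ)) * (-2 * h' - 6)) * evenTerm K h' z w s ν := by
  have hz0 : z ≠ 0 := by rintro rfl; simp at hz
  have hK0 : (K : ℂ) ≠ 0 := by exact_mod_cast hK.ne'
  have h1 : JoW (2 * K) ν s z w = mordell (2 * K) σ z w := by
    rw [JoW, JoWIntegrand_eq, mordell, hσ]
  have heC : (e : ℂ) = (6 * ν ^ 2 + 6 * ν + 1 - s * (2 * ν + 1)) / 2 := by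
    have : (2 * e : ℂ) = 6 * ν ^ 2 + 6 * ν + 1 - s * (2 * ν + 1) := by exact_mod_cast he
    linear_combination this / 2
  have hs2 : (s : ℂ) ^ 2 = 1 := by rcases hs with rfl | rfl <;> simp
  have hexp : nome (2 * K) h' (1 / z) ^ (-e) *
      exp (-(3 * Real.pi * (2 * K : ℕ) * σ ^ 2 / (2 * z)) + 3 * Real.pi * I * σ) =
      exp (-(2 * Real.pi / (3 * (2 * K : ℕ) * z))) *
      exp (Real.pi * I / (2 * (2 * K : ℕ)) * (-2 * h' - 6)) *
      exp (Real.pi * I / (2 * (2 * K : ℕ))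
      * (h' * (-12 * (ν : ℂ) - 12 * (ν : ℂ) ^ 2 + s * (4 * ν) + s * 2) - 12 * ν + s * 2)) := by
    rw [nome_zpow, ← exp_add, ← exp_add, ← exp_add]
    congr 1
    push_cast
    rw [heC, hσ]
    push_cast
    field_simp
    linear_combination -hs2
      - (6 + 36 * ν - 12 * ν * s + 36 * ν ^ 2 - 6 * s : ℂ) * I_sq
  rw [evenTerm, h1]
  linear_combination (-1 : ℂ) ^ ν * mordell (2 * K) σ z w * hexp

/-- A real number `a` with `|a| < 2/(3k)`, `k = 2K`, differs from `(±1/3 + odd)/k` by a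
non-integer. -/
theorem even_line_avoids {a : ℝ} (hK : 0 < K) (ha : |a| < 2 / (3 * ((2 * K : ℕ) : ℝ))) {s : ℤ}
    (hs : s = 1 ∨ s = -1) (ν n : ℤ) : ((s / 3 - (2 * ν + 1)) / (2 * K : ℕ) : ℝ) - a ≠ n := by
  intro hn
  have hKr : (0 : ℝ) < K := by exact_mod_cast hK
  push_cast at hn ha
  have h1 : 2 * (K : ℝ) * a = s / 3 - (2 * ν + 1) - 2 * K * n := by
    rw [← hn]; field_simp; ring
  have h2 : |2 * (K : ℝ) * a| < 2 / 3 := by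
    rw [abs_mul, abs_of_pos (by positivity)]
    calc 2 * (K : ℝ) * |a| < 2 * K * (2 / (3 * (2 * K))) := by gcongr
      _ = 2 / 3 := by field_simp
  rw [h1, abs_lt] at h2
  obtain ⟨h3, h4⟩ := h2
  rcases hs with rfl | rfl
  · have h5 : (-1 : ℝ) < ((2 * ν + 1 + 2 * K * n : ℤ) : ℝ) := by push_cast at h4 ⊢; linarith
    have h6 : ((2 * ν + 1 + 2 * K * n : ℤ) : ℝ) < 1 := by push_cast at h3 ⊢; linarith
    have h5' : (-1 : ℤ) < 2 * ν + 1 + 2 * K * n := by exact_mod_cast h5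
    have h6' : (2 * ν + 1 + 2 * K * n : ℤ) < 1 := by exact_mod_cast h6
    have : 2 * ν + 1 + 2 * K * n = 2 * (ν + K * n) + 1 := by ring
    omega
  · have h5 : (-1 : ℝ) < ((2 * ν + 1 + 2 * K * n : ℤ) : ℝ) := by push_cast at h4 ⊢; linarith
    have h6 : ((2 * ν + 1 + 2 * K * n : ℤ) : ℝ) < 1 := by push_cast at h3 ⊢; linarith
    have h5' : (-1 : ℤ) < 2 * ν + 1 + 2 * K * n := by exact_mod_cast h5
    have h6' : (2 * ν + 1 + 2 * K * n : ℤ) < 1 := by exact_mod_cast h6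
    have : 2 * ν + 1 + 2 * K * n = 2 * (ν + K * n) + 1 := by ring
    omega

theorem integrable_JoWIntegrand (hK : 0 < K) (hz : 0 < z.re)
    (hw : |obliqueRe z w| < 2 / (3 * ((2 * K : ℕ) : ℝ))) (ν : ℤ) {s : ℤ} (hs : s = 1 ∨ s = -1) :
    Integrable (JoWIntegrand (2 * K) ν s z w) := by
  rw [JoWIntegrand_eq]
  exact integrable_mordellIntegrand (by omega) hz (even_line_avoids hK hw hs ν)

/-- The integral of the jump, as a sum of Mordell integrals. -/
theorem integral_evenJump (hK : 0 < K) (hodd : Odd h') (hz : 0 < z.re)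
    (hw : |obliqueRe z w| < 2 / (3 * ((2 * K : ℕ) : ℝ))) {a : ℝ} (ha1 : obliqueRe z w < a)
    (ha2 : a < obliqueRe z w + 1) :
    ∫ t : ℝ, evenJump K h h' z (obliqueLine z a t) *
        (sin (Real.pi * (obliqueLine z a t - w)))⁻¹ =
      -evenJumpConst K h h' z * (2 * I / (2 * K : ℕ)) *
        (exp (-(2 * Real.pi / (3 * (2 * K : ℕ) * z))) *
          exp (Real.pi * I / (2 * (2 * K : ℕ)) * (-2 * h' - 6))) *
        ∑ ν ∈ Finset.range K, (evenTerm K h' z w 1 ν + evenTerm K h' z w (-1) ν) := by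
  have hKr : (0 : ℝ) < K := by exact_mod_cast hK
  have hwl := (abs_lt.mp hw).1
  have hwr := (abs_lt.mp hw).2
  have hk : 0 < 2 * K := by omega
  have hint (σ : ℝ) : Integrable fun t : ℝ => centredGauss (2 * K) σ z (obliqueLine z a t) *
      (sin (Real.pi * (obliqueLine z a t - w)))⁻¹ := by
    refine integrable_mul_inv_sin hz (differentiable_centredGauss (2 * K) σ z).continuous
      (boundedOnStrips_centredGauss hk hz σ) fun n hn => ?_
    have h1 : (0 : ℤ) < n := by exact_mod_cast (by linarith : (0 : ℝ) < n)
    have h2 : n < 1 := by exact_mod_cast (by linarith : (n : ℝ) < 1)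
    omega
  have hadd (c₁ c₂ : ℂ) (σ₁ σ₂ : ℝ) : Integrable fun t : ℝ =>
      c₁ * (centredGauss (2 * K) σ₁ z (obliqueLine z a t) *
        (sin (Real.pi * (obliqueLine z a t - w)))⁻¹) +
      c₂ * (centredGauss (2 * K) σ₂ z (obliqueLine z a t) *
        (sin (Real.pi * (obliqueLine z a t - w)))⁻¹) :=
    ((hint σ₁).const_mul c₁).add ((hint σ₂).const_mul c₂)
  have hsplit (t : ℝ) : evenJump K h h' z (obliqueLine z a t) *
      (sin (Real.pi * (obliqueLine z a t - w)))⁻¹ = evenJumpConst K h h' z *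
      ∑ i ∈ Finset.range K,
      (((-1) ^ i * nome (2 * K) h' (1 / z) ^ (-(3 * (i : ℤ) ^ 2 + 2 * i))) *
        (centredGauss (2 * K) ((6 * i + 2) / (3 * (2 * K : ℕ))) z (obliqueLine z a t) *
          (sin (Real.pi * (obliqueLine z a t - w)))⁻¹) +
      ((-1) ^ i * nome (2 * K) h' (1 / z) ^ (-(3 * (i : ℤ) ^ 2 + 4 * i + 1))) *
        (centredGauss (2 * K) ((6 * i + 4) / (3 * (2 * K : ℕ))) z (obliqueLine z a t) *
          (sin (Real.pi * (obliqueLine z a t - w)))⁻¹)) := by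
    rw [evenJump, mul_assoc, Finset.sum_mul]
    congr 1
    refine Finset.sum_congr rfl fun i _ => ?_
    ring
  simp only [hsplit]
  rw [integral_const_mul, integral_finsetSum _ fun i _ => hadd _ _ _ _]
  have hper := fun (s : ℤ) (hs : s = 1 ∨ s = -1) => evenTerm_add (z := z) (w := w) hK hodd hs
  have hrev (f : ℤ → ℂ) (hf : ∀ n, f (n + K) = f n) :
      ∑ i ∈ Finset.range K, f i = ∑ i ∈ Finset.range K, f (-(i + 1)) := by
    rw [← sum_range_neg_of_periodic hf]
    exact (sum_range_add_one_of_periodic (f := fun n => f (-n)) fun n => by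
      rw [← hf]; congr 1; ring).symm
  rw [Finset.sum_add_distrib, hrev _ (hper 1 (Or.inl rfl)), hrev _ (hper (-1) (Or.inr rfl)),
    ← Finset.sum_add_distrib, Finset.mul_sum, Finset.mul_sum]
  refine Finset.sum_congr rfl fun i hi => ?_
  have hi' : (i : ℝ) + 1 ≤ K := by exact_mod_cast Finset.mem_range.mp hi
  have hi0 : (0 : ℝ) ≤ i := Nat.cast_nonneg i
  have e1 : 2 / (3 * ((2 * K : ℕ) : ℝ)) ≤ (6 * i + 2) / (3 * (2 * K : ℕ)) := by
    gcongr; linarith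
  have e2 : (6 * i + 2) / (3 * ((2 * K : ℕ) : ℝ)) ≤ (6 * i + 4) / (3 * (2 * K : ℕ)) := by
    gcongr; norm_num
  have e3 : (6 * i + 4) / (3 * ((2 * K : ℕ) : ℝ)) ≤ 1 - 2 / (3 * (2 * K : ℕ)) := by
    rw [le_sub_iff_add_le, ← add_div, div_le_one (by positivity)]
    push_cast
    linarith
  rw [integral_add ((hint _).const_mul _) ((hint _).const_mul _), integral_const_mul,
    integral_const_mul, integral_centredGauss hk hz ha1 ha2 (by linarith) (by linarith),
    integral_centredGauss hk hz ha1 ha2 (by linarith) (by linarith)]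
  have t1 := centre_term_even (h' := h') (w := w) hK hz (Or.inr rfl : (-1 : ℤ) = 1 ∨ _) (-(i + 1))
    (3 * (i : ℤ) ^ 2 + 2 * i) (by ring)
    (σ := (6 * i + 2) / (3 * (2 * K : ℕ))) (by push_cast; field_simp; ring)
  have t2 := centre_term_even (h' := h') (w := w) hK hz (Or.inl rfl : (1 : ℤ) = 1 ∨ _) (-(i + 1))
    (3 * (i : ℤ) ^ 2 + 4 * i + 1) (by ring)
    (σ := (6 * i + 4) / (3 * (2 * K : ℕ))) (by push_cast; field_simp; ring)
  have hsg : (-1 : ℂ) ^ (-((i : ℤ) + 1)) = -(-1) ^ i := by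
    rw [zpow_neg, ← Nat.cast_add_one, zpow_natCast, ← inv_pow, pow_succ]
    norm_num
  rw [hsg] at t1 t2
  linear_combination (-2 * I / (2 * K : ℕ) * evenJumpConst K h h' z) * t1
    - (2 * I / (2 * K : ℕ) * evenJumpConst K h h' z) * t2

/-- There are no poles close to the real axis. -/
theorem even_regular (hK : 0 < K) (hodd : Odd h) (hz : 0 < z.re)
    (hw : |obliqueRe z w| < 2 / (3 * ((2 * K : ℕ) : ℝ))) (n : ℤ) :
    exp (2 * Real.pi * I * w) * nome (2 * K) h z ^ (2 * n + 1) ≠ 1 := by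
  intro hp
  have hK0 : (K : ℂ) ≠ 0 := by exact_mod_cast hK.ne'
  have hKr : (0 : ℝ) < K := by exact_mod_cast hK
  rw [nome_zpow, ← exp_add] at hp
  obtain ⟨l, hl⟩ := exp_eq_one_iff.mp hp
  have hwl : w = obliqueLine z (l - (2 * n + 1) * h / (2 * K)) (-(2 * n + 1) / (2 * K)) := by
    refine mul_left_cancel₀ two_pi_I_ne_zero ?_
    rw [obliqueLine]
    push_cast at hl ⊢
    field_simp at hl ⊢
    linear_combination hl
  rw [hwl, obliqueRe_obliqueLine hz] at hw
  have h2 : |2 * (K : ℝ) * (l - (2 * n + 1) * h / (2 * K))| < 2 / 3 := by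
    rw [abs_mul, abs_of_pos (by positivity)]
    push_cast at hw
    calc 2 * (K : ℝ) * |(l : ℝ) - (2 * n + 1) * h / (2 * K)| < 2 * K * (2 / (3 * (2 * K))) := by gcongr
      _ = 2 / 3 := by field_simp
  have h3 : 2 * (K : ℝ) * (l - (2 * n + 1) * h / (2 * K)) =
      ((2 * (K * l) - (2 * n + 1) * h : ℤ) : ℝ) := by push_cast; field_simp
  rw [h3, abs_lt] at h2
  have h5 : (-1 : ℤ) < 2 * (K * l) - (2 * n + 1) * h := by
    exact_mod_cast (by linarith [h2.1] : (-1 : ℝ) < ((2 * (K * l) - (2 * n + 1) * h : ℤ) : ℝ))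
  have h6 : 2 * (K * l) - (2 * n + 1) * h < 1 := by
    exact_mod_cast (by linarith [h2.2] : ((2 * (K * l) - (2 * n + 1) * h : ℤ) : ℝ) < 1)
  obtain ⟨a, ha⟩ := hodd
  have : (2 * n + 1) * h = 2 * (n * h + a) + 1 := by rw [ha]; ring
  omega

/-- The transformation law for even denominators. -/
theorem calRo_transform_even (hK : 0 < K) (hh : h * h' ≡ -1 [ZMOD (4 * (2 * K : ℕ) : ℤ)])
    (hz : 0 < z.re) (hw : |obliqueRe z w| < 2 / (3 * ((2 * K : ℕ) : ℝ))) :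
    exp (Real.pi * I * w) * calRo (nome (2 * K) h z) w =
      -(evenGauss K h h' z w * exp (2 * Real.pi * w / z) * nome (2 * K) h' (1 / z) ^ 3)
        * loW (nome (2 * K) h' (1 / z)) (I * w / z)
      + z / 2 * (evenJumpConst K h h' z * (2 * I / (2 * K : ℕ)) *
        (exp (-(2 * Real.pi / (3 * (2 * K : ℕ) * z))) *
          exp (Real.pi * I / (2 * (2 * K : ℕ)) * (-2 * h' - 6))) *
        ∑ ν ∈ Finset.range K, (evenTerm K h' z w 1 ν + evenTerm K h' z w (-1) ν)) := by
  have hz0 : z ≠ 0 := by rintro rfl; simp at hz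
  have hk : 0 < 2 * K := by omega
  have hq0 := nome_ne_zero (2 * K) h z
  have hq1 := nome_ne_zero (2 * K) h' (1 / z)
  set R := evenPair hK hh hz with hR
  have hreg' : R.Regular w := by
    intro n
    have := even_regular hK (odd_of_modEq hh).1 hz hw n
    rw [zpow_add_one₀ hq0, zpow_mul] at this
    simp only [RankPair.y, hR, evenPair]
    rw [← zpow_natCast]
    convert this using 1
    push_cast
    ring
  have hgc : Continuous fun s => evenJump K h h' z (s + 1) := by
    unfold evenJump
    have := fun σ => (differentiable_centredGauss (2 * K) σ z).continuous
    fun_prop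
  have hmain := R.eq_main_add_integral 1 hgc (evenJump_add_one hK hh hz) hreg'
    (a := obliqueRe z w - 1 / 2) (by change obliqueRe z w - 1 < _; linarith)
    (by change _ < obliqueRe z w; linarith)
  have e1 : rankFn R.p (R.y w) = calRo (nome (2 * K) h z) w := by
    rw [calRo_eq_rankFn _ _ hq0, mul_comm (exp _)]
    rfl
  have hX : exp (2 * Real.pi * I * (I * w / z)) = exp (-2 * Real.pi * w / z) := by
    congr 1
    field_simp
    linear_combination w * I_sq
  have hYw : R.Y w = (nome (2 * K) h' (1 / z))⁻¹ * exp (-2 * Real.pi * w / z) := rfl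
  have hsec := hreg'.second
  have hp₁ : R.p₁ = nome (2 * K) h' (1 / z) ^ 2 := rfl
  have e2 : R.main 1 w = -(evenGauss K h h' z w * exp (2 * Real.pi * w / z)
      * nome (2 * K) h' (1 / z) ^ 3) * loW (nome (2 * K) h' (1 / z)) (I * w / z) := by
    rw [loW_eq_calRo hq1 (norm_nome_lt_one hk h' (re_one_div_pos hz)), hX, calRo_eq_rankFn _ _ hq1,
      hX]
    · have e : exp (-2 * Real.pi * w / z) * nome (2 * K) h' (1 / z) =
          R.Y w * nome (2 * K) h' (1 / z) ^ 2 := by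
        rw [hYw]; field_simp
      have hrk := rankFn_mul_nome R.p₁_ne R.p₁_lt (R.Y_ne w) hsec
      rw [hp₁] at hrk
      rw [e, hrk, RankPair.main, hp₁, hYw,
        show 2 * Real.pi * w / z = -(-2 * Real.pi * w / z) by ring, exp_neg]
      change evenGauss K h h' z w * _ = _
      have hX0 := exp_ne_zero (-2 * Real.pi * w / z)
      generalize exp (-2 * Real.pi * w / z) = X at hX0 ⊢
      field_simp
      ring
    · intro n
      have := hsec (n + 1)
      rw [hYw, hp₁] at this
      rw [hX]
      have h1 : nome (2 * K) h' (1 / z) ^ (2 * n + 1) =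
          (nome (2 * K) h' (1 / z))⁻¹ * (nome (2 * K) h' (1 / z) ^ 2) ^ (n + 1) := by
        rw [← zpow_natCast, ← zpow_mul, ← zpow_neg_one, ← zpow_add₀ hq1]
        congr 1
        push_cast
        ring
      rw [h1, mul_left_comm, ← mul_assoc]
      exact this
  have e3 : ∫ t : ℝ, evenJump K h h' z (obliqueLine R.Z (obliqueRe z w - 1 / 2) t + 1) *
      (sin (Real.pi * (obliqueLine R.Z (obliqueRe z w - 1 / 2) t - w)))⁻¹ =
      -∫ t : ℝ, evenJump K h h' z (obliqueLine z (obliqueRe z w + 1 / 2) t) *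
      (sin (Real.pi * (obliqueLine z (obliqueRe z w + 1 / 2) t - w)))⁻¹ := by
    rw [← integral_neg]
    refine integral_congr_ae (ae_of_all _ fun t => ?_)
    have e : obliqueLine z (obliqueRe z w + 1 / 2) t
        = obliqueLine R.Z (obliqueRe z w - 1 / 2) t + 1 := by
      rw [obliqueLine, obliqueLine, show R.Z = z from rfl]
      push_cast
      ring
    simp only [e]
    rw [show Real.pi * (obliqueLine R.Z (obliqueRe z w - 1 / 2) t + 1 - w)
      = Real.pi * (obliqueLine R.Z (obliqueRe z w - 1 / 2) t - w) + Real.pi by ring,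
      sin_add_pi, inv_neg]
    ring
  rw [e1, e2, e3, integral_evenJump hK (odd_of_modEq hh).2 hz hw (by linarith) (by linarith),
    show R.Z = z from rfl] at hmain
  rw [hmain]
  ring

end Even

/-! ### The rank function as a sum over Durfee squares -/

/-- The `q`-Pochhammer symbol `(u; p)_∞ = ∏_{j ≥ 0} (1 - u p^j)`. -/
noncomputable def qp (p u : ℂ) : ℂ := ∏' j : ℕ, (1 - u * p ^ j)

theorem summable_norm_mul_pow {p : ℂ} (hp : ‖p‖ < 1) (u : ℂ) :
    Summable fun j : ℕ => ‖-(u * p ^ j)‖ := by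
  simp only [norm_neg, norm_mul, norm_pow]
  exact (summable_geometric_of_lt_one (norm_nonneg _) hp).mul_left _

theorem multipliable_qp {p : ℂ} (hp : ‖p‖ < 1) (u : ℂ) :
    Multipliable fun j : ℕ => 1 - u * p ^ j := by
  simp only [sub_eq_add_neg]
  exact multipliable_one_add_of_summable (summable_norm_mul_pow hp u)

theorem qp_eq_mul {p : ℂ} (hp : ‖p‖ < 1) (u : ℂ) : qp p u = (1 - u) * qp p (u * p) := by
  rw [qp, tprod_eq_zero_mul']
  · simp only [pow_zero, mul_one, qp]
    congr 1
    refine tprod_congr fun j => ?_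
    rw [pow_succ']; ring
  · simpa [pow_succ', mul_assoc] using multipliable_qp hp (u * p)

theorem qp_eq_prod_mul {p : ℂ} (hp : ‖p‖ < 1) (u : ℂ) (n : ℕ) :
    qp p u = (∏ j ∈ Finset.range n, (1 - u * p ^ j)) * qp p (u * p ^ n) := by
  induction n with
  | zero => simp
  | succ n ih => rw [ih, Finset.prod_range_succ, qp_eq_mul hp (u * p ^ n), pow_succ]; ring_nf

theorem qp_ne_zero {p u : ℂ} (hp : ‖p‖ < 1) (h : ∀ j : ℕ, u * p ^ j ≠ 1) : qp p u ≠ 0 := by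
  unfold qp
  have := tprod_one_add_ne_zero_of_summable (f := fun j : ℕ => -(u * p ^ j)) (fun j => ?_)
    (summable_norm_mul_pow hp u)
  · simpa [sub_eq_add_neg] using this
  · rw [← sub_eq_add_neg, sub_ne_zero]; exact (h j).symm

theorem qp_eq_zero {p u : ℂ} (hp : ‖p‖ < 1) (j : ℕ) (h : u * p ^ j = 1) : qp p u = 0 := by
  rw [qp_eq_prod_mul hp u (j + 1), Finset.prod_range_succ, h]; simp

theorem norm_qp_le {p : ℂ} (hp : ‖p‖ < 1) {u : ℂ} {R : ℝ} (hu : ‖u‖ ≤ R) :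
    ‖qp p u‖ ≤ Real.exp (R * (1 / (1 - ‖p‖))) := by
  have hR : 0 ≤ R := (norm_nonneg u).trans hu
  have ht := ((multipliable_qp hp u).hasProd.tendsto_prod_nat).norm
  refine le_of_tendsto ht (Eventually.of_forall fun n => ?_)
  calc ‖∏ j ∈ Finset.range n, (1 - u * p ^ j)‖
      ≤ ∏ j ∈ Finset.range n, Real.exp (R * ‖p‖ ^ j) := by
        rw [norm_prod]
        refine Finset.prod_le_prod (fun _ _ => norm_nonneg _) fun j _ => ?_
        calc ‖1 - u * p ^ j‖ ≤ 1 + ‖u‖ * ‖p‖ ^ j := by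
              refine (norm_sub_le _ _).trans ?_
              rw [norm_one, norm_mul, norm_pow]
          _ ≤ R * ‖p‖ ^ j + 1 := by
              rw [add_comm]; gcongr
          _ ≤ _ := Real.add_one_le_exp _
    _ = Real.exp (R * ∑ j ∈ Finset.range n, ‖p‖ ^ j) := by
        rw [Finset.mul_sum, Real.exp_sum]
    _ ≤ _ := by
        apply Real.exp_le_exp.mpr
        gcongr
        rw [one_div, ← tsum_geometric_of_lt_one (norm_nonneg p) hp]
        exact (summable_geometric_of_lt_one (norm_nonneg p) hp).sum_le_tsum _
          (fun i _ => by positivity)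

theorem differentiable_qp {p : ℂ} (hp : ‖p‖ < 1) : Differentiable ℂ (qp p) := by
  have hloc (R : ℝ) : DifferentiableOn ℂ (qp p) (Metric.ball 0 R) := by
    have h : HasProdLocallyUniformlyOn (fun (j : ℕ) (u : ℂ) => 1 + -(u * p ^ j))
        (fun u => ∏' j : ℕ, (1 + -(u * p ^ j))) (Metric.ball 0 R) := by
      refine ((summable_geometric_of_lt_one (norm_nonneg p) hp).mul_left
        R).hasProdLocallyUniformlyOn_nat_one_add Metric.isOpen_ball
        (Eventually.of_forall fun j u hu => ?_) fun j => by fun_prop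
      rw [norm_neg, norm_mul, norm_pow]
      have : ‖u‖ ≤ R := by simpa using (Metric.mem_ball.mp hu).le
      gcongr
    have := h.differentiableOn (Eventually.of_forall fun s => by
      simpa [Finset.prod_fn] using DifferentiableOn.finsetProd (fun _ _ => by fun_prop))
      Metric.isOpen_ball
    simp only [← sub_eq_add_neg] at this
    exact this
  intro u
  exact (hloc (‖u‖ + 1)).differentiableAt (Metric.isOpen_ball.mem_nhds (by simp))

/-- The theta function `(y; p)_∞ (p/y; p)_∞`, whose zeros are the powers of `p`. -/
noncomputable def thetaProd (p y : ℂ) : ℂ := qp p y * qp p (y⁻¹ * p)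

theorem thetaProd_mul_nome {p y : ℂ} (hp0 : p ≠ 0) (hp : ‖p‖ < 1) (hy : y ≠ 0) :
    thetaProd p (y * p) = -y⁻¹ * thetaProd p y := by
  have e : (y * p)⁻¹ * p = y⁻¹ := by field_simp
  rw [thetaProd, thetaProd, e, qp_eq_mul hp y⁻¹, qp_eq_mul hp y]
  field_simp
  ring

theorem thetaProd_ne_zero {p y : ℂ} (hp0 : p ≠ 0) (hp : ‖p‖ < 1) (hy : y ≠ 0)
    (h : ∀ n : ℤ, y * p ^ n ≠ 1) : thetaProd p y ≠ 0 := by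
  refine mul_ne_zero (qp_ne_zero hp fun j => by exact_mod_cast h j) (qp_ne_zero hp fun j hj => ?_)
  refine h (-(j + 1)) ?_
  rw [mul_assoc, ← pow_succ', inv_mul_eq_one₀ hy] at hj
  rw [hj, ← zpow_natCast, ← zpow_add₀ hp0]
  simp

theorem thetaProd_eq_zero {p y : ℂ} (hp0 : p ≠ 0) (hp : ‖p‖ < 1) (n : ℤ)
    (h : y * p ^ n = 1) : thetaProd p y = 0 := by
  have hy : y ≠ 0 := by rintro rfl; simp at h
  rw [thetaProd, mul_eq_zero]
  rcases lt_or_ge n 0 with hn | hn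
  · right
    refine qp_eq_zero hp (-n - 1).toNat ?_
    rw [← zpow_natCast, Int.toNat_of_nonneg (by omega), mul_assoc, ← zpow_one_add₀ hp0]
    have : y⁻¹ = p ^ n := inv_eq_of_mul_eq_one_right h
    rw [this, ← zpow_add₀ hp0]
    simp
  · left
    refine qp_eq_zero hp n.toNat ?_
    rw [← zpow_natCast, Int.toNat_of_nonneg hn]; exact h

/-- The `n`-th term of the sum over Durfee squares: `y p^{n²+n} / ((y; p)_{n+1} (p/y; p)_{n+1})`. -/
noncomputable def durfeeTerm (p : ℂ) (n : ℕ) (y : ℂ) : ℂ :=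
  y * p ^ (n ^ 2 + n) /
    ((∏ j ∈ Finset.range (n + 1), (1 - y * p ^ j)) *
      ∏ j ∈ Finset.range (n + 1), (1 - y⁻¹ * p ^ (j + 1)))

/-- The terms multiplied by the theta function, which clears their denominators. -/
noncomputable def durfeeNum (p : ℂ) (n : ℕ) (y : ℂ) : ℂ :=
  y * p ^ (n ^ 2 + n) * qp p (y * p ^ (n + 1)) * qp p (y⁻¹ * p ^ (n + 2))

section Regular

variable {p y : ℂ}

theorem one_sub_mul_pow_ne_zero (h : ∀ n : ℤ, y * p ^ n ≠ 1) (j : ℕ) : 1 - y * p ^ j ≠ 0 :=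
  sub_ne_zero.mpr fun h' => h j (by rw [zpow_natCast]; exact h'.symm)

theorem one_sub_inv_mul_pow_ne_zero (hp0 : p ≠ 0) (hy : y ≠ 0) (h : ∀ n : ℤ, y * p ^ n ≠ 1)
    (j : ℕ) : 1 - y⁻¹ * p ^ j ≠ 0 := by
  refine sub_ne_zero.mpr fun h' => h (-j) ?_
  rw [eq_comm, inv_mul_eq_one₀ hy] at h'
  rw [h', zpow_neg, zpow_natCast, mul_inv_cancel₀ (pow_ne_zero _ hp0)]

theorem thetaProd_mul_durfeeTerm (hp0 : p ≠ 0) (hp : ‖p‖ < 1) (hy : y ≠ 0)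
    (h : ∀ n : ℤ, y * p ^ n ≠ 1) (n : ℕ) :
    thetaProd p y * durfeeTerm p n y = durfeeNum p n y := by
  have h1 : ∏ j ∈ Finset.range (n + 1), (1 - y * p ^ j) ≠ 0 :=
    Finset.prod_ne_zero_iff.mpr fun j _ => one_sub_mul_pow_ne_zero h j
  have h2 : ∏ j ∈ Finset.range (n + 1), (1 - y⁻¹ * p ^ (j + 1)) ≠ 0 :=
    Finset.prod_ne_zero_iff.mpr fun j _ => one_sub_inv_mul_pow_ne_zero hp0 hy h (j + 1)
  have e : ∏ j ∈ Finset.range (n + 1), (1 - y⁻¹ * p * p ^ j)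
      = ∏ j ∈ Finset.range (n + 1), (1 - y⁻¹ * p ^ (j + 1)) :=
    Finset.prod_congr rfl fun j _ => by rw [pow_succ']; ring
  rw [thetaProd, qp_eq_prod_mul hp y (n + 1), qp_eq_prod_mul hp (y⁻¹ * p) (n + 1), e,
    durfeeTerm, durfeeNum, show y⁻¹ * p * p ^ (n + 1) = y⁻¹ * p ^ (n + 2) by ring]
  generalize ∏ j ∈ Finset.range (n + 1), (1 - y⁻¹ * p ^ (j + 1)) = B at *
  field_simp

theorem norm_durfeeNum_le (hp : ‖p‖ < 1) {R : ℝ} (hy : ‖y‖ ≤ R) (hy' : ‖y⁻¹‖ ≤ R) (n : ℕ) :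
    ‖durfeeNum p n y‖ ≤ R * (Real.exp (R * (1 / (1 - ‖p‖)))) ^ 2 * ‖p‖ ^ n := by
  have hR : 0 ≤ R := (norm_nonneg y).trans hy
  have hb {u : ℂ} (hu : ‖u‖ ≤ R) (m : ℕ) : ‖u * p ^ m‖ ≤ R := by
    rw [norm_mul, norm_pow]
    exact (mul_le_of_le_one_right (norm_nonneg _) (pow_le_one₀ (norm_nonneg _) hp.le)).trans hu
  have h1 := norm_qp_le hp (hb hy (n + 1))
  have h2 := norm_qp_le hp (hb hy' (n + 2))
  have h3 : ‖p‖ ^ (n ^ 2 + n) ≤ ‖p‖ ^ n :=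
    pow_le_pow_of_le_one (norm_nonneg _) hp.le (Nat.le_add_left n (n ^ 2))
  rw [durfeeNum, norm_mul, norm_mul, norm_mul, norm_pow]
  calc ‖y‖ * ‖p‖ ^ (n ^ 2 + n) * ‖qp p (y * p ^ (n + 1))‖ * ‖qp p (y⁻¹ * p ^ (n + 2))‖
      ≤ R * ‖p‖ ^ n * Real.exp (R * (1 / (1 - ‖p‖))) * Real.exp (R * (1 / (1 - ‖p‖))) := by
        gcongr
    _ = _ := by ring

theorem summable_durfeeNum (hp : ‖p‖ < 1) (y : ℂ) : Summable fun n => durfeeNum p n y :=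
  Summable.of_norm_bounded
    ((summable_geometric_of_lt_one (norm_nonneg p) hp).mul_left _)
    (norm_durfeeNum_le hp (le_max_left ‖y‖ ‖y⁻¹‖) (le_max_right _ _))

theorem summable_durfeeTerm (hp0 : p ≠ 0) (hp : ‖p‖ < 1) (hy : y ≠ 0)
    (h : ∀ n : ℤ, y * p ^ n ≠ 1) : Summable fun n => durfeeTerm p n y := by
  have hθ := thetaProd_ne_zero hp0 hp hy h
  refine (((summable_durfeeNum hp y).mul_left (thetaProd p y)⁻¹)).congr fun n => ?_
  rw [← thetaProd_mul_durfeeTerm hp0 hp hy h]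
  field_simp

theorem durfeeTerm_zero (hy1 : y ≠ 1) (hy : y ≠ 0) (h : y ≠ p) :
    durfeeTerm p 0 y = y ^ 2 / ((1 - y) * (y - p)) := by
  have h1 : 1 - y ≠ 0 := sub_ne_zero.mpr hy1.symm
  have h2 : y - p ≠ 0 := sub_ne_zero.mpr h
  have h3 : 1 - y⁻¹ * p = (y - p) / y := by field_simp
  simp [durfeeTerm]
  rw [h3]
  field_simp

theorem durfeeTerm_succ (n : ℕ) :
    durfeeTerm p (n + 1) y = durfeeTerm p n y *
      (p ^ (2 * n + 2) / ((1 - y * p ^ (n + 1)) * (1 - y⁻¹ * p ^ (n + 2)))) := by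
  rw [durfeeTerm, durfeeTerm, Finset.prod_range_succ _ (n + 1), Finset.prod_range_succ _ (n + 1),
    div_mul_div_comm, show (n + 1) ^ 2 + (n + 1) = n ^ 2 + n + (2 * n + 2) by ring, pow_add]
  congr 1 <;> ring

theorem durfeeTerm_mul_nome (hp0 : p ≠ 0) (hy : y ≠ 0) (h : ∀ n : ℤ, y * p ^ n ≠ 1) (n : ℕ) :
    durfeeTerm p n (y * p) =
      durfeeTerm p n y * (p * (p ^ (n + 1) - y) / (1 - y * p ^ (n + 1))) := by
  have h1 := one_sub_mul_pow_ne_zero h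
  have h2 := one_sub_inv_mul_pow_ne_zero hp0 hy h
  have e1 : ∏ j ∈ Finset.range (n + 1), (1 - y * p * p ^ j)
      = (∏ j ∈ Finset.range (n + 1), (1 - y * p ^ j)) * (1 - y * p ^ (n + 1)) / (1 - y) := by
    have h0 := h1 0
    rw [pow_zero, mul_one] at h0
    rw [eq_div_iff h0, ← Finset.prod_range_succ (fun j => 1 - y * p ^ j),
      Finset.prod_range_succ' (fun j => 1 - y * p ^ j)]
    simp only [pow_zero, mul_one]
    congr 1
    exact Finset.prod_congr rfl fun j _ => by rw [pow_succ']; ring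
  have e2 : ∏ j ∈ Finset.range (n + 1), (1 - (y * p)⁻¹ * p ^ (j + 1))
      = (∏ j ∈ Finset.range (n + 1), (1 - y⁻¹ * p ^ (j + 1))) * (1 - y⁻¹)
        / (1 - y⁻¹ * p ^ (n + 1)) := by
    rw [eq_div_iff (h2 (n + 1))]
    have e (j : ℕ) : 1 - (y * p)⁻¹ * p ^ (j + 1) = 1 - y⁻¹ * p ^ j := by
      rw [pow_succ']; field_simp
    simp only [e]
    rw [← Finset.prod_range_succ (fun j => 1 - y⁻¹ * p ^ j), Finset.prod_range_succ']
    simp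
  have h3 : ∏ j ∈ Finset.range (n + 1), (1 - y * p ^ j) ≠ 0 :=
    Finset.prod_ne_zero_iff.mpr fun j _ => h1 j
  have h4 : ∏ j ∈ Finset.range (n + 1), (1 - y⁻¹ * p ^ (j + 1)) ≠ 0 :=
    Finset.prod_ne_zero_iff.mpr fun j _ => h2 (j + 1)
  have h5 := h1 0
  have h6 := h2 0
  have h7 := h2 (n + 1)
  have h8 := h1 (n + 1)
  rw [pow_zero, mul_one] at h5 h6
  rw [durfeeTerm, durfeeTerm, e1, e2]
  generalize ∏ j ∈ Finset.range (n + 1), (1 - y * p ^ j) = A at *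
  generalize ∏ j ∈ Finset.range (n + 1), (1 - y⁻¹ * p ^ (j + 1)) = B at *
  generalize p ^ (n + 1) = P at *
  generalize p ^ (n ^ 2 + n) = Q at *
  have h9 : y - 1 ≠ 0 := by
    intro h0; apply h5; linear_combination -h0
  have h10 : y - P ≠ 0 := by
    intro h0; apply h7; rw [sub_eq_zero] at h0; subst h0; field_simp; ring
  have h6' : 1 - y⁻¹ = (y - 1) / y := by field_simp
  have h7' : 1 - y⁻¹ * P = (y - P) / y := by field_simp
  rw [h6', h7']
  field_simp
  ring

/-- The sum over Durfee squares satisfies the functional equation of `rankFn`: after a shift of `y`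
the sum telescopes. -/
theorem tsum_durfeeTerm_mul_nome (hp0 : p ≠ 0) (hp : ‖p‖ < 1) (hy : y ≠ 0)
    (h : ∀ n : ℤ, y * p ^ n ≠ 1) :
    1 + ∑' n, durfeeTerm p n (y * p)
      = -p * y ^ 3 * (1 + ∑' n, durfeeTerm p n y) - p * y ^ 2 + 1 := by
  have h1 := one_sub_mul_pow_ne_zero h
  have h2 := one_sub_inv_mul_pow_ne_zero hp0 hy h
  have hyp (n : ℤ) : y * p * p ^ n ≠ 1 := by
    rw [mul_assoc, ← zpow_one_add₀ hp0]; exact h _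
  have hs := summable_durfeeTerm hp0 hp hy h
  have hs' := summable_durfeeTerm hp0 hp (mul_ne_zero hy hp0) hyp
  set T : ℕ → ℂ := fun n => durfeeTerm p n y * (1 - y⁻¹ * p ^ (n + 1)) * (p * y * (1 - y ^ 2))
    with hT
  have hstep (n : ℕ) : T (n + 1) - T n
      = durfeeTerm p n (y * p) + p * y ^ 3 * durfeeTerm p n y := by
    have h8 := h1 (n + 1)
    have h9 := h2 (n + 2)
    simp only [hT]
    rw [durfeeTerm_succ, durfeeTerm_mul_nome hp0 hy h, show n + 1 + 1 = n + 2 by ring]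
    generalize durfeeTerm p n y = S at *
    rw [show p ^ (2 * n + 2) = (p ^ (n + 1)) ^ 2 by ring]
    generalize p ^ (n + 1) = P at *
    generalize 1 - y⁻¹ * p ^ (n + 2) = B at *
    have h8' : 1 - P * y ≠ 0 := by rwa [mul_comm]
    field_simp
    ring
  have htend : Tendsto T atTop (𝓝 0) := by
    have hpow : Tendsto (fun n : ℕ => 1 - y⁻¹ * p ^ (n + 1)) atTop (𝓝 1) := by
      have := ((tendsto_pow_atTop_nhds_zero_of_norm_lt_one hp).comp
        (tendsto_add_atTop_nat 1)).const_mul y⁻¹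
      simpa using this.const_sub 1
    simpa using (hs.tendsto_atTop_zero.mul hpow).mul_const (p * y * (1 - y ^ 2))
  have hsum : ∑' n, (T (n + 1) - T n) = 0 - T 0 := by
    have hsm : Summable fun n => T (n + 1) - T n := by
      simp only [hstep]; exact hs'.add (hs.mul_left _)
    refine tendsto_nhds_unique hsm.hasSum.tendsto_sum_nat ?_
    simp only [Finset.sum_range_sub]
    exact htend.sub_const _
  have hT0 : T 0 = p * y ^ 2 * (1 + y) := by
    have a1 : y ≠ 1 := by simpa using h 0
    have a2 : y ≠ p := by
      intro h0; apply h (-1); rw [h0, zpow_neg_one, mul_inv_cancel₀ hp0]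
    simp only [hT]
    rw [durfeeTerm_zero a1 hy a2]
    have b1 : 1 - y ≠ 0 := sub_ne_zero.mpr a1.symm
    have b2 : y - p ≠ 0 := sub_ne_zero.mpr a2
    rw [zero_add, pow_one, show 1 - y⁻¹ * p = (y - p) / y by field_simp]
    field_simp
    ring
  simp only [hstep] at hsum
  rw [hs'.tsum_add (hs.mul_left _), tsum_mul_left, hT0] at hsum
  linear_combination hsum

end Regular

/-- A doubly quasi-periodic entire function of negative degree vanishes. -/
theorem eq_zero_of_quasiPeriodic {D : ℂ → ℂ} {l : ℂ} (hD : Differentiable ℂ D) (hl : l.re < 0)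
    (h1 : ∀ w, D (w + 2 * Real.pi * I) = D w)
    (h2 : ∀ w, D (w + l) = exp l * exp (2 * w) * D w) : D = 0 := by
  -- bounded on a fundamental cell
  have hzper (n : ℤ) (w : ℂ) : D (w + n * (2 * Real.pi * I)) = D w := by
    have hp : Function.Periodic D (2 * Real.pi * I) := h1
    simpa using hp.int_mul n w
  obtain ⟨M, hM⟩ : ∃ M, ∀ w : ℂ, l.re ≤ w.re → w.re ≤ -l.re → ‖D w‖ ≤ M := by
    obtain ⟨M, hM⟩ := ((isCompact_Icc (a := l.re) (b := -l.re)).reProdIm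
      (isCompact_Icc (a := 0) (b := 2 * Real.pi))).exists_bound_of_continuousOn
      hD.continuous.continuousOn
    refine ⟨M, fun w ha hb => ?_⟩
    have hpi : 0 < 2 * Real.pi := Real.two_pi_pos
    obtain ⟨h3, h4⟩ := toIcoMod_mem_Ico hpi 0 w.im
    rw [← hzper (-toIcoDiv hpi 0 w.im) w]
    refine hM _ ⟨by simpa using ⟨ha, hb⟩, ?_⟩
    have : (w + ((-toIcoDiv hpi 0 w.im : ℤ) : ℂ) * (2 * Real.pi * I)).im
        = toIcoMod hpi 0 w.im := by
      have e : toIcoMod hpi 0 w.im = w.im - toIcoDiv hpi 0 w.im * (2 * Real.pi) := by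
        rw [toIcoMod, zsmul_eq_mul]
      rw [e]
      simp only [add_im, mul_im, mul_re, I_re, I_im, intCast_re, intCast_im, ofReal_re, ofReal_im,
        re_ofNat, im_ofNat]
      push_cast
      ring
    rw [Set.mem_preimage, this]
    exact ⟨h3, by linarith⟩
  have hexp : ‖exp l‖ ≤ 1 := by rw [norm_exp]; exact Real.exp_le_one_iff.mpr hl.le
  have hneg (n : ℕ) : ∀ w : ℂ, (n + 1) * l.re ≤ w.re → w.re ≤ 0 → ‖D w‖ ≤ M := by
    induction n with
    | zero => exact fun w ha hb => hM w (by simpa using ha) (by linarith)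
    | succ n ih =>
      intro w ha hb
      rcases le_total l.re w.re with hc | hc
      · exact hM w hc (by linarith)
      have h3 := h2 (w - l)
      rw [sub_add_cancel] at h3
      rw [h3, norm_mul, norm_mul]
      have h4 : ‖exp (2 * (w - l))‖ ≤ 1 := by
        rw [norm_exp]; apply Real.exp_le_one_iff.mpr; simp; linarith
      have h5 := ih (w - l) (by push_cast at ha; simp; linarith) (by simp; linarith)
      calc _ ≤ 1 * 1 * ‖D (w - l)‖ := by gcongr
        _ ≤ M := by simpa using h5
  have hpos (n : ℕ) : ∀ w : ℂ, 0 ≤ w.re → w.re ≤ -((n + 1) * l.re) → ‖D w‖ ≤ M := by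
    induction n with
    | zero => exact fun w ha hb => hM w (by linarith) (by simpa using hb)
    | succ n ih =>
      intro w ha hb
      rcases le_total w.re (-l.re) with hc | hc
      · exact hM w (by linarith) hc
      have h5 := ih (w + l) (by simp; linarith) (by push_cast at hb; simp; linarith)
      have h3 : D w = exp (-l - 2 * w) * D (w + l) := by
        rw [h2, ← mul_assoc, ← exp_add, ← exp_add]
        simp
      have h4 : ‖exp (-l - 2 * w)‖ ≤ 1 := by
        rw [norm_exp]; apply Real.exp_le_one_iff.mpr; simp; linarith
      rw [h3, norm_mul]
      calc _ ≤ 1 * ‖D (w + l)‖ := by gcongr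
        _ ≤ M := by simpa using h5
  have hbd : ∀ w, ‖D w‖ ≤ M := by
    intro w
    obtain ⟨n, hn⟩ := exists_nat_ge (|w.re| / -l.re)
    rw [div_le_iff₀ (by linarith)] at hn
    rcases le_total 0 w.re with hw | hw
    · refine hpos n w hw ?_
      rw [abs_of_nonneg hw] at hn; linarith
    · refine hneg n w ?_ hw
      rw [abs_of_nonpos hw] at hn; linarith
  have hconst := hD.apply_eq_apply_of_bounded
    (isBounded_iff_forall_norm_le.mpr ⟨M, by rintro _ ⟨w, rfl⟩; exact hbd w⟩)
  -- a constant with the second quasi-period is zero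
  have h3 := h2 (-l)
  rw [hconst (-l + l) 0, hconst (-l) 0] at h3
  have h4 : exp l * exp (2 * -l) ≠ 1 := by
    rw [← exp_add]
    intro h0
    have := congrArg norm h0
    rw [norm_exp, norm_one, Real.exp_eq_one_iff] at this
    simp at this
    linarith
  have h5 : D 0 = 0 := by
    by_contra hne
    exact h4 (mul_right_cancel₀ hne (by rw [← h3, one_mul]))
  funext w
  rw [hconst w 0, h5]; rfl

/-- The rank function as a sum over Durfee squares.  The difference of the two sides, multiplied by
the theta function `thetaProd`, is entire in `log y` and doubly quasi-periodic of negative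
degree. -/
theorem rankFn_eq_tsum_durfeeTerm {p y : ℂ} (hp0 : p ≠ 0) (hp : ‖p‖ < 1) (hy : y ≠ 0)
    (h : ∀ n : ℤ, y * p ^ n ≠ 1) : rankFn p y = 1 + ∑' n, durfeeTerm p n y := by
  set l := log p with hl
  have hel : exp l = p := exp_log hp0
  have hlre : l.re < 0 := by
    rw [hl, log_re]; exact Real.log_neg (norm_pos_iff.mpr hp0) hp
  have hΘd : Differentiable ℂ fun w => thetaProd p (exp w) := by
    have h1 := differentiable_qp hp
    have h2 : Differentiable ℂ fun w => (exp w)⁻¹ :=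
      (differentiable_exp).inv fun w => exp_ne_zero w
    exact (h1.comp differentiable_exp).mul (h1.comp (h2.mul_const p))
  -- the part coming from the sum over Durfee squares
  have hAd : Differentiable ℂ fun w => ∑' n, durfeeNum p n (exp w) := by
    have hloc (R : ℝ) : DifferentiableOn ℂ (fun w => ∑' n, durfeeNum p n (exp w))
        (Metric.ball 0 R) := by
      refine differentiableOn_tsum_of_summable_norm
        (u := fun n => Real.exp R * (Real.exp (Real.exp R * (1 / (1 - ‖p‖)))) ^ 2 * ‖p‖ ^ n)
        ((summable_geometric_of_lt_one (norm_nonneg p) hp).mul_left _) (fun n => ?_)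
        Metric.isOpen_ball fun n w hw => ?_
      · have h1 := differentiable_qp hp
        have h2 : Differentiable ℂ fun w => (exp w)⁻¹ :=
          (differentiable_exp).inv fun w => exp_ne_zero w
        exact (((differentiable_exp.mul_const _).mul
          (h1.comp (differentiable_exp.mul_const _))).mul
          (h1.comp (h2.mul_const _))).differentiableOn
      · have hw' : |w.re| ≤ R := (abs_re_le_norm w).trans (by simpa using (Metric.mem_ball.mp hw).le)
        refine norm_durfeeNum_le hp ?_ ?_ n
        · rw [norm_exp]; exact Real.exp_le_exp.mpr ((le_abs_self _).trans hw')
        · rw [← exp_neg, norm_exp]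
          exact Real.exp_le_exp.mpr (by simpa using (neg_le_abs _).trans hw')
    exact fun w => (hloc (‖w‖ + 1)).differentiableAt (Metric.isOpen_ball.mem_nhds (by simp))
  set F : ℂ → ℂ := fun w => thetaProd p (exp w) * (1 - rankFn p (exp w))
    + ∑' n, durfeeNum p n (exp w) with hF
  have hFreg {w : ℂ} (hw : ∀ n : ℤ, exp w * p ^ n ≠ 1) : ContinuousAt F w := by
    have h1 : ContinuousAt (fun w => rankFn p (exp w)) w :=
      ContinuousAt.comp (g := rankFn p) (analyticAt_rankFn hp0 hp (exp_ne_zero _) hw).continuousAt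
        (by fun_prop)
    exact (hΘd.continuous.continuousAt.mul (continuousAt_const.sub h1)).add
      hAd.continuous.continuousAt
  have hFeq {w : ℂ} (hw : ∀ n : ℤ, exp w * p ^ n ≠ 1) : F w
      = thetaProd p (exp w) * (1 + ∑' n, durfeeTerm p n (exp w) - rankFn p (exp w)) := by
    simp only [hF]
    simp only [← thetaProd_mul_durfeeTerm hp0 hp (exp_ne_zero _) hw, tsum_mul_left]
    ring
  obtain ⟨D, hDd, hDF⟩ := exists_entire_extension (F := F) (fun w₀ => by
    by_cases hw : ∀ n : ℤ, exp w₀ * p ^ n ≠ 1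
    · have h1 : AnalyticAt ℂ (fun w => rankFn p (exp w)) w₀ :=
        AnalyticAt.fun_comp (analyticAt_rankFn hp0 hp (exp_ne_zero _) hw) (by fun_prop)
      refine ⟨F, ?_, by simp⟩
      exact ((hΘd.analyticAt _).mul (analyticAt_const.sub h1)).add (hAd.analyticAt _)
    · push Not at hw
      obtain ⟨n, hn⟩ := hw
      obtain ⟨H, hH, hHe⟩ := exists_rankFn_eq_add_polar hp0 hp n hn
      have hH' : AnalyticAt ℂ (fun w => H (exp w)) w₀ := AnalyticAt.fun_comp hH (by fun_prop)
      have hds {f : ℂ → ℂ} (hf : Differentiable ℂ f) : AnalyticAt ℂ (dslope f w₀) w₀ :=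
        ((differentiableOn_dslope (s := Set.univ) univ_mem).mpr
          hf.differentiableOn).analyticAt univ_mem
      set E : ℂ → ℂ := fun w => 1 - exp w * p ^ n with hE
      have hEd : Differentiable ℂ E := by simp only [hE]; fun_prop
      have hE0 : dslope E w₀ w₀ ≠ 0 := by
        rw [dslope_same]
        have : HasDerivAt E (-(exp w₀ * p ^ n)) w₀ :=
          ((Complex.hasDerivAt_exp w₀).mul_const _).const_sub 1
        rw [this.deriv, hn]; norm_num
      refine ⟨fun w => thetaProd p (exp w) * (1 - H (exp w)) - 1 / qPoch p * ((-1 : ℂ) ^ n * p ^ pent n)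
          * (dslope (fun w => thetaProd p (exp w)) w₀ w / dslope E w₀ w)
          + ∑' n, durfeeNum p n (exp w), ?_, ?_⟩
      · exact (((hΘd.analyticAt _).mul (analyticAt_const.sub hH')).sub
          (analyticAt_const.mul ((hds hΘd).div (hds hEd) hE0))).add (hAd.analyticAt _)
      · filter_upwards [self_mem_nhdsWithin] with w hw
        have hw' : w - w₀ ≠ 0 := sub_ne_zero.mpr hw
        simp only [hF]
        have e1 : E w₀ = 0 := by simp [hE, hn]
        rw [hHe _ (exp_ne_zero _), dslope_of_ne _ hw, dslope_of_ne _ hw, slope_def_field,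
          slope_def_field, thetaProd_eq_zero hp0 hp n hn, e1, sub_zero, sub_zero,
          div_div_div_cancel_right₀ hw']
        simp only [hE]
        ring)
  -- the regular points are dense
  have hpole (w : ℂ) : (∀ n : ℤ, exp (w + l) * p ^ n ≠ 1) ↔ ∀ n : ℤ, exp w * p ^ n ≠ 1 := by
    have e (n : ℤ) : exp (w + l) * p ^ n = exp w * p ^ (n + 1) := by
      rw [exp_add, hel, zpow_add_one₀ hp0]; ring
    refine ⟨fun hw n => ?_, fun hw n => by rw [e]; exact hw _⟩
    have := hw (n - 1)
    rwa [e, sub_add_cancel] at this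
  have hdense : Dense {w : ℂ | ∀ n : ℤ, exp w * p ^ n ≠ 1} := by
    have : {w : ℂ | ∀ n : ℤ, exp w * p ^ n ≠ 1} = {w | thetaProd p (exp w) = 0}ᶜ := by
      ext w
      simp only [Set.mem_ofPred_eq, Set.mem_compl_iff]
      refine ⟨fun hw => thetaProd_ne_zero hp0 hp (exp_ne_zero _) hw, fun hw n hn => ?_⟩
      exact hw (thetaProd_eq_zero hp0 hp n hn)
    rw [this, ← interior_eq_empty_iff_dense_compl]
    by_contra hne
    obtain ⟨w₀, hw₀⟩ := Set.nonempty_iff_ne_empty.mpr hne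
    have hz := hΘd.differentiableOn.analyticOnNhd isOpen_univ |>.eq_of_eventuallyEq
      (g := fun _ => 0) (fun _ _ => analyticAt_const) (z₀ := w₀)
      (by
        filter_upwards [isOpen_interior.mem_nhds hw₀] with w hw
        have h0 : w ∈ {w | thetaProd p (exp w) = 0} := interior_subset hw
        exact h0)
    refine thetaProd_ne_zero hp0 hp hy h ?_
    have := congrFun hz (log y)
    simpa [exp_log hy] using this
  have hDreg {w : ℂ} (hw : ∀ n : ℤ, exp w * p ^ n ≠ 1) : D w
      = thetaProd p (exp w) * (1 + ∑' n, durfeeTerm p n (exp w) - rankFn p (exp w)) := by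
    rw [hDF w (hFreg hw), hFeq hw]
  have hD0 : D = 0 := by
    refine eq_zero_of_quasiPeriodic hDd hlre (fun w => ?_) fun w => ?_
    · have : (fun w => D (w + 2 * Real.pi * I)) = D := by
        have hc := hDd.continuous
        refine Continuous.ext_on hdense (hc.comp (by fun_prop)) hc fun w hw => ?_
        have e : exp (w + 2 * Real.pi * I) = exp w := by rw [exp_add, exp_two_pi_mul_I, mul_one]
        rw [hDreg (w := w + _) (by rw [e]; exact hw), hDreg hw, e]
      exact congrFun this w
    · have : (fun w => D (w + l)) = fun w => exp l * exp (2 * w) * D w := by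
        have hc := hDd.continuous
        refine Continuous.ext_on hdense (hc.comp (by fun_prop))
          (Continuous.mul (by fun_prop) hc) fun w hw => ?_
        have hw' := (hpole w).mpr hw
        have e : exp (w + l) = exp w * p := by rw [exp_add, hel]
        rw [hDreg hw', hDreg hw, e, thetaProd_mul_nome hp0 hp (exp_ne_zero _),
          rankFn_mul_nome hp0 hp (exp_ne_zero _) hw,
          tsum_durfeeTerm_mul_nome hp0 hp (exp_ne_zero _) hw, hel, two_mul w, exp_add]
        have := exp_ne_zero w
        field_simp
        ring
      exact congrFun this w
  have hfin := hDreg (w := log y) (by rw [exp_log hy]; exact h)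
  rw [hD0, exp_log hy, Pi.zero_apply, eq_comm, mul_eq_zero] at hfin
  rcases hfin with h0 | h0
  · exact absurd h0 (thetaProd_ne_zero hp0 hp hy h)
  · exact (sub_eq_zero.mp h0).symm

/-! ### The generating function of odd Durfee symbols -/

/-- Splitting off all copies of `a` from a multiset with elements in `insert a s`. -/
def multisetInsertEquiv {α : Type*} [DecidableEq α] {a : α} {s : Finset α} (ha : a ∉ s) :
    ℕ × {m : Multiset α // ∀ b ∈ m, b ∈ s} ≃ {m : Multiset α // ∀ b ∈ m, b ∈ insert a s} where
  toFun x := ⟨Multiset.replicate x.1 a + x.2.1, fun b hb => by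
    rcases Multiset.mem_add.mp hb with h | h
    · rw [Multiset.eq_of_mem_replicate h]; exact Finset.mem_insert_self _ _
    · exact Finset.mem_insert_of_mem (x.2.2 b h)⟩
  invFun m := ⟨m.1.count a, m.1.filter (· ≠ a), fun b hb => by
    obtain ⟨h1, h2⟩ := Multiset.mem_filter.mp hb
    exact (Finset.mem_insert.mp (m.2 b h1)).resolve_left h2⟩
  left_inv := by
    rintro ⟨n, m, hm⟩
    have hna : a ∉ m := fun h => ha (hm a h)
    refine Prod.ext ?_ (Subtype.ext ?_)
    · simp [Multiset.count_eq_zero_of_notMem hna]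
    · simp only [Multiset.filter_add]
      rw [Multiset.filter_eq_nil.mpr, zero_add, Multiset.filter_eq_self.mpr]
      · rintro b hb rfl; exact hna hb
      · intro b hb; simpa using Multiset.eq_of_mem_replicate hb
  right_inv := by
    rintro ⟨m, hm⟩
    refine Subtype.ext ?_
    have := Multiset.filter_add_not (· = a) m
    rwa [Multiset.filter_eq'] at this

theorem hasSum_mul_of_summable_norm {ι κ : Type*} {f : ι → ℂ} {g : κ → ℂ} {a b : ℂ}
    (hf : HasSum f a) (hg : HasSum g b) (hf' : Summable fun i => ‖f i‖)
    (hg' : Summable fun i => ‖g i‖) : HasSum (fun x : ι × κ => f x.1 * g x.2) (a * b) :=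
  hf.mul hg (summable_mul_of_summable_norm hf' hg')

/-- The generating function of multisets: `∑_m ∏_{a ∈ m} f(a) = ∏_{a ∈ s} 1 / (1 - f(a))`. -/
theorem hasSum_multiset_prod {α : Type*} (s : Finset α) (f : α → ℂ)
    (hf : ∀ a ∈ s, ‖f a‖ < 1) :
    (Summable fun m : {m : Multiset α // ∀ b ∈ m, b ∈ s} => ‖(m.1.map f).prod‖) ∧
      HasSum (fun m : {m : Multiset α // ∀ b ∈ m, b ∈ s} => (m.1.map f).prod)
        (∏ a ∈ s, (1 - f a)⁻¹) := by
  classical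
  induction s using Finset.induction_on with
  | empty =>
    have h : HasSum (fun m : {m : Multiset α // ∀ b ∈ m, b ∈ (∅ : Finset α)} => (m.1.map f).prod)
        1 := by
      have h1 := hasSum_single (f := fun m : {m : Multiset α // ∀ b ∈ m, b ∈ (∅ : Finset α)} =>
        (m.1.map f).prod) ⟨0, by simp⟩ fun m hm => absurd (Subtype.ext
          (Multiset.eq_zero_of_forall_notMem fun b hb => by simpa using m.2 b hb)) hm
      simpa using h1
    exact ⟨h.summable.norm, by simpa using h⟩
  | insert a s ha ih =>
    obtain ⟨h1, h2⟩ := ih fun b hb => hf b (Finset.mem_insert_of_mem hb)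
    have hfa := hf a (Finset.mem_insert_self _ _)
    have hg : Summable fun n : ℕ => ‖f a ^ n‖ := by
      simpa using summable_geometric_of_lt_one (norm_nonneg _) hfa
    have e (x : ℕ × {m : Multiset α // ∀ b ∈ m, b ∈ s}) :
        ((multisetInsertEquiv ha x).1.map f).prod = f a ^ x.1 * (x.2.1.map f).prod := by
      simp [multisetInsertEquiv]
    constructor
    · rw [← (multisetInsertEquiv ha).summable_iff]
      refine (Summable.mul_norm hg h1).congr fun x => ?_
      rw [Function.comp_apply, e]
    · rw [← (multisetInsertEquiv ha).hasSum_iff, Finset.prod_insert ha]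
      have h3 := hasSum_mul_of_summable_norm (f := fun n : ℕ => f a ^ n)
        (g := fun m : {m : Multiset α // ∀ b ∈ m, b ∈ s} => (m.1.map f).prod)
        (hasSum_geometric_of_norm_lt_one hfa) h2 hg h1
      convert h3 using 1
      funext x
      rw [Function.comp_apply, e]

/-- The odd numbers up to `2n + 1`. -/
def oddsUpTo (n : ℕ) : Finset ℕ := (Finset.range (n + 1)).image fun j => 2 * j + 1

theorem mem_oddsUpTo {n a : ℕ} : a ∈ oddsUpTo n ↔ Odd a ∧ a ≤ 2 * n + 1 := by
  simp only [oddsUpTo, Finset.mem_image, Finset.mem_range]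
  constructor
  · rintro ⟨j, hj, rfl⟩; exact ⟨⟨j, rfl⟩, by omega⟩
  · rintro ⟨⟨j, rfl⟩, h⟩; exact ⟨j, by omega, rfl⟩

theorem prod_oddsUpTo {M : Type*} [CommMonoid M] (n : ℕ) (f : ℕ → M) :
    ∏ a ∈ oddsUpTo n, f a = ∏ j ∈ Finset.range (n + 1), f (2 * j + 1) :=
  Finset.prod_image fun _ _ _ _ h => by simpa using h

/-- An odd Durfee symbol is its subscript with two rows. -/
def OddDurfeeSymbol.equivSigma : OddDurfeeSymbol ≃
    Σ n : ℕ, {m : Multiset ℕ // ∀ b ∈ m, b ∈ oddsUpTo n} ×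
      {m : Multiset ℕ // ∀ b ∈ m, b ∈ oddsUpTo n} where
  toFun σ := ⟨σ.side, ⟨σ.top, fun b hb => mem_oddsUpTo.mpr (σ.top_spec b hb)⟩,
    ⟨σ.bottom, fun b hb => mem_oddsUpTo.mpr (σ.bottom_spec b hb)⟩⟩
  invFun x := ⟨x.1, x.2.1.1, x.2.2.1, fun b hb => mem_oddsUpTo.mp (x.2.1.2 b hb),
    fun b hb => mem_oddsUpTo.mp (x.2.2.2 b hb)⟩
  left_inv _ := rfl
  right_inv _ := rfl

theorem prod_map_mul_pow (m : Multiset ℕ) (u q : ℂ) :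
    (m.map fun a => u * q ^ a).prod = u ^ m.card * q ^ m.sum := by
  induction m using Multiset.induction_on with
  | empty => simp
  | cons a m ih =>
    rw [Multiset.map_cons, Multiset.prod_cons, ih, Multiset.card_cons, Multiset.sum_cons, pow_succ,
      pow_add]
    ring

theorem norm_mul_pow_lt_one {q u : ℂ} (hq : ‖q‖ < 1) (hu : ‖u * q‖ < 1) {a : ℕ} (ha : 1 ≤ a) :
    ‖u * q ^ a‖ < 1 := by
  refine lt_of_le_of_lt ?_ hu
  rw [norm_mul, norm_mul, norm_pow]
  exact mul_le_mul_of_nonneg_left (pow_le_of_le_one (norm_nonneg _) hq.le (by omega))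
    (norm_nonneg _)

/-- In the annulus `|q| < |x| < |q|⁻¹` there are no poles. -/
theorem mul_zpow_ne_one {q x : ℂ} (hq : ‖q‖ < 1)
    (hx : ‖x * q‖ < 1) (hx' : ‖x⁻¹ * q‖ < 1) (n : ℤ) : x * q ^ (2 * n + 1) ≠ 1 := by
  intro h
  rcases le_or_gt 0 n with hn | hn
  · have h1 := norm_mul_pow_lt_one hq hx (a := 2 * n.toNat + 1) (by omega)
    have e : x * q ^ (2 * n.toNat + 1) = x * q ^ (2 * n + 1) := by
      rw [← zpow_natCast]; push_cast; rw [Int.toNat_of_nonneg hn]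
    rw [e, h, norm_one] at h1
    exact lt_irrefl _ h1
  · have h1 := norm_mul_pow_lt_one hq hx' (a := 2 * (-n - 1).toNat + 1) (by omega)
    have e : x⁻¹ * q ^ (2 * (-n - 1).toNat + 1) = (x * q ^ (2 * n + 1))⁻¹ := by
      rw [← zpow_natCast, mul_inv, ← zpow_neg]
      congr 2
      omega
    rw [e, h, inv_one, norm_one] at h1
    exact lt_irrefl _ h1

/-- The generating function of the pairs of rows belonging to a given subscript. -/
theorem hasSum_rows {q u v : ℂ} (hq : ‖q‖ < 1) (hu : ‖u * q‖ < 1) (hv : ‖v * q‖ < 1) (n : ℕ) :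
    (Summable fun x : {m : Multiset ℕ // ∀ b ∈ m, b ∈ oddsUpTo n} ×
        {m : Multiset ℕ // ∀ b ∈ m, b ∈ oddsUpTo n} =>
        ‖u ^ x.1.1.card * v ^ x.2.1.card * q ^ (2 * n ^ 2 + 2 * n + 1 + x.1.1.sum + x.2.1.sum)‖) ∧
      HasSum (fun x : {m : Multiset ℕ // ∀ b ∈ m, b ∈ oddsUpTo n} ×
        {m : Multiset ℕ // ∀ b ∈ m, b ∈ oddsUpTo n} =>
        u ^ x.1.1.card * v ^ x.2.1.card * q ^ (2 * n ^ 2 + 2 * n + 1 + x.1.1.sum + x.2.1.sum))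
        (q ^ (2 * n ^ 2 + 2 * n + 1) * ((∏ j ∈ Finset.range (n + 1), (1 - u * q ^ (2 * j + 1))⁻¹) *
          ∏ j ∈ Finset.range (n + 1), (1 - v * q ^ (2 * j + 1))⁻¹)) := by
  have hodd {w : ℂ} (hw : ‖w * q‖ < 1) : ∀ a ∈ oddsUpTo n, ‖w * q ^ a‖ < 1 := fun a ha => by
    obtain ⟨⟨j, rfl⟩, -⟩ := mem_oddsUpTo.mp ha
    exact norm_mul_pow_lt_one hq hw (by omega)
  obtain ⟨h1, h2⟩ := hasSum_multiset_prod (oddsUpTo n) (fun a => u * q ^ a) (hodd hu)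
  obtain ⟨h3, h4⟩ := hasSum_multiset_prod (oddsUpTo n) (fun a => v * q ^ a) (hodd hv)
  simp only [prod_map_mul_pow, prod_oddsUpTo] at h1 h2 h3 h4
  have e (x : {m : Multiset ℕ // ∀ b ∈ m, b ∈ oddsUpTo n} ×
      {m : Multiset ℕ // ∀ b ∈ m, b ∈ oddsUpTo n}) :
      u ^ x.1.1.card * v ^ x.2.1.card * q ^ (2 * n ^ 2 + 2 * n + 1 + x.1.1.sum + x.2.1.sum)
      = q ^ (2 * n ^ 2 + 2 * n + 1) * (u ^ x.1.1.card * q ^ x.1.1.sum *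
          (v ^ x.2.1.card * q ^ x.2.1.sum)) := by
    rw [pow_add, pow_add]; ring
  have hs := Summable.mul_norm h1 h3
  simp only [e]
  constructor
  · refine (hs.mul_left ‖q ^ (2 * n ^ 2 + 2 * n + 1)‖).congr fun x => ?_
    rw [norm_mul (q ^ _)]
  · exact (hasSum_mul_of_summable_norm h2 h4 h1 h3).mul_left _

/-- A majorant for all the sums over odd Durfee symbols. -/
theorem summable_symbols {r ρ : ℝ} (hr0 : 0 < r) (hr : r < 1) (hρ0 : 0 ≤ ρ) (hρ : ρ * r < 1) :
    Summable fun σ : OddDurfeeSymbol => ρ ^ (σ.top.card + σ.bottom.card) * r ^ σ.size := by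
  have hq : ‖(r : ℂ)‖ < 1 := by rwa [norm_real, Real.norm_of_nonneg hr0.le]
  have hu : ‖(ρ : ℂ) * (r : ℂ)‖ < 1 := by
    rwa [norm_mul, norm_real, norm_real, Real.norm_of_nonneg hr0.le, Real.norm_of_nonneg hρ0]
  rw [← OddDurfeeSymbol.equivSigma.symm.summable_iff]
  have hrow := hasSum_rows hq hu hu
  have hnn (x : Σ n : ℕ, {m : Multiset ℕ // ∀ b ∈ m, b ∈ oddsUpTo n} ×
      {m : Multiset ℕ // ∀ b ∈ m, b ∈ oddsUpTo n}) :
      ((fun σ : OddDurfeeSymbol => ρ ^ (σ.top.card + σ.bottom.card) * r ^ σ.size) ∘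
        OddDurfeeSymbol.equivSigma.symm) x = ρ ^ x.2.1.1.card * ρ ^ x.2.2.1.card *
        r ^ (2 * x.1 ^ 2 + 2 * x.1 + 1 + x.2.1.1.sum + x.2.2.1.sum) := by
    simp [OddDurfeeSymbol.equivSigma, OddDurfeeSymbol.size, pow_add]
  set t : ℕ → ℝ := fun n => r ^ (2 * n ^ 2 + 2 * n + 1) *
    ((∏ j ∈ Finset.range (n + 1), (1 - ρ * r ^ (2 * j + 1))⁻¹) *
      ∏ j ∈ Finset.range (n + 1), (1 - ρ * r ^ (2 * j + 1))⁻¹) with ht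
  have hrow' (n : ℕ) : HasSum (fun x : {m : Multiset ℕ // ∀ b ∈ m, b ∈ oddsUpTo n} ×
        {m : Multiset ℕ // ∀ b ∈ m, b ∈ oddsUpTo n} =>
        ρ ^ x.1.1.card * ρ ^ x.2.1.card * r ^ (2 * n ^ 2 + 2 * n + 1 + x.1.1.sum + x.2.1.sum))
        (t n) := by
    have := (hrow n).2
    rw [← hasSum_ofReal]
    convert this using 1
    · funext x; push_cast; rfl
    · simp only [ht]; push_cast; rfl
  rw [summable_sigma_of_nonneg]
  · simp only [hnn]
    refine ⟨fun n => (hrow' n).summable, ?_⟩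
    simp only [(hrow' _).tsum_eq]
    -- consecutive terms have a ratio tending to zero
    have hpos (j : ℕ) : 0 < 1 - ρ * r ^ (2 * j + 1) := by
      have : ρ * r ^ (2 * j + 1) ≤ ρ * r :=
        mul_le_mul_of_nonneg_left (pow_le_of_le_one hr0.le hr.le (by omega)) hρ0
      linarith
    have htpos (n : ℕ) : 0 < t n := by
      have : 0 < ∏ j ∈ Finset.range (n + 1), (1 - ρ * r ^ (2 * j + 1))⁻¹ :=
        Finset.prod_pos fun j _ => inv_pos.mpr (hpos j)
      simp only [ht]; positivity
    refine summable_of_ratio_test_tendsto_lt_one (l := 0) one_pos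
      (Eventually.of_forall fun n => (htpos n).ne') ?_
    have hratio (n : ℕ) : ‖t (n + 1)‖ / ‖t n‖
        = r ^ (4 * n + 4) * ((1 - ρ * r ^ (2 * (n + 1) + 1))⁻¹) ^ 2 := by
      rw [Real.norm_of_nonneg (htpos _).le, Real.norm_of_nonneg (htpos _).le,
        div_eq_iff (htpos n).ne']
      simp only [ht]
      rw [Finset.prod_range_succ _ (n + 1), show 2 * (n + 1) ^ 2 + 2 * (n + 1) + 1
        = 4 * n + 4 + (2 * n ^ 2 + 2 * n + 1) by ring, pow_add r (4 * n + 4)]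
      ring
    simp only [hratio]
    have h0 := tendsto_pow_atTop_nhds_zero_of_lt_one hr0.le hr
    have h1 : Tendsto (fun n : ℕ => r ^ (4 * n + 4)) atTop (𝓝 0) :=
      h0.comp (tendsto_atTop_mono (fun n => (by omega : n ≤ 4 * n + 4)) tendsto_id)
    have h2 : Tendsto (fun n : ℕ => r ^ (2 * (n + 1) + 1)) atTop (𝓝 0) :=
      h0.comp (tendsto_atTop_mono (fun n => (by omega : n ≤ 2 * (n + 1) + 1)) tendsto_id)
    have h3 : Tendsto (fun n : ℕ => 1 - ρ * r ^ (2 * (n + 1) + 1)) atTop (𝓝 1) := by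
      simpa using (h2.const_mul ρ).const_sub 1
    simpa using h1.mul ((h3.inv₀ one_ne_zero).pow 2)
  · intro x
    rw [hnn]
    positivity

/-- The two-variable generating function of odd Durfee symbols by odd rank and size. -/
theorem tsum_symbols {q x : ℂ} (hq0 : q ≠ 0) (hq : ‖q‖ < 1) (hx0 : x ≠ 0) (hx : ‖x * q‖ < 1)
    (hx' : ‖x⁻¹ * q‖ < 1) :
    ∑' σ : OddDurfeeSymbol, x ^ σ.rank * q ^ σ.size =
      ∑' n : ℕ, q ^ (2 * n ^ 2 + 2 * n + 1) *
        ((∏ j ∈ Finset.range (n + 1), (1 - x * q ^ (2 * j + 1))⁻¹) *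
          ∏ j ∈ Finset.range (n + 1), (1 - x⁻¹ * q ^ (2 * j + 1))⁻¹) := by
  have hpos : 0 < ‖q‖ := norm_pos_iff.mpr hq0
  have hterm (σ : OddDurfeeSymbol) : x ^ σ.rank * q ^ σ.size
      = x ^ σ.top.card * x⁻¹ ^ σ.bottom.card * q ^ σ.size := by
    rw [OddDurfeeSymbol.rank, zpow_sub₀ hx0, zpow_natCast, zpow_natCast, inv_pow, div_eq_mul_inv]
  have hs : Summable fun σ : OddDurfeeSymbol => x ^ σ.rank * q ^ σ.size := by
    refine Summable.of_norm_bounded (summable_symbols hpos hq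
      (ρ := max ‖x‖ ‖x⁻¹‖) (by positivity) ?_) fun σ => ?_
    · rw [norm_mul] at hx hx'
      rcases max_cases ‖x‖ ‖x⁻¹‖ with ⟨h, -⟩ | ⟨h, -⟩ <;> rwa [h]
    · rw [hterm, norm_mul, norm_mul, norm_pow, norm_pow, norm_pow, pow_add]
      gcongr
      · exact le_max_left _ _
      · exact le_max_right _ _
  have hrow := hasSum_rows hq hx hx'
  rw [← OddDurfeeSymbol.equivSigma.symm.tsum_eq]
  rw [← OddDurfeeSymbol.equivSigma.symm.summable_iff] at hs
  change ∑' c, ((fun σ : OddDurfeeSymbol => x ^ σ.rank * q ^ σ.size) ∘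
    OddDurfeeSymbol.equivSigma.symm) c = _
  rw [Summable.tsum_sigma' (fun n => ?_) hs]
  · refine tsum_congr fun n => ?_
    rw [← (hrow n).2.tsum_eq]
    exact tsum_congr fun y => (hterm (OddDurfeeSymbol.equivSigma.symm ⟨n, y⟩)).trans rfl
  · refine (hrow n).2.summable.congr fun y => ?_
    exact ((hterm (OddDurfeeSymbol.equivSigma.symm ⟨n, y⟩)).trans rfl).symm

/-- `𝓡^o(q; w)` is, up to elementary factors, the generating function of odd Durfee symbols. -/
theorem calRo_eq_tsum_symbols {q w : ℂ} (hq0 : q ≠ 0) (hq : ‖q‖ < 1)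
    (hx : ‖exp (2 * Real.pi * I * w) * q‖ < 1) (hx' : ‖(exp (2 * Real.pi * I * w))⁻¹ * q‖ < 1) :
    calRo q w = 1 + exp (2 * Real.pi * I * w) *
      ∑' σ : OddDurfeeSymbol, exp (2 * Real.pi * I * w) ^ σ.rank * q ^ σ.size := by
  set x := exp (2 * Real.pi * I * w) with hxd
  have hx0 : x ≠ 0 := exp_ne_zero _
  have hp0 : q ^ 2 ≠ 0 := pow_ne_zero _ hq0
  have hp : ‖q ^ 2‖ < 1 := by rw [norm_pow]; exact pow_lt_one₀ (norm_nonneg _) hq (by norm_num)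
  have hreg (n : ℤ) : x * q * (q ^ 2) ^ n ≠ 1 := by
    have e : x * q * (q ^ 2) ^ n = x * q ^ (2 * n + 1) := by
      rw [← zpow_natCast, ← zpow_mul, zpow_add_one₀ hq0]; push_cast; ring
    rw [e]
    exact mul_zpow_ne_one hq hx hx' n
  rw [calRo_eq_rankFn q w hq0, ← hxd,
    rankFn_eq_tsum_durfeeTerm hp0 hp (mul_ne_zero hx0 hq0) hreg, tsum_symbols hq0 hq hx0 hx hx',
    ← tsum_mul_left]
  congr 1
  refine tsum_congr fun n => ?_
  rw [durfeeTerm, Finset.prod_inv_distrib, Finset.prod_inv_distrib, div_eq_mul_inv, mul_inv]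
  have e1 : ∏ j ∈ Finset.range (n + 1), (1 - x * q * (q ^ 2) ^ j)
      = ∏ j ∈ Finset.range (n + 1), (1 - x * q ^ (2 * j + 1)) :=
    Finset.prod_congr rfl fun j _ => by rw [← pow_mul]; ring
  have e2 : ∏ j ∈ Finset.range (n + 1), (1 - (x * q)⁻¹ * (q ^ 2) ^ (j + 1))
      = ∏ j ∈ Finset.range (n + 1), (1 - x⁻¹ * q ^ (2 * j + 1)) :=
    Finset.prod_congr rfl fun j _ => by rw [← pow_mul]; field_simp; ring
  rw [e1, e2, ← pow_mul]
  ring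

theorem one_le_size (σ : OddDurfeeSymbol) : 1 ≤ σ.size := by
  unfold OddDurfeeSymbol.size; omega

theorem finite_symbols_of_size (n : ℕ) : Finite {σ : OddDurfeeSymbol // σ.size = n} := by
  by_contra h
  rw [not_finite_iff_infinite] at h
  have h1 := (summable_symbols (r := 1 / 2) (ρ := 1) (by norm_num) (by norm_num) (by norm_num)
    (by norm_num)).comp_injective
    (Subtype.val_injective (p := fun σ : OddDurfeeSymbol => σ.size = n))
  have h2 : Summable fun _ : {σ : OddDurfeeSymbol // σ.size = n} => (1 / 2 : ℝ) ^ n := by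
    refine h1.congr fun σ => ?_
    simp [σ.2]
  rw [summable_const_iff] at h2
  exact absurd h2 (by positivity)

/-- The second moment is the sum of `binom(rank + 1, 2)` over the symbols. -/
theorem etaTwoOdd_eq_sum (n : ℕ) [Fintype {σ : OddDurfeeSymbol // σ.size = n}] :
    etaTwoOdd n = ∑ σ : {σ : OddDurfeeSymbol // σ.size = n}, Ring.choose (σ.1.rank + 1) 2 := by
  classical
  have hcard (m : ℤ) : oddRankCount m n = (Finset.univ.filter
      fun σ : {σ : OddDurfeeSymbol // σ.size = n} => σ.1.rank = m).card := by
    rw [oddRankCount, ← Fintype.card_subtype, ← Nat.card_eq_fintype_card]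
    exact Nat.card_congr (Equiv.subtypeSubtypeEquivSubtypeInter
      (fun σ : OddDurfeeSymbol => σ.size = n) (fun σ => σ.rank = m)).symm
  rw [etaTwoOdd, Finset.sum_comp (fun m => Ring.choose (m + 1) 2)
    (fun σ : {σ : OddDurfeeSymbol // σ.size = n} => σ.1.rank)]
  rw [finsum_eq_sum_of_support_subset (s := Finset.univ.image
    fun σ : {σ : OddDurfeeSymbol // σ.size = n} => σ.1.rank)]
  · refine Finset.sum_congr rfl fun m _ => ?_
    rw [hcard, nsmul_eq_mul, mul_comm]
  · intro m hm
    rw [Function.mem_support, hcard] at hm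
    have hne : (Finset.univ.filter
      fun σ : {σ : OddDurfeeSymbol // σ.size = n} => σ.1.rank = m).Nonempty := by
      rw [← Finset.card_pos]
      rcases Nat.eq_zero_or_pos (Finset.univ.filter
        fun σ : {σ : OddDurfeeSymbol // σ.size = n} => σ.1.rank = m).card with h | h
      · rw [h] at hm; simp at hm
      · exact h
    obtain ⟨σ, hσ⟩ := hne
    exact Finset.mem_coe.mpr (Finset.mem_image.mpr ⟨σ, by simp, (Finset.mem_filter.mp hσ).2⟩)

theorem choose_succ_two (m : ℤ) : ((Ring.choose (m + 1) 2 : ℤ) : ℂ) = (m + 1) * m / 2 := by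
  have h := Ring.descPochhammer_eq_factorial_smul_choose (m + 1) 2
  have h2 : (m + 1) * m = 2 * Ring.choose (m + 1) 2 := by
    simpa [descPochhammer_succ_right, Nat.factorial, Polynomial.smeval_mul, Polynomial.smeval_sub]
      using h
  have h3 := congrArg (Int.cast : ℤ → ℂ) h2
  push_cast at h3
  rw [h3]; ring

/-- Collecting the symbols of a given size. -/
theorem hasSum_etaTwoOdd {q S : ℂ} (h : HasSum (fun σ : OddDurfeeSymbol =>
      ((Ring.choose (σ.rank + 1) 2 : ℤ) : ℂ) * q ^ σ.size) S) :
    HasSum (fun n : ℕ => (etaTwoOdd (n + 1) : ℂ) * q ^ (n + 1)) S := by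
  have h1 : HasSum (fun n : ℕ => (etaTwoOdd n : ℂ) * q ^ n) S := by
    rw [← (Equiv.sigmaFiberEquiv OddDurfeeSymbol.size).hasSum_iff] at h
    refine h.sigma fun n => ?_
    have := finite_symbols_of_size n
    have := Fintype.ofFinite {σ : OddDurfeeSymbol // σ.size = n}
    rw [etaTwoOdd_eq_sum, Int.cast_sum, Finset.sum_mul]
    have h2 := hasSum_fintype fun σ : {σ : OddDurfeeSymbol // σ.size = n} =>
      ((Ring.choose (σ.1.rank + 1) 2 : ℤ) : ℂ) * q ^ n
    convert h2 using 1
    funext σ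
    simp [Equiv.sigmaFiberEquiv, σ.2]
  have h0 : etaTwoOdd 0 = 0 := by
    have : IsEmpty {σ : OddDurfeeSymbol // σ.size = 0} :=
      ⟨fun σ => by have := one_le_size σ.1; have := σ.2; omega⟩
    have := Fintype.ofFinite {σ : OddDurfeeSymbol // σ.size = 0}
    rw [etaTwoOdd_eq_sum]
    simp
  have h2 := (hasSum_nat_add_iff' 1).mpr h1
  simpa [h0] using h2

/-! ### The second moment as a derivative -/

/-- The points `w` with `|e^{2πiw}|` and its inverse less than `ρ`. -/
def expAnnulus (ρ : ℝ) : Set ℂ :=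
  {w | ‖exp (2 * Real.pi * I * w)‖ < ρ ∧ ‖(exp (2 * Real.pi * I * w))⁻¹‖ < ρ}

theorem isOpen_expAnnulus (ρ : ℝ) : IsOpen (expAnnulus ρ) := by
  have h1 : Continuous fun w : ℂ => exp (2 * Real.pi * I * w) := by fun_prop
  exact (isOpen_lt h1.norm continuous_const).inter
    (isOpen_lt (h1.inv₀ fun w => exp_ne_zero _).norm continuous_const)

theorem zero_mem_expAnnulus {ρ : ℝ} (hρ : 1 < ρ) : (0 : ℂ) ∈ expAnnulus ρ := by
  constructor <;> simpa using hρ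

theorem norm_exp_zpow_rank_le {ρ : ℝ} {w : ℂ} (hw : w ∈ expAnnulus ρ) (σ : OddDurfeeSymbol) :
    ‖exp (2 * Real.pi * I * w) ^ σ.rank‖ ≤ ρ ^ (σ.top.card + σ.bottom.card) := by
  rw [OddDurfeeSymbol.rank, zpow_sub₀ (exp_ne_zero _), zpow_natCast, zpow_natCast, div_eq_mul_inv,
    ← inv_pow, norm_mul, norm_pow, norm_pow, pow_add]
  have h0 : 0 ≤ ρ := (norm_nonneg _).trans hw.1.le
  have h1 := hw.1.le
  have h2 := hw.2.le
  gcongr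

theorem hasDerivAt_exp_zpow (m : ℤ) (c w : ℂ) :
    HasDerivAt (fun w : ℂ => c * exp (2 * Real.pi * I * w) ^ m)
      (2 * Real.pi * I * m * (c * exp (2 * Real.pi * I * w) ^ m)) w := by
  have h : HasDerivAt (fun w : ℂ => c * exp (m * (2 * Real.pi * I * w)))
      (c * (exp (m * (2 * Real.pi * I * w)) * (m * (2 * Real.pi * I * 1)))) w :=
    ((((hasDerivAt_id w).const_mul (2 * Real.pi * I)).const_mul (m : ℂ)).cexp).const_mul c
  simp only [exp_int_mul] at h
  convert h using 1
  ring

/-- The series of odd Durfee symbols may be differentiated term by term: it is analytic in `w`, and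
applying `L^o` produces the weights `binom(rank + 1, 2)`. -/
theorem hasSum_Lo_calRo {q : ℂ} (hq0 : q ≠ 0) (hq : ‖q‖ < 1) :
    AnalyticAt ℂ (fun w => calRo q w) 0 ∧
      HasSum (fun σ : OddDurfeeSymbol => ((Ring.choose (σ.rank + 1) 2 : ℤ) : ℂ) * q ^ σ.size)
        (Lo fun w => calRo q w) := by
  have hr0 : 0 < ‖q‖ := norm_pos_iff.mpr hq0
  set r := ‖q‖ with hr
  set d := (1 - r) / 4 with hd
  have hd0 : 0 < d := by rw [hd]; linarith
  set ρ := 1 + d with hρ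
  have hρ1 : 1 < ρ := by linarith
  have hρr : ρ ^ 2 * r < 1 := by
    have : r = 1 - 4 * d := by rw [hd]; ring
    rw [this, hρ]; nlinarith [mul_pos hd0 hd0, mul_pos (mul_pos hd0 hd0) hd0]
  have hρr' : ρ * r < 1 := by nlinarith
  have hU := isOpen_expAnnulus ρ
  have h0U := zero_mem_expAnnulus hρ1
  -- first derivative
  set f : OddDurfeeSymbol → ℂ → ℂ := fun σ w =>
    q ^ σ.size * exp (2 * Real.pi * I * w) ^ (σ.rank + 1) with hf
  have hfd (σ : OddDurfeeSymbol) (w : ℂ) := hasDerivAt_exp_zpow (σ.rank + 1) (q ^ σ.size) w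
  have hfU (σ : OddDurfeeSymbol) (w : ℂ) (hw : w ∈ expAnnulus ρ) :
      ‖f σ w‖ ≤ ρ * (ρ ^ (σ.top.card + σ.bottom.card) * r ^ σ.size) := by
    simp only [hf]
    rw [zpow_add_one₀ (exp_ne_zero _), norm_mul, norm_mul, norm_pow, ← hr]
    calc r ^ σ.size * (‖exp (2 * Real.pi * I * w) ^ σ.rank‖ * ‖exp (2 * Real.pi * I * w)‖)
        ≤ r ^ σ.size * (ρ ^ (σ.top.card + σ.bottom.card) * ρ) := by
          gcongr
          · exact norm_exp_zpow_rank_le hw σ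
          · exact hw.1.le
      _ = _ := by ring
  have hsum := (summable_symbols hr0 hq (by linarith) hρr').mul_left ρ
  have hcal (w : ℂ) (hw : w ∈ expAnnulus ρ) : calRo q w = 1 + ∑' σ, f σ w := by
    have hx {y : ℂ} (hy : ‖y‖ < ρ) : ‖y * q‖ < 1 := by
      rw [norm_mul]
      exact (mul_le_mul_of_nonneg_right hy.le hr0.le).trans_lt hρr'
    rw [calRo_eq_tsum_symbols hq0 hq (hx hw.1) (hx hw.2), ← tsum_mul_left]
    congr 1
    refine tsum_congr fun σ => ?_
    simp only [hf]
    rw [zpow_add_one₀ (exp_ne_zero _)]; ring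
  have hfdiff (σ : OddDurfeeSymbol) : DifferentiableOn ℂ (f σ) (expAnnulus ρ) :=
    fun w _ => (hfd σ w).differentiableAt.differentiableWithinAt
  have hd1 (w : ℂ) (hw : w ∈ expAnnulus ρ) :
      HasSum (fun σ => deriv (f σ) w) (deriv (fun w => calRo q w) w) := by
    have h1 := Complex.hasSum_deriv_of_summable_norm hsum hfdiff hU hfU hw
    have h2 : (fun w => calRo q w) =ᶠ[𝓝 w] fun w => 1 + ∑' σ, f σ w := by
      filter_upwards [hU.mem_nhds hw] with v hv using hcal v hv
    rw [h2.deriv_eq, deriv_const_add]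
    exact h1
  -- second derivative
  set g : OddDurfeeSymbol → ℂ → ℂ := fun σ w =>
    (2 * Real.pi * I * ((σ.rank + 1 : ℤ) : ℂ) * q ^ σ.size) *
      exp (2 * Real.pi * I * w) ^ σ.rank with hg
  have hgd (σ : OddDurfeeSymbol) (w : ℂ) := hasDerivAt_exp_zpow σ.rank
    (2 * Real.pi * I * ((σ.rank + 1 : ℤ) : ℂ) * q ^ σ.size) w
  have hgdiff (σ : OddDurfeeSymbol) : DifferentiableOn ℂ (g σ) (expAnnulus ρ) :=
    fun w _ => (hgd σ w).differentiableAt.differentiableWithinAt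
  have hgU (σ : OddDurfeeSymbol) (w : ℂ) (hw : w ∈ expAnnulus ρ) :
      ‖g σ w‖ ≤ 2 * Real.pi * (1 + 1 / d) *
        ((ρ ^ 2) ^ (σ.top.card + σ.bottom.card) * r ^ σ.size) := by
    set c := σ.top.card + σ.bottom.card with hc
    have h1 : ‖((σ.rank + 1 : ℤ) : ℂ)‖ ≤ (c : ℝ) + 1 := by
      rw [norm_intCast]
      have : |σ.rank + 1| ≤ (c : ℤ) + 1 := by
        rw [OddDurfeeSymbol.rank, abs_le, hc]; push_cast; constructor <;> omega
      exact_mod_cast this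
    -- Bernoulli's inequality absorbs the linear factor into a power of `ρ`
    have h2 : (c : ℝ) + 1 ≤ (1 + 1 / d) * ρ ^ c := by
      have h3 := one_add_mul_le_pow (a := d) (by linarith) c
      rw [← hρ] at h3
      have h4 : (c : ℝ) ≤ 1 / d * ρ ^ c := by
        rw [one_div, inv_mul_eq_div, le_div_iff₀ hd0]; linarith
      have h5 : 1 ≤ ρ ^ c := one_le_pow₀ hρ1.le
      linarith
    simp only [hg]
    rw [norm_mul, norm_mul, norm_mul, norm_mul, norm_mul, norm_I, norm_real, norm_pow, ← hr,
      Real.norm_of_nonneg Real.pi_pos.le, norm_ofNat, mul_one]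
    calc 2 * Real.pi * ‖((σ.rank + 1 : ℤ) : ℂ)‖ * r ^ σ.size *
          ‖exp (2 * Real.pi * I * w) ^ σ.rank‖
        ≤ 2 * Real.pi * ((1 + 1 / d) * ρ ^ c) * r ^ σ.size * ρ ^ c := by
          have := Real.pi_pos
          have := norm_exp_zpow_rank_le hw σ
          gcongr
          exact h1.trans h2
      _ = _ := by rw [← pow_mul, mul_comm 2 c, pow_mul]; ring
  have hsum2 := (summable_symbols hr0 hq (by positivity) hρr).mul_left (2 * Real.pi * (1 + 1 / d))
  have hd2 : HasSum (fun σ => deriv (g σ) 0)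
      (deriv (fun w => exp (-2 * Real.pi * I * w) * deriv (fun w => calRo q w) w) 0) := by
    have h1 := Complex.hasSum_deriv_of_summable_norm hsum2 hgdiff hU hgU h0U
    have h2 : (fun w => exp (-2 * Real.pi * I * w) * deriv (fun w => calRo q w) w)
        =ᶠ[𝓝 0] fun w => ∑' σ, g σ w := by
      filter_upwards [hU.mem_nhds h0U] with w hw
      rw [← (hd1 w hw).tsum_eq, ← tsum_mul_left]
      refine tsum_congr fun σ => ?_
      rw [(hfd σ w).deriv]
      simp only [hg]
      rw [zpow_add_one₀ (exp_ne_zero _), show -2 * Real.pi * I * w = -(2 * Real.pi * I * w) by ring,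
        exp_neg]
      have := exp_ne_zero (2 * Real.pi * I * w)
      field_simp
    rwa [h2.deriv_eq]
  refine ⟨?_, ?_⟩
  · have h1 := (differentiableOn_tsum_of_summable_norm hsum hfdiff hU hfU).const_add 1
    refine (h1.congr fun w hw => hcal w hw).analyticAt (hU.mem_nhds h0U)
  · have h1 := hd2.mul_left (-1 / (8 * (Real.pi : ℂ) ^ 2))
    rw [Lo]
    have he (σ : OddDurfeeSymbol) : -1 / (8 * (Real.pi : ℂ) ^ 2) * deriv (g σ) 0
        = ((Ring.choose (σ.rank + 1) 2 : ℤ) : ℂ) * q ^ σ.size := ?_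
    · simpa only [he] using h1
    have hpi : (Real.pi : ℂ) ≠ 0 := ofReal_ne_zero.mpr Real.pi_ne_zero
    rw [(hgd σ 0).deriv, choose_succ_two]
    simp only [mul_zero, exp_zero, one_zpow, mul_one]
    push_cast
    field_simp
    rw [I_sq]
    ring

/-- Twice differentiating the generating function of odd Durfee symbols in the form prescribed by `L^o`
produces the weights `binom(rank + 1, 2)`. -/
theorem Lo_calRo {q : ℂ} (hq0 : q ≠ 0) (hq : ‖q‖ < 1) :
    AnalyticAt ℂ (fun w => calRo q w) 0 ∧
      (Summable fun n : ℕ => (etaTwoOdd (n + 1) : ℂ) * q ^ (n + 1)) ∧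
      Lo (fun w => calRo q w) = R2o q := by
  obtain ⟨h1, h2⟩ := hasSum_Lo_calRo hq0 hq
  have h3 := hasSum_etaTwoOdd h2
  exact ⟨h1, h3.summable, h3.tsum_eq.symm⟩

/-! ### The operator `L^o` -/

theorem Lo_congr {f g : ℂ → ℂ} (h : f =ᶠ[𝓝 0] g) : Lo f = Lo g := by
  rw [Lo, Lo]
  congr 1
  exact (EventuallyEq.rfl.mul h.deriv).deriv_eq

/-- For analytic `f` the operator is `-1/(8π²) (f'' - 2πi f')` at `0`. -/
theorem Lo_eq {f : ℂ → ℂ} (hf : AnalyticAt ℂ f 0) :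
    Lo f = -1 / (8 * Real.pi ^ 2) * (deriv (deriv f) 0 - 2 * Real.pi * I * deriv f 0) := by
  have h1 : HasDerivAt (fun w : ℂ => exp (-2 * Real.pi * I * w))
      (exp (-2 * Real.pi * I * 0) * (-2 * Real.pi * I * 1)) 0 :=
    ((hasDerivAt_id (0 : ℂ)).const_mul (-2 * Real.pi * I)).cexp
  have h2 := hf.deriv.differentiableAt.hasDerivAt
  rw [Lo, (h1.fun_mul h2).deriv]
  simp only [mul_zero, exp_zero, one_mul, mul_one]
  ring

theorem Lo_add {f g : ℂ → ℂ} (hf : AnalyticAt ℂ f 0) (hg : AnalyticAt ℂ g 0) :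
    Lo (fun w => f w + g w) = Lo f + Lo g := by
  have h1 : deriv (fun w => f w + g w) =ᶠ[𝓝 0] fun w => deriv f w + deriv g w := by
    filter_upwards [hf.eventually_analyticAt, hg.eventually_analyticAt] with w h1 h2
    exact deriv_fun_add h1.differentiableAt h2.differentiableAt
  rw [Lo_eq hf, Lo_eq hg, Lo_eq (hf.fun_add hg), h1.deriv_eq, h1.self_of_nhds,
    deriv_fun_add hf.deriv.differentiableAt hg.deriv.differentiableAt]
  ring

theorem Lo_const_mul (c : ℂ) {f : ℂ → ℂ} (hf : AnalyticAt ℂ f 0) :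
    Lo (fun w => c * f w) = c * Lo f := by
  have h1 : deriv (fun w => c * f w) = fun w => c * deriv f w := by
    funext w; exact deriv_const_mul_field c
  rw [Lo_eq hf, Lo_eq (analyticAt_const.fun_mul hf), h1, deriv_const_mul_field]
  ring

theorem Lo_sum {ι : Type*} (s : Finset ι) {f : ι → ℂ → ℂ} (hf : ∀ i ∈ s, AnalyticAt ℂ (f i) 0) :
    Lo (fun w => ∑ i ∈ s, f i w) = ∑ i ∈ s, Lo (f i) := by
  classical
  induction s using Finset.induction_on with
  | empty => simp [Lo]
  | insert a s ha ih =>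
    have hs : AnalyticAt ℂ (fun w => ∑ i ∈ s, f i w) 0 := by
      exact Finset.analyticAt_fun_sum s fun i hi => hf i (Finset.mem_insert_of_mem hi)
    simp only [Finset.sum_insert ha]
    rw [Lo_add (hf a (Finset.mem_insert_self _ _)) hs,
      ih fun i hi => hf i (Finset.mem_insert_of_mem hi)]

theorem deriv_eq_zero_of_eventually_even {f : ℂ → ℂ} (h : ∀ᶠ w in 𝓝 0, f (-w) = f w) :
    deriv f 0 = 0 := by
  have h1 : (fun w => f (-w)) =ᶠ[𝓝 0] f := h
  have h2 := h1.deriv_eq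
  rw [deriv_comp_neg, neg_zero] at h2
  exact self_eq_neg.mp h2.symm

/-- `L^o` of an even function times a Gaussian: the linear term in the exponent cancels against the
factor `e^{-2πiw}` in `L^o`. -/
theorem Lo_gauss_mul (C c : ℂ) {N : ℂ → ℂ} (hN : AnalyticAt ℂ N 0)
    (heven : ∀ᶠ w in 𝓝 0, N (-w) = N w) :
    Lo (fun w => C * (exp (2 * Real.pi * I * w + c * w ^ 2) * N w))
      = C * (-1 / (8 * Real.pi ^ 2) * (2 * c * N 0 + deriv (deriv N) 0)) := by
  have hE (w : ℂ) : HasDerivAt (fun w : ℂ => exp (2 * Real.pi * I * w + c * w ^ 2))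
      (exp (2 * Real.pi * I * w + c * w ^ 2) * (2 * Real.pi * I * 1 + c * (2 * w ^ 1 * 1))) w := by
    have := (((hasDerivAt_id w).const_mul (2 * Real.pi * I)).add
      (((hasDerivAt_id w).pow 2).const_mul c)).cexp
    simpa using this
  have hEN : AnalyticAt ℂ (fun w => exp (2 * Real.pi * I * w + c * w ^ 2) * N w) 0 :=
    AnalyticAt.fun_mul (by fun_prop) hN
  rw [Lo_const_mul C hEN, Lo]
  congr 2
  have h1 : (fun w => exp (-2 * Real.pi * I * w) *
      deriv (fun w => exp (2 * Real.pi * I * w + c * w ^ 2) * N w) w) =ᶠ[𝓝 0]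
      fun w => exp (c * w ^ 2) * ((2 * Real.pi * I + 2 * c * w) * N w + deriv N w) := by
    filter_upwards [hN.eventually_analyticAt] with w hw
    rw [((hE w).fun_mul hw.differentiableAt.hasDerivAt).deriv,
      show -2 * Real.pi * I * w = -(2 * Real.pi * I * w) by ring, exp_neg, exp_add]
    have := exp_ne_zero (2 * Real.pi * I * w)
    field_simp
  have h2 : HasDerivAt (fun w : ℂ => exp (c * w ^ 2)) (exp (c * 0 ^ 2) * (c * (2 * 0 ^ 1 * 1))) 0 := by
    have := (((hasDerivAt_id (0 : ℂ)).pow 2).const_mul c).cexp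
    simpa using this
  have h3 : HasDerivAt (fun w : ℂ => 2 * Real.pi * I + 2 * c * w) (2 * c * 1) 0 :=
    ((hasDerivAt_id (0 : ℂ)).const_mul (2 * c)).const_add _
  have h4 := h2.fun_mul ((h3.fun_mul hN.differentiableAt.hasDerivAt).fun_add
    hN.deriv.differentiableAt.hasDerivAt)
  rw [h1.deriv_eq, h4.deriv, deriv_eq_zero_of_eventually_even heven]
  simp

/-! ### Differentiation of the Mordell integrals -/

/-- On a line through a real point which is not an integer, `sin π(s - w)` stays away from zero,
uniformly for `w` near `0`. -/
theorem exists_le_norm_sin {z : ℂ} (hz : 0 < z.re) {σ : ℝ} (hσ : ∀ n : ℤ, σ ≠ n) :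
    ∃ ε > 0, ∃ c > 0, ∀ w ∈ Metric.ball (0 : ℂ) ε, ∀ t : ℝ,
      c ≤ ‖sin (Real.pi * (obliqueLine z σ t - w))‖ := by
  have hpi := Real.pi_pos
  -- the distance of `σ` from the integers
  obtain ⟨δ, hδ0, hδ⟩ : ∃ δ > 0, ∀ a : ℝ, |a - σ| ≤ δ → ∀ n : ℤ, a ≠ n := by
    have h1 : σ ∉ Set.range ((↑) : ℤ → ℝ) := by rintro ⟨n, hn⟩; exact hσ n hn.symm
    have h2 : IsClosed (Set.range ((↑) : ℤ → ℝ)) := Int.isClosedEmbedding_coe_real.isClosed_range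
    obtain ⟨δ, hδ, hb⟩ := Metric.isOpen_iff.mp h2.isOpen_compl σ h1
    refine ⟨δ / 2, by positivity, fun a ha n hn => ?_⟩
    have h3 : a ∈ Metric.ball σ δ := by rw [Metric.mem_ball, Real.dist_eq]; linarith
    exact hb h3 ⟨n, hn.symm⟩
  set T := 2 / z.re with hT
  have hcomp : IsCompact (Set.Icc (σ - δ) (σ + δ) ×ˢ Set.Icc (-T) T) :=
    isCompact_Icc.prod isCompact_Icc
  have hcont : Continuous fun x : ℝ × ℝ => ‖sin (Real.pi * obliqueLine z x.1 x.2)‖ := by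
    have := continuous_obliqueLine z
    exact (Complex.continuous_sin.comp (continuous_const.mul this)).norm
  obtain ⟨x₀, hx₀, hmin⟩ := hcomp.exists_isMinOn
    ⟨(σ, 0), by constructor <;> constructor <;> simp <;> positivity⟩ hcont.continuousOn
  have hc₀ : 0 < ‖sin (Real.pi * obliqueLine z x₀.1 x₀.2)‖ := by
    refine norm_pos_iff.mpr (sin_pi_mul_ne_zero (z := z) fun n => ?_)
    rw [obliqueRe_obliqueLine hz]
    exact hδ _ (by rw [abs_le]; constructor <;> linarith [hx₀.1.1, hx₀.1.2]) n
  have hcr : Continuous fun w : ℂ => obliqueRe z w := by unfold obliqueRe; fun_prop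
  obtain ⟨ε, hε, hball⟩ := Metric.continuousAt_iff.mp (hcr.continuousAt (x := (0 : ℂ))) δ hδ0
  refine ⟨min ε 1, by positivity, min ‖sin (Real.pi * obliqueLine z x₀.1 x₀.2)‖ (1 / 4),
    by positivity, fun w hw t => ?_⟩
  have hw1 : ‖w‖ < min ε 1 := by simpa using hw
  have hre : |obliqueRe z w| < δ := by
    have := hball (x := w) (by simpa using hw1.trans_le (min_le_left _ _))
    rw [Real.dist_eq] at this
    simpa [obliqueRe] using this
  obtain ⟨a, s, hs⟩ : ∃ a s : ℝ, obliqueLine z σ t - w = obliqueLine z a s ∧ |a - σ| ≤ δ := by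
    refine ⟨_, _, (obliqueLine_eq hz _).symm, ?_⟩
    rw [obliqueRe_sub, obliqueRe_obliqueLine hz]
    rw [sub_sub_cancel_left, abs_neg]
    exact hre.le
  obtain ⟨hs, ha⟩ := hs
  rw [hs]
  rcases le_or_gt |s| T with h | h
  · refine (min_le_left _ _).trans (hmin (a := (a, s)) ⟨?_, abs_le.mp h⟩)
    rw [abs_le] at ha
    constructor <;> linarith [ha.1, ha.2]
  · refine (min_le_right _ _).trans ?_
    have him : (Real.pi * obliqueLine z a s : ℂ).im = Real.pi * (z.re * s) := by
      rw [im_ofReal_mul, obliqueLine_im]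
    have h1 : 2 < |z.re * s| := by
      rw [abs_mul, abs_of_pos hz]
      rw [hT, div_lt_iff₀ hz] at h
      linarith
    have h2 : 1 ≤ |(Real.pi * obliqueLine z a s : ℂ).im| := by
      rw [him, abs_mul, abs_of_pos hpi]
      nlinarith [Real.pi_gt_three]
    have h3 := exp_abs_im_le_norm_sin h2
    have h4 : (1 : ℝ) ≤ Real.exp |(Real.pi * obliqueLine z a s : ℂ).im| :=
      Real.one_le_exp (abs_nonneg _)
    linarith

section

variable {k : ℕ} {z w : ℂ} {σ : ℝ}

/-- `e^u - e^{-u} X` with `u = πiσ + πzx/k` and `X = e^{2πiw}`, that is `2 e^{πiw} sinh(u - πiw)`. -/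
noncomputable def mordellDenom (k : ℕ) (σ : ℝ) (z w : ℂ) (x : ℝ) : ℂ :=
  exp (Real.pi * I * σ + Real.pi * z * x / k)
    - exp (-(Real.pi * I * σ + Real.pi * z * x / k)) * exp (2 * Real.pi * I * w)

theorem mordellDenom_eq (k : ℕ) (σ : ℝ) (z w : ℂ) (x : ℝ) : mordellDenom k σ z w x =
    exp (Real.pi * I * w) * (2 * sinh (Real.pi * I * (σ - w) + Real.pi * z * x / k)) := by
  rw [mordellDenom, sinh, mul_div_cancel₀ _ two_ne_zero, mul_sub, ← exp_add, ← exp_add, ← exp_add]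
  ring_nf

theorem sinh_eq_sin_obliqueLine (hk : 0 < k) (σ : ℝ) (z w : ℂ) (x : ℝ) :
    sinh (Real.pi * I * (σ - w) + Real.pi * z * x / k) =
      sin (Real.pi * (obliqueLine z σ ((-1 / k : ℝ) * x) - w)) * I := by
  have hk0 : (k : ℂ) ≠ 0 := by exact_mod_cast hk.ne'
  rw [← sinh_mul_I, obliqueLine]
  congr 1
  push_cast
  field_simp
  linear_combination z * x * I_sq

/-- Up to constants, the `j`-th derivative of the integrand of a Mordell integral with respect to
`e^{2πiw}`. -/
noncomputable def mordellDerivIntegrand (k : ℕ) (σ : ℝ) (z : ℂ) (j : ℕ) (w : ℂ) (x : ℝ) : ℂ :=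
  exp (-3 * Real.pi * z * x ^ 2 / (2 * k) + 3 * Real.pi * z * x / k
    - j * (Real.pi * I * σ + Real.pi * z * x / k)) / mordellDenom k σ z w x ^ (j + 1)

theorem exists_le_norm_mordellDenom (hk : 0 < k) (hz : 0 < z.re) (hσ : ∀ n : ℤ, σ ≠ n) :
    ∃ ε > 0, ∃ c > 0, ∀ w ∈ Metric.ball (0 : ℂ) ε, ∀ x : ℝ, c ≤ ‖mordellDenom k σ z w x‖ := by
  obtain ⟨ε, hε, c, hc, h⟩ := exists_le_norm_sin hz hσ
  refine ⟨ε, hε, Real.exp (-(Real.pi * ε)) * (2 * c), by positivity, fun w hw x => ?_⟩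
  rw [mordellDenom_eq, sinh_eq_sin_obliqueLine hk, norm_mul, norm_mul, norm_mul, norm_I, mul_one,
    norm_ofNat, norm_exp]
  gcongr
  · have h1 : (Real.pi * I * w).re = -(Real.pi * w.im) := by simp
    rw [h1, neg_le_neg_iff]
    have := Real.pi_pos
    gcongr
    exact (le_abs_self _).trans ((abs_im_le_norm w).trans (by simpa using (Metric.mem_ball.mp hw).le))
  · exact h w hw _

theorem integrable_exp_quadratic (hk : 0 < k) (hz : 0 < z.re) (c d : ℂ) :
    Integrable fun x : ℝ => exp (-3 * Real.pi * z * x ^ 2 / (2 * k) + c * x + d) := by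
  have hkr : (0 : ℝ) < k := by exact_mod_cast hk
  have h := integrable_cexp_quadratic (b := 3 * Real.pi * z / (2 * k)) ?_ c d
  · refine h.congr (ae_of_all _ fun x => ?_)
    simp only
    congr 1
    ring
  · have : 3 * Real.pi * z / (2 * k) = ((3 * Real.pi / (2 * k) : ℝ) : ℂ) * z := by
      push_cast; ring
    rw [this, re_ofReal_mul]
    have := Real.pi_pos
    positivity

theorem continuous_mordellDerivIntegrand (j : ℕ) (h : ∀ x : ℝ, mordellDenom k σ z w x ≠ 0) :
    Continuous (mordellDerivIntegrand k σ z j w) := by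
  have h1 : Continuous (mordellDenom k σ z w) := by unfold mordellDenom; fun_prop
  unfold mordellDerivIntegrand
  exact Continuous.div (by fun_prop) (h1.pow _) fun x => pow_ne_zero _ (h x)

theorem norm_mordellDerivIntegrand_le {c : ℝ} (hc : 0 < c) {x : ℝ} (j : ℕ)
    (h : c ≤ ‖mordellDenom k σ z w x‖) : ‖mordellDerivIntegrand k σ z j w x‖ ≤
      ‖exp (-3 * Real.pi * z * x ^ 2 / (2 * k)
        + (3 * Real.pi * z / k - j * (Real.pi * z / k)) * x + -(j * (Real.pi * I * σ)))‖ *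
        (c ^ (j + 1))⁻¹ := by
  rw [mordellDerivIntegrand, norm_div, norm_pow, div_eq_mul_inv]
  have e : -3 * Real.pi * z * x ^ 2 / (2 * k) + 3 * Real.pi * z * x / k
      - j * (Real.pi * I * σ + Real.pi * z * x / k) = -3 * Real.pi * z * x ^ 2 / (2 * k)
        + (3 * Real.pi * z / k - j * (Real.pi * z / k)) * x + -(j * (Real.pi * I * σ)) := by ring
  rw [e]
  gcongr

theorem integrable_mordellDerivIntegrand (hk : 0 < k) (hz : 0 < z.re) (j : ℕ) {c : ℝ} (hc : 0 < c)
    (h : ∀ x : ℝ, c ≤ ‖mordellDenom k σ z w x‖) : Integrable (mordellDerivIntegrand k σ z j w) := by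
  refine Integrable.mono' ((integrable_exp_quadratic hk hz
    (3 * Real.pi * z / k - j * (Real.pi * z / k)) (-(j * (Real.pi * I * σ)))).norm.mul_const
    (c ^ (j + 1))⁻¹)
    (continuous_mordellDerivIntegrand j fun x h0 => ?_).aestronglyMeasurable
    (ae_of_all _ fun x => norm_mordellDerivIntegrand_le hc j (h x))
  have := h x
  rw [h0, norm_zero] at this
  linarith

theorem hasDerivAt_integral_mordellDerivIntegrand (hk : 0 < k) (hz : 0 < z.re) (j : ℕ)
    {ε c : ℝ} (hc : 0 < c) (h : ∀ w ∈ Metric.ball (0 : ℂ) ε, ∀ x : ℝ, c ≤ ‖mordellDenom k σ z w x‖)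
    (hw : w ∈ Metric.ball (0 : ℂ) ε) :
    HasDerivAt (fun w => ∫ x : ℝ, mordellDerivIntegrand k σ z j w x)
      (2 * Real.pi * I * (j + 1) * exp (2 * Real.pi * I * w) *
        ∫ x : ℝ, mordellDerivIntegrand k σ z (j + 1) w x) w := by
  rw [← integral_const_mul]
  have hd (v : ℂ) (hv : v ∈ Metric.ball (0 : ℂ) ε) (x : ℝ) :
      HasDerivAt (fun v => mordellDerivIntegrand k σ z j v x) (2 * Real.pi * I * (j + 1) *
        exp (2 * Real.pi * I * v) * mordellDerivIntegrand k σ z (j + 1) v x) v := by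
    have h0 : mordellDenom k σ z v x ≠ 0 := fun h0 => by
      have := h v hv x
      rw [h0, norm_zero] at this
      linarith
    have h1 : HasDerivAt (fun v => mordellDenom k σ z v x)
        (-(exp (-(Real.pi * I * σ + Real.pi * z * x / k)) *
          (exp (2 * Real.pi * I * v) * (2 * Real.pi * I * 1)))) v :=
      ((((hasDerivAt_id v).const_mul (2 * Real.pi * I)).cexp).const_mul _).const_sub _
    have h2 := ((h1.pow (j + 1)).inv (pow_ne_zero _ h0)).const_mul
      (exp (-3 * Real.pi * z * x ^ 2 / (2 * k) + 3 * Real.pi * z * x / k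
        - j * (Real.pi * I * σ + Real.pi * z * x / k)))
    refine h2.congr_deriv ?_
    rw [mordellDerivIntegrand, show -3 * Real.pi * z * x ^ 2 / (2 * k) + 3 * Real.pi * z * x / k
        - ((j + 1 : ℕ) : ℂ) * (Real.pi * I * σ + Real.pi * z * x / k) =
        (-3 * Real.pi * z * x ^ 2 / (2 * k) + 3 * Real.pi * z * x / k
        - j * (Real.pi * I * σ + Real.pi * z * x / k)) + -(Real.pi * I * σ + Real.pi * z * x / k) by
      push_cast; ring, exp_add]
    simp only [Nat.add_sub_cancel, Pi.pow_apply]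
    field_simp
    push_cast
    ring
  set M := ‖(2 * Real.pi * I * (j + 1) : ℂ)‖ * Real.exp (2 * Real.pi * ε) with hM
  have hb := ((integrable_exp_quadratic hk hz
    (3 * Real.pi * z / k - (j + 1 : ℕ) * (Real.pi * z / k))
    (-((j + 1 : ℕ) * (Real.pi * I * σ)))).norm.mul_const (c ^ (j + 1 + 1))⁻¹).const_mul M
  refine (hasDerivAt_integral_of_dominated_loc_of_deriv_le (Metric.isOpen_ball.mem_nhds hw)
    (Filter.eventually_of_mem (Metric.isOpen_ball.mem_nhds hw) fun v hv =>
      (integrable_mordellDerivIntegrand hk hz j hc (h v hv)).aestronglyMeasurable)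
    (integrable_mordellDerivIntegrand hk hz j hc (h w hw))
    ((integrable_mordellDerivIntegrand hk hz (j + 1) hc (h w hw)).const_mul _).aestronglyMeasurable
    (ae_of_all _ fun x v hv => ?_) hb (ae_of_all _ fun x v hv => hd v hv x)).2
  rw [norm_mul, norm_mul]
  have h1 : ‖exp (2 * Real.pi * I * v)‖ ≤ Real.exp (2 * Real.pi * ε) := by
    rw [norm_exp, Real.exp_le_exp]
    have h2 : (2 * Real.pi * I * v).re = -(2 * Real.pi * v.im) := by simp
    have h3 : -v.im ≤ ε := (neg_le_abs _).trans
      ((abs_im_le_norm v).trans (by simpa using (Metric.mem_ball.mp hv).le))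
    rw [h2]
    nlinarith [Real.pi_pos]
  have h2 := norm_mordellDerivIntegrand_le hc (j + 1) (h v hv x)
  rw [hM]
  gcongr

/-- The integrand of `mordellCubic`. -/
noncomputable def mordellCubicIntegrand (k : ℕ) (σ : ℝ) (z : ℂ) (x : ℝ) : ℂ :=
  exp (-3 * Real.pi * z * x ^ 2 / (2 * k) + Real.pi * z * x / k) /
    sinh (Real.pi * I * σ + Real.pi * z * x / k) ^ 3

/-- The image of the Mordell integral `mordell` under `L^o`: all the integrals `I_{k,ν}^{o,±}(z)`
and `J_{k,ν}^{o,±}(z)` are of this form. -/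
noncomputable def mordellCubic (k : ℕ) (σ : ℝ) (z : ℂ) : ℂ := ∫ x : ℝ, mordellCubicIntegrand k σ z x

theorem IoIntegrand_eq (k : ℕ) (ν s : ℤ) (z : ℂ) :
    IoIntegrand k ν s z = mordellCubicIntegrand k (-s * (ν - 1 / 6) / k) z := by
  ext x
  rw [IoIntegrand, mordellCubicIntegrand]
  congr 3
  push_cast
  ring

theorem JoIntegrand_eq (k : ℕ) (ν s : ℤ) (z : ℂ) :
    JoIntegrand k ν s z = mordellCubicIntegrand k ((s / 3 - (2 * ν + 1)) / k) z := by
  ext x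
  rw [JoIntegrand, mordellCubicIntegrand]
  congr 3
  push_cast
  ring

theorem mordellCubicIntegrand_eq (k : ℕ) (σ : ℝ) (z : ℂ) (x : ℝ) : mordellCubicIntegrand k σ z x =
    8 * exp (2 * Real.pi * I * σ) * mordellDerivIntegrand k σ z 2 0 x := by
  have e : exp (-3 * Real.pi * z * x ^ 2 / (2 * k) + Real.pi * z * x / k) =
      exp (2 * Real.pi * I * σ) * exp (-3 * Real.pi * z * x ^ 2 / (2 * k) + 3 * Real.pi * z * x / k
        - ((2 : ℕ) : ℂ) * (Real.pi * I * σ + Real.pi * z * x / k)) := by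
    rw [← exp_add]
    congr 1
    push_cast
    ring
  rw [mordellCubicIntegrand, mordellDerivIntegrand, mordellDenom_eq, mul_zero, exp_zero, one_mul,
    sub_zero, mul_pow, e, div_eq_mul_inv, div_eq_mul_inv, mul_inv]
  ring

theorem integrable_mordellCubicIntegrand (hk : 0 < k) (hz : 0 < z.re) (hσ : ∀ n : ℤ, σ ≠ n) :
    Integrable (mordellCubicIntegrand k σ z) := by
  obtain ⟨ε, hε, c, hc, h⟩ := exists_le_norm_mordellDenom hk hz hσ
  exact ((integrable_mordellDerivIntegrand hk hz 2 hc (h 0 (by simpa using hε))).const_mul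
    (8 * exp (2 * Real.pi * I * σ))).congr
      (ae_of_all _ fun x => (mordellCubicIntegrand_eq k σ z x).symm)

theorem exp_mul_mordell (k : ℕ) (σ : ℝ) (z w : ℂ) : exp (-Real.pi * I * w) * mordell k σ z w =
    ∫ x : ℝ, mordellDerivIntegrand k σ z 0 w x := by
  rw [mordell, ← integral_const_mul]
  congr 1
  ext x
  rw [mordellIntegrand, mordellDerivIntegrand, mordellDenom_eq, show -Real.pi * I * w
    = -(Real.pi * I * w) by ring, exp_neg, zero_add, pow_one, Nat.cast_zero, zero_mul, sub_zero]
  simp only [div_eq_mul_inv, mul_inv, one_mul]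
  ring

/-- In the variable `e^{2πiw}` the operator `L^o` is a second derivative, so it turns the simple factor
`1 / sinh` into `1 / sinh³`. -/
theorem Lo_mordell (hk : 0 < k) (hz : 0 < z.re) (hσ : ∀ n : ℤ, σ ≠ n) :
    AnalyticAt ℂ (fun w => exp (-Real.pi * I * w) * mordell k σ z w) 0 ∧
      Lo (fun w => exp (-Real.pi * I * w) * mordell k σ z w) =
        1 / 8 * exp (-(2 * Real.pi * I * σ)) * mordellCubic k σ z := by
  obtain ⟨ε, hε, c, hc, h⟩ := exists_le_norm_mordellDenom hk hz hσ
  have h0 : (0 : ℂ) ∈ Metric.ball (0 : ℂ) ε := by simpa using hε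
  have hd (j : ℕ) {w : ℂ} (hw : w ∈ Metric.ball (0 : ℂ) ε) :=
    hasDerivAt_integral_mordellDerivIntegrand hk hz j hc h hw
  simp only [exp_mul_mordell]
  constructor
  · refine DifferentiableOn.analyticAt (s := Metric.ball 0 ε) (fun w hw => ?_)
      (Metric.isOpen_ball.mem_nhds h0)
    exact (hd 0 hw).differentiableAt.differentiableWithinAt
  · have h1 : (fun w => exp (-2 * Real.pi * I * w) *
        deriv (fun w => ∫ x : ℝ, mordellDerivIntegrand k σ z 0 w x) w) =ᶠ[𝓝 0]
        fun w => 2 * Real.pi * I * ∫ x : ℝ, mordellDerivIntegrand k σ z 1 w x := by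
      filter_upwards [Metric.isOpen_ball.mem_nhds h0] with w hw
      rw [(hd 0 hw).deriv, show -2 * Real.pi * I * w = -(2 * Real.pi * I * w) by ring, exp_neg]
      have := exp_ne_zero (2 * Real.pi * I * w)
      push_cast
      field_simp
      ring_nf
    rw [Lo, h1.deriv_eq, ((hd 1 h0).const_mul (2 * Real.pi * I)).deriv, mordellCubic]
    simp only [mordellCubicIntegrand_eq]
    rw [integral_const_mul, exp_neg]
    have hpi : (Real.pi : ℂ) ≠ 0 := ofReal_ne_zero.mpr Real.pi_ne_zero
    have := exp_ne_zero (2 * Real.pi * I * σ)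
    simp only [mul_zero, exp_zero]
    push_cast
    field_simp
    rw [I_sq]
    ring

end

/-! ### Taylor coefficients of the transformed rank functions -/

/-- The rank function close to its centre of symmetry `-1`, normalised so that it becomes an even
function of `v`. -/
noncomputable def evenRank (p v : ℂ) : ℂ := exp (v / 2) * rankFn p (-exp v)

section

variable {p : ℂ}

theorem neg_one_mul_zpow_ne_one (hp0 : p ≠ 0) (hp : ‖p‖ < 1) (n : ℤ) : -1 * p ^ n ≠ 1 := by
  intro h
  have h1 : p ^ (2 * n) = p ^ (0 : ℤ) := by
    rw [mul_comm, zpow_mul, zpow_zero]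
    have : p ^ n = -1 := by linear_combination -h
    rw [this]; norm_num
  have h2 := zpow_injective_of_norm_lt_one hp0 hp h1
  have h3 : n = 0 := by omega
  rw [h3] at h
  norm_num at h

theorem evenRank_neg (hp0 : p ≠ 0) (v : ℂ) : evenRank p (-v) = evenRank p v := by
  have h := rankFn_inv (p := p) (y := -exp v) hp0 (neg_ne_zero.mpr (exp_ne_zero v))
  rw [inv_neg, ← exp_neg, neg_neg] at h
  rw [evenRank, evenRank, h, ← mul_assoc, ← exp_add]
  ring_nf

theorem evenRank_zero (p : ℂ) : evenRank p 0 = go p := by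
  rw [evenRank, zero_div, exp_zero, one_mul, go, rankFn, rankSum]
  congr 1
  refine tsum_congr fun n => ?_
  rw [pent]
  ring_nf

/-- The second Taylor coefficient of `evenRank`.  Differentiating term by term gives the series of
`ho` and a remainder which is odd under the reflection `m ↦ -m` of the summation index. -/
theorem evenRank_deriv (hp0 : p ≠ 0) (hp : ‖p‖ < 1) :
    AnalyticAt ℂ (evenRank p) 0 ∧ deriv (deriv (evenRank p)) 0 = ho p / 2 := by
  have hreg := neg_one_mul_zpow_ne_one hp0 hp
  obtain ⟨c, hc, hev⟩ := exists_le_norm_one_sub (y₀ := -1) hp0 hp (by norm_num)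
  have hexp : Tendsto (fun v : ℂ => -exp v) (𝓝 0) (𝓝 (-1)) := by
    have : Continuous fun v : ℂ => -exp v := by fun_prop
    simpa using this.tendsto 0
  obtain ⟨ε₀, hε₀, hball⟩ := Metric.eventually_nhds_iff_ball.mp (hexp.eventually hev)
  set ε := min ε₀ 1 with hε
  have hε0 : 0 < ε := by positivity
  have hD (v : ℂ) (hv : v ∈ Metric.ball (0 : ℂ) ε) (n : ℤ) : c ≤ ‖1 + exp v * p ^ n‖ := by
    have h := hball v (Metric.ball_subset_ball (min_le_left _ _) hv) n (hreg n)
    rwa [neg_mul, sub_neg_eq_add] at h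
  have hD0 (v : ℂ) (hv : v ∈ Metric.ball (0 : ℂ) ε) (n : ℤ) : 1 + exp v * p ^ n ≠ 0 := fun h0 => by
    have := hD v hv n
    rw [h0, norm_zero] at this
    linarith
  have hE (v : ℂ) (hv : v ∈ Metric.ball (0 : ℂ) ε) : ‖exp (v / 2)‖ ≤ Real.exp 1 := by
    rw [norm_exp, Real.exp_le_exp]
    have h1 : ‖v‖ < 1 := by
      have := Metric.mem_ball.mp hv
      rw [dist_zero_right] at this
      exact this.trans_le (min_le_right _ _)
    have h2 := (le_abs_self _).trans ((abs_re_le_norm v).trans h1.le)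
    have h3 : (v / 2).re = v.re / 2 := by simp
    linarith
  have h0 : (0 : ℂ) ∈ Metric.ball (0 : ℂ) ε := by simpa using hε0
  set a : ℤ → ℂ := fun n => (-1 : ℂ) ^ n * p ^ pent n with ha
  have hs : Summable fun n => ‖a n‖ := by
    simp only [ha]
    simpa only [zero_mul, add_zero] using summable_norm_pent hp0 hp 0
  -- the terms and their derivatives
  have hdD (n : ℤ) (v : ℂ) : HasDerivAt (fun v => 1 + exp v * p ^ n) (exp v * p ^ n) v :=
    ((Complex.hasDerivAt_exp v).mul_const _).const_add 1
  have hdE (v : ℂ) : HasDerivAt (fun v : ℂ => exp (v / 2)) (exp (v / 2) * (1 / 2)) v :=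
    ((hasDerivAt_id v).div_const 2).cexp
  set f : ℤ → ℂ → ℂ := fun n v => a n * (exp (v / 2) * (1 + exp v * p ^ n)⁻¹) with hf
  set g : ℤ → ℂ → ℂ := fun n v => a n * (exp (v / 2) *
    ((1 + exp v * p ^ n)⁻¹ ^ 2 - (1 + exp v * p ^ n)⁻¹ / 2)) with hg
  have hdf (n : ℤ) (v : ℂ) (hv : v ∈ Metric.ball (0 : ℂ) ε) : HasDerivAt (f n) (g n v) v := by
    have h1 := (((hdE v).fun_mul ((hdD n v).fun_inv (hD0 v hv n)))).const_mul (a n)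
    refine h1.congr_deriv ?_
    have h2 := hD0 v hv n
    simp only [hg]
    field_simp
    ring
  have hdg (n : ℤ) : HasDerivAt (g n) (a n * ((1 - 3 * p ^ n) / (2 * (1 + p ^ n) ^ 3)
      + (p ^ n - 1) / (4 * (1 + p ^ n) ^ 2))) 0 := by
    have h2 := hD0 0 h0 n
    have h3 := (hdD n 0).fun_inv h2
    have h1 := (((hdE 0).fun_mul ((h3.fun_pow 2).fun_sub (h3.div_const 2)))).const_mul (a n)
    refine h1.congr_deriv ?_
    simp only [zero_div, exp_zero, one_mul] at h2 ⊢
    congr 1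
    push_cast
    field_simp
    ring
  have hdgd (n : ℤ) (v : ℂ) (hv : v ∈ Metric.ball (0 : ℂ) ε) : DifferentiableAt ℂ (g n) v := by
    have h3 := (hdD n v).fun_inv (hD0 v hv n)
    exact ((((hdE v).fun_mul ((h3.fun_pow 2).fun_sub (h3.div_const 2)))).const_mul
      (a n)).differentiableAt
  have hDi (v : ℂ) (hv : v ∈ Metric.ball (0 : ℂ) ε) (n : ℤ) : ‖(1 + exp v * p ^ n)⁻¹‖ ≤ c⁻¹ := by
    rw [norm_inv]
    exact inv_anti₀ hc (hD v hv n)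
  have hfb (n : ℤ) (v : ℂ) (hv : v ∈ Metric.ball (0 : ℂ) ε) :
      ‖f n v‖ ≤ ‖a n‖ * (Real.exp 1 * c⁻¹) := by
    simp only [hf]
    rw [norm_mul (a n), norm_mul (exp _)]
    have h1 := hE v hv
    have h2 := hDi v hv n
    gcongr
  have hgb (n : ℤ) (v : ℂ) (hv : v ∈ Metric.ball (0 : ℂ) ε) :
      ‖g n v‖ ≤ ‖a n‖ * (Real.exp 1 * (c⁻¹ ^ 2 + c⁻¹ / 2)) := by
    simp only [hg]
    rw [norm_mul (a n), norm_mul (exp _)]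
    have h1 := hE v hv
    have h2 : ‖(1 + exp v * p ^ n)⁻¹ ^ 2 - (1 + exp v * p ^ n)⁻¹ / 2‖ ≤ c⁻¹ ^ 2 + c⁻¹ / 2 := by
      refine (norm_sub_le _ _).trans ?_
      rw [norm_pow, norm_div, norm_ofNat]
      have := hDi v hv n
      gcongr
    gcongr
  have hfd (n : ℤ) : DifferentiableOn ℂ (f n) (Metric.ball 0 ε) := fun v hv =>
    (hdf n v hv).differentiableAt.differentiableWithinAt
  have hgd (n : ℤ) : DifferentiableOn ℂ (g n) (Metric.ball 0 ε) := fun v hv =>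
    (hdgd n v hv).differentiableWithinAt
  have heq (v : ℂ) : evenRank p v = 1 / qPoch p * ∑' n, f n v := by
    rw [evenRank, rankFn, rankSum, mul_left_comm, ← tsum_mul_left (a := exp (v / 2))]
    congr 1
    refine tsum_congr fun n => ?_
    simp only [hf]
    rw [neg_mul, sub_neg_eq_add, div_eq_mul_inv]
    ring
  have hd1 (v : ℂ) (hv : v ∈ Metric.ball (0 : ℂ) ε) :
      deriv (evenRank p) v = 1 / qPoch p * ∑' n, g n v := by
    have h1 := Complex.hasSum_deriv_of_summable_norm (hs.mul_right _) hfd Metric.isOpen_ball hfb hv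
    rw [funext heq, deriv_const_mul_field, ← h1.tsum_eq]
    congr 1
    exact tsum_congr fun n => (hdf n v hv).deriv
  constructor
  · rw [funext heq]
    exact (((differentiableOn_tsum_of_summable_norm (hs.mul_right _) hfd Metric.isOpen_ball
      hfb).const_mul _).analyticAt (Metric.isOpen_ball.mem_nhds h0))
  -- the second derivative
  have h1 := Complex.hasSum_deriv_of_summable_norm (hs.mul_right _) hgd Metric.isOpen_ball hgb h0
  have h2 : deriv (evenRank p) =ᶠ[𝓝 0] fun v => 1 / qPoch p * ∑' n, g n v := by
    filter_upwards [Metric.isOpen_ball.mem_nhds h0] with v hv using hd1 v hv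
  rw [h2.deriv_eq, deriv_const_mul_field, ← h1.tsum_eq]
  have hpn (n : ℤ) : 1 + p ^ n ≠ 0 := by simpa using hD0 0 h0 n
  have hodd : ∑' n, a n * ((p ^ n - 1) / (4 * (1 + p ^ n) ^ 2)) = 0 := by
    have h : ∑' n, a n * ((p ^ n - 1) / (4 * (1 + p ^ n) ^ 2))
        = -∑' n, a n * ((p ^ n - 1) / (4 * (1 + p ^ n) ^ 2)) := by
      conv_lhs => rw [← (Equiv.neg ℤ).tsum_eq]
      rw [← tsum_neg]
      refine tsum_congr fun n => ?_
      have hX : p ^ n ≠ 0 := zpow_ne_zero _ hp0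
      have hX1 := hpn n
      simp only [ha]
      rw [Equiv.neg_apply, pent_neg, zpow_neg, ← inv_zpow, show ((-1 : ℂ))⁻¹ = -1 by norm_num,
        zpow_sub₀ hp0, zpow_neg]
      generalize p ^ n = X at *
      have hX2 : 1 + X⁻¹ = (1 + X) / X := by field_simp; ring
      rw [hX2]
      field_simp
      ring
    exact self_eq_neg.mp h
  have hsum2 : Summable fun n => a n * ((p ^ n - 1) / (4 * (1 + p ^ n) ^ 2)) := by
    refine Summable.of_norm_bounded (hs.mul_right ((c⁻¹ + 2 * c⁻¹ ^ 2) / 4)) fun n => ?_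
    have h3 := hDi 0 h0 n
    rw [exp_zero, one_mul] at h3
    have e : (p ^ n - 1) / (4 * (1 + p ^ n) ^ 2)
        = ((1 + p ^ n)⁻¹ - 2 * (1 + p ^ n)⁻¹ ^ 2) / 4 := by
      have := hpn n
      field_simp
      ring
    rw [norm_mul, e, norm_div, norm_ofNat]
    gcongr
    refine (norm_sub_le _ _).trans ?_
    rw [norm_mul, norm_pow, norm_ofNat]
    gcongr
  have hsum1 : Summable fun n => a n * ((1 - 3 * p ^ n) / (2 * (1 + p ^ n) ^ 3)) := by
    refine (h1.summable.sub hsum2).congr fun n => ?_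
    rw [(hdg n).deriv]
    ring
  simp only [fun n => (hdg n).deriv, mul_add]
  rw [hsum1.tsum_add hsum2, hodd, add_zero, ho, mul_div_assoc, ← tsum_div_const]
  congr 1
  refine tsum_congr fun n => ?_
  simp only [ha]
  have := hpn n
  rw [← pent]
  field_simp

end

theorem deriv_deriv_comp_mul_left (c : ℂ) (f : ℂ → ℂ) :
    deriv (deriv fun w => f (c * w)) 0 = c ^ 2 * deriv (deriv f) 0 := by
  have h1 (g : ℂ → ℂ) : (deriv fun w => g (c * w)) = fun w => c * deriv g (c * w) := by
    funext w
    rw [deriv_comp_mul_left, smul_eq_mul]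
  rw [h1, deriv_const_mul_field, h1 (deriv f)]
  simp only [mul_zero]
  ring

/-! ### The transformation laws of the deformed function -/

theorem cpow_neg_half {z : ℂ} : z ^ (-1 / 2 : ℂ) = (z ^ (1 / 2 : ℂ))⁻¹ := by
  rw [← cpow_neg]
  norm_num

/-- The constant in front of the Mordell integrals, for odd denominators. -/
noncomputable def oddFactor (k : ℕ) (h : ℤ) (z : ℂ) : ℂ :=
  -(1 / ((Real.sqrt 2 : ℂ) * k)) * exp (Real.pi * I / 2 * k * (3 * h + 1)) * omega (2 * h) k
    * z ^ (1 / 2 : ℂ) * exp (Real.pi * I * h / (2 * k) - 2 * Real.pi * z / (3 * k))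

/-- The constant in front of the Mordell integrals, for the even denominator `2K`. -/
noncomputable def evenFactor (K : ℕ) (h h' : ℤ) (z : ℂ) : ℂ :=
  1 / ((2 * K : ℕ) : ℂ) * (-1 : ℂ) ^ ((h' + 1) / 2) * omega h K * z ^ (1 / 2 : ℂ)
    * exp (Real.pi * I / (2 * (2 * K : ℕ)) * (h - 3 * h' - 6) - 2 * Real.pi * z / (3 * (2 * K : ℕ)))

section

variable {k K : ℕ} {h h' : ℤ} {z w : ℂ}

/-- The constants of `calRo_transform_odd`, multiplied out. -/
theorem oddFactor_eq (hz0 : z ≠ 0) : -(z / 2 * (oddConst k h z * (2 * I / k) *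
    exp (-(Real.pi / (24 * k * z))))) = oddFactor k h z := by
  have hs : (Real.sqrt 2 : ℂ) ≠ 0 := by simp
  have e1 : exp (Real.pi * I / 2 * (k + 1 + 3 * h * k))
      = I * exp (Real.pi * I / 2 * k * (3 * h + 1)) := by
    rw [show Real.pi * I / 2 * (k + 1 + 3 * h * k)
      = Real.pi / 2 * I + Real.pi * I / 2 * k * (3 * h + 1) by ring, exp_add, exp_pi_div_two_mul_I]
  have e2 : exp (Real.pi / (24 * k * z) - 2 * Real.pi * z / (3 * k) + Real.pi * I * h / (2 * k))
      * exp (-(Real.pi / (24 * k * z)))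
      = exp (Real.pi * I * h / (2 * k) - 2 * Real.pi * z / (3 * k)) := by
    rw [← exp_add]; ring_nf
  rw [oddConst, oddFactor, e1, ← e2, ← cpow_neg_half_mul hz0, mul_comm (Real.sqrt 2 : ℂ),
    one_div (_ * _), mul_inv]
  linear_combination -(z ^ (-1 / 2 : ℂ) * z * omega (2 * h) k *
    exp (Real.pi * I / 2 * k * (3 * h + 1)) * (exp (Real.pi / (24 * k * z) - 2 * Real.pi * z / (3 * k)
      + Real.pi * I * h / (2 * k)) * exp (-(Real.pi / (24 * k * z)))) * (k : ℂ)⁻¹ *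
      (Real.sqrt 2 : ℂ)⁻¹) * (- I_sq)

/-- The constants of `calRo_transform_even`, multiplied out. -/
theorem evenFactor_eq (hK : 0 < K) (hz0 : z ≠ 0) (hodd : Odd h') :
    z / 2 * (evenJumpConst K h h' z * (2 * I / (2 * K : ℕ)) *
        (exp (-(2 * Real.pi / (3 * (2 * K : ℕ) * z))) *
          exp (Real.pi * I / (2 * (2 * K : ℕ)) * (-2 * h' - 6)))) = evenFactor K h h' z := by
  obtain ⟨b, rfl⟩ := hodd
  have hK0 : (K : ℂ) ≠ 0 := by exact_mod_cast hK.ne'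
  have e1 : (-1 : ℂ) ^ ((2 * b + 1 + 1) / 2) = -(I ^ (-(2 * b + 1)) * I) := by
    have hI : I ^ (2 : ℤ) = -1 := by exact_mod_cast I_sq
    rw [show (2 * b + 1 + 1) / 2 = b + 1 by omega, zpow_add_one₀ (by norm_num),
      ← zpow_add_one₀ I_ne_zero, show -(2 * b + 1) + 1 = 2 * -b by ring, zpow_mul, hI, zpow_neg,
      ← inv_zpow]
    norm_num
  have e2 : exp (-(2 * Real.pi * z / (3 * (2 * K : ℕ))) + 8 * Real.pi / (3 * (2 * K : ℕ) * z)
        + Real.pi * I / (2 * (2 * K : ℕ)) * (h - 5 * (2 * b + 1 : ℤ))) *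
        nome (2 * K) (2 * b + 1) (1 / z) *
        (exp (-(2 * Real.pi / (3 * (2 * K : ℕ) * z))) *
          exp (Real.pi * I / (2 * (2 * K : ℕ)) * (-2 * (2 * b + 1 : ℤ) - 6)))
      = exp (Real.pi * I / (2 * (2 * K : ℕ)) * (h - 3 * (2 * b + 1 : ℤ) - 6)
        - 2 * Real.pi * z / (3 * (2 * K : ℕ))) := by
    rw [nome, ← exp_add, ← exp_add, ← exp_add]
    congr 1
    push_cast
    field_simp
    linear_combination 12 * I_sq
  rw [evenFactor, ← e2, e1, ← cpow_neg_half_mul hz0, evenJumpConst, evenConst]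
  ring

theorem sum_signs (f : ℤ → ℂ) : ∑ s ∈ ({1, -1} : Finset ℤ), f s = f 1 + f (-1) :=
  Finset.sum_pair (by norm_num)

/-- The transformation law for odd denominators, in terms of an even function of `w`. -/
theorem calRo_eq_oddConst_mul_add (hk : 0 < k) (hodd : Odd k) (hh : h * h' ≡ -1 [ZMOD (k : ℤ)])
    (he : 2 ∣ h') (hz : 0 < z.re) (hw : |obliqueRe z w| < 1 / (6 * (k : ℝ)))
    (hreg : ∀ n : ℤ, exp (2 * Real.pi * I * w) * nome k h z ^ (2 * n + 1) ≠ 1) :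
    calRo (nome k h z) w = oddConst k h z * (exp (2 * Real.pi * I * w
        + 3 * Real.pi * k / (2 * z) * w ^ 2) * evenRank (sqrtNome k h' (1 / z)) (-(Real.pi / z) * w))
      + oddFactor k h z * ∑ ν ∈ Finset.range k, ∑ s ∈ ({1, -1} : Finset ℤ),
        (s * exp (Real.pi * I / (2 * k) * (h' * (-3 * (ν : ℂ) ^ 2 + ν) - s * (6 * ν) + s))) *
          (exp (-Real.pi * I * w) * IoW k ν s z w) := by
  have hz0 : z ≠ 0 := by rintro rfl; simp at hz
  have h1 := calRo_transform_odd hk hodd hh he hz hw hreg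
  have h2 : exp (-Real.pi * I * w) * exp (Real.pi * I * w) = 1 := by
    rw [← exp_add]; simp
  have h3 : exp (-Real.pi * I * w) * (oddGauss k h z w * hoW (sqrtNome k h' (1 / z)) (I * w / z)) =
      oddConst k h z * (exp (2 * Real.pi * I * w + 3 * Real.pi * k / (2 * z) * w ^ 2) *
        evenRank (sqrtNome k h' (1 / z)) (-(Real.pi / z) * w)) := by
    rw [oddGauss, hoW_eq_rankFn, evenRank, show Real.pi * I * (I * w / z) = -(Real.pi / z) * w by
      linear_combination Real.pi * w / z * I_sq]
    have e : exp (-Real.pi * I * w) * exp (3 * Real.pi * I * w + 3 * Real.pi * k * w ^ 2 / (2 * z)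
        - Real.pi * w / (2 * z)) = exp (2 * Real.pi * I * w + 3 * Real.pi * k / (2 * z) * w ^ 2) *
        exp (-(Real.pi / z) * w / 2) := by
      rw [← exp_add, ← exp_add]
      congr 1
      field_simp
      ring
    linear_combination oddConst k h z * rankFn (sqrtNome k h' (1 / z)) (-exp (-(Real.pi / z) * w)) * e
  have h4 : ∑ ν ∈ Finset.range k, ∑ s ∈ ({1, -1} : Finset ℤ),
        (s * exp (Real.pi * I / (2 * k) * (h' * (-3 * (ν : ℂ) ^ 2 + ν) - s * (6 * ν) + s))) *
          (exp (-Real.pi * I * w) * IoW k ν s z w) = exp (-Real.pi * I * w) *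
      ∑ ν ∈ Finset.range k, (oddTerm k h' z w 1 ν + oddTerm k h' z w (-1) ν) := by
    rw [Finset.mul_sum]
    refine Finset.sum_congr rfl fun ν _ => ?_
    rw [sum_signs, oddTerm, oddTerm]
    push_cast
    ring
  rw [h4, ← h3, ← oddFactor_eq hz0]
  linear_combination exp (-Real.pi * I * w) * h1 - calRo (nome k h z) w * h2

/-- The transformation law for the even denominator `2K`. -/
theorem calRo_eq_loW_add (hK : 0 < K) (hh : h * h' ≡ -1 [ZMOD (4 * (2 * K : ℕ) : ℤ)])
    (hz : 0 < z.re) (hw : |obliqueRe z w| < 2 / (3 * ((2 * K : ℕ) : ℝ))) :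
    calRo (nome (2 * K) h z) w =
      I ^ (-h') * z ^ (-1 / 2 : ℂ)
        * exp (-(2 * Real.pi * z / (3 * (2 * K : ℕ))) - 10 * Real.pi / (3 * (2 * K : ℕ) * z)
            + Real.pi * I / (2 * (2 * K : ℕ)) * (h + 7 * h'))
        * exp (2 * Real.pi * I * w + 3 * Real.pi * w ^ 2 * (2 * K : ℕ) / (2 * z)
            - 2 * Real.pi * w / z)
        * omega h K * loW (nome (2 * K) h' (1 / z)) (I * w / z)
      + evenFactor K h h' z * ∑ ν ∈ Finset.range K, ∑ s ∈ ({1, -1} : Finset ℤ),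
        ((-1 : ℂ) ^ ν * exp (Real.pi * I / (2 * (2 * K : ℕ))
          * (h' * (-12 * (ν : ℂ) - 12 * (ν : ℂ) ^ 2 + s * (4 * ν) + s * 2) - 12 * ν + s * 2)))
          * (exp (-Real.pi * I * w) * JoW (2 * K) ν s z w) := by
  have hz0 : z ≠ 0 := by rintro rfl; simp at hz
  have hK0 : (K : ℂ) ≠ 0 := by exact_mod_cast hK.ne'
  have h1 := calRo_transform_even hK hh hz hw
  have h2 : exp (-Real.pi * I * w) * exp (Real.pi * I * w) = 1 := by
    rw [← exp_add]; simp
  have h3 : exp (-Real.pi * I * w) *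
      (-(evenGauss K h h' z w * exp (2 * Real.pi * w / z) * nome (2 * K) h' (1 / z) ^ 3)) =
      I ^ (-h') * z ^ (-1 / 2 : ℂ)
        * exp (-(2 * Real.pi * z / (3 * (2 * K : ℕ))) - 10 * Real.pi / (3 * (2 * K : ℕ) * z)
            + Real.pi * I / (2 * (2 * K : ℕ)) * (h + 7 * h'))
        * exp (2 * Real.pi * I * w + 3 * Real.pi * w ^ 2 * (2 * K : ℕ) / (2 * z)
            - 2 * Real.pi * w / z)
        * omega h K := by
    have e : exp (-Real.pi * I * w) * (exp (-(2 * Real.pi * z / (3 * (2 * K : ℕ)))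
          + 8 * Real.pi / (3 * (2 * K : ℕ) * z) + Real.pi * I / (2 * (2 * K : ℕ)) * (h - 5 * h')) *
        exp (3 * Real.pi * I * w + 3 * Real.pi * (2 * K : ℕ) * w ^ 2 / (2 * z)
          - 4 * Real.pi * w / z) * exp (2 * Real.pi * w / z) * nome (2 * K) h' (1 / z) ^ 3) =
        exp (-(2 * Real.pi * z / (3 * (2 * K : ℕ))) - 10 * Real.pi / (3 * (2 * K : ℕ) * z)
            + Real.pi * I / (2 * (2 * K : ℕ)) * (h + 7 * h'))
        * exp (2 * Real.pi * I * w + 3 * Real.pi * w ^ 2 * (2 * K : ℕ) / (2 * z)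
            - 2 * Real.pi * w / z) := by
      rw [nome, ← exp_nat_mul]
      simp only [← exp_add]
      congr 1
      push_cast
      field_simp
      linear_combination 36 * I_sq
    rw [evenGauss, evenConst]
    linear_combination I ^ (-h') * z ^ (-1 / 2 : ℂ) * omega h K * e
  have h4 : ∑ ν ∈ Finset.range K, ∑ s ∈ ({1, -1} : Finset ℤ),
        ((-1 : ℂ) ^ ν * exp (Real.pi * I / (2 * (2 * K : ℕ))
          * (h' * (-12 * (ν : ℂ) - 12 * (ν : ℂ) ^ 2 + s * (4 * ν) + s * 2) - 12 * ν + s * 2)))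
          * (exp (-Real.pi * I * w) * JoW (2 * K) ν s z w) = exp (-Real.pi * I * w) *
      ∑ ν ∈ Finset.range K, (evenTerm K h' z w 1 ν + evenTerm K h' z w (-1) ν) := by
    rw [Finset.mul_sum]
    refine Finset.sum_congr rfl fun ν _ => ?_
    rw [sum_signs, evenTerm, evenTerm, zpow_natCast]
    push_cast
    ring
  rw [h4, ← h3, ← evenFactor_eq hK hz0 (odd_of_modEq hh).2]
  linear_combination exp (-Real.pi * I * w) * h1 - calRo (nome (2 * K) h z) w * h2

end

/-! ### The transformation laws of the second moment -/

/-- `e^{-2πiu} (𝓡^o(q; u) - 1)`, the generating function of odd Durfee symbols by odd rank.  It is an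
even function of `u`, the two rows of a symbol playing symmetric roles. -/
noncomputable def symbolFn (q u : ℂ) : ℂ := exp (-(2 * Real.pi * I * u)) * (calRo q u - 1)

section

variable {q : ℂ}

theorem eventually_norm_exp_mul_lt_one (hq : ‖q‖ < 1) : ∀ᶠ w : ℂ in 𝓝 0,
    ‖exp (2 * Real.pi * I * w) * q‖ < 1 ∧ ‖(exp (2 * Real.pi * I * w))⁻¹ * q‖ < 1 := by
  have h1 : Continuous fun w : ℂ => exp (2 * Real.pi * I * w) := by fun_prop
  have h2 : Continuous fun w : ℂ => ‖exp (2 * Real.pi * I * w) * q‖ := by fun_prop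
  have h3 : Continuous fun w : ℂ => ‖(exp (2 * Real.pi * I * w))⁻¹ * q‖ :=
    ((h1.inv₀ fun w => exp_ne_zero _).mul continuous_const).norm
  exact (h2.continuousAt.eventually_lt continuousAt_const (by simpa using hq)).and
    (h3.continuousAt.eventually_lt continuousAt_const (by simpa using hq))

theorem symbolFn_even (hq0 : q ≠ 0) (hq : ‖q‖ < 1) :
    ∀ᶠ u in 𝓝 0, symbolFn q (-u) = symbolFn q u := by
  filter_upwards [eventually_norm_exp_mul_lt_one hq] with u hu
  have e : exp (2 * Real.pi * I * -u) = (exp (2 * Real.pi * I * u))⁻¹ := by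
    rw [← exp_neg]; ring_nf
  have key {v : ℂ} (h1 : ‖exp (2 * Real.pi * I * v) * q‖ < 1)
      (h2 : ‖(exp (2 * Real.pi * I * v))⁻¹ * q‖ < 1) : symbolFn q v =
      ∑' σ : OddDurfeeSymbol, exp (2 * Real.pi * I * v) ^ σ.rank * q ^ σ.size := by
    rw [symbolFn, calRo_eq_tsum_symbols hq0 hq h1 h2, exp_neg]
    have := exp_ne_zero (2 * Real.pi * I * v)
    field_simp
    ring
  rw [key hu.1 hu.2, key (by rw [e]; exact hu.2) (by rw [e, inv_inv]; exact hu.1),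
    tsum_symbols hq0 hq (exp_ne_zero _) hu.1 hu.2, tsum_symbols hq0 hq (exp_ne_zero _)
      (by rw [e]; exact hu.2) (by rw [e, inv_inv]; exact hu.1), e, inv_inv]
  exact tsum_congr fun n => by ring

theorem analyticAt_symbolFn (hq0 : q ≠ 0) (hq : ‖q‖ < 1) : AnalyticAt ℂ (symbolFn q) 0 := by
  unfold symbolFn
  exact AnalyticAt.fun_mul (by fun_prop) ((Lo_calRo hq0 hq).1.fun_sub analyticAt_const)

theorem symbolFn_zero (hq0 : q ≠ 0) (hq : ‖q‖ < 1) : symbolFn q 0 = q ^ 2 * mo q := by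
  have h1 := eventually_norm_exp_mul_lt_one hq |>.self_of_nhds
  have h2 : mo q = loW q 0 := by
    rw [mo, loW, mul_zero, exp_zero]
    simp only [one_mul]
  rw [h2, loW_eq_calRo hq0 hq (mul_zpow_ne_one hq h1.1 h1.2), symbolFn, mul_zero, neg_zero, exp_zero]
  field_simp

/-- The summand `1` of `𝓡^o(q; w) = 1 + e^{2πiw} symbolFn q w` is invisible to `L^o`. -/
theorem deriv_deriv_symbolFn (hq0 : q ≠ 0) (hq : ‖q‖ < 1) :
    -1 / (8 * Real.pi ^ 2) * deriv (deriv (symbolFn q)) 0 = R2o q := by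
  have hN := analyticAt_symbolFn hq0 hq
  have h1 := Lo_gauss_mul 1 0 hN (symbolFn_even hq0 hq)
  have h2 : (fun w => calRo q w) = fun w => 1 + 1 *
      (exp (2 * Real.pi * I * w + 0 * w ^ 2) * symbolFn q w) := by
    funext w
    rw [symbolFn, exp_neg]
    have := exp_ne_zero (2 * Real.pi * I * w)
    field_simp
    ring_nf
  have h3 : Lo (fun _ => 1) = 0 := by simp [Lo]
  rw [← (Lo_calRo hq0 hq).2.2, h2, Lo_add analyticAt_const
    (analyticAt_const.fun_mul (AnalyticAt.fun_mul (by fun_prop) hN)), h1, h3]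
  ring

end

section

variable {k K : ℕ} {h h' : ℤ} {z : ℂ}

theorem eventually_obliqueRe_lt (z : ℂ) {c : ℝ} (hc : 0 < c) :
    ∀ᶠ w in 𝓝 0, |obliqueRe z w| < c := by
  have h1 : Continuous fun w => |obliqueRe z w| := by unfold obliqueRe; fun_prop
  exact h1.continuousAt.eventually_lt continuousAt_const (by simpa [obliqueRe] using hc)

theorem mordell_center_odd (hk : 0 < k) {s : ℤ} (hs : s = 1 ∨ s = -1) (ν n : ℤ) :
    (-s * (ν - 1 / 6) / k : ℝ) ≠ n := by
  have hkr : (0 : ℝ) < k := by exact_mod_cast hk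
  have := mordell_line_avoids (a := 0) hk (by rw [abs_zero]; positivity) hs ν n
  simpa using this

theorem mordell_center_even (hK : 0 < K) {s : ℤ} (hs : s = 1 ∨ s = -1) (ν n : ℤ) :
    ((s / 3 - (2 * ν + 1)) / (2 * K : ℕ) : ℝ) ≠ n := by
  have hKr : (0 : ℝ) < (2 * K : ℕ) := by exact_mod_cast (by omega : 0 < 2 * K)
  have := even_line_avoids (a := 0) hK (by rw [abs_zero]; positivity) hs ν n
  rwa [sub_zero] at this

theorem Lo_IoW (hk : 0 < k) (hz : 0 < z.re) (ν : ℤ) {s : ℤ} (hs : s = 1 ∨ s = -1) :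
    AnalyticAt ℂ (fun w => exp (-Real.pi * I * w) * IoW k ν s z w) 0 ∧
      Lo (fun w => exp (-Real.pi * I * w) * IoW k ν s z w) =
        1 / 8 * exp (2 * Real.pi * I * (s * (ν - 1 / 6) / k)) * Io k ν s z := by
  have h1 := Lo_mordell hk hz (mordell_center_odd hk hs ν)
  have e (w : ℂ) : IoW k ν s z w = mordell k (-s * (ν - 1 / 6) / k) z w := by
    rw [IoW, IoWIntegrand_eq, mordell]
  have e2 : Io k ν s z = mordellCubic k (-s * (ν - 1 / 6) / k) z := by
    rw [Io, IoIntegrand_eq, mordellCubic]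
  simp only [e, e2]
  refine ⟨h1.1, h1.2.trans ?_⟩
  congr 3
  push_cast
  ring

theorem Lo_JoW (hK : 0 < K) (hz : 0 < z.re) (ν : ℤ) {s : ℤ} (hs : s = 1 ∨ s = -1) :
    AnalyticAt ℂ (fun w => exp (-Real.pi * I * w) * JoW (2 * K) ν s z w) 0 ∧
      Lo (fun w => exp (-Real.pi * I * w) * JoW (2 * K) ν s z w) =
        1 / 8 * exp (-(2 * Real.pi * I * ((s / 3 - (2 * ν + 1)) / (2 * K : ℕ)))) *
          Jo (2 * K) ν s z := by
  have h1 := Lo_mordell (k := 2 * K) (by omega) hz (mordell_center_even hK hs ν)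
  have e (w : ℂ) : JoW (2 * K) ν s z w =
      mordell (2 * K) ((s / 3 - (2 * ν + 1)) / (2 * K : ℕ)) z w := by
    rw [JoW, JoWIntegrand_eq, mordell]
  have e2 : Jo (2 * K) ν s z = mordellCubic (2 * K) ((s / 3 - (2 * ν + 1)) / (2 * K : ℕ)) z := by
    rw [Jo, JoIntegrand_eq, mordellCubic]
  simp only [e, e2]
  refine ⟨h1.1, h1.2.trans ?_⟩
  congr 3
  push_cast
  ring

/-- Applying `L^o` to a Gaussian times an even function plus a finite combination of Mordell
integrals. -/
theorem Lo_eq_of_eventually {F N : ℂ → ℂ} {C c d E : ℂ} {n : ℕ} {a : ℕ → ℤ → ℂ}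
    {M : ℕ → ℤ → ℂ → ℂ} (hN : AnalyticAt ℂ N 0) (heven : ∀ᶠ w in 𝓝 0, N (-w) = N w)
    (hM : ∀ ν, ∀ s ∈ ({1, -1} : Finset ℤ), AnalyticAt ℂ (M ν s) 0)
    (hF : ∀ᶠ w in 𝓝 0, F w = C * (exp (2 * Real.pi * I * w + c * w ^ 2) * N (d * w))
      + E * ∑ ν ∈ Finset.range n, ∑ s ∈ ({1, -1} : Finset ℤ), a ν s * M ν s w) :
    Lo F = C * (-1 / (8 * Real.pi ^ 2) * (2 * c * N 0 + d ^ 2 * deriv (deriv N) 0))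
      + E * ∑ ν ∈ Finset.range n, ∑ s ∈ ({1, -1} : Finset ℤ), a ν s * Lo (M ν s) := by
  have hlim : Tendsto (fun w : ℂ => d * w) (𝓝 0) (𝓝 0) := by
    have : Continuous fun w : ℂ => d * w := by fun_prop
    simpa using this.tendsto 0
  have hNd : AnalyticAt ℂ (fun w => N (d * w)) 0 :=
    AnalyticAt.fun_comp (by simpa using hN) (by fun_prop)
  have heven' : ∀ᶠ w in 𝓝 0, N (d * -w) = N (d * w) := by
    filter_upwards [hlim.eventually heven] with w hw
    rw [mul_neg, hw]
  have hs (ν : ℕ) : AnalyticAt ℂ (fun w => ∑ s ∈ ({1, -1} : Finset ℤ), a ν s * M ν s w) 0 :=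
    Finset.analyticAt_fun_sum _ fun s hs => analyticAt_const.fun_mul (hM ν s hs)
  have hss : AnalyticAt ℂ (fun w => ∑ ν ∈ Finset.range n, ∑ s ∈ ({1, -1} : Finset ℤ),
      a ν s * M ν s w) 0 := Finset.analyticAt_fun_sum _ fun ν _ => hs ν
  rw [Lo_congr hF, Lo_add (analyticAt_const.fun_mul (AnalyticAt.fun_mul (by fun_prop) hNd))
    (analyticAt_const.fun_mul hss), Lo_gauss_mul C c hNd heven', Lo_const_mul E hss,
    deriv_deriv_comp_mul_left, mul_zero, Lo_sum _ fun ν _ => hs ν]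
  congr 2
  refine Finset.sum_congr rfl fun ν _ => ?_
  rw [Lo_sum _ fun s hs => analyticAt_const.fun_mul (hM ν s hs)]
  exact Finset.sum_congr rfl fun s hs => Lo_const_mul _ (hM ν s hs)

theorem mem_signs {s : ℤ} (hs : s ∈ ({1, -1} : Finset ℤ)) : s = 1 ∨ s = -1 := by simpa using hs

/-- `L^o` applied to the transformation law for odd denominators.  The first and second Taylor
coefficients of the even function `evenRank` are `g^o` and half of `h^o`. -/
theorem R2o_transform_odd (hk : 0 < k) (hodd : Odd k) (hh : h * h' ≡ -1 [ZMOD (k : ℤ)])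
    (he : 2 ∣ h') (hz : 0 < z.re) :
    R2o (nome k h z) = oddConst k h z * (-1 / (8 * Real.pi ^ 2) *
        (2 * (3 * Real.pi * k / (2 * z)) * go (sqrtNome k h' (1 / z))
          + (-(Real.pi / z)) ^ 2 * (ho (sqrtNome k h' (1 / z)) / 2)))
      + oddFactor k h z * ∑ ν ∈ Finset.range k, ∑ s ∈ ({1, -1} : Finset ℤ),
        (s * exp (Real.pi * I / (2 * k) * (h' * (-3 * (ν : ℂ) ^ 2 + ν) - s * (6 * ν) + s))) *
          (1 / 8 * exp (2 * Real.pi * I * (s * (ν - 1 / 6) / k)) * Io k ν s z) := by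
  have hq0 := nome_ne_zero k h z
  have hq := norm_nome_lt_one hk h hz
  have hp0 := sqrtNome_ne_zero k h' (1 / z)
  have hp := norm_sqrtNome_lt_one hk h' (re_one_div_pos hz)
  have hkr : (0 : ℝ) < k := by exact_mod_cast hk
  obtain ⟨hN, hN2⟩ := evenRank_deriv hp0 hp
  rw [← (Lo_calRo hq0 hq).2.2, Lo_eq_of_eventually (N := evenRank (sqrtNome k h' (1 / z)))
    (M := fun ν s w => exp (-Real.pi * I * w) * IoW k ν s z w) hN
    (Eventually.of_forall (evenRank_neg hp0)) (fun ν s hs => (Lo_IoW hk hz ν (mem_signs hs)).1) (by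
      filter_upwards [eventually_obliqueRe_lt z (c := 1 / (6 * (k : ℝ))) (by positivity),
        eventually_norm_exp_mul_lt_one hq] with w hw1 hw2
      exact calRo_eq_oddConst_mul_add hk hodd hh he hz hw1 (mul_zpow_ne_one hq hw2.1 hw2.2)),
    evenRank_zero, hN2]
  congr 2
  refine Finset.sum_congr rfl fun ν _ => Finset.sum_congr rfl fun s hs => ?_
  rw [(Lo_IoW hk hz ν (mem_signs hs)).2]
  push_cast
  rfl

/-- `L^o` applied to the transformation law for even denominators.  The transformed function is
`𝓡^o(q₁; iw/z) - 1` up to elementary factors, so its second derivative is again a second moment. -/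
theorem R2o_transform_even (hK : 0 < K) (hh : h * h' ≡ -1 [ZMOD (4 * (2 * K : ℕ) : ℤ)])
    (hz : 0 < z.re) :
    R2o (nome (2 * K) h z) =
      I ^ (-h') * z ^ (-1 / 2 : ℂ)
        * exp (-(2 * Real.pi * z / (3 * (2 * K : ℕ))) - 10 * Real.pi / (3 * (2 * K : ℕ) * z)
            + Real.pi * I / (2 * (2 * K : ℕ)) * (h + 7 * h'))
        * omega h K * (nome (2 * K) h' (1 / z))⁻¹ ^ 2 * (-1 / (8 * Real.pi ^ 2) *
          (2 * (3 * Real.pi * (2 * K : ℕ) / (2 * z)) *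
            (nome (2 * K) h' (1 / z) ^ 2 * mo (nome (2 * K) h' (1 / z)))
          + (I / z) ^ 2 * deriv (deriv (symbolFn (nome (2 * K) h' (1 / z)))) 0))
      + evenFactor K h h' z * ∑ ν ∈ Finset.range K, ∑ s ∈ ({1, -1} : Finset ℤ),
        ((-1 : ℂ) ^ ν * exp (Real.pi * I / (2 * (2 * K : ℕ))
          * (h' * (-12 * (ν : ℂ) - 12 * (ν : ℂ) ^ 2 + s * (4 * ν) + s * 2) - 12 * ν + s * 2)))
          * (1 / 8 * exp (-(2 * Real.pi * I * ((s / 3 - (2 * ν + 1)) / (2 * K : ℕ)))) *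
            Jo (2 * K) ν s z) := by
  have hk : 0 < 2 * K := by omega
  have hkr : (0 : ℝ) < (2 * K : ℕ) := by exact_mod_cast hk
  have hz0 : z ≠ 0 := by rintro rfl; simp at hz
  have hq0 := nome_ne_zero (2 * K) h z
  have hq := norm_nome_lt_one hk h hz
  have hp0 := nome_ne_zero (2 * K) h' (1 / z)
  have hp := norm_nome_lt_one hk h' (re_one_div_pos hz)
  have hlim : Tendsto (fun w : ℂ => I / z * w) (𝓝 0) (𝓝 0) := by
    have : Continuous fun w : ℂ => I / z * w := by fun_prop
    simpa using this.tendsto 0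
  set C := I ^ (-h') * z ^ (-1 / 2 : ℂ)
        * exp (-(2 * Real.pi * z / (3 * (2 * K : ℕ))) - 10 * Real.pi / (3 * (2 * K : ℕ) * z)
            + Real.pi * I / (2 * (2 * K : ℕ)) * (h + 7 * h'))
        * omega h K * (nome (2 * K) h' (1 / z))⁻¹ ^ 2 with hC
  have hF : ∀ᶠ w in 𝓝 0, calRo (nome (2 * K) h z) w = C * (exp (2 * Real.pi * I * w
        + 3 * Real.pi * (2 * K : ℕ) / (2 * z) * w ^ 2) *
          symbolFn (nome (2 * K) h' (1 / z)) (I / z * w))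
      + evenFactor K h h' z * ∑ ν ∈ Finset.range K, ∑ s ∈ ({1, -1} : Finset ℤ),
        ((-1 : ℂ) ^ ν * exp (Real.pi * I / (2 * (2 * K : ℕ))
          * (h' * (-12 * (ν : ℂ) - 12 * (ν : ℂ) ^ 2 + s * (4 * ν) + s * 2) - 12 * ν + s * 2)))
          * (exp (-Real.pi * I * w) * JoW (2 * K) ν s z w) := by
    filter_upwards [eventually_obliqueRe_lt z (c := 2 / (3 * ((2 * K : ℕ) : ℝ))) (by positivity),
      hlim.eventually (eventually_norm_exp_mul_lt_one hp)] with w hw1 hw2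
    rw [calRo_eq_loW_add hK hh hz hw1, show I * w / z = I / z * w by ring,
      loW_eq_calRo hp0 hp (mul_zpow_ne_one hp hw2.1 hw2.2)]
    have e : exp (2 * Real.pi * I * w + 3 * Real.pi * w ^ 2 * (2 * K : ℕ) / (2 * z)
          - 2 * Real.pi * w / z) * (exp (2 * Real.pi * I * (I / z * w)))⁻¹ ^ 2 =
        exp (2 * Real.pi * I * w + 3 * Real.pi * (2 * K : ℕ) / (2 * z) * w ^ 2) *
          exp (-(2 * Real.pi * I * (I / z * w))) := by
      rw [← exp_neg, ← exp_nat_mul, ← exp_add, ← exp_add]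
      congr 1
      push_cast
      field_simp
      linear_combination -2 * w * I_sq
    rw [symbolFn, add_left_inj, hC]
    linear_combination I ^ (-h') * z ^ (-1 / 2 : ℂ)
      * exp (-(2 * Real.pi * z / (3 * (2 * K : ℕ))) - 10 * Real.pi / (3 * (2 * K : ℕ) * z)
          + Real.pi * I / (2 * (2 * K : ℕ)) * (h + 7 * h'))
      * omega h K * (nome (2 * K) h' (1 / z))⁻¹ ^ 2
      * (calRo (nome (2 * K) h' (1 / z)) (I / z * w) - 1) * e
  rw [← (Lo_calRo hq0 hq).2.2, Lo_eq_of_eventually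
    (M := fun ν s w => exp (-Real.pi * I * w) * JoW (2 * K) ν s z w) (analyticAt_symbolFn hp0 hp)
    (symbolFn_even hp0 hp) (fun ν s hs => (Lo_JoW hK hz ν (mem_signs hs)).1) hF, symbolFn_zero hp0 hp,
    add_right_inj]
  congr 1
  refine Finset.sum_congr rfl fun ν _ => Finset.sum_congr rfl fun s hs => ?_
  rw [(Lo_JoW hK hz ν (mem_signs hs)).2]
  push_cast
  rfl

end

end OddRank

theorem mainTheorem10 (h h' : ℤ) (k : ℕ) (hk : 0 < k) (hcop : IsCoprime h (k : ℤ))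
    (z : ℂ) (hz : 0 < z.re) :
    -- `L^o` turns the deformed function into `R₂^o`
    (AnalyticAt ℂ (fun w : ℂ => OddRank.calRo (OddRank.nome k h z) w) 0 ∧
      (Summable fun n : ℕ =>
        (OddRank.etaTwoOdd (n + 1) : ℂ) * OddRank.nome k h z ^ (n + 1)) ∧
      OddRank.Lo (fun w : ℂ => OddRank.calRo (OddRank.nome k h z) w)
        = OddRank.R2o (OddRank.nome k h z)) ∧
    -- transformation law of the deformed function, `k` odd
    (Odd k → h * h' ≡ -1 [ZMOD (k : ℤ)] → 4 ∣ h' →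
      ∀ w : ℂ, |OddRank.obliqueRe z w| < 1 / (6 * (k : ℝ)) →
        (∀ n : ℤ, exp (2 * Real.pi * I * w) * OddRank.nome k h z ^ (2 * n + 1) ≠ 1) →
        (∀ ν : ℤ, ∀ s ∈ ({1, -1} : Finset ℤ),
          Integrable (OddRank.IoWIntegrand k ν s z w)) ∧
        OddRank.calRo (OddRank.nome k h z) w =
          -(1 / (Real.sqrt 2 : ℂ)) * z ^ (-1 / 2 : ℂ) * OddRank.omega (2 * h) k
            * exp (Real.pi / (24 * k * z) - 2 * Real.pi * z / (3 * k) + Real.pi * I * h / (2 * k))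
            * exp (Real.pi * I / 2 * (k + 1 + 3 * h * k))
            * exp (2 * Real.pi * I * w + 3 * Real.pi * k * w ^ 2 / (2 * z) - Real.pi * w / (2 * z))
            * OddRank.hoW (OddRank.sqrtNome k h' (1 / z)) (I * w / z)
          - 1 / ((Real.sqrt 2 : ℂ) * k) * exp (Real.pi * I / 2 * k * (3 * h + 1))
            * OddRank.omega (2 * h) k * z ^ (1 / 2 : ℂ) * exp (-Real.pi * I * w)
            * exp (Real.pi * I * h / (2 * k) - 2 * Real.pi * z / (3 * k))
            * ∑ ν ∈ Finset.range k, ∑ s ∈ ({1, -1} : Finset ℤ),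
                (s : ℂ) * exp (Real.pi * I / (2 * k)
                    * (h' * (-3 * (ν : ℂ) ^ 2 + ν) - s * (6 * ν) + s))
                  * OddRank.IoW k ν s z w) ∧
    -- transformation law of the deformed function, `k` even
    (Even k → h * h' ≡ -1 [ZMOD (4 * (k : ℤ))] →
      ∀ w : ℂ, |OddRank.obliqueRe z w| < 2 / (3 * (k : ℝ)) →
        (∀ ν : ℤ, ∀ s ∈ ({1, -1} : Finset ℤ),
          Integrable (OddRank.JoWIntegrand k ν s z w)) ∧
        OddRank.calRo (OddRank.nome k h z) w =
          I ^ (-h') * z ^ (-1 / 2 : ℂ)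
            * exp (-(2 * Real.pi * z / (3 * k)) - 10 * Real.pi / (3 * k * z)
                + Real.pi * I / (2 * k) * (h + 7 * h'))
            * exp (2 * Real.pi * I * w + 3 * Real.pi * w ^ 2 * k / (2 * z) - 2 * Real.pi * w / z)
            * OddRank.omega h (k / 2)
            * OddRank.loW (OddRank.nome k h' (1 / z)) (I * w / z)
          + 1 / (k : ℂ) * (-1 : ℂ) ^ ((h' + 1) / 2) * exp (-Real.pi * I * w)
            * OddRank.omega h (k / 2) * z ^ (1 / 2 : ℂ)
            * exp (Real.pi * I / (2 * k) * (h - 3 * h' - 6) - 2 * Real.pi * z / (3 * k))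
            * ∑ ν ∈ Finset.range (k / 2), ∑ s ∈ ({1, -1} : Finset ℤ),
                (-1 : ℂ) ^ ν * exp (Real.pi * I / (2 * k)
                    * (h' * (-12 * (ν : ℂ) - 12 * (ν : ℂ) ^ 2 + s * (4 * ν) + s * 2)
                      - 12 * ν + s * 2))
                  * OddRank.JoW k ν s z w) ∧
    -- transformation law of `R₂^o`, `k` odd
    (Odd k → h * h' ≡ -1 [ZMOD (k : ℤ)] → 2 ∣ h' →
        (∀ ν : ℤ, ∀ s ∈ ({1, -1} : Finset ℤ), Integrable (OddRank.IoIntegrand k ν s z)) ∧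
        OddRank.R2o (OddRank.nome k h z) =
          -(1 / (Real.sqrt 2 : ℂ)) * OddRank.omega (2 * h) k
            * exp (Real.pi / (24 * k * z) - 2 * Real.pi * z / (3 * k) + Real.pi * I * h / (2 * k)
                + Real.pi * I / 2 * (k + 1 + 3 * h * k))
            * (-(3 * k / (8 * Real.pi * z ^ (3 / 2 : ℂ)))
                  * OddRank.go (OddRank.sqrtNome k h' (1 / z))
                - 1 / (16 * z ^ (5 / 2 : ℂ)) * OddRank.ho (OddRank.sqrtNome k h' (1 / z)))
          - 1 / (8 * (Real.sqrt 2 : ℂ) * k)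
            * exp (Real.pi * I / 2 * k * (3 * h + 1) + Real.pi * I * h / (2 * k)
                - 2 * Real.pi * z / (3 * k))
            * OddRank.omega (2 * h) k * z ^ (1 / 2 : ℂ)
            * ∑ ν ∈ Finset.range k, ∑ s ∈ ({1, -1} : Finset ℤ),
                (s : ℂ) * exp (Real.pi * I / (2 * k)
                    * (h' * (-3 * (ν : ℂ) ^ 2 + ν) + s * (1 / 3) - s * (2 * ν)))
                  * OddRank.Io k ν s z) ∧
    -- transformation law of `R₂^o`, `k` even
    (Even k → h * h' ≡ -1 [ZMOD (4 * (k : ℤ))] →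
        (∀ ν : ℤ, ∀ s ∈ ({1, -1} : Finset ℤ), Integrable (OddRank.JoIntegrand k ν s z)) ∧
        OddRank.R2o (OddRank.nome k h z) =
          I ^ (-h')
            * exp (-(2 * Real.pi * z / (3 * k)) - 10 * Real.pi / (3 * k * z)
                + Real.pi * I / (2 * k) * (h + 7 * h'))
            * OddRank.omega h (k / 2)
            * (-(3 * k / (8 * Real.pi * z ^ (3 / 2 : ℂ)))
                  * OddRank.mo (OddRank.nome k h' (1 / z))
                - 1 / z ^ (5 / 2 : ℂ) * OddRank.nome k h' (1 / z) ^ (-2 : ℤ)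
                  * OddRank.R2o (OddRank.nome k h' (1 / z)))
          + 1 / (8 * (k : ℂ)) * (-1 : ℂ) ^ ((1 + h') / 2)
            * OddRank.omega h (k / 2) * z ^ (1 / 2 : ℂ)
            * exp (Real.pi * I / (2 * k) * (h - 3 * h') - 2 * Real.pi * z / (3 * k)
                - Real.pi * I / k)
            * ∑ ν ∈ Finset.range (k / 2), ∑ s ∈ ({1, -1} : Finset ℤ),
                (-1 : ℂ) ^ ν * exp (Real.pi * I * h' / k
                    * (-6 * (ν : ℂ) - 6 * (ν : ℂ) ^ 2 + s * (2 * ν) + s * 1)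
                    - 2 * Real.pi * I * ν / k + s * (Real.pi * I / (3 * k)))
                  * OddRank.Jo k ν s z) := by
  have hz0 : z ≠ 0 := by rintro rfl; simp at hz
  have hk0 : (k : ℂ) ≠ 0 := by exact_mod_cast hk.ne'
  have hr0 : z ^ (1 / 2 : ℂ) ≠ 0 := by simp [cpow_eq_zero_iff, hz0]
  have hpow (n : ℕ) : z ^ (1 / 2 + n : ℂ) = z ^ (1 / 2 : ℂ) * z ^ n := by
    rw [cpow_add _ _ hz0, cpow_natCast]
  have hz3 : z ^ (3 / 2 : ℂ) = z ^ (1 / 2 : ℂ) * z := by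
    rw [show (3 / 2 : ℂ) = 1 / 2 + (1 : ℕ) by norm_num, hpow, pow_one]
  have hz5 : z ^ (5 / 2 : ℂ) = z ^ (1 / 2 : ℂ) * z ^ 2 := by
    rw [show (5 / 2 : ℂ) = 1 / 2 + (2 : ℕ) by norm_num, hpow]
  refine ⟨OddRank.Lo_calRo (OddRank.nome_ne_zero k h z) (OddRank.norm_nome_lt_one hk h hz),
    fun hodd hh h4 w hw hreg => ⟨fun ν s hs =>
      OddRank.integrable_IoWIntegrand hk hz hw ν (OddRank.mem_signs hs), ?_⟩,
    fun heven hh w hw => ?_, fun hodd hh h2 => ⟨fun ν s hs => ?_, ?_⟩, fun heven hh => ?_⟩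
  · rw [OddRank.calRo_eq_oddConst_mul_add hk hodd hh (dvd_trans (by norm_num) h4) hz hw hreg,
      OddRank.evenRank, OddRank.hoW_eq_rankFn, OddRank.oddConst, OddRank.oddFactor,
      show Real.pi * I * (I * w / z) = -(Real.pi / z) * w by
        linear_combination Real.pi * w / z * I_sq]
    have e : exp (2 * Real.pi * I * w + 3 * Real.pi * k * w ^ 2 / (2 * z) - Real.pi * w / (2 * z)) =
        exp (2 * Real.pi * I * w + 3 * Real.pi * k / (2 * z) * w ^ 2) *
          exp (-(Real.pi / z) * w / 2) := by
      rw [← exp_add]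
      congr 1
      field_simp
      ring
    have hsum : ∑ ν ∈ Finset.range k, ∑ s ∈ ({1, -1} : Finset ℤ),
        (s * exp (Real.pi * I / (2 * k) * (h' * (-3 * (ν : ℂ) ^ 2 + ν) - s * (6 * ν) + s))) *
          (exp (-Real.pi * I * w) * OddRank.IoW k ν s z w) = exp (-Real.pi * I * w) *
        ∑ ν ∈ Finset.range k, ∑ s ∈ ({1, -1} : Finset ℤ),
          (s : ℂ) * exp (Real.pi * I / (2 * k)
              * (h' * (-3 * (ν : ℂ) ^ 2 + ν) - s * (6 * ν) + s)) * OddRank.IoW k ν s z w := by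
      simp only [Finset.mul_sum]
      exact Finset.sum_congr rfl fun ν _ => Finset.sum_congr rfl fun s _ => by ring
    rw [hsum, e]
    ring
  · obtain ⟨K, rfl⟩ := heven.two_dvd
    have hK : 0 < K := by omega
    refine ⟨fun ν s hs => OddRank.integrable_JoWIntegrand hK hz hw ν (OddRank.mem_signs hs), ?_⟩
    have hsum : ∑ ν ∈ Finset.range K, ∑ s ∈ ({1, -1} : Finset ℤ),
        ((-1 : ℂ) ^ ν * exp (Real.pi * I / (2 * (2 * K : ℕ))
          * (h' * (-12 * (ν : ℂ) - 12 * (ν : ℂ) ^ 2 + s * (4 * ν) + s * 2) - 12 * ν + s * 2)))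
          * (exp (-Real.pi * I * w) * OddRank.JoW (2 * K) ν s z w) = exp (-Real.pi * I * w) *
        ∑ ν ∈ Finset.range K, ∑ s ∈ ({1, -1} : Finset ℤ),
          (-1 : ℂ) ^ ν * exp (Real.pi * I / (2 * (2 * K : ℕ))
            * (h' * (-12 * (ν : ℂ) - 12 * (ν : ℂ) ^ 2 + s * (4 * ν) + s * 2) - 12 * ν + s * 2))
          * OddRank.JoW (2 * K) ν s z w := by
      simp only [Finset.mul_sum]
      exact Finset.sum_congr rfl fun ν _ => Finset.sum_congr rfl fun s _ => by ring
    rw [Nat.mul_div_cancel_left K two_pos, OddRank.calRo_eq_loW_add hK hh hz hw,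
      OddRank.evenFactor, hsum]
    ring
  · rw [OddRank.IoIntegrand_eq]
    exact OddRank.integrable_mordellCubicIntegrand hk hz
      (OddRank.mordell_center_odd hk (OddRank.mem_signs hs) ν)
  · rw [OddRank.R2o_transform_odd hk hodd hh h2 hz, OddRank.oddConst, OddRank.oddFactor, hz3, hz5,
      OddRank.cpow_neg_half]
    have hsum : ∑ ν ∈ Finset.range k, ∑ s ∈ ({1, -1} : Finset ℤ),
        (s * exp (Real.pi * I / (2 * k) * (h' * (-3 * (ν : ℂ) ^ 2 + ν) - s * (6 * ν) + s))) *
          (1 / 8 * exp (2 * Real.pi * I * (s * (ν - 1 / 6) / k)) * OddRank.Io k ν s z) = 1 / 8 *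
        ∑ ν ∈ Finset.range k, ∑ s ∈ ({1, -1} : Finset ℤ),
          (s : ℂ) * exp (Real.pi * I / (2 * k)
              * (h' * (-3 * (ν : ℂ) ^ 2 + ν) + s * (1 / 3) - s * (2 * ν)))
            * OddRank.Io k ν s z := by
      simp only [Finset.mul_sum]
      refine Finset.sum_congr rfl fun ν _ => Finset.sum_congr rfl fun s _ => ?_
      -- the phase which `L^o` leaves in front of a Mordell integral
      rw [show Real.pi * I / (2 * k) * (h' * (-3 * (ν : ℂ) ^ 2 + ν) + s * (1 / 3) - s * (2 * ν)) =
        Real.pi * I / (2 * k) * (h' * (-3 * (ν : ℂ) ^ 2 + ν) - s * (6 * ν) + s) +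
          2 * Real.pi * I * (s * (ν - 1 / 6) / k) by field_simp; ring, exp_add]
      ring
    have hpi : (Real.pi : ℂ) ≠ 0 := by exact_mod_cast Real.pi_ne_zero
    -- the Taylor coefficients at `0` of the even function
    have hmain : (z ^ (1 / 2 : ℂ))⁻¹ * (-1 / (8 * Real.pi ^ 2) *
          (2 * (3 * Real.pi * k / (2 * z)) * OddRank.go (OddRank.sqrtNome k h' (1 / z))
            + (-(Real.pi / z)) ^ 2 * (OddRank.ho (OddRank.sqrtNome k h' (1 / z)) / 2))) =
        -(3 * k / (8 * Real.pi * (z ^ (1 / 2 : ℂ) * z)))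
            * OddRank.go (OddRank.sqrtNome k h' (1 / z))
          - 1 / (16 * (z ^ (1 / 2 : ℂ) * z ^ 2)) * OddRank.ho (OddRank.sqrtNome k h' (1 / z)) := by
      field_simp
      ring
    rw [hsum, ← hmain, exp_add _ (Real.pi * I / 2 * (k + 1 + 3 * h * k)),
      add_sub_assoc, exp_add (Real.pi * I / 2 * k * (3 * h + 1))]
    ring
  · obtain ⟨K, rfl⟩ := heven.two_dvd
    have hK : 0 < K := by omega
    refine ⟨fun ν s hs => ?_, ?_⟩
    · rw [OddRank.JoIntegrand_eq]
      exact OddRank.integrable_mordellCubicIntegrand hk hz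
        (OddRank.mordell_center_even hK (OddRank.mem_signs hs) ν)
    have hsum : OddRank.evenFactor K h h' z * ∑ ν ∈ Finset.range K, ∑ s ∈ ({1, -1} : Finset ℤ),
        ((-1 : ℂ) ^ ν * exp (Real.pi * I / (2 * (2 * K : ℕ))
          * (h' * (-12 * (ν : ℂ) - 12 * (ν : ℂ) ^ 2 + s * (4 * ν) + s * 2) - 12 * ν + s * 2)))
          * (1 / 8 * exp (-(2 * Real.pi * I * ((s / 3 - (2 * ν + 1)) / (2 * K : ℕ)))) *
            OddRank.Jo (2 * K) ν s z) =
        1 / (8 * ((2 * K : ℕ) : ℂ)) * (-1 : ℂ) ^ ((1 + h') / 2)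
            * OddRank.omega h K * z ^ (1 / 2 : ℂ)
            * exp (Real.pi * I / (2 * (2 * K : ℕ)) * (h - 3 * h')
                - 2 * Real.pi * z / (3 * (2 * K : ℕ)) - Real.pi * I / (2 * K : ℕ))
            * ∑ ν ∈ Finset.range K, ∑ s ∈ ({1, -1} : Finset ℤ),
                (-1 : ℂ) ^ ν * exp (Real.pi * I * h' / (2 * K : ℕ)
                    * (-6 * (ν : ℂ) - 6 * (ν : ℂ) ^ 2 + s * (2 * ν) + s * 1)
                    - 2 * Real.pi * I * ν / (2 * K : ℕ) + s * (Real.pi * I / (3 * (2 * K : ℕ))))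
                  * OddRank.Jo (2 * K) ν s z := by
      rw [OddRank.evenFactor, add_comm 1 h']
      simp only [Finset.mul_sum]
      refine Finset.sum_congr rfl fun ν _ => Finset.sum_congr rfl fun s _ => ?_
      have e : exp (Real.pi * I / (2 * (2 * K : ℕ)) * (h - 3 * h' - 6)
            - 2 * Real.pi * z / (3 * (2 * K : ℕ))) *
          exp (Real.pi * I / (2 * (2 * K : ℕ))
            * (h' * (-12 * (ν : ℂ) - 12 * (ν : ℂ) ^ 2 + s * (4 * ν) + s * 2) - 12 * ν + s * 2)) *
          exp (-(2 * Real.pi * I * ((s / 3 - (2 * ν + 1)) / (2 * K : ℕ)))) =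
          exp (Real.pi * I / (2 * (2 * K : ℕ)) * (h - 3 * h')
                - 2 * Real.pi * z / (3 * (2 * K : ℕ)) - Real.pi * I / (2 * K : ℕ)) *
          exp (Real.pi * I * h' / (2 * K : ℕ)
                    * (-6 * (ν : ℂ) - 6 * (ν : ℂ) ^ 2 + s * (2 * ν) + s * 1)
                    - 2 * Real.pi * I * ν / (2 * K : ℕ) + s * (Real.pi * I / (3 * (2 * K : ℕ)))) := by
        simp only [← exp_add]
        congr 1
        field_simp
        ring
      linear_combination 1 / (8 * ((2 * K : ℕ) : ℂ)) * (-1 : ℂ) ^ ((h' + 1) / 2)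
            * OddRank.omega h K * z ^ (1 / 2 : ℂ) * (-1 : ℂ) ^ ν * OddRank.Jo (2 * K) ν s z * e
    have hp0 := OddRank.nome_ne_zero (2 * K) h' (1 / z)
    have hR := OddRank.deriv_deriv_symbolFn hp0
      (OddRank.norm_nome_lt_one hk h' (OddRank.re_one_div_pos hz))
    rw [Nat.mul_div_cancel_left K two_pos, OddRank.R2o_transform_even hK hh hz, hsum, ← hR, hz3, hz5,
      OddRank.cpow_neg_half, add_left_inj]
    have hpi : (Real.pi : ℂ) ≠ 0 := by exact_mod_cast Real.pi_ne_zero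
    -- the factor `(i/z)²` is the source of the sign in front of `R₂^o(q₁)`
    rw [show OddRank.nome (2 * K) h' (1 / z) ^ (-2 : ℤ) = (OddRank.nome (2 * K) h' (1 / z) ^ 2)⁻¹ by
      rw [zpow_neg]; norm_cast, div_pow I, I_sq]
    field_simp
    ring
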